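/- Let $N\ge 1$ be an integer, $1<p<N$, $s\in(0,1)$, $0\le m<p-1$, $\lambda>0$, and let $\Omega\subset\mathbb R^N$ be a bounded domain with smooth boundary; write $d(x)=\operatorname{dist}(x,\partial\Omega)$. Let $\gamma,\delta\in\mathbb R$ and $\mathbf d>N$ satisfy $\gamma<1/\mathbf d$ and, if $m>0$, also $0<\delta<m$ and $2\delta-\mathbf d\,\gamma>2m-1$ (if $m=0$, the term containing $\gamma$ and $\delta$ below is absent). Fix a nonnegative function $\underline g\in L^\infty(\Omega)$ that is not a.e. zero, and say that $g$ satisfies (H2) if $g\ge\lambda\,\underline g$ a.e. in $\Omega$. Identify $W_0^{1,p}(\Omega)$ with the functions of $W^{1,p}(\mathbb R^N)$ vanishing a.e. outside $\Omega$, put $\mathbf{WL}=W_0^{1,p}(\Omega)\cap L^{2(m+1)}(\Omega)$ and $[t]^{p-1}=|t|^{p-2}t$. For $g\in L^2(\Omega)$, a weak solution of $$u^{2m+1}-\lambda\Delta_pu+\lambda(-\Delta)^s_pu=g(x)u^m+\lambda m\,d(x)^{-\gamma}u^\delta\ \text{ in }\Omega,\qquad u>0\ \text{ in }\Omega,\qquad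 u=0\ \text{ on }\mathbb R^N\setminus\Omega\qquad(S_\lambda)$$ is a function $u\in\mathbf{WL}$ with $u\ge0$, $u\not\equiv0$, such that for all $\varphi\in\mathbf{WL}$ $$\int_\Omega u^{2m+1}\varphi\,dx+\lambda\int_\Omega|\nabla u|^{p-2}\nabla u\cdot\nabla\varphi\,dx+\lambda\iint_{\mathbb R^{2N}}\frac{[u(x)-u(y)]^{p-1}(\varphi(x)-\varphi(y))}{|x-y|^{N+sp}}\,dx\,dy=\int_\Omega\big(g\,u^m+\lambda m\,d^{-\gamma}u^\delta\big)\varphi\,dx .$$ 1. If $g_0\in L^2(\Omega)$ satisfies (H2), then $(S_\lambda)$ with $g=g_0$ has a weak solution $u\in\mathbf{WL}$ with $u>0$ a.e. in $\Omega$. Moreover, if in addition $g_0\in L^r(\Omega)$ for some $r>\frac N{sp}$, with also $r<\frac1\gamma$ when $\gamma>0$, then $u\in L^\infty(\Omega)$. 2. If $g_1,g_2\in L^2(\Omega)$ both satisfy (H2) and $u_1,u_2$ are weak solutions of $(S_\lambda)$ with $g=g_1$ and $g=g_2$, respectively, then $$\big\|(u_1^{m+1}-u_2^{m+1})^+\big\|_{L^2(\Omega)}\le\big\|(g_1-g_2)^+\big\|_{L^2(\Omega)}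 .$$ -/

import Mathlib

open MeasureTheory Set Filter Topology
open scoped ContDiff

namespace MixedLocalNonlocal

/-- A bounded domain (nonempty connected open set) of `ℝ^N` with smooth boundary: near each
boundary point, `Ω` is the sublevel set `{ρ < 0}` of a smooth function with nonvanishing
differential at that point. -/
structure IsSmoothBoundedDomain {N : ℕ} (Ω : Set (EuclideanSpace ℝ (Fin N))) : Prop where
  isOpen : IsOpen Ω
  isConnected : IsConnected Ω
  isBounded : Bornology.IsBounded Ω
  smooth_boundary : ∀ x ∈ frontier Ω, ∃ U ∈ 𝓝 x, ∃ ρ : EuclideanSpace ℝ (Fin N) → ℝ,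
    ContDiff ℝ ∞ ρ ∧ fderiv ℝ ρ x ≠ 0 ∧ ∀ y ∈ U, (y ∈ Ω ↔ ρ y < 0)

/-- `G` is a weak (distributional) gradient of `u` on `ℝ^N`. -/
structure IsWeakGradient {N : ℕ} (u : EuclideanSpace ℝ (Fin N) → ℝ)
    (G : EuclideanSpace ℝ (Fin N) → EuclideanSpace ℝ (Fin N)) : Prop where
  locallyIntegrable : LocallyIntegrable u volume
  locallyIntegrable_grad : LocallyIntegrable G volume
  integral_eq : ∀ φ : EuclideanSpace ℝ (Fin N) → ℝ, ContDiff ℝ ∞ φ → HasCompactSupport φ →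
    ∀ i : Fin N, ∫ x, u x * fderiv ℝ φ x (EuclideanSpace.single i 1) = - ∫ x, G x i * φ x

open Classical in
/-- The weak gradient of `u` (unique up to null sets when it exists; `0` if there is none). -/
noncomputable def weakGradient {N : ℕ} (u : EuclideanSpace ℝ (Fin N) → ℝ) :
    EuclideanSpace ℝ (Fin N) → EuclideanSpace ℝ (Fin N) :=
  if h : ∃ G, IsWeakGradient u G then h.choose else 0

/-- Membership in `W_0^{1,p}(Ω)`, whose elements are identified with their extensions by zero:
functions in `W^{1,p}(ℝ^N)` vanishing almost everywhere outside `Ω`. -/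
structure MemW01p {N : ℕ} (Ω : Set (EuclideanSpace ℝ (Fin N))) (p : ℝ)
    (u : EuclideanSpace ℝ (Fin N) → ℝ) : Prop where
  memLp : MemLp u (ENNReal.ofReal p) volume
  exists_weakGradient : ∃ G, IsWeakGradient u G
  memLp_weakGradient : MemLp (weakGradient u) (ENNReal.ofReal p) volume
  eq_zero_outside : ∀ᵐ x ∂volume.restrict Ωᶜ, u x = 0

/-- Membership in `WL = W_0^{1,p}(Ω) ∩ L^{2(m+1)}(Ω)`. -/
structure MemWL {N : ℕ} (Ω : Set (EuclideanSpace ℝ (Fin N))) (p m : ℝ)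
    (u : EuclideanSpace ℝ (Fin N) → ℝ) : Prop where
  memW01p : MemW01p Ω p u
  memLp : MemLp u (ENNReal.ofReal (2 * (m + 1))) (volume.restrict Ω)

/-- The odd power `[t]^{p-1} = |t|^{p-2} t`. -/
noncomputable def signedPow (p t : ℝ) : ℝ := |t| ^ (p - 2) * t

/-- The form `∫_Ω |∇u|^{p-2} ∇u · ∇φ` of the operator `-Δ_p`. -/
noncomputable def localForm {N : ℕ} (Ω : Set (EuclideanSpace ℝ (Fin N))) (p : ℝ)
    (u φ : EuclideanSpace ℝ (Fin N) → ℝ) : ℝ :=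
  ∫ x in Ω, ‖weakGradient u x‖ ^ (p - 2) * inner ℝ (weakGradient u x) (weakGradient φ x)

/-- The form `∬ [u(x) - u(y)]^{p-1} (φ(x) - φ(y)) / |x - y|^{N + sp} dx dy` over `ℝ^{2N}`
of the operator `(-Δ)^s_p`. -/
noncomputable def nonlocalForm {N : ℕ} (p s : ℝ) (u φ : EuclideanSpace ℝ (Fin N) → ℝ) : ℝ :=
  ∫ z : EuclideanSpace ℝ (Fin N) × EuclideanSpace ℝ (Fin N),
    signedPow p (u z.1 - u z.2) * (φ z.1 - φ z.2) / ‖z.1 - z.2‖ ^ ((N : ℝ) + s * p)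

/-- The distance `d(x)` from `x` to the boundary of `Ω`. -/
noncomputable def bdryDist {N : ℕ} (Ω : Set (EuclideanSpace ℝ (Fin N)))
    (x : EuclideanSpace ℝ (Fin N)) : ℝ :=
  Metric.infDist x (frontier Ω)

/-- Weak solutions of
`u^{2m+1} - lam Δ_p u + lam (-Δ)^s_p u = g u^m + lam m d(x)^{-γ} u^δ` in `Ω`,
`u = 0` in `ℝ^N \ Ω`. -/
structure IsWeakSolution {N : ℕ} (Ω : Set (EuclideanSpace ℝ (Fin N))) (p s m δ γ lam : ℝ)
    (g u : EuclideanSpace ℝ (Fin N) → ℝ) : Prop where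
  memWL : MemWL Ω p m u
  nonneg : ∀ᵐ x ∂volume.restrict Ω, 0 ≤ u x
  nontrivial : ¬ (∀ᵐ x ∂volume.restrict Ω, u x = 0)
  weak_eq : ∀ φ : EuclideanSpace ℝ (Fin N) → ℝ, MemWL Ω p m φ →
    (∫ x in Ω, u x ^ (2 * m + 1) * φ x) + lam * localForm Ω p u φ + lam * nonlocalForm p s u φ
      = ∫ x in Ω, (g x * u x ^ m + lam * m * bdryDist Ω x ^ (-γ) * u x ^ δ) * φ x

end MixedLocalNonlocal

open MixedLocalNonlocal

namespace MixedLocalNonlocal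

/-! Put q = m + 1, so that q < p. The problem is convex in the variable w = u^q. Weak solutions are
critical points of J(u) = `lowerOrder` + (λ/p) E(u), where E is the sum of the local and the
nonlocal p-energy. In w the energy E is convex (`energy_qmean_le`), the term u^(2q) is quadratic,
the g term is linear, and the weighted term enters with the favourable sign because t^(δ+1) is
concave in t^q when δ ≤ m. Hence J is strongly convex with respect to the L² distance of w
(`Source.lowerOrder_qmean_le`).

Existence: a minimizing sequence is Cauchy in L² in the variable w, directly from strong convexity.
The lower-order terms then hardly change between two members of the sequence, so evaluating J at
ordinary midpoints makes the midpoint defects of E vanish, and uniform convexity of the p-th power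
makes the gradients Cauchy in L^p. Strong limits are thus obtained without weak compactness
(`exists_minimizer`). The minimizer is not zero because J is negative at small multiples of a bump
(`exists_functional_neg`). Passing to the positive part lowers J, so the sign constraint is inactive
and the Euler–Lagrange equation holds for every test function (`weak_eq_of_minimizer`).

Positivity: testing with (ψ - n u)^+ and letting n tend to infinity leaves only the nonlocal
interaction between {u = 0} and {u > 0}, which has a strict sign. One of the two sets is therefore
null (`WeakSol.ae_pos`).

Comparison: with a = u₁ and b = u₂, test the first equation with a - min(a,b)^q / a^(q-1) and the
second with b - max(a,b)^q / b^(q-1). Picone's inequality (`picone_form`) together with E(min) +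
E(max) ≤ E(a) + E(b) shows that the operators contribute a nonnegative amount
(`picone_pair_nonneg`). What remains is the inequality ∫ (a^q - b^q - (g₁ - g₂)) (a^q - b^q)^+ ≤ 0,
from which Young's inequality gives the L² estimate. A shift by ε and a truncation of u₁ at height c
make the test functions admissible, and both are removed by dominated convergence
(`WeakSol.eLpNorm_le`).

Boundedness: De Giorgi iteration on the functions (u - κ)^+. The nonlocal and the zeroth-order terms
are nonnegative and are dropped, so only the local energy and r > N/p are used
(`WeakSol.memLp_top`). The weight d^(-γ) is in L^r when γ r < 1, because the part of Ω within
distance ε of the boundary has volume O(ε) (`exists_volume_le`).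

The Sobolev calculus rests on difference quotients: those of an L^p function with a weak gradient
converge strongly, and a function with smaller increments inherits a weak derivative
(`weakDeriv_of_lipschitz`). This yields the chain rule for truncations, lattice operations, power
means and Picone quotients. -/

/-- Euclidean space of dimension `N`. -/
abbrev Euc (N : ℕ) := EuclideanSpace ℝ (Fin N)

/-- The `i`-th vector of the standard basis. -/
noncomputable abbrev stdVec {N : ℕ} (i : Fin N) : Euc N := EuclideanSpace.single i 1

/-- `u` belongs to `W^{1,p}(ℝ^N)` with weak gradient `G`. -/
structure IsSobolev {N : ℕ} (p : ℝ) (u : Euc N → ℝ) (G : Euc N → Euc N) : Prop where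
  memLp : MemLp u (ENNReal.ofReal p) volume
  memLp_grad : MemLp G (ENNReal.ofReal p) volume
  weak : IsWeakGradient u G

/-- Hölder's inequality. It serves to pass to the limit in the integration-by-parts identity that
defines weak gradients. -/
lemma tendsto_integral_mul_of_tendsto_eLpNorm {X : Type*} [MeasurableSpace X] {μ : Measure X}
    {p p' : ENNReal} [hpp : ENNReal.HolderTriple p p' 1] {f : ℕ → X → ℝ} {f₀ g : X → ℝ}
    (hf : ∀ n, MemLp (f n) p μ) (hf₀ : MemLp f₀ p μ) (hg : MemLp g p' μ)
    (h : Tendsto (fun n => eLpNorm (f n - f₀) p μ) atTop (𝓝 0)) :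
    Tendsto (fun n => ∫ x, f n x * g x ∂μ) atTop (𝓝 (∫ x, f₀ x * g x ∂μ)) := by
  have hint : ∀ {v : X → ℝ}, MemLp v p μ → Integrable (fun x => v x * g x) μ := fun hv =>
    memLp_one_iff_integrable.1 (MemLp.mul' (p := p) (q := p') hg hv)
  refine tendsto_integral_of_L1' _ (hint hf₀).1 (Eventually.of_forall fun n => hint (hf n)) ?_
  have hle : ∀ n, eLpNorm ((fun x => f n x * g x) - fun x => f₀ x * g x) 1 μ
      ≤ eLpNorm (f n - f₀) p μ * eLpNorm g p' μ := by
    intro n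
    have e : ((fun x => f n x * g x) - fun x => f₀ x * g x) = (f n - f₀) • g := by
      ext x; simp [sub_mul]
    rw [e]
    exact eLpNorm_smul_le_mul_eLpNorm hg.1 ((hf n).1.sub hf₀.1)
  refine tendsto_of_tendsto_of_tendsto_of_le_of_le tendsto_const_nhds ?_ (fun _ => zero_le) hle
  simpa using ENNReal.Tendsto.mul_const h (Or.inr hg.2.ne)

/-! ### Weak gradients: uniqueness, linear operations, closedness in L^p -/

section Basics

variable {N : ℕ} {u v : Euc N → ℝ} {G H : Euc N → Euc N} {p : ℝ}

lemma continuous_coord (i : Fin N) : Continuous fun x : Euc N => x i := by fun_prop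

lemma norm_coord_le (x : Euc N) (i : Fin N) : ‖x i‖ ≤ ‖x‖ := PiLp.norm_apply_le x i

lemma locallyIntegrable_coord {G : Euc N → Euc N} (hG : LocallyIntegrable G volume) (i : Fin N) :
    LocallyIntegrable (fun x => G x i) volume :=
  hG.mono ((continuous_coord i).comp_aestronglyMeasurable hG.aestronglyMeasurable)
    (Eventually.of_forall fun _ => norm_coord_le _ _)

/-- The fundamental lemma of the calculus of variations, applied coordinatewise. It allows the
gradient picked by choice in `weakGradient` to be replaced by any explicit one. -/
lemma IsWeakGradient.ae_eq (hG : IsWeakGradient u G) (hH : IsWeakGradient u H) :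
    G =ᵐ[volume] H := by
  have hi : ∀ i : Fin N, ∀ᵐ x, G x i = H x i := by
    intro i
    refine ae_eq_of_integral_contDiff_smul_eq (locallyIntegrable_coord hG.locallyIntegrable_grad i)
      (locallyIntegrable_coord hH.locallyIntegrable_grad i) fun g hg hgc => ?_
    have h1 := hG.integral_eq g hg hgc i
    have h2 := hH.integral_eq g hg hgc i
    simp only [smul_eq_mul, mul_comm (g _)]
    linarith
  filter_upwards [ae_all_iff.2 hi] with x hx
  ext i; exact hx i

lemma IsWeakGradient.weakGradient (h : IsWeakGradient u G) :
    IsWeakGradient u (weakGradient u) := by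
  have h' : ∃ G, IsWeakGradient u G := ⟨G, h⟩
  rw [MixedLocalNonlocal.weakGradient, dif_pos h']
  exact h'.choose_spec

lemma IsWeakGradient.weakGradient_ae_eq (h : IsWeakGradient u G) :
    MixedLocalNonlocal.weakGradient u =ᵐ[volume] G :=
  h.weakGradient.ae_eq h

lemma IsWeakGradient.congr (h : IsWeakGradient u G) (hu : u =ᵐ[volume] v)
    (hG : G =ᵐ[volume] H) : IsWeakGradient v H where
  locallyIntegrable := h.locallyIntegrable.congr hu
  locallyIntegrable_grad := h.locallyIntegrable_grad.congr hG
  integral_eq φ hφ hc i := by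
    have h1 := h.integral_eq φ hφ hc i
    rw [integral_congr_ae (g := fun x => v x * fderiv ℝ φ x (EuclideanSpace.single i 1)),
      integral_congr_ae (f := fun x => G x i * φ x) (g := fun x => H x i * φ x)] at h1
    · exact h1
    · filter_upwards [hG] with x hx; rw [hx]
    · filter_upwards [hu] with x hx; rw [hx]

lemma hasCompactSupport_fderiv_apply {φ : Euc N → ℝ} (hc : HasCompactSupport φ) (e : Euc N) :
    HasCompactSupport fun x => fderiv ℝ φ x e :=
  hc.fderiv_apply ℝ e

lemma continuous_fderiv_apply' {φ : Euc N → ℝ} (hφ : ContDiff ℝ ∞ φ) (e : Euc N) :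
    Continuous fun x => fderiv ℝ φ x e :=
  (hφ.continuous_fderiv (by simp)).clm_apply continuous_const

lemma integrable_mul_of_locallyIntegrable {f φ : Euc N → ℝ} (hf : LocallyIntegrable f volume)
    (hφ : Continuous φ) (hc : HasCompactSupport φ) : Integrable (fun x => f x * φ x) := by
  have := hf.integrable_smul_left_of_hasCompactSupport hφ hc
  simpa [mul_comm] using this

lemma IsWeakGradient.add (hu : IsWeakGradient u G) (hv : IsWeakGradient v H) :
    IsWeakGradient (fun x => u x + v x) (fun x => G x + H x) where
  locallyIntegrable := hu.locallyIntegrable.add hv.locallyIntegrable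
  locallyIntegrable_grad := hu.locallyIntegrable_grad.add hv.locallyIntegrable_grad
  integral_eq φ hφ hc i := by
    have cd := continuous_fderiv_apply' hφ (EuclideanSpace.single i 1)
    have cc := hasCompactSupport_fderiv_apply hc (EuclideanSpace.single i 1)
    simp only [PiLp.add_apply, add_mul]
    rw [integral_add (integrable_mul_of_locallyIntegrable hu.locallyIntegrable cd cc)
      (integrable_mul_of_locallyIntegrable hv.locallyIntegrable cd cc),
      integral_add (integrable_mul_of_locallyIntegrable (locallyIntegrable_coord hu.locallyIntegrable_grad i) hφ.continuous hc)
      (integrable_mul_of_locallyIntegrable (locallyIntegrable_coord hv.locallyIntegrable_grad i) hφ.continuous hc),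
      hu.integral_eq φ hφ hc i, hv.integral_eq φ hφ hc i]
    ring

lemma IsWeakGradient.const_mul (hu : IsWeakGradient u G) (c : ℝ) :
    IsWeakGradient (fun x => c * u x) (fun x => c • G x) where
  locallyIntegrable := hu.locallyIntegrable.smul c
  locallyIntegrable_grad := hu.locallyIntegrable_grad.smul c
  integral_eq φ hφ hc i := by
    simp only [PiLp.smul_apply, smul_eq_mul, mul_assoc, integral_const_mul]
    rw [hu.integral_eq φ hφ hc i]
    ring

lemma euc_sum (e : Euc N) : e = ∑ i, e i • stdVec i := by
  ext j
  simp [Finset.sum_apply, Pi.single_apply]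

lemma inner_stdVec (x : Euc N) (i : Fin N) : inner ℝ x (stdVec i) = x i := by
  simp [stdVec, EuclideanSpace.inner_single_right]

lemma IsWeakGradient.integral_fderiv (hu : IsWeakGradient u G) {φ : Euc N → ℝ}
    (hφ : ContDiff ℝ ∞ φ) (hc : HasCompactSupport φ) (e : Euc N) :
    ∫ x, u x * fderiv ℝ φ x e = - ∫ x, inner ℝ (G x) e * φ x := by
  have e1 : ∀ x, u x * fderiv ℝ φ x e = ∑ i, e i * (u x * fderiv ℝ φ x (stdVec i)) := by
    intro x
    conv_lhs => rw [euc_sum e]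
    simp only [map_sum, map_smul, smul_eq_mul, Finset.mul_sum]
    exact Finset.sum_congr rfl fun i _ => by ring
  have e2 : ∀ x, inner ℝ (G x) e * φ x = ∑ i, e i * (G x i * φ x) := by
    intro x
    conv_lhs => rw [euc_sum e]
    simp only [inner_sum, inner_smul_right, inner_stdVec, Finset.sum_mul]
    exact Finset.sum_congr rfl fun i _ => by ring
  simp only [e1, e2]
  rw [integral_finsetSum, integral_finsetSum, ← Finset.sum_neg_distrib]
  · refine Finset.sum_congr rfl fun i _ => ?_
    rw [integral_const_mul, integral_const_mul, hu.integral_eq φ hφ hc i]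
    ring
  · exact fun i _ => (integrable_mul_of_locallyIntegrable (locallyIntegrable_coord hu.locallyIntegrable_grad i) hφ.continuous hc).const_mul _
  · exact fun i _ => (integrable_mul_of_locallyIntegrable hu.locallyIntegrable (continuous_fderiv_apply' hφ _)
      (hasCompactSupport_fderiv_apply hc _)).const_mul _

lemma one_le_ofReal {p : ℝ} (hp : 1 < p) : (1 : ENNReal) ≤ ENNReal.ofReal p := by
  rw [← ENNReal.ofReal_one]; exact ENNReal.ofReal_le_ofReal hp.le

lemma IsSobolev.congr (h : IsSobolev p u G) (hu : u =ᵐ[volume] v) (hG : G =ᵐ[volume] H) :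
    IsSobolev p v H :=
  ⟨h.memLp.ae_eq hu, h.memLp_grad.ae_eq hG, h.weak.congr hu hG⟩

lemma IsSobolev.weakGradient (h : IsSobolev p u G) :
    IsSobolev p u (MixedLocalNonlocal.weakGradient u) :=
  h.congr (EventuallyEq.refl _ _) h.weak.weakGradient_ae_eq.symm

lemma IsSobolev.add (hu : IsSobolev p u G) (hv : IsSobolev p v H) :
    IsSobolev p (fun x => u x + v x) (fun x => G x + H x) :=
  ⟨hu.memLp.add hv.memLp, hu.memLp_grad.add hv.memLp_grad, hu.weak.add hv.weak⟩

lemma IsSobolev.const_mul (hu : IsSobolev p u G) (c : ℝ) :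
    IsSobolev p (fun x => c * u x) (fun x => c • G x) :=
  ⟨hu.memLp.const_mul c, hu.memLp_grad.const_smul c, hu.weak.const_mul c⟩

lemma IsSobolev.sub (hu : IsSobolev p u G) (hv : IsSobolev p v H) :
    IsSobolev p (fun x => u x - v x) (fun x => G x - H x) := by
  have := hu.add (hv.const_mul (-1))
  simpa [← sub_eq_add_neg] using this

lemma MemW01p.isSobolev {Ω : Set (Euc N)} (h : MemW01p Ω p u) :
    IsSobolev p u (MixedLocalNonlocal.weakGradient u) :=
  ⟨h.memLp, h.memLp_weakGradient, h.exists_weakGradient.choose_spec.weakGradient⟩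

lemma IsSobolev.memW01p {Ω : Set (Euc N)} (h : IsSobolev p u G)
    (h0 : ∀ᵐ x ∂volume.restrict Ωᶜ, u x = 0) : MemW01p Ω p u :=
  ⟨h.memLp, ⟨G, h.weak⟩, h.weakGradient.memLp_grad, h0⟩

lemma isSobolev_of_contDiff {ψ : Euc N → ℝ} (hψ : ContDiff ℝ 1 ψ)
    (hc : HasCompactSupport ψ) : IsSobolev p ψ (fun x => gradient ψ x) := by
  have hcont : Continuous fun x => gradient ψ x :=
    (InnerProductSpace.toDual ℝ (Euc N)).symm.continuous.comp (hψ.continuous_fderiv one_ne_zero)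
  have hgc : HasCompactSupport fun x => gradient ψ x := by
    refine (hc.fderiv ℝ).comp_left (g := (InnerProductSpace.toDual ℝ (Euc N)).symm) (by simp)
  refine ⟨hψ.continuous.memLp_of_hasCompactSupport hc, hcont.memLp_of_hasCompactSupport hgc,
    hψ.continuous.locallyIntegrable, hcont.locallyIntegrable, fun φ hφ hφc i => ?_⟩
  have e : ∀ x, gradient ψ x i = fderiv ℝ ψ x (stdVec i) := by
    intro x
    rw [← inner_stdVec]
    simp [gradient, InnerProductSpace.toDual_symm_apply]
  simp only [e]
  have c1 : Continuous fun x => fderiv ℝ ψ x (stdVec i) :=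
    (hψ.continuous_fderiv one_ne_zero).clm_apply continuous_const
  refine integral_mul_fderiv_eq_neg_fderiv_mul_of_integrable ?_ ?_ ?_
    (fun x _ => hψ.differentiable (by simp) x)
    (fun x _ => hφ.differentiable (by simp) x)
  · exact (c1.mul hφ.continuous).integrable_of_hasCompactSupport (hφc.mul_left)
  · exact (hψ.continuous.mul (continuous_fderiv_apply' hφ _)).integrable_of_hasCompactSupport
      (hc.mul_right)
  · exact (hψ.continuous.mul hφ.continuous).integrable_of_hasCompactSupport hc.mul_right

lemma holderTriple_ofReal (hp : 1 < p) :
    ENNReal.HolderTriple (ENNReal.ofReal p) (ENNReal.ofReal (p / (p - 1))) 1 := by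
  have h := Real.HolderConjugate.conjExponent hp
  exact h.ennrealOfReal

lemma isWeakGradient_of_forall_integral_eq {V : Euc N → Euc N} (hp : 1 < p) (hu : MemLp u (ENNReal.ofReal p))
    (hV : MemLp V (ENNReal.ofReal p)) (h : ∀ φ : Euc N → ℝ, ContDiff ℝ ∞ φ → HasCompactSupport φ →
      ∀ i : Fin N, ∫ x, u x * fderiv ℝ φ x (stdVec i) = - ∫ x, V x i * φ x) : IsSobolev p u V :=
  ⟨hu, hV, hu.locallyIntegrable (one_le_ofReal hp), hV.locallyIntegrable (one_le_ofReal hp), h⟩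

lemma memLp_coord {q : ENNReal} (hG : MemLp G q volume) (i : Fin N) :
    MemLp (fun x => G x i) q volume :=
  hG.mono ((continuous_coord i).comp_aestronglyMeasurable hG.1)
    (Eventually.of_forall fun _ => norm_coord_le _ _)

/-- The weak gradient is a closed operator in `L^p`. -/
lemma IsSobolev.of_tendsto (hp : 1 < p) {w : ℕ → Euc N → ℝ} {W : ℕ → Euc N → Euc N}
    (h : ∀ n, IsSobolev p (w n) (W n)) (hu : MemLp u (ENNReal.ofReal p))
    (hG : MemLp G (ENNReal.ofReal p))
    (h1 : Tendsto (fun n => eLpNorm (w n - u) (ENNReal.ofReal p) volume) atTop (𝓝 0))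
    (h2 : Tendsto (fun n => eLpNorm (W n - G) (ENNReal.ofReal p) volume) atTop (𝓝 0)) :
    IsSobolev p u G := by
  have := holderTriple_ofReal hp
  refine isWeakGradient_of_forall_integral_eq hp hu hG fun φ hφ hc i => ?_
  have t1 := tendsto_integral_mul_of_tendsto_eLpNorm (p' := ENNReal.ofReal (p / (p - 1)))
    (fun n => (h n).memLp) hu
    ((continuous_fderiv_apply' hφ (stdVec i)).memLp_of_hasCompactSupport
      (hasCompactSupport_fderiv_apply hc (stdVec i))) h1
  have t2 := tendsto_integral_mul_of_tendsto_eLpNorm (p' := ENNReal.ofReal (p / (p - 1)))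
    (f := fun n x => W n x i) (f₀ := fun x => G x i)
    (fun n => memLp_coord (h n).memLp_grad i) (memLp_coord hG i)
    (hφ.continuous.memLp_of_hasCompactSupport hc) (by
      refine tendsto_of_tendsto_of_tendsto_of_le_of_le tendsto_const_nhds h2 (fun _ => zero_le)
        fun n => eLpNorm_mono fun x => ?_
      exact norm_coord_le (W n x - G x) i)
  refine tendsto_nhds_unique t1 ?_
  refine t2.neg.congr fun n => ?_
  exact ((h n).weak.integral_eq φ hφ hc i).symm

end Basics

/-! ### Jensen and Minkowski inequalities for averages -/

/-- Jensen's inequality, read off from the monotonicity of L^p norms in the exponent on a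
probability space. -/
lemma enorm_integral_rpow_le {T H : Type*} [MeasurableSpace T] {m : Measure T}
    [IsProbabilityMeasure m] [NormedAddCommGroup H] [NormedSpace ℝ H] {p : ℝ} (hp : 1 ≤ p)
    {f : T → H} (hf : AEStronglyMeasurable f m) :
    ‖∫ t, f t ∂m‖ₑ ^ p ≤ ∫⁻ t, ‖f t‖ₑ ^ p ∂m := by
  have h1 := eLpNorm'_le_eLpNorm'_of_exponent_le one_pos hp m hf
  rw [eLpNorm'_eq_lintegral_enorm, eLpNorm'_eq_lintegral_enorm] at h1
  simp only [ENNReal.rpow_one, div_one] at h1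
  calc ‖∫ t, f t ∂m‖ₑ ^ p ≤ (∫⁻ t, ‖f t‖ₑ ∂m) ^ p :=
        ENNReal.rpow_le_rpow (enorm_integral_le_lintegral_enorm _) (by linarith)
    _ ≤ ((∫⁻ t, ‖f t‖ₑ ^ p ∂m) ^ (1 / p)) ^ p := ENNReal.rpow_le_rpow h1 (by linarith)
    _ = ∫⁻ t, ‖f t‖ₑ ^ p ∂m := by
        rw [← ENNReal.rpow_mul, one_div_mul_cancel (by linarith), ENNReal.rpow_one]

/-- Minkowski-type inequality for averages over a probability space. -/
lemma lintegral_enorm_integral_rpow_le {X T H : Type*} [MeasurableSpace X] [MeasurableSpace T]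
    {μ : Measure X} [SFinite μ] {m : Measure T} [IsProbabilityMeasure m] [NormedAddCommGroup H]
    [NormedSpace ℝ H] {p : ℝ} (hp : 1 ≤ p) {F : X × T → H}
    (hF : AEStronglyMeasurable F (μ.prod m)) :
    ∫⁻ x, ‖∫ t, F (x, t) ∂m‖ₑ ^ p ∂μ ≤ ∫⁻ t, ∫⁻ x, ‖F (x, t)‖ₑ ^ p ∂μ ∂m := by
  rw [lintegral_lintegral_swap (f := fun t x => ‖F (x, t)‖ₑ ^ p)
    ((hF.enorm.pow_const p).comp_quasiMeasurePreserving Measure.measurePreserving_swap.quasiMeasurePreserving)]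
  refine lintegral_mono_ae ?_
  filter_upwards [hF.prodMk_left] with x hx
  exact enorm_integral_rpow_le hp hx

/-! ### Translations of Sobolev functions -/

section Translation

variable {N : ℕ} {u : Euc N → ℝ} {G : Euc N → Euc N} {p : ℝ}

/-- Continuity of translation in L^q, as a case of the continuity of composition with a continuously
varying family of measure-preserving maps. -/
lemma tendsto_eLpNorm_translate_sub {H : Type*} [NormedAddCommGroup H] {q : ENNReal}
    (hq : 1 ≤ q) (hq' : q ≠ ⊤) {g : Euc N → H} (hg : MemLp g q volume) :
    Tendsto (fun h : Euc N => eLpNorm (fun x => g (x + h) - g x) q volume) (𝓝 0) (𝓝 0) := by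
  have : Fact (1 ≤ q) := ⟨hq⟩
  let T : C(Euc N, C(Euc N, Euc N)) :=
    (ContinuousMap.mk (fun a : Euc N × Euc N => a.2 + a.1) (by fun_prop)).curry
  have hT : ∀ h, MeasurePreserving (T h) (volume : Measure (Euc N)) volume := fun h =>
    measurePreserving_add_right volume h
  have h1 := Filter.Tendsto.compMeasurePreservingLp (l := 𝓝 (0 : Euc N)) (f := fun _ => hg.toLp g)
    (g := fun h => T h) tendsto_const_nhds (T.continuous.tendsto 0) hT (hT 0) hq'
  have h2 := (Lp.tendsto_Lp_iff_tendsto_eLpNorm' _ _).1 h1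
  refine h2.congr fun h => eLpNorm_congr_ae ?_
  have e1 := Lp.coeFn_compMeasurePreserving (hg.toLp g) (hT h)
  have e2 := Lp.coeFn_compMeasurePreserving (hg.toLp g) (hT 0)
  have e3 := (hT h).quasiMeasurePreserving.ae_eq_comp hg.coeFn_toLp
  have e4 := (hT 0).quasiMeasurePreserving.ae_eq_comp hg.coeFn_toLp
  filter_upwards [e1, e2, e3, e4] with x h1 h2 h3 h4
  simp only [Pi.sub_apply, h1, h2, h3, h4]
  simp [T, ContinuousMap.curry]

/-- The uniform probability measure on `(0, 1]`. -/
noncomputable abbrev unitMeasure : Measure ℝ := volume.restrict (Ioc 0 1)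

instance : IsProbabilityMeasure unitMeasure := ⟨by simp⟩

lemma quasiMeasurePreserving_segment (h : Euc N) :
    Measure.QuasiMeasurePreserving (fun z : Euc N × ℝ => z.1 + z.2 • h)
      ((volume : Measure (Euc N)).prod unitMeasure) volume :=
  MeasureTheory.QuasiMeasurePreserving.prod_of_left (by fun_prop) (Eventually.of_forall fun s =>
    (measurePreserving_add_right volume (s • h)).quasiMeasurePreserving)

lemma aestronglyMeasurable_segment {H : Type*} [NormedAddCommGroup H] {g : Euc N → H}
    (hg : AEStronglyMeasurable g volume) (h : Euc N) :
    AEStronglyMeasurable (fun z : Euc N × ℝ => g (z.1 + z.2 • h))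
      ((volume : Measure (Euc N)).prod unitMeasure) :=
  hg.comp_quasiMeasurePreserving (quasiMeasurePreserving_segment h)

lemma integral_fderiv_segment {φ : Euc N → ℝ} (hφ : ContDiff ℝ ∞ φ) (x h : Euc N) :
    ∫ s, fderiv ℝ φ (x - s • h) h ∂unitMeasure = φ x - φ (x - h) := by
  have hd : ∀ s ∈ uIcc (0:ℝ) 1, HasDerivAt (fun s : ℝ => φ (x - s • h)) (-fderiv ℝ φ (x - s • h) h) s := by
    intro s _
    have h1 : HasDerivAt (fun s : ℝ => x - s • h) (-h) s := by
      simpa using ((hasDerivAt_id s).smul_const h).const_sub x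
    have h2 := ((hφ.differentiable (by simp)) (x - s • h)).hasFDerivAt.comp_hasDerivAt s h1
    simpa [Function.comp_def] using h2
  have h3 := intervalIntegral.integral_eq_sub_of_hasDerivAt hd ((by
    refine Continuous.intervalIntegrable ?_ _ _
    exact ((hφ.continuous_fderiv (by simp)).comp (by fun_prop) |>.clm_apply continuous_const).neg))
  rw [intervalIntegral.integral_of_le zero_le_one, integral_neg] at h3
  simp only [one_smul, zero_smul, sub_zero] at h3
  linarith

/-- The translates of ψ along the segment all live in one compact set, the one swept out by its
support, and f is integrable there. This justifies the Fubini steps in `IsSobolev.translate_sub`. -/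
lemma integrable_prod_segment {f ψ : Euc N → ℝ} (hf : LocallyIntegrable f volume)
    (hψ : Continuous ψ) (hc : HasCompactSupport ψ) (h : Euc N) :
    Integrable (fun z : Euc N × ℝ => f z.1 * ψ (z.1 - z.2 • h))
      ((volume : Measure (Euc N)).prod unitMeasure) := by
  obtain ⟨C, hC⟩ := hψ.bounded_above_of_compact_support hc
  set K : Set (Euc N) := (fun z : Euc N × ℝ => z.1 + z.2 • h) '' (tsupport ψ ×ˢ Icc 0 1) with hK
  have hKc : IsCompact K := (hc.isCompact.prod isCompact_Icc).image (by fun_prop)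
  have hfi : Integrable (K.indicator fun x => ‖f x‖ * C) volume :=
    (integrable_indicator_iff hKc.measurableSet).2
      (((hf.integrableOn_isCompact hKc).norm).mul_const C)
  have hfi2 := hfi.comp_fst unitMeasure
  refine hfi2.mono' ?_ ?_
  · refine (hf.aestronglyMeasurable.comp_fst).mul ?_
    exact (hψ.comp (by fun_prop : Continuous fun z : Euc N × ℝ => z.1 - z.2 • h)).aestronglyMeasurable
  · have : ∀ᵐ z ∂((volume : Measure (Euc N)).prod unitMeasure), z.2 ∈ Ioc (0:ℝ) 1 :=
      Measure.quasiMeasurePreserving_snd.ae (ae_restrict_mem measurableSet_Ioc)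
    filter_upwards [this] with z hz
    by_cases hzK : z.1 ∈ K
    · rw [indicator_of_mem hzK, norm_mul]
      exact mul_le_mul_of_nonneg_left (hC _) (norm_nonneg _)
    · rw [indicator_of_notMem hzK]
      have : ψ (z.1 - z.2 • h) = 0 := by
        by_contra hne
        exact hzK ⟨(z.1 - z.2 • h, z.2), ⟨subset_tsupport _ hne, hz.1.le, hz.2⟩, by simp⟩
      simp [this]

/-- By duality: both sides are integrated against a test function φ, the translation is moved onto
φ, and the fundamental theorem of calculus is applied to φ. Poincaré's inequality, the embedding
into W^{s,p} and the convergence of difference quotients all depend on this identity. -/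
lemma IsSobolev.translate_sub (hp : 1 < p) (hu : IsSobolev p u G) (h : Euc N) :
    ∀ᵐ x, u (x + h) - u x = ∫ s, inner ℝ (G (x + s • h)) h ∂unitMeasure := by
  have hGh : MemLp (fun x => inner ℝ (G x) h) (ENNReal.ofReal p) volume := by
    refine MemLp.of_le_mul (c := ‖h‖) hu.memLp_grad
      (hu.memLp_grad.1.inner aestronglyMeasurable_const) (Eventually.of_forall fun x => ?_)
    rw [mul_comm]; exact norm_inner_le_norm _ _
  have hmeas := aestronglyMeasurable_segment hGh.1 h
  have hp0 : ENNReal.ofReal p ≠ 0 := by simp; linarith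
  have hR : MemLp (fun x => ∫ s, inner ℝ (G (x + s • h)) h ∂unitMeasure) (ENNReal.ofReal p)
      volume := by
    refine ⟨hmeas.integral_prod_right', ?_⟩
    rw [eLpNorm_lt_top_iff_lintegral_rpow_enorm_lt_top hp0 ENNReal.ofReal_ne_top,
      ENNReal.toReal_ofReal (by linarith)]
    refine (lintegral_enorm_integral_rpow_le hp.le hmeas).trans_lt ?_
    have : ∀ s : ℝ, ∫⁻ x, ‖(inner ℝ (G (x + s • h)) h : ℝ)‖ₑ ^ p = ∫⁻ x, ‖(inner ℝ (G x) h : ℝ)‖ₑ ^ p :=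
      fun s => lintegral_add_right_eq_self (fun x => ‖(inner ℝ (G x) h : ℝ)‖ₑ ^ p) (s • h)
    simp only [this, lintegral_const, measure_univ, mul_one]
    have h3 := (eLpNorm_lt_top_iff_lintegral_rpow_enorm_lt_top hp0 ENNReal.ofReal_ne_top).1 hGh.2
    rwa [ENNReal.toReal_ofReal (by linarith)] at h3
  have hul : LocallyIntegrable (fun x => u (x + h)) volume :=
    MemLp.locallyIntegrable
      (hu.memLp.comp_measurePreserving (measurePreserving_add_right volume h)) (one_le_ofReal hp)
  refine ae_eq_of_integral_contDiff_smul_eq (hul.sub hu.weak.locallyIntegrable)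
    (hR.locallyIntegrable (one_le_ofReal hp)) fun φ hφ hc => ?_
  have hd : Continuous fun x => fderiv ℝ φ x h := continuous_fderiv_apply' hφ h
  have hdc := hasCompactSupport_fderiv_apply hc h
  have hGl := hGh.locallyIntegrable (one_le_ofReal hp)
  have shift : ∀ (f : Euc N → ℝ) (a : Euc N), ∫ x, φ x * f (x + a) = ∫ x, f x * φ (x - a) := by
    intro f a
    rw [← integral_add_right_eq_self (fun x => f x * φ (x - a)) a]
    exact integral_congr_ae (Eventually.of_forall fun x => by simp [mul_comm])
  -- right-hand side
  have hR1 : ∫ x, φ x • ∫ s, inner ℝ (G (x + s • h)) h ∂unitMeasure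
      = ∫ s, ∫ x, φ x * inner ℝ (G (x + s • h)) h ∂volume ∂unitMeasure := by
    simp only [smul_eq_mul, ← integral_const_mul]
    refine integral_integral_swap ?_
    have hi := integrable_prod_segment hGl hφ.continuous hc h
    -- The shear (x, s) ↦ (x + s h, s) preserves the product measure, so integrability passes from
    -- f(x) ψ(x - s h) to f(x + s h) ψ(x).
    have hmp : MeasurePreserving (fun z : Euc N × ℝ => (z.1 + z.2 • h, z.2))
        ((volume : Measure (Euc N)).prod unitMeasure) (volume.prod unitMeasure) := by
      have h1 := (MeasurePreserving.id unitMeasure).skew_product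
        (g := fun (s : ℝ) (x : Euc N) => x + s • h) (μc := (volume : Measure (Euc N)))
        (μd := volume) (by fun_prop)
        (Eventually.of_forall fun s => (measurePreserving_add_right volume (s • h)).map_eq)
      exact (Measure.measurePreserving_swap.comp h1).comp Measure.measurePreserving_swap
    refine (hmp.integrable_comp_of_integrable hi).congr (Eventually.of_forall fun z => ?_)
    simp [Function.uncurry, mul_comm]
  have hR2 : ∀ s : ℝ, ∫ x, φ x * inner ℝ (G (x + s • h)) h
      = - ∫ x, u x * fderiv ℝ φ (x - s • h) h := by
    intro s
    rw [shift (fun x => inner ℝ (G x) h) (s • h)]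
    have h1 := hu.weak.integral_fderiv (φ := fun x => φ (x - s • h))
      (hφ.comp (contDiff_id.sub contDiff_const)) (hc.comp_homeomorph (Homeomorph.subRight (s • h))) h
    have h2 : ∀ x, fderiv ℝ (fun x => φ (x - s • h)) x = fderiv ℝ φ (x - s • h) := fun x =>
      by simpa [sub_eq_add_neg] using fderiv_comp_add_right (f := φ) (x := x) (-(s • h))
    simp only [h2] at h1
    rw [h1, neg_neg]
  have hL : ∫ x, φ x • (u (x + h) - u x) = ∫ x, u x * (φ (x - h) - φ x) := by
    simp only [smul_eq_mul, mul_sub]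
    have i1 := (integrable_mul_of_locallyIntegrable hul hφ.continuous hc)
    have i2 := (integrable_mul_of_locallyIntegrable hu.weak.locallyIntegrable hφ.continuous hc)
    have i3 : Integrable fun x => u x * φ (x - h) := integrable_mul_of_locallyIntegrable
      hu.weak.locallyIntegrable (hφ.continuous.comp (by fun_prop))
      (hc.comp_homeomorph (Homeomorph.subRight h))
    rw [integral_sub (by simpa [mul_comm] using i1) (by simpa [mul_comm] using i2),
      integral_sub i3 i2, shift u h]
    simp [mul_comm]
  change ∫ x, φ x • (u (x + h) - u x) = _
  rw [hR1, hL]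
  simp only [hR2, integral_neg]
  rw [integral_integral_swap (f := fun s x => u x * fderiv ℝ φ (x - s • h) h)
    (integrable_prod_segment hu.weak.locallyIntegrable hd hdc h).swap, ← integral_neg]
  refine integral_congr_ae (Eventually.of_forall fun x => ?_)
  simp only [integral_const_mul, integral_fderiv_segment hφ]
  ring

end Translation

lemma eLpNorm_rpow_ofReal {X H : Type*} [MeasurableSpace X] {μ : Measure X}
    [NormedAddCommGroup H] {p : ℝ} (hp : 0 < p) (f : X → H) :
    eLpNorm f (ENNReal.ofReal p) μ ^ p = ∫⁻ x, ‖f x‖ₑ ^ p ∂μ := by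
  rw [eLpNorm_eq_lintegral_rpow_enorm_toReal (by simpa using hp) ENNReal.ofReal_ne_top,
    ENNReal.toReal_ofReal hp.le, ← ENNReal.rpow_mul, one_div_mul_cancel hp.ne', ENNReal.rpow_one]

/-! ### Difference quotients and weak derivatives -/

section Quotients

variable {N : ℕ} {u u₁ u₂ v : Euc N → ℝ} {G G₁ G₂ V : Euc N → Euc N} {p : ℝ}

lemma memLp_inner_const {q : ENNReal} (hG : MemLp G q volume) (e : Euc N) :
    MemLp (fun x => inner ℝ (G x) e) q volume := by
  refine MemLp.of_le_mul (c := ‖e‖) hG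
    (hG.1.inner aestronglyMeasurable_const) (Eventually.of_forall fun x => ?_)
  rw [mul_comm]; exact norm_inner_le_norm _ _

lemma IsSobolev.lintegral_translate_sub_le (hp : 1 < p) (hu : IsSobolev p u G) (h : Euc N) :
    ∫⁻ x, ‖u (x + h) - u x‖ₑ ^ p ≤ ‖h‖ₑ ^ p * ∫⁻ x, ‖G x‖ₑ ^ p := by
  have hp0 : 0 ≤ p := by linarith
  have hGh := memLp_inner_const hu.memLp_grad h
  calc ∫⁻ x, ‖u (x + h) - u x‖ₑ ^ p
      = ∫⁻ x, ‖∫ s, inner ℝ (G (x + s • h)) h ∂unitMeasure‖ₑ ^ p := by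
        refine lintegral_congr_ae ?_
        filter_upwards [hu.translate_sub hp h] with x hx
        rw [hx]
    _ ≤ ∫⁻ s, ∫⁻ x, ‖(inner ℝ (G (x + s • h)) h : ℝ)‖ₑ ^ p ∂volume ∂unitMeasure :=
        lintegral_enorm_integral_rpow_le hp.le (aestronglyMeasurable_segment hGh.1 h)
    _ = ∫⁻ x, ‖(inner ℝ (G x) h : ℝ)‖ₑ ^ p := by
        have : ∀ s : ℝ, ∫⁻ x, ‖(inner ℝ (G (x + s • h)) h : ℝ)‖ₑ ^ p
            = ∫⁻ x, ‖(inner ℝ (G x) h : ℝ)‖ₑ ^ p :=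
          fun s => lintegral_add_right_eq_self (fun x => ‖(inner ℝ (G x) h : ℝ)‖ₑ ^ p) (s • h)
        simp only [this, lintegral_const, measure_univ, mul_one]
    _ ≤ ∫⁻ x, ‖h‖ₑ ^ p * ‖G x‖ₑ ^ p := by
        refine lintegral_mono fun x => ?_
        rw [← ENNReal.mul_rpow_of_nonneg _ _ hp0]
        refine ENNReal.rpow_le_rpow ?_ hp0
        rw [mul_comm, ← ofReal_norm, ← ofReal_norm, ← ofReal_norm, ← ENNReal.ofReal_mul (norm_nonneg _)]
        exact ENNReal.ofReal_le_ofReal (norm_inner_le_norm _ _)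
    _ = ‖h‖ₑ ^ p * ∫⁻ x, ‖G x‖ₑ ^ p :=
        lintegral_const_mul' _ _ (ENNReal.rpow_ne_top_of_nonneg hp0 enorm_ne_top)

/-- Difference quotients of a Sobolev function converge strongly to the directional derivative. -/
lemma IsSobolev.tendsto_quotient (hp : 1 < p) (hu : IsSobolev p u G) (e : Euc N) {t : ℕ → ℝ}
    (ht : Tendsto t atTop (𝓝 0)) (ht0 : ∀ n, t n ≠ 0) :
    Tendsto (fun n => eLpNorm ((fun x => (t n)⁻¹ * (u (x + t n • e) - u x))
      - fun x => inner ℝ (G x) e) (ENNReal.ofReal p) volume) atTop (𝓝 0) := by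
  have hp0 : 0 < p := by linarith
  set g : Euc N → ℝ := fun x => inner ℝ (G x) e with hg
  have hgm : MemLp g (ENNReal.ofReal p) volume := memLp_inner_const hu.memLp_grad e
  have htr := tendsto_eLpNorm_translate_sub (one_le_ofReal hp) ENNReal.ofReal_ne_top hgm
  rw [ENNReal.tendsto_nhds_zero] at htr ⊢
  intro ε hε
  obtain ⟨δ, hδ, hδε⟩ := Metric.eventually_nhds_iff.1 (htr ε hε)
  have hte : Tendsto (fun n => |t n| * ‖e‖) atTop (𝓝 0) := by simpa using ht.abs.mul_const ‖e‖
  filter_upwards [hte.eventually (gt_mem_nhds hδ)] with n hn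
  -- The error of the quotient at x is the average over s in (0,1] of g(x + s t e) - g(x). Each of
  -- these translates is within ε of g in L^p once |t| ‖e‖ < δ.
  rw [← ENNReal.rpow_le_rpow_iff hp0, eLpNorm_rpow_ofReal hp0]
  have hseg : AEStronglyMeasurable (fun z : Euc N × ℝ => g (z.1 + z.2 • (t n • e)) - g z.1)
      (volume.prod unitMeasure) :=
    (aestronglyMeasurable_segment hgm.1 (t n • e)).sub hgm.1.comp_fst
  calc ∫⁻ x, ‖((fun x => (t n)⁻¹ * (u (x + t n • e) - u x)) - g) x‖ₑ ^ p
      = ∫⁻ x, ‖∫ s, (g (x + s • (t n • e)) - g x) ∂unitMeasure‖ₑ ^ p := by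
        refine lintegral_congr_ae ?_
        have hi : ∀ᵐ x, Integrable (fun s => g (x + s • (t n • e))) unitMeasure := by
          have h1 : AEStronglyMeasurable (fun z : Euc N × ℝ => g (z.1 + z.2 • (t n • e)))
            (volume.prod unitMeasure) := aestronglyMeasurable_segment hgm.1 (t n • e)
          have h2 : ∫⁻ x, ∫⁻ s, ‖g (x + s • (t n • e))‖ₑ ^ p ∂unitMeasure ≠ ⊤ := by
            rw [lintegral_lintegral_swap (h1.enorm.pow_const p)]
            have : ∀ s : ℝ, ∫⁻ x, ‖g (x + s • (t n • e))‖ₑ ^ p = ∫⁻ x, ‖g x‖ₑ ^ p :=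
              fun s => lintegral_add_right_eq_self (fun x => ‖g x‖ₑ ^ p) (s • (t n • e))
            simp only [this, lintegral_const, measure_univ, mul_one]
            rw [← eLpNorm_rpow_ofReal hp0]
            exact ENNReal.rpow_ne_top_of_nonneg hp0.le hgm.2.ne
          filter_upwards [ae_lt_top' ((h1.enorm.pow_const p).lintegral_prod_right') h2,
            h1.prodMk_left] with x hx hxm
          rw [← eLpNorm_rpow_ofReal hp0] at hx
          have : MemLp (fun s => g (x + s • (t n • e))) (ENNReal.ofReal p) unitMeasure :=
            ⟨hxm, by
              rw [lt_top_iff_ne_top]; intro h; rw [h, ENNReal.top_rpow_of_pos hp0] at hx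
              exact lt_irrefl _ hx⟩
          exact this.integrable (one_le_ofReal hp)
        filter_upwards [hu.translate_sub hp (t n • e), hi] with x hx hxi
        rw [integral_sub hxi (integrable_const _), Pi.sub_apply, hx]
        simp only [inner_smul_right, integral_const_mul, inv_mul_cancel_left₀ (ht0 n)]
        simp [hg]
    _ ≤ ∫⁻ s, ∫⁻ x, ‖g (x + s • (t n • e)) - g x‖ₑ ^ p ∂volume ∂unitMeasure :=
        lintegral_enorm_integral_rpow_le hp.le hseg
    _ ≤ ∫⁻ _s, ε ^ p ∂unitMeasure := by
        refine lintegral_mono_ae ((ae_restrict_mem measurableSet_Ioc).mono fun s hs => ?_)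
        rw [← eLpNorm_rpow_ofReal hp0]
        refine ENNReal.rpow_le_rpow (hδε ?_) hp0.le
        rw [dist_zero_right, norm_smul, norm_smul, Real.norm_eq_abs, Real.norm_eq_abs,
          abs_of_pos hs.1]
        calc s * (|t n| * ‖e‖) ≤ 1 * (|t n| * ‖e‖) := by
              have := hs.2; gcongr
          _ < δ := by rwa [one_mul]
    _ = ε ^ p := by simp

lemma one_lt_conj_exponent (hp : 1 < p) : 1 < p / (p - 1) := by
  rw [lt_div_iff₀ (by linarith)]; linarith

/-- The difference quotient of a function of `L^p` paired with a test function. -/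
lemma tendsto_integral_quotient_mul (hp : 1 < p) (hv : MemLp v (ENNReal.ofReal p)) (e : Euc N)
    {t : ℕ → ℝ} (ht : Tendsto t atTop (𝓝 0)) (ht0 : ∀ n, t n ≠ 0) {φ : Euc N → ℝ}
    (hφ : ContDiff ℝ ∞ φ) (hc : HasCompactSupport φ) :
    Tendsto (fun n => ∫ x, (t n)⁻¹ * (v (x + t n • e) - v x) * φ x) atTop
      (𝓝 (- ∫ x, v x * fderiv ℝ φ x e)) := by
  have hp' := one_lt_conj_exponent hp
  have hht := holderTriple_ofReal hp
  have hht' : ENNReal.HolderTriple (ENNReal.ofReal (p / (p - 1))) (ENNReal.ofReal p) 1 := hht.symm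
  -- The quotient is moved from v to φ by a change of variables, which reverses the direction e. The
  -- quotients of φ converge strongly in the dual exponent.
  have hφS := isSobolev_of_contDiff (p := p / (p - 1)) (hφ.of_le (by simp)) hc
  have h1 := hφS.tendsto_quotient hp' (-e) ht ht0
  have hq : ∀ n, MemLp (fun x => (t n)⁻¹ * (φ (x + t n • -e) - φ x))
      (ENNReal.ofReal (p / (p - 1))) volume := fun n =>
    ((hφS.memLp.comp_measurePreserving (measurePreserving_add_right volume (t n • -e))).sub
      hφS.memLp).const_mul _
  have h2 := tendsto_integral_mul_of_tendsto_eLpNorm hq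
    (memLp_inner_const hφS.memLp_grad (-e)) hv h1
  have e1 : ∫ x, inner ℝ (gradient φ x) (-e) * v x = - ∫ x, v x * fderiv ℝ φ x e := by
    rw [← integral_neg]
    refine integral_congr_ae (Eventually.of_forall fun x => ?_)
    simp [gradient, InnerProductSpace.toDual_symm_apply, mul_comm]
  rw [e1] at h2
  refine h2.congr fun n => ?_
  have i0 : ∀ (a : Euc N), Integrable (fun x => φ (x + a) * v x) := fun a =>
    memLp_one_iff_integrable.1 (MemLp.mul' (p := ENNReal.ofReal (p / (p - 1)))
      (q := ENNReal.ofReal p) hv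
      (hφS.memLp.comp_measurePreserving (measurePreserving_add_right volume a)))
  have i1 : ∀ (a : Euc N), Integrable (fun x => v (x + a) * φ x) := fun a =>
    memLp_one_iff_integrable.1 (MemLp.mul' (p := ENNReal.ofReal p)
      (q := ENNReal.ofReal (p / (p - 1))) hφS.memLp
      (hv.comp_measurePreserving (measurePreserving_add_right volume a)))
  have s1 : ∫ x, v (x + t n • e) * φ x = ∫ x, φ (x + t n • -e) * v x := by
    rw [← integral_add_right_eq_self (fun x => φ (x + t n • -e) * v x) (t n • e)]
    exact integral_congr_ae (Eventually.of_forall fun x => by simp [mul_comm])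
  have i00 := i0 0
  have i10 := i1 0
  simp only [add_zero] at i00 i10
  simp only [mul_assoc, integral_const_mul, sub_mul]
  rw [integral_sub (i0 _) i00, integral_sub (i1 _) i10, s1]
  simp only [mul_comm (φ _)]

/-- A generalized dominated convergence argument. The quotients of v are bounded by those of u₁ and
u₂, which converge strongly in L^p. A pointwise limit g is needed only along index sequences on
which the quotients of u₁ and u₂ also converge at x. This is why `hd` asks for nothing more, and why
one-sided differentiability of the outer function suffices in applications. -/
lemma weakDeriv_of_lipschitz (hp : 1 < p) (h₁ : IsSobolev p u₁ G₁) (h₂ : IsSobolev p u₂ G₂)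
    (hv : MemLp v (ENNReal.ofReal p)) {L : ℝ} (e : Euc N)
    {t : ℕ → ℝ} (ht : Tendsto t atTop (𝓝 0)) (ht0 : ∀ n, t n ≠ 0)
    (hL : ∀ h, ∀ᵐ x, |v (x + h) - v x| ≤ L * (|u₁ (x + h) - u₁ x| + |u₂ (x + h) - u₂ x|))
    {g : Euc N → ℝ}
    (hd : ∀ᵐ x, ∀ k : ℕ → ℕ, Tendsto k atTop atTop →
      Tendsto (fun n => (t (k n))⁻¹ * (u₁ (x + t (k n) • e) - u₁ x)) atTop (𝓝 (inner ℝ (G₁ x) e)) →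
      Tendsto (fun n => (t (k n))⁻¹ * (u₂ (x + t (k n) • e) - u₂ x)) atTop (𝓝 (inner ℝ (G₂ x) e)) →
      Tendsto (fun n => (t (k n))⁻¹ * (v (x + t (k n) • e) - v x)) atTop (𝓝 (g x))) :
    MemLp g (ENNReal.ofReal p) ∧ ∀ φ : Euc N → ℝ, ContDiff ℝ ∞ φ → HasCompactSupport φ →
      ∫ x, v x * fderiv ℝ φ x e = - ∫ x, g x * φ x := by
  have hp0 : ENNReal.ofReal p ≠ 0 := by simp; linarith
  have hht := holderTriple_ofReal hp
  have hquot : ∀ {w : Euc N → ℝ}, MemLp w (ENNReal.ofReal p) → ∀ s : ℝ,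
      MemLp (fun x => s⁻¹ * (w (x + s • e) - w x)) (ENNReal.ofReal p) := fun hw s =>
    ((hw.comp_measurePreserving (measurePreserving_add_right volume (s • e))).sub hw).const_mul _
  have hm₁ := memLp_inner_const h₁.memLp_grad e
  have hm₂ := memLp_inner_const h₂.memLp_grad e
  have t1 := h₁.tendsto_quotient hp e ht ht0
  have t2 := h₂.tendsto_quotient hp e ht ht0
  -- A subsequence is harmless: the paired quotients of v converge along the full sequence, so their
  -- limit may be identified along any subsequence.
  obtain ⟨k₁, hk₁, ha₁⟩ := (tendstoInMeasure_of_tendsto_eLpNorm hp0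
    (fun n => (hquot h₁.memLp (t n)).1) hm₁.1 t1).exists_seq_tendsto_ae
  obtain ⟨k₂, hk₂, ha₂⟩ := (tendstoInMeasure_of_tendsto_eLpNorm hp0
    (fun n => (hquot h₂.memLp (t (k₁ n))).1) hm₂.1 (t2.comp hk₁.tendsto_atTop)).exists_seq_tendsto_ae
  set k : ℕ → ℕ := fun n => k₁ (k₂ n) with hk
  have hkt : Tendsto k atTop atTop := hk₁.tendsto_atTop.comp hk₂.tendsto_atTop
  set D₁ : ℕ → Euc N → ℝ := fun n x => (t (k n))⁻¹ * (u₁ (x + t (k n) • e) - u₁ x) with hD₁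
  set D₂ : ℕ → Euc N → ℝ := fun n x => (t (k n))⁻¹ * (u₂ (x + t (k n) • e) - u₂ x) with hD₂
  set Q : ℕ → Euc N → ℝ := fun n x => (t (k n))⁻¹ * (v (x + t (k n) • e) - v x) with hQ
  have hQg : ∀ᵐ x, Tendsto (fun n => Q n x) atTop (𝓝 (g x)) := by
    filter_upwards [hd, ha₁, ha₂] with x hx h1 h2
    exact hx k hkt (h1.comp hk₂.tendsto_atTop) h2
  have hDL : ∀ᵐ x, ∀ n, |Q n x| ≤ L * (|D₁ n x| + |D₂ n x|) := by
    rw [ae_all_iff]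
    intro n
    filter_upwards [hL (t (k n) • e)] with x hx
    simp only [hQ, hD₁, hD₂, abs_mul]
    have := mul_le_mul_of_nonneg_left hx (abs_nonneg (t (k n))⁻¹)
    linarith
  set B : Euc N → ℝ := fun x => |L| * (|inner ℝ (G₁ x) e| + |inner ℝ (G₂ x) e|) with hB
  have hBm : MemLp B (ENNReal.ofReal p) := (hm₁.abs.add hm₂.abs).const_mul _
  have hgB : ∀ᵐ x, |g x| ≤ B x := by
    filter_upwards [hQg, hDL, ha₁, ha₂] with x hx hl h1 h2
    have h1' : Tendsto (fun n => |L| * (|D₁ n x| + |D₂ n x|)) atTop (𝓝 (B x)) :=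
      ((h1.comp hk₂.tendsto_atTop).abs.add h2.abs).const_mul _
    refine le_of_tendsto_of_tendsto' hx.abs h1' fun n => (hl n).trans ?_
    gcongr; exact le_abs_self L
  have hgm : AEStronglyMeasurable g volume :=
    aestronglyMeasurable_of_tendsto_ae atTop (fun n => (hquot hv (t (k n))).1) hQg
  have hgL : MemLp g (ENNReal.ofReal p) := hBm.mono hgm (by
    filter_upwards [hgB] with x hx
    rw [Real.norm_eq_abs]; exact hx.trans (le_abs_self _))
  refine ⟨hgL, fun φ hφ hc => ?_⟩
  have hφL : ∀ q, MemLp φ q volume := fun q => hφ.continuous.memLp_of_hasCompactSupport hc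
  have lim1 := (tendsto_integral_quotient_mul hp hv e ht ht0 hφ hc).comp hkt
  -- the quotients clipped at the limiting bound
  set W : ℕ → Euc N → ℝ := fun n x => max (-B x) (min (Q n x) (B x)) with hW
  have hWm : ∀ n, AEStronglyMeasurable (W n) volume := fun n =>
    hBm.1.neg.sup ((hquot hv (t (k n))).1.inf hBm.1)
  have hB0 : ∀ x, 0 ≤ B x := fun x => by positivity
  have hWB : ∀ n x, |W n x| ≤ B x := fun n x => by
    rw [abs_le]; exact ⟨le_max_left _ _, max_le (by linarith [hB0 x]) (min_le_right _ _)⟩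
  have hWL : ∀ n, MemLp (W n) (ENNReal.ofReal p) := fun n => hBm.mono (hWm n)
    (Eventually.of_forall fun x => by
      rw [Real.norm_eq_abs]; exact (hWB n x).trans (le_abs_self _))
  have lim2 : Tendsto (fun n => ∫ x, W n x * φ x) atTop (𝓝 (∫ x, g x * φ x)) := by
    refine tendsto_integral_of_dominated_convergence (fun x => B x * |φ x|)
      (fun n => (hWm n).mul hφ.continuous.aestronglyMeasurable)
      (memLp_one_iff_integrable.1 (MemLp.mul' (p := ENNReal.ofReal p)
        (q := ENNReal.ofReal (p / (p - 1))) (hφL _).abs hBm)) ?_ ?_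
    · refine fun n => Eventually.of_forall fun x => ?_
      rw [norm_mul, Real.norm_eq_abs, Real.norm_eq_abs]
      exact mul_le_mul_of_nonneg_right (hWB n x) (abs_nonneg _)
    · filter_upwards [hQg, hgB] with x hx hb
      have := (tendsto_const_nhds (x := -B x)).max (hx.min (tendsto_const_nhds (x := B x)))
      rw [min_eq_left (abs_le.1 hb).2, max_eq_right (abs_le.1 hb).1] at this
      exact this.mul_const _
  have lim3 : Tendsto (fun n => ∫ x, (Q n x - W n x) * φ x) atTop (𝓝 0) := by
    have := tendsto_integral_mul_of_tendsto_eLpNorm (p := ENNReal.ofReal p)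
      (p' := ENNReal.ofReal (p / (p - 1))) (f := fun n x => Q n x - W n x) (f₀ := fun _ => 0)
      (g := φ) (μ := (volume : Measure (Euc N))) (fun n => (hquot hv (t (k n))).sub (hWL n)) (by simp) (hφL _) ?_
    · simpa using this
    have t1' := t1.comp hkt
    have t2' := t2.comp hkt
    have hs := (ENNReal.Tendsto.const_mul (a := ENNReal.ofReal |L|) (t1'.add t2')
      (Or.inr ENNReal.ofReal_ne_top))
    simp only [add_zero, mul_zero] at hs
    refine tendsto_of_tendsto_of_tendsto_of_le_of_le tendsto_const_nhds hs (fun _ => zero_le) ?_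
    intro n
    -- Clipping removes at most the positive part of |Q| - B. Since |Q| ≤ |L| (|D₁| + |D₂|) and B is
    -- the same expression in the limits, the removed part is controlled by the strong convergence
    -- of D₁ and D₂.
    have hle : ∀ᵐ x, ‖Q n x - W n x - 0‖ ≤
        |L| * ‖|D₁ n x - inner ℝ (G₁ x) e| + |D₂ n x - inner ℝ (G₂ x) e|‖ := by
      filter_upwards [hDL] with x hx
      have h3 : |Q n x - W n x| ≤ max 0 (|Q n x| - B x) := by
        simp only [hW]
        have := hB0 x
        rcases le_total (Q n x) (B x) with h | h
        · rw [min_eq_left h]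
          rcases le_total (-B x) (Q n x) with h' | h'
          · rw [max_eq_right h']; simp
          · rw [max_eq_left h', abs_of_nonpos (by linarith : Q n x ≤ 0),
              abs_of_nonpos (by linarith)]
            refine le_max_of_le_right (by linarith)
        · rw [min_eq_right h, max_eq_right (by linarith), abs_of_nonneg (by linarith : 0 ≤ Q n x),
            abs_of_nonneg (by linarith)]
          exact le_max_right _ _
      simp only [sub_zero]
      rw [Real.norm_eq_abs, Real.norm_eq_abs, abs_of_nonneg (a := _ + _) (by positivity)]
      refine h3.trans (max_le (by positivity) ?_)
      have h4 : |Q n x| ≤ |L| * (|D₁ n x| + |D₂ n x|) :=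
        (hx n).trans (by gcongr; exact le_abs_self L)
      have h5 := abs_sub_abs_le_abs_sub (D₁ n x) (inner ℝ (G₁ x) e)
      have h6 := abs_sub_abs_le_abs_sub (D₂ n x) (inner ℝ (G₂ x) e)
      have h7 := mul_le_mul_of_nonneg_left (add_le_add h5 h6) (abs_nonneg L)
      simp only [hB]
      linarith
    refine (eLpNorm_le_mul_eLpNorm_of_ae_le_mul hle _).trans ?_
    refine mul_le_mul_right ?_ _
    refine (eLpNorm_add_le (((hquot h₁.memLp (t (k n))).sub hm₁).abs).1
      (((hquot h₂.memLp (t (k n))).sub hm₂).abs).1 (one_le_ofReal hp)).trans ?_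
    exact add_le_add (eLpNorm_mono fun x => by simp) (eLpNorm_mono fun x => by simp)
  have hsum : Tendsto (fun n => ∫ x, Q n x * φ x) atTop (𝓝 (∫ x, g x * φ x)) := by
    have := lim3.add lim2
    rw [zero_add] at this
    refine this.congr fun n => ?_
    have iW : Integrable fun x => W n x * φ x :=
      memLp_one_iff_integrable.1 (MemLp.mul' (p := ENNReal.ofReal p)
        (q := ENNReal.ofReal (p / (p - 1))) (hφL _) (hWL n))
    have iQ : Integrable fun x => Q n x * φ x :=
      memLp_one_iff_integrable.1 (MemLp.mul' (p := ENNReal.ofReal p)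
        (q := ENNReal.ofReal (p / (p - 1))) (hφL _) (hquot hv (t (k n))))
    simp only [sub_mul]
    rw [integral_sub iQ iW]; ring
  have := tendsto_nhds_unique lim1 hsum
  linarith

end Quotients

/-! ### Chain rule, lattice operations and Poincaré's inequality -/

/-- `Φ` has, relative to `S`, the one-sided directional derivative `l` at `z` in direction `η`. -/
def DirDeriv (Φ : ℝ × ℝ → ℝ) (S : Set (ℝ × ℝ)) (z η : ℝ × ℝ) (l : ℝ) : Prop :=
  ∀ (s : ℕ → ℝ) (d : ℕ → ℝ × ℝ), (∀ n, 0 < s n) → Tendsto s atTop (𝓝 0) →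
    Tendsto d atTop (𝓝 η) → (∀ n, z + s n • d n ∈ S) →
    Tendsto (fun n => (s n)⁻¹ * (Φ (z + s n • d n) - Φ z)) atTop (𝓝 l)

lemma dirDeriv_of_hasFDerivAt {Φ : ℝ × ℝ → ℝ} {S : Set (ℝ × ℝ)} {z η : ℝ × ℝ}
    {Φ' : ℝ × ℝ →L[ℝ] ℝ} (h : HasFDerivAt Φ Φ' z) : DirDeriv Φ S z η (Φ' η) := by
  intro s d hs0 hs hd _
  have hsd : Tendsto (fun n => s n • d n) atTop (𝓝 0) := by simpa using hs.smul hd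
  have h1 := h.hasFDerivWithinAt.lim (s := univ) (c := fun n => (s n)⁻¹) (d := fun n => s n • d n)
    (l := atTop) hsd (by simp)
    (hd.congr fun n => by rw [inv_smul_smul₀ (hs0 n).ne'])
  simpa using h1

section Chain

variable {N : ℕ} {u u₁ u₂ v : Euc N → ℝ} {G G₁ G₂ V : Euc N → Euc N} {p : ℝ}

lemma ae_translate {P : Euc N → Prop} (h : ∀ᵐ x, P x) (a : Euc N) : ∀ᵐ x : Euc N, P (x + a) :=
  (measurePreserving_add_right volume a).quasiMeasurePreserving.ae h

lemma tendsto_inv_nat_succ : Tendsto (fun n : ℕ => 1 / ((n : ℝ) + 1)) atTop (𝓝 0) :=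
  tendsto_one_div_add_atTop_nhds_zero_nat

lemma inv_nat_succ_pos (n : ℕ) : 0 < 1 / ((n : ℝ) + 1) := Nat.one_div_pos_of_nat

/-- Chain rule for Lipschitz functions with one-sided directional derivatives. -/
lemma IsSobolev.comp₂ (hp : 1 < p) (h₁ : IsSobolev p u₁ G₁) (h₂ : IsSobolev p u₂ G₂)
    {Φ : ℝ × ℝ → ℝ} {S : Set (ℝ × ℝ)} (hS : ∀ᵐ x, (u₁ x, u₂ x) ∈ S) {L : ℝ}
    (hL : ∀ a ∈ S, ∀ b ∈ S, |Φ a - Φ b| ≤ L * (|a.1 - b.1| + |a.2 - b.2|))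
    (hΦ : MemLp (fun x => Φ (u₁ x, u₂ x)) (ENNReal.ofReal p))
    (hd : ∀ᵐ x, ∀ i, DirDeriv Φ S (u₁ x, u₂ x) (G₁ x i, G₂ x i) (V x i)) :
    IsSobolev p (fun x => Φ (u₁ x, u₂ x)) V := by
  have key := fun i : Fin N => weakDeriv_of_lipschitz (L := L) hp h₁ h₂ hΦ (stdVec i)
    (t := fun n : ℕ => 1 / ((n : ℝ) + 1)) tendsto_inv_nat_succ
    (fun n => (inv_nat_succ_pos n).ne') (by
      intro h
      filter_upwards [hS, ae_translate hS h] with x hx hxh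
      exact hL _ hxh _ hx) (g := fun x => V x i) (by
      have hall : ∀ᵐ x, ∀ n : ℕ, (u₁ (x + (1 / ((n : ℝ) + 1)) • stdVec i),
          u₂ (x + (1 / ((n : ℝ) + 1)) • stdVec i)) ∈ S :=
        ae_all_iff.2 fun n => ae_translate hS _
      filter_upwards [hd, hall] with x hx hxS k hk h1 h2
      -- The directions are the difference quotients themselves, so z + s d is exactly the
      -- translated pair (u₁, u₂) and lies in S for almost every x. This is the reason for letting
      -- the direction vary in `DirDeriv`.
      have h3 := hx i (fun n => 1 / ((k n : ℝ) + 1))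
        (fun n => ((1 / ((k n : ℝ) + 1))⁻¹ * (u₁ (x + (1 / ((k n : ℝ) + 1)) • stdVec i) - u₁ x),
          (1 / ((k n : ℝ) + 1))⁻¹ * (u₂ (x + (1 / ((k n : ℝ) + 1)) • stdVec i) - u₂ x)))
        (fun n => inv_nat_succ_pos _) (tendsto_inv_nat_succ.comp hk)
        (by
          rw [inner_stdVec] at h1 h2
          exact h1.prodMk_nhds h2)
      have e : ∀ n, ((u₁ x, u₂ x) : ℝ × ℝ) + (1 / ((k n : ℝ) + 1)) •
          (((1 / ((k n : ℝ) + 1))⁻¹ * (u₁ (x + (1 / ((k n : ℝ) + 1)) • stdVec i) - u₁ x),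
          (1 / ((k n : ℝ) + 1))⁻¹ * (u₂ (x + (1 / ((k n : ℝ) + 1)) • stdVec i) - u₂ x)) : ℝ × ℝ)
          = (u₁ (x + (1 / ((k n : ℝ) + 1)) • stdVec i),
            u₂ (x + (1 / ((k n : ℝ) + 1)) • stdVec i)) := by
        intro n
        have := (inv_nat_succ_pos (k n)).ne'
        ext
        · simp [inv_mul_cancel_left₀ (by positivity : ((k n : ℝ) + 1) ≠ 0)]
        · simp [inv_mul_cancel_left₀ (by positivity : ((k n : ℝ) + 1) ≠ 0)]
      simp only [e] at h3
      exact h3 fun n => hxS _)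
  refine isWeakGradient_of_forall_integral_eq hp hΦ ?_ fun φ hφ hc i => (key i).2 φ hφ hc
  exact memLp_piLp_iff.2 fun i => (key i).1

/-- The weak gradient vanishes almost everywhere on the level sets of the function. -/
lemma IsSobolev.grad_eq_zero_of_eq (hp : 1 < p) (hu : IsSobolev p u G) {c : ℝ} (hc : 0 ≤ c) :
    ∀ᵐ x, u x = c → G x = 0 := by
  have hv : MemLp (fun x => max (u x - c) 0) (ENNReal.ofReal p) := by
    refine hu.memLp.mono ((hu.memLp.1.sub aestronglyMeasurable_const).sup aestronglyMeasurable_const)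
      (Eventually.of_forall fun x => ?_)
    rw [Real.norm_eq_abs, Real.norm_eq_abs, abs_of_nonneg (le_max_right _ _)]
    exact max_le (by linarith [le_abs_self (u x)]) (abs_nonneg _)
  have hLip : ∀ h, ∀ᵐ x, |max (u (x + h) - c) 0 - max (u x - c) 0| ≤
      1 * (|u (x + h) - u x| + |u (x + h) - u x|) := fun h => Eventually.of_forall fun x => by
    have := abs_max_sub_max_le_abs (u (x + h) - c) (u x - c) 0
    rw [sub_sub_sub_cancel_right] at this
    linarith [abs_nonneg (u (x + h) - u x)]
  -- Quotients from the right and from the left (σ = 1 and σ = -1) both give a weak derivative of (u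
  -- - c)^+. On {u = c} they equal max(G_i, 0) and min(G_i, 0), and uniqueness of the weak
  -- derivative forces G_i = 0 there.
  have main : ∀ (i : Fin N) (σ : ℝ), (σ = 1 ∨ σ = -1) →
      MemLp (fun x => if u x = c then σ * max (σ * G x i) 0 else if c < u x then G x i else 0) (ENNReal.ofReal p) ∧
      ∀ φ : Euc N → ℝ, ContDiff ℝ ∞ φ → HasCompactSupport φ →
      ∫ x, max (u x - c) 0 * fderiv ℝ φ x (stdVec i) =
       - ∫ x, (if u x = c then σ * max (σ * G x i) 0 else if c < u x then G x i else 0) * φ x := by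
    intro i σ hσ
    have hσ2 : σ * σ = 1 := by rcases hσ with h | h <;> simp [h]
    have hσ0 : σ ≠ 0 := by rcases hσ with h | h <;> simp [h]
    have hσi : σ⁻¹ = σ := inv_eq_of_mul_eq_one_left hσ2
    refine weakDeriv_of_lipschitz (L := 1) hp hu hu hv (stdVec i)
      (t := fun n : ℕ => σ * (1 / ((n : ℝ) + 1))) (by simpa using tendsto_inv_nat_succ.const_mul σ)
      (fun n => mul_ne_zero hσ0 (inv_nat_succ_pos n).ne') hLip ?_
    refine Eventually.of_forall fun x k hk h1 _ => ?_
    rw [inner_stdVec] at h1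
    have hs : Tendsto (fun n => 1 / ((k n : ℝ) + 1)) atTop (𝓝 0) := tendsto_inv_nat_succ.comp hk
    set w : ℕ → ℝ := fun n => u (x + (σ * (1 / ((k n : ℝ) + 1))) • stdVec i) with hw
    change Tendsto (fun n => (σ * (1 / ((k n : ℝ) + 1)))⁻¹ * (w n - u x)) atTop (𝓝 (G x i)) at h1
    change Tendsto (fun n => (σ * (1 / ((k n : ℝ) + 1)))⁻¹ * (max (w n - c) 0 - max (u x - c) 0))
      atTop _
    have hwu : Tendsto w atTop (𝓝 (u x)) := by
      have h2 := ((hs.const_mul σ).mul h1).add_const (u x)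
      simp only [mul_zero, zero_mul, zero_add] at h2
      refine h2.congr fun n => ?_
      rw [mul_inv_cancel_left₀ (mul_ne_zero hσ0 (inv_nat_succ_pos (k n)).ne')]; ring
    split_ifs with hx hx'
    · have h2 := ((h1.const_mul σ).max (tendsto_const_nhds (x := (0:ℝ)))).const_mul σ
      refine h2.congr fun n => ?_
      have hpos := inv_nat_succ_pos (k n)
      rw [hx, sub_self, max_self, sub_zero, mul_inv, hσi, mul_assoc, mul_assoc, ← mul_assoc σ σ, hσ2, one_mul,
        mul_max_of_nonneg _ _ (inv_nonneg.2 hpos.le), mul_zero]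
    · refine h1.congr' ?_
      filter_upwards [hwu.eventually (lt_mem_nhds hx')] with n hn
      rw [max_eq_left (by linarith), max_eq_left (by linarith)]; ring
    · have hx'' : u x < c := lt_of_le_of_ne (not_lt.1 hx') hx
      refine tendsto_const_nhds.congr' ?_
      filter_upwards [hwu.eventually (gt_mem_nhds hx'')] with n hn
      rw [max_eq_right (by linarith), max_eq_right (by linarith)]; simp
  have hi : ∀ i : Fin N, ∀ᵐ x, u x = c → G x i = 0 := by
    intro i
    obtain ⟨m1, e1⟩ := main i 1 (Or.inl rfl)
    obtain ⟨m2, e2⟩ := main i (-1) (Or.inr rfl)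
    have := ae_eq_of_integral_contDiff_smul_eq (m1.locallyIntegrable (one_le_ofReal hp))
      (m2.locallyIntegrable (one_le_ofReal hp)) (fun φ hφ hcφ => by
        have h1 := e1 φ hφ hcφ
        have h2 := e2 φ hφ hcφ
        simp only [smul_eq_mul, mul_comm (φ _)]
        linarith)
    filter_upwards [this] with x hx hxc
    simp only [hxc, if_true] at hx
    rcases le_total (G x i) 0 with h | h
    · rw [max_eq_right (by linarith), max_eq_left (by linarith)] at hx; linarith
    · rw [max_eq_left (by linarith), max_eq_right (by linarith)] at hx; linarith
  filter_upwards [ae_all_iff.2 hi] with x hx hxc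
  ext i; exact hx i hxc

lemma IsSobolev.grad_eq_of_eq (hp : 1 < p) (h₁ : IsSobolev p u₁ G₁) (h₂ : IsSobolev p u₂ G₂) :
    ∀ᵐ x, u₁ x = u₂ x → G₁ x = G₂ x := by
  filter_upwards [(h₁.sub h₂).grad_eq_zero_of_eq hp le_rfl] with x hx he
  exact sub_eq_zero.1 (hx (by rw [he, sub_self]))

lemma memLp_of_lipschitz {q : ENNReal} {Ω : Measure (Euc N)} {Φ : ℝ × ℝ → ℝ} {S : Set (ℝ × ℝ)}
    (hS : ∀ᵐ x ∂Ω, (u₁ x, u₂ x) ∈ S)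
    (h0 : (0, 0) ∈ S) (hΦ0 : Φ (0, 0) = 0) {L : ℝ}
    (hL : ∀ a ∈ S, ∀ b ∈ S, |Φ a - Φ b| ≤ L * (|a.1 - b.1| + |a.2 - b.2|))
    (hm : AEStronglyMeasurable (fun x => Φ (u₁ x, u₂ x)) Ω) (h₁ : MemLp u₁ q Ω)
    (h₂ : MemLp u₂ q Ω) : MemLp (fun x => Φ (u₁ x, u₂ x)) q Ω := by
  refine MemLp.of_le_mul (c := L) (h₁.abs.add h₂.abs) hm ?_
  filter_upwards [hS] with x hx
  have h1 := hL _ hx _ h0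
  rw [hΦ0] at h1
  simp only [sub_zero] at h1
  rw [Real.norm_eq_abs, Real.norm_eq_abs]
  refine h1.trans_eq ?_
  rw [← abs_of_nonneg (a := |u₁ x| + |u₂ x|) (by positivity)]
  rfl

-- On the contact set {u₁ = u₂} the two gradients coincide almost everywhere, so the one-sided
-- derivative max(G₁ i, G₂ i) is unambiguous and the chain rule applies.
open Classical in
lemma IsSobolev.sup (hp : 1 < p) (h₁ : IsSobolev p u₁ G₁) (h₂ : IsSobolev p u₂ G₂) :
    IsSobolev p (fun x => max (u₁ x) (u₂ x)) (fun x => if u₂ x < u₁ x then G₁ x else G₂ x) := by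
  have hL : ∀ a ∈ (univ : Set (ℝ × ℝ)), ∀ b ∈ (univ : Set (ℝ × ℝ)),
      |max a.1 a.2 - max b.1 b.2| ≤ 1 * (|a.1 - b.1| + |a.2 - b.2|) := by
    intro a _ b _
    have := abs_max_sub_max_le_max a.1 a.2 b.1 b.2
    have h2 := max_le_add_of_nonneg (abs_nonneg (a.1 - b.1)) (abs_nonneg (a.2 - b.2))
    linarith
  refine h₁.comp₂ (Φ := fun z => max z.1 z.2) (S := univ) (L := 1) hp h₂
    (Eventually.of_forall fun x => mem_univ _) hL
    (memLp_of_lipschitz (Φ := fun z => max z.1 z.2) (S := univ) (Eventually.of_forall fun x => mem_univ _) (mem_univ _) (by simp) hL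
      (h₁.memLp.1.sup h₂.memLp.1) h₁.memLp h₂.memLp) ?_
  filter_upwards [h₁.grad_eq_of_eq hp h₂] with x hx i
  intro s d hs0 hs hd _
  have hd1 : Tendsto (fun n => (d n).1) atTop (𝓝 (G₁ x i)) := (continuous_fst.tendsto _).comp hd
  have hd2 : Tendsto (fun n => (d n).2) atTop (𝓝 (G₂ x i)) := (continuous_snd.tendsto _).comp hd
  have l1 : Tendsto (fun n => u₁ x + s n * (d n).1) atTop (𝓝 (u₁ x)) := by
    simpa using (hs.mul hd1).const_add (u₁ x)
  have l2 : Tendsto (fun n => u₂ x + s n * (d n).2) atTop (𝓝 (u₂ x)) := by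
    simpa using (hs.mul hd2).const_add (u₂ x)
  simp only [Prod.fst_add, Prod.smul_fst, Prod.snd_add, Prod.smul_snd, smul_eq_mul]
  rcases lt_trichotomy (u₂ x) (u₁ x) with h | h | h
  · rw [if_pos h]
    refine hd1.congr' ?_
    filter_upwards [l2.eventually_lt l1 h] with n hn
    rw [max_eq_left hn.le, max_eq_left h.le, add_sub_cancel_left, inv_mul_cancel_left₀ (hs0 n).ne']
  · rw [if_neg (by simp [h])]
    have h3 := hd1.max hd2
    rw [hx h.symm, max_self] at h3
    refine h3.congr fun n => ?_
    rw [h, max_self, max_add_add_left, add_sub_cancel_left, ← mul_max_of_nonneg _ _ (hs0 n).le,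
      inv_mul_cancel_left₀ (hs0 n).ne']
  · rw [if_neg (not_lt.2 h.le)]
    refine hd2.congr' ?_
    filter_upwards [l1.eventually_lt l2 h] with n hn
    rw [max_eq_right hn.le, max_eq_right h.le, add_sub_cancel_left, inv_mul_cancel_left₀ (hs0 n).ne']

open Classical in
lemma IsSobolev.inf (hp : 1 < p) (h₁ : IsSobolev p u₁ G₁) (h₂ : IsSobolev p u₂ G₂) :
    IsSobolev p (fun x => min (u₁ x) (u₂ x)) (fun x => if u₂ x < u₁ x then G₂ x else G₁ x) := by
  refine ((h₁.add h₂).sub (h₁.sup hp h₂)).congr (Eventually.of_forall fun x => ?_)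
    (Eventually.of_forall fun x => ?_)
  · have := min_add_max (u₁ x) (u₂ x)
    simp only
    linarith
  · simp only
    split_ifs <;> simp

open Classical in
lemma IsSobolev.posPart (hp : 1 < p) (h : IsSobolev p u G) :
    IsSobolev p (fun x => max (u x) 0) (fun x => if 0 < u x then G x else 0) := by
  have h0 : IsSobolev p (fun _ : Euc N => (0:ℝ)) (fun _ => 0) := by
    simpa using h.const_mul 0
  exact h.sup hp h0

open Classical in
/-- Truncation from below at a nonnegative level. -/
lemma IsSobolev.subLevel (hp : 1 < p) (h : IsSobolev p u G) {c : ℝ} (hc : 0 ≤ c) :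
    IsSobolev p (fun x => max (u x - c) 0) (fun x => if c < u x then G x else 0) := by
  have hL : ∀ a ∈ (univ : Set (ℝ × ℝ)), ∀ b ∈ (univ : Set (ℝ × ℝ)),
      |max (a.1 - c) 0 - max (b.1 - c) 0| ≤ 1 * (|a.1 - b.1| + |a.2 - b.2|) := by
    intro a _ b _
    have := abs_max_sub_max_le_abs (a.1 - c) (b.1 - c) 0
    rw [sub_sub_sub_cancel_right] at this
    linarith [abs_nonneg (a.2 - b.2)]
  refine h.comp₂ (Φ := fun z => max (z.1 - c) 0) (S := univ) (L := 1) hp h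
    (Eventually.of_forall fun x => mem_univ _) hL
    (memLp_of_lipschitz (Φ := fun z => max (z.1 - c) 0) (S := univ) (u₂ := u)
      (Eventually.of_forall fun x => mem_univ _) (mem_univ _)
      (by simpa using hc) hL
      ((h.memLp.1.sub aestronglyMeasurable_const).sup aestronglyMeasurable_const) h.memLp h.memLp) ?_
  filter_upwards [h.grad_eq_zero_of_eq hp hc] with x hx i
  intro s d hs0 hs hd _
  have hd1 : Tendsto (fun n => (d n).1) atTop (𝓝 (G x i)) := (continuous_fst.tendsto _).comp hd
  have l1 : Tendsto (fun n => u x + s n * (d n).1) atTop (𝓝 (u x)) := by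
    simpa using (hs.mul hd1).const_add (u x)
  simp only [Prod.fst_add, Prod.smul_fst, smul_eq_mul]
  rcases lt_trichotomy c (u x) with h | h | h
  · rw [if_pos h]
    refine hd1.congr' ?_
    filter_upwards [l1.eventually (lt_mem_nhds h)] with n hn
    rw [max_eq_left (by linarith), max_eq_left (by linarith), sub_sub_sub_cancel_right, add_sub_cancel_left,
      inv_mul_cancel_left₀ (hs0 n).ne']
  · rw [if_neg (by simp [h])]
    have h3 := hd1.max (tendsto_const_nhds (x := (0:ℝ)))
    rw [hx h.symm] at h3
    simp only [PiLp.zero_apply, max_self] at h3 ⊢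
    refine h3.congr fun n => ?_
    rw [h, add_sub_cancel_left, sub_self, max_self, sub_zero]
    conv_rhs => rw [← mul_zero (s n), ← mul_max_of_nonneg _ _ (hs0 n).le, inv_mul_cancel_left₀ (hs0 n).ne']
  · rw [if_neg (not_lt.2 h.le)]
    refine tendsto_const_nhds.congr' ?_
    filter_upwards [l1.eventually (gt_mem_nhds h)] with n hn
    rw [max_eq_right (by linarith), max_eq_right (by linarith)]; simp

/-- Poincaré's inequality for functions vanishing outside a bounded set. -/
lemma IsSobolev.poincare (hp : 1 < p) (hN : 0 < N) {R : ℝ} (hR : 0 < R) (hu : IsSobolev p u G)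
    (h0 : ∀ᵐ x, R < ‖x‖ → u x = 0) :
    ∫⁻ x, ‖u x‖ₑ ^ p ≤ ENNReal.ofReal (3 * R) ^ p * ∫⁻ x, ‖G x‖ₑ ^ p := by
  -- A shift of length 3R moves the ball of radius R off itself, so one of u(x), u(x + h) vanishes
  -- at almost every x and ‖u(x + h)‖ is at most ‖u(x + h) - u(x)‖.
  set h : Euc N := (3 * R) • stdVec ⟨0, hN⟩ with hh
  have hn : ‖h‖ = 3 * R := by simp [hh, norm_smul, abs_of_pos hR]
  have h1 := hu.lintegral_translate_sub_le hp h
  rw [← ofReal_norm, hn] at h1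
  refine le_trans ?_ h1
  have e := lintegral_add_right_eq_self (μ := (volume : Measure (Euc N))) (fun x => ‖u x‖ₑ ^ p) h
  rw [← e]
  refine lintegral_mono_ae ?_
  filter_upwards [h0, ae_translate h0 h] with x hx hxh
  rcases le_or_gt ‖x‖ R with hr | hr
  · have : R < ‖x + h‖ := by
      have := norm_sub_le_norm_add h x
      rw [add_comm, hn] at this
      linarith
    rw [hxh this]; simp only [enorm_zero]
    rw [ENNReal.zero_rpow_of_pos (by linarith)]; exact zero_le
  · rw [hx hr, sub_zero]

end Chain

/-! ### The nonlocal form as an integral of increments -/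

/-- The measure `|x - y|^{-(N + sp)} dx dy` on `ℝ^N × ℝ^N`. -/
noncomputable def nlMeasure (N : ℕ) (p s : ℝ) : Measure (Euc N × Euc N) :=
  volume.withDensity fun z => ENNReal.ofReal (1 / ‖z.1 - z.2‖ ^ ((N : ℝ) + s * p))

/-- The increments `u x - u y`. -/
def incr {N : ℕ} (u : Euc N → ℝ) : Euc N × Euc N → ℝ := fun z => u z.1 - u z.2

section Nonlocal

variable {N : ℕ} {u v : Euc N → ℝ} {G : Euc N → Euc N} {p s : ℝ}

lemma nlMeasure_absolutelyContinuous :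
    nlMeasure N p s ≪ ((volume : Measure (Euc N)).prod volume) :=
  withDensity_absolutelyContinuous _ _

lemma ae_nlMeasure_fst {P : Euc N → Prop} (h : ∀ᵐ x, P x) : ∀ᵐ z ∂nlMeasure N p s, P z.1 :=
  nlMeasure_absolutelyContinuous.ae_le
    ((Measure.quasiMeasurePreserving_fst (μ := volume) (ν := volume)).ae h)

lemma ae_nlMeasure_snd {P : Euc N → Prop} (h : ∀ᵐ x, P x) : ∀ᵐ z ∂nlMeasure N p s, P z.2 :=
  nlMeasure_absolutelyContinuous.ae_le
    ((Measure.quasiMeasurePreserving_snd (μ := volume) (ν := volume)).ae h)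

lemma measurable_kernel : Measurable fun z : Euc N × Euc N =>
    1 / ‖z.1 - z.2‖ ^ ((N : ℝ) + s * p) := by
  fun_prop

/-- The nonlocal form takes the same shape |ξ|^{p-2}⟨ξ, η⟩ as the local one, with increments in
place of gradients. Integrability, first variation and convexity are then proved once for both. -/
lemma nonlocalForm_eq (u φ : Euc N → ℝ) : nonlocalForm p s u φ
    = ∫ z, ‖incr u z‖ ^ (p - 2) * inner ℝ (incr u z) (incr φ z) ∂nlMeasure N p s := by
  rw [nlMeasure, integral_withDensity_eq_integral_toReal_smul measurable_kernel.ennreal_ofReal (by simp)]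
  refine integral_congr_ae (Eventually.of_forall fun z => ?_)
  simp only
  rw [ENNReal.toReal_ofReal (by positivity)]
  simp only [signedPow, incr, Real.norm_eq_abs, smul_eq_mul, RCLike.inner_apply, conj_trivial]
  ring

lemma aestronglyMeasurable_incr (hu : AEStronglyMeasurable u volume) :
    AEStronglyMeasurable (incr u) (nlMeasure N p s) :=
  (hu.comp_fst.sub hu.comp_snd).mono_ac nlMeasure_absolutelyContinuous

/-- Near the origin the singularity has order N + sp - p < N because s < 1, and at infinity the
decay has order N + sp > N because s > 0. -/
lemma integrable_kernel (hN : 0 < N) (hp : 1 < p) (hs0 : 0 < s) (hs1 : s < 1) :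
    Integrable fun h : Euc N => 1 / ‖h‖ ^ ((N : ℝ) + s * p) * min 1 (‖h‖ ^ p) := by
  have hm : Measurable fun h : Euc N => 1 / ‖h‖ ^ ((N : ℝ) + s * p) * min 1 (‖h‖ ^ p) := by
    fun_prop
  have hsp : 0 < s * p := by positivity
  have hfr : Module.finrank ℝ (Euc N) = N := by simp
  have h1 : IntegrableOn (fun h : Euc N => 1 / ‖h‖ ^ ((N : ℝ) + s * p) * min 1 (‖h‖ ^ p))
      (Metric.ball 0 1) := by
    refine integrableOn_ball_of_norm_le_rpow (C := 1) (α := N + s * p - p) (by rw [hfr]; exact hN)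
      (by rw [hfr]; nlinarith) (Eventually.of_forall fun h => ?_) hm.aestronglyMeasurable
    rw [Real.norm_eq_abs, abs_of_nonneg (by positivity), one_mul]
    rcases eq_or_ne h 0 with rfl | hh
    · rw [norm_zero, Real.zero_rpow (by positivity)]; simp; positivity
    · have hpos : 0 < ‖h‖ := norm_pos_iff.2 hh
      calc 1 / ‖h‖ ^ ((N : ℝ) + s * p) * min 1 (‖h‖ ^ p)
          ≤ 1 / ‖h‖ ^ ((N : ℝ) + s * p) * ‖h‖ ^ p := by gcongr; exact min_le_right _ _
        _ = ‖h‖ ^ (-(N + s * p - p)) := by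
          rw [one_div, ← Real.rpow_neg hpos.le, ← Real.rpow_add hpos]; congr 1; ring
  have h2 : IntegrableOn (fun h : Euc N => 1 / ‖h‖ ^ ((N : ℝ) + s * p) * min 1 (‖h‖ ^ p))
      (Metric.ball 0 1)ᶜ := by
    have hi := (integrable_one_add_norm (E := Euc N) (μ := volume) (r := N + s * p)
      (by rw [hfr]; linarith)).const_mul ((2 : ℝ) ^ ((N : ℝ) + s * p))
    refine hi.integrableOn.mono' hm.aestronglyMeasurable
      ((ae_restrict_mem measurableSet_ball.compl).mono fun h hh => ?_)
    have hge : 1 ≤ ‖h‖ := by simpa using hh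
    have hpos : 0 < ‖h‖ := by linarith
    rw [Real.norm_eq_abs, abs_of_nonneg (by positivity)]
    calc 1 / ‖h‖ ^ ((N : ℝ) + s * p) * min 1 (‖h‖ ^ p)
        ≤ 1 / ‖h‖ ^ ((N : ℝ) + s * p) * 1 := by gcongr; exact min_le_left _ _
      _ = (1 / ‖h‖) ^ ((N : ℝ) + s * p) := by
        rw [mul_one, Real.div_rpow zero_le_one hpos.le, Real.one_rpow]
      _ ≤ (2 / (1 + ‖h‖)) ^ ((N : ℝ) + s * p) := by
        refine Real.rpow_le_rpow (by positivity) ?_ (by positivity)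
        rw [div_le_div_iff₀ hpos (by positivity)]; linarith
      _ = 2 ^ ((N : ℝ) + s * p) * (1 + ‖h‖) ^ (-((N : ℝ) + s * p)) := by
        rw [Real.div_rpow (by norm_num) (by positivity), Real.rpow_neg (by positivity)]; rfl
  have := h1.union h2
  rwa [union_compl_self, integrableOn_univ] at this

/-- `W^{1,p}(ℝ^N)` is contained in the fractional space `W^{s,p}(ℝ^N)`. -/
lemma IsSobolev.memLp_incr (hN : 0 < N) (hp : 1 < p) (hs0 : 0 < s) (hs1 : s < 1)
    (hu : IsSobolev p u G) : MemLp (incr u) (ENNReal.ofReal p) (nlMeasure N p s) := by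
  have hp0 : 0 < p := by linarith
  have hpE : ENNReal.ofReal p ≠ 0 := by simpa using hp0
  refine ⟨aestronglyMeasurable_incr hu.memLp.1, ?_⟩
  rw [eLpNorm_lt_top_iff_lintegral_rpow_enorm_lt_top hpE ENNReal.ofReal_ne_top,
    ENNReal.toReal_ofReal hp0.le]
  have hmeas : AEMeasurable (fun z : Euc N × Euc N => ‖incr u z‖ₑ ^ p) (volume.prod volume) :=
    (hu.memLp.1.comp_fst.sub hu.memLp.1.comp_snd).enorm.pow_const p
  set A := ∫⁻ x, ‖G x‖ₑ ^ p with hA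
  set B := (eLpNorm u (ENNReal.ofReal p) volume + eLpNorm u (ENNReal.ofReal p) volume) ^ p with hB
  have hAt : A ≠ ⊤ := by
    rw [hA, ← eLpNorm_rpow_ofReal hp0]
    exact ENNReal.rpow_ne_top_of_nonneg hp0.le hu.memLp_grad.2.ne
  have hBt : B ≠ ⊤ := ENNReal.rpow_ne_top_of_nonneg hp0.le
    (ENNReal.add_ne_top.2 ⟨hu.memLp.2.ne, hu.memLp.2.ne⟩)
  -- Long increments are bounded by the L^p norm of u alone, short ones by |h|^p times the energy.
  -- The minimum of the two is what the kernel can integrate.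
  have hbound : ∀ h : Euc N, ∫⁻ x, ‖u (x + h) - u x‖ₑ ^ p
      ≤ (A + B) * ENNReal.ofReal (min 1 (‖h‖ ^ p)) := by
    intro h
    rcases le_total 1 (‖h‖ ^ p) with h1 | h1
    · rw [min_eq_left h1, ENNReal.ofReal_one, mul_one]
      refine le_trans ?_ (le_add_of_nonneg_left (zero_le (a := A)))
      rw [← eLpNorm_rpow_ofReal hp0]
      refine ENNReal.rpow_le_rpow ?_ hp0.le
      have mp := measurePreserving_add_right (volume : Measure (Euc N)) h
      have h2 := eLpNorm_comp_measurePreserving hu.memLp.1 mp (p := ENNReal.ofReal p)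
      refine (eLpNorm_sub_le (f := u ∘ fun x => x + h) (g := u)
        (hu.memLp.1.comp_measurePreserving mp) hu.memLp.1 (one_le_ofReal hp)).trans ?_
      rw [h2]
    · rw [min_eq_right h1]
      refine (hu.lintegral_translate_sub_le hp h).trans ?_
      rw [mul_comm, ← ofReal_norm, ENNReal.ofReal_rpow_of_nonneg (norm_nonneg _) hp0.le]
      gcongr
      exact le_self_add
  calc ∫⁻ z, ‖incr u z‖ₑ ^ p ∂nlMeasure N p s
      = ∫⁻ z, ENNReal.ofReal (1 / ‖z.1 - z.2‖ ^ ((N : ℝ) + s * p)) * ‖incr u z‖ₑ ^ p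
          ∂((volume : Measure (Euc N)).prod volume) := by
        rw [nlMeasure, lintegral_withDensity_eq_lintegral_mul₀ measurable_kernel.ennreal_ofReal.aemeasurable
          (by rw [Measure.volume_eq_prod]; exact hmeas)]
        rfl
    _ = ∫⁻ x : Euc N, ∫⁻ y : Euc N, ENNReal.ofReal (1 / ‖x - y‖ ^ ((N : ℝ) + s * p)) * ‖u x - u y‖ₑ ^ p :=
        lintegral_prod _ (measurable_kernel.ennreal_ofReal.aemeasurable.mul hmeas)
    _ = ∫⁻ x : Euc N, ∫⁻ h : Euc N, ENNReal.ofReal (1 / ‖h‖ ^ ((N : ℝ) + s * p)) * ‖u (x + h) - u x‖ₑ ^ p := by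
        refine lintegral_congr fun x => ?_
        rw [← lintegral_add_left_eq_self _ x]
        refine lintegral_congr fun h => ?_
        rw [sub_add_cancel_left, norm_neg, ← enorm_neg (u x - u (x + h)), neg_sub]
    _ = ∫⁻ h : Euc N, ∫⁻ x : Euc N, ENNReal.ofReal (1 / ‖h‖ ^ ((N : ℝ) + s * p)) * ‖u (x + h) - u x‖ₑ ^ p := by
        refine lintegral_lintegral_swap ?_
        have hk : Measurable fun h : Euc N => ENNReal.ofReal (1 / ‖h‖ ^ ((N : ℝ) + s * p)) := by fun_prop
        refine (hk.comp measurable_snd).aemeasurable.mul ?_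
        have hq : Measure.QuasiMeasurePreserving (fun z : Euc N × Euc N => z.1 + z.2)
            ((volume : Measure (Euc N)).prod volume) volume :=
          MeasureTheory.QuasiMeasurePreserving.prod_of_left (by fun_prop)
            (Eventually.of_forall fun y => (measurePreserving_add_right volume y).quasiMeasurePreserving)
        exact ((hu.memLp.1.comp_quasiMeasurePreserving hq).sub hu.memLp.1.comp_fst).enorm.pow_const p
    _ ≤ ∫⁻ h : Euc N, ENNReal.ofReal (1 / ‖h‖ ^ ((N : ℝ) + s * p)) *
          ((A + B) * ENNReal.ofReal (min 1 (‖h‖ ^ p))) := by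
        refine lintegral_mono fun h => ?_
        rw [lintegral_const_mul' _ _ ENNReal.ofReal_ne_top]
        gcongr
        exact hbound h
    _ = (A + B) * ∫⁻ h : Euc N, ENNReal.ofReal (1 / ‖h‖ ^ ((N : ℝ) + s * p) * min 1 (‖h‖ ^ p)) := by
        rw [← lintegral_const_mul' _ _ (ENNReal.add_ne_top.2 ⟨hAt, hBt⟩)]
        refine lintegral_congr fun h => ?_
        rw [ENNReal.ofReal_mul (by positivity)]; ring
    _ < ⊤ := by
        refine ENNReal.mul_lt_top (ENNReal.add_lt_top.2 ⟨hAt.lt_top, hBt.lt_top⟩) ?_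
        have := (integrable_kernel hN hp hs0 hs1).lintegral_lt_top
        exact this

end Nonlocal

/-! ### Pointwise inequalities: Picone, power means, minimum and maximum -/

section Inequalities

lemma young_rpow {p q x t : ℝ} (hq : 0 < q) (hqp : q ≤ p) (hx : 0 ≤ x) (ht : 0 ≤ t) :
    x ^ q * t ^ (p - q) ≤ q / p * x ^ p + (p - q) / p * t ^ p := by
  have hp : 0 < p := by linarith
  have h := Real.geom_mean_le_arith_mean2_weighted (w₁ := q / p) (w₂ := (p - q) / p)
    (p₁ := x ^ p) (p₂ := t ^ p) (by positivity) (div_nonneg (by linarith) hp.le)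
    (by positivity) (by positivity) (by field_simp; ring)
  rwa [← Real.rpow_mul hx, ← Real.rpow_mul ht, mul_div_cancel₀ _ hp.ne',
    mul_div_cancel₀ _ hp.ne'] at h

/-- Subadditivity of the perspective function `x ^ q / y ^ (q - 1)`. -/
lemma perspective_add_le {q x₁ x₂ y₁ y₂ : ℝ} (hq : 1 ≤ q) (hx₁ : 0 ≤ x₁) (hx₂ : 0 ≤ x₂)
    (hy₁ : 0 < y₁) (hy₂ : 0 < y₂) :
    (x₁ + x₂) ^ q / (y₁ + y₂) ^ (q - 1) ≤ x₁ ^ q / y₁ ^ (q - 1) + x₂ ^ q / y₂ ^ (q - 1) := by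
  have hp : ∀ {x y : ℝ}, 0 ≤ x → 0 < y → x ^ q / y ^ (q - 1) = y * (x / y) ^ q := by
    intro x y hx hy
    rw [Real.div_rpow hx hy.le, Real.rpow_sub_one hy.ne']
    field_simp
  have hy : 0 < y₁ + y₂ := by positivity
  rw [hp (by positivity) hy, hp hx₁ hy₁, hp hx₂ hy₂]
  have h := (convexOn_rpow hq).2 (mem_Ici.2 (show 0 ≤ x₁ / y₁ by positivity))
    (mem_Ici.2 (show 0 ≤ x₂ / y₂ by positivity)) (show 0 ≤ y₁ / (y₁ + y₂) by positivity)
    (show 0 ≤ y₂ / (y₁ + y₂) by positivity) (by field_simp)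
  simp only [smul_eq_mul] at h
  have e : y₁ / (y₁ + y₂) * (x₁ / y₁) + y₂ / (y₁ + y₂) * (x₂ / y₂) = (x₁ + x₂) / (y₁ + y₂) := by
    field_simp
  rw [e] at h
  calc (y₁ + y₂) * ((x₁ + x₂) / (y₁ + y₂)) ^ q
      ≤ (y₁ + y₂) * (y₁ / (y₁ + y₂) * (x₁ / y₁) ^ q + y₂ / (y₁ + y₂) * (x₂ / y₂) ^ q) := by gcongr
    _ = _ := by field_simp

lemma abs_rpow_mul_self {p t : ℝ} (ht : 0 < t) : |t| ^ (p - 2) * t = t ^ (p - 1) := by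
  rw [abs_of_pos ht, ← Real.rpow_add_one ht.ne']; ring_nf

/-- Write a = b + t and a' ≤ b' + τ. Subadditivity of the perspective x^q / y^(q-1) bounds the
increment of a'^q / a^(q-1) by τ^q / t^(q-1), and Young's inequality splits the resulting product
t^(p-q) τ^q. -/
lemma discrete_picone_of_lt {p q a b a' b' : ℝ} (hq : 1 ≤ q) (hqp : q ≤ p) (hb : 0 < b)
    (hab : b < a) (ha' : 0 ≤ a') (hb' : 0 ≤ b') :
    q / p * (|a - b| ^ p - |a' - b'| ^ p) ≤
      |a - b| ^ (p - 2) * ((a - b) *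
        ((a - a' ^ q / a ^ (q - 1)) - (b - b' ^ q / b ^ (q - 1)))) := by
  have hp : 0 < p := by linarith
  set t := a - b with ht
  have htp : 0 < t := by rw [ht]; linarith
  set τ := |a' - b'| with hτ
  have hτ0 : 0 ≤ τ := abs_nonneg _
  have h1 : a' ^ q / a ^ (q - 1) ≤ b' ^ q / b ^ (q - 1) + τ ^ q / t ^ (q - 1) := by
    have ha : a = b + t := by rw [ht]; ring
    refine le_trans ?_ (perspective_add_le hq hb' hτ0 hb htp)
    rw [← ha]
    have : 0 < a := by linarith
    gcongr
    linarith [le_abs_self (a' - b')]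
  rw [← mul_assoc, abs_rpow_mul_self htp, abs_of_pos htp]
  have h2 : t ^ (p - 1) * (τ ^ q / t ^ (q - 1)) = τ ^ q * t ^ (p - q) := by
    rw [mul_div_assoc', mul_comm, mul_div_assoc, ← Real.rpow_sub htp]; ring_nf
  have h3 := young_rpow (by linarith : 0 < q) hqp hτ0 htp.le
  have h4 : t ^ (p - 1) * t = t ^ p := by
    rw [← Real.rpow_add_one htp.ne']; ring_nf
  have h5 := mul_le_mul_of_nonneg_left h1 (Real.rpow_nonneg htp.le (p - 1))
  have h6 : (p - q) / p = 1 - q / p := by field_simp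
  rw [h6] at h3
  rw [mul_add, h2] at h5
  have h7 : t ^ (p - 1) * (a - a' ^ q / a ^ (q - 1) - (b - b' ^ q / b ^ (q - 1)))
      = t ^ (p - 1) * t - t ^ (p - 1) * (a' ^ q / a ^ (q - 1)) +
        t ^ (p - 1) * (b' ^ q / b ^ (q - 1)) := by rw [ht]; ring
  rw [h7, h4]
  linarith

/-- A discrete Picone inequality. -/
lemma discrete_picone {p q a b a' b' : ℝ} (hq : 1 ≤ q) (hqp : q ≤ p) (ha : 0 < a) (hb : 0 < b)
    (ha' : 0 ≤ a') (hb' : 0 ≤ b') :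
    q / p * (|a - b| ^ p - |a' - b'| ^ p) ≤
      |a - b| ^ (p - 2) * ((a - b) *
        ((a - a' ^ q / a ^ (q - 1)) - (b - b' ^ q / b ^ (q - 1)))) := by
  rcases lt_trichotomy b a with h | h | h
  · exact discrete_picone_of_lt hq hqp hb h ha' hb'
  · subst h
    have hp : 0 < p := by linarith
    have h0 : 0 ≤ |a' - b'| ^ p := by positivity
    have h1 : 0 < q / p := by positivity
    rw [sub_self, abs_zero, Real.zero_rpow hp.ne', zero_mul, mul_zero]
    nlinarith
  · have := discrete_picone_of_lt hq hqp ha h hb' ha'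
    rw [abs_sub_comm b a, abs_sub_comm b' a'] at this
    refine this.trans_eq ?_
    ring

/-- A pointwise Picone inequality for gradients. -/
lemma gradient_picone {H : Type*} [NormedAddCommGroup H] [InnerProductSpace ℝ H] {p q r : ℝ}
    (hq : 1 ≤ q) (hqp : q ≤ p) (hr : 0 ≤ r) (ξ η : H) :
    q / p * (‖ξ‖ ^ p - ‖η‖ ^ p) ≤ ‖ξ‖ ^ (p - 2) *
      inner ℝ ξ (ξ - ((q * r ^ (q - 1)) • η - ((q - 1) * r ^ q) • ξ)) := by
  have hp : 0 < p := by linarith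
  have hq0 : 0 < q := by linarith
  set x := ‖ξ‖ with hx
  set y := ‖η‖ with hy
  have hy0 : 0 ≤ y := norm_nonneg _
  rcases eq_or_ne ξ 0 with h | h
  · have hx0 : x = 0 := by rw [hx, h, norm_zero]
    have h0 : 0 ≤ y ^ p := by positivity
    have h1 : 0 < q / p := by positivity
    rw [hx0, Real.zero_rpow hp.ne', h, inner_zero_left, mul_zero]
    nlinarith
  have hxp : 0 < x := norm_pos_iff.2 h
  simp only [inner_sub_right, inner_smul_right, real_inner_self_eq_norm_sq]
  rw [← hx]
  have hin : inner ℝ ξ η ≤ x * y := real_inner_le_norm _ _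
  have e2 : x ^ (p - 2) * x ^ 2 = x ^ p := by
    rw [← Real.rpow_two, ← Real.rpow_add hxp]; ring_nf
  -- Here r plays the role of v/u, and the vector paired with ξ is the gradient of u - v^q /
  -- u^(q-1). After Cauchy–Schwarz, Young with exponents q/(q-1) and q absorbs the powers of r; a
  -- second Young inequality passes from q to p.
  have h1 : x ^ (p - 2) * (q * r ^ (q - 1) * inner ℝ ξ η) ≤
      x ^ (p - 2) * (q * r ^ (q - 1) * (x * y)) := by gcongr
  have h2 : r ^ (q - 1) * x ^ (q - 1) * y ≤ (q - 1) / q * (r ^ q * x ^ q) + 1 / q * y ^ q := by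
    have h := Real.geom_mean_le_arith_mean2_weighted (w₁ := (q - 1) / q) (w₂ := 1 / q)
      (p₁ := (r * x) ^ q) (p₂ := y ^ q) (div_nonneg (by linarith) hq0.le) (by positivity)
      (by positivity) (by positivity) (by field_simp; ring)
    rw [← Real.rpow_mul (by positivity), ← Real.rpow_mul hy0, mul_div_cancel₀ _ hq0.ne',
      mul_div_cancel₀ _ hq0.ne', Real.rpow_one, Real.mul_rpow hr hxp.le,
      Real.mul_rpow hr hxp.le] at h
    exact h
  have h3 := young_rpow hq0 hqp hy0 hxp.le
  have e3 : x ^ (p - 2) * (q * r ^ (q - 1) * (x * y)) = q * (x ^ (p - q) * (r ^ (q - 1) * x ^ (q - 1) * y)) := by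
    have : x ^ (p - 2) * x = x ^ (p - q) * x ^ (q - 1) := by
      rw [← Real.rpow_add_one hxp.ne', ← Real.rpow_add hxp]; ring_nf
    linear_combination (q * r ^ (q - 1) * y) * this
  have e4 : x ^ (p - q) * x ^ q = x ^ p := by rw [← Real.rpow_add hxp]; ring_nf
  have h5 : q * (x ^ (p - q) * (r ^ (q - 1) * x ^ (q - 1) * y)) ≤
      (q - 1) * r ^ q * x ^ p + y ^ q * x ^ (p - q) := by
    calc q * (x ^ (p - q) * (r ^ (q - 1) * x ^ (q - 1) * y))
        ≤ q * (x ^ (p - q) * ((q - 1) / q * (r ^ q * x ^ q) + 1 / q * y ^ q)) := by gcongr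
      _ = (q - 1) * r ^ q * (x ^ (p - q) * x ^ q) + y ^ q * x ^ (p - q) := by field_simp
      _ = _ := by rw [e4]
  have h6 : (p - q) / p = 1 - q / p := by field_simp
  rw [h6] at h3
  have : x ^ (p - 2) * (x ^ 2 - (q * r ^ (q - 1) * inner ℝ ξ η - (q - 1) * r ^ q * x ^ 2))
      = x ^ p + (q - 1) * r ^ q * x ^ p - x ^ (p - 2) * (q * r ^ (q - 1) * inner ℝ ξ η) := by
    linear_combination (1 + (q - 1) * r ^ q) * e2
  rw [this]
  linarith

/-- The power mean of order `q` of two nonnegative numbers. -/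
noncomputable def qmean (q a c : ℝ) : ℝ := ((a ^ q + c ^ q) / 2) ^ (1 / q)

lemma qmean_nonneg {q a c : ℝ} (ha : 0 ≤ a) (hc : 0 ≤ c) : 0 ≤ qmean q a c := by
  unfold qmean; positivity

lemma qmean_rpow {q a c : ℝ} (hq : 0 < q) (ha : 0 ≤ a) (hc : 0 ≤ c) :
    qmean q a c ^ q = (a ^ q + c ^ q) / 2 := by
  rw [qmean, ← Real.rpow_mul (by positivity), one_div_mul_cancel hq.ne', Real.rpow_one]

lemma qmean_zero {q : ℝ} (hq : 0 < q) : qmean q 0 0 = 0 := by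
  simp [qmean, Real.zero_rpow hq.ne', hq.ne']

lemma qmean_mono {q a b c d : ℝ} (hq : 0 < q) (ha : 0 ≤ a) (hc : 0 ≤ c) (hab : a ≤ b)
    (hcd : c ≤ d) : qmean q a c ≤ qmean q b d := by
  unfold qmean
  gcongr

lemma qmean_add_le {q a b c d : ℝ} (hq : 1 ≤ q) (ha : 0 ≤ a) (hb : 0 ≤ b) (hc : 0 ≤ c)
    (hd : 0 ≤ d) : qmean q (a + b) (c + d) ≤ qmean q a c + qmean q b d := by
  have h := Real.Lp_add_le_of_nonneg (s := Finset.univ) (f := ![a, c]) (g := ![b, d]) hq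
    (by intro i _; fin_cases i <;> simpa) (by intro i _; fin_cases i <;> simpa)
  simp only [Fin.sum_univ_two, Matrix.cons_val_zero, Matrix.cons_val_one] at h
  unfold qmean
  rw [Real.div_rpow (by positivity) (by norm_num), Real.div_rpow (by positivity) (by norm_num),
    Real.div_rpow (by positivity) (by norm_num), ← add_div]
  gcongr

/-- Power means increase with the exponent: t^(p/q) is convex. In `le_qmean_rpow` the exponent is
below q and concavity reverses the inequality. -/
lemma qmean_rpow_le {p q a c : ℝ} (hq : 0 < q) (hqp : q ≤ p) (ha : 0 ≤ a) (hc : 0 ≤ c) :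
    qmean q a c ^ p ≤ (a ^ p + c ^ p) / 2 := by
  have h := (convexOn_rpow ((one_le_div hq).2 hqp)).2 (mem_Ici.2 (show 0 ≤ a ^ q by positivity)) (mem_Ici.2 (show 0 ≤ c ^ q by positivity))
    (show (0 : ℝ) ≤ 1 / 2 by norm_num) (show (0 : ℝ) ≤ 1 / 2 by norm_num) (by norm_num)
  simp only [smul_eq_mul] at h
  rw [← Real.rpow_mul ha, ← Real.rpow_mul hc, mul_div_cancel₀ _ hq.ne'] at h
  have e : qmean q a c ^ p = (1 / 2 * a ^ q + 1 / 2 * c ^ q) ^ (p / q) := by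
    rw [qmean, ← Real.rpow_mul (by positivity)]; congr 1 <;> ring
  rw [e]; linarith

lemma le_qmean_rpow {θ q a c : ℝ} (hθ : 0 < θ) (hθq : θ ≤ q) (ha : 0 ≤ a) (hc : 0 ≤ c) :
    (a ^ θ + c ^ θ) / 2 ≤ qmean q a c ^ θ := by
  have hq : 0 < q := by linarith
  have h := (Real.concaveOn_rpow (p := θ / q) (by positivity) ((div_le_one hq).2 hθq)).2
    (mem_Ici.2 (show 0 ≤ a ^ q by positivity)) (mem_Ici.2 (show 0 ≤ c ^ q by positivity))
    (show (0 : ℝ) ≤ 1 / 2 by norm_num) (show (0 : ℝ) ≤ 1 / 2 by norm_num) (by norm_num)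
  simp only [smul_eq_mul] at h
  rw [← Real.rpow_mul ha, ← Real.rpow_mul hc, mul_div_cancel₀ _ hq.ne'] at h
  have e : qmean q a c ^ θ = (1 / 2 * a ^ q + 1 / 2 * c ^ q) ^ (θ / q) := by
    rw [qmean, ← Real.rpow_mul (by positivity)]; congr 1 <;> ring
  rw [e]; linarith

/-- The power mean is a norm on pairs, up to a constant factor, so this is its reverse triangle
inequality. Combined with `qmean_rpow_le` it gives hidden convexity of the nonlocal energy. -/
lemma abs_qmean_sub_le {q a b c d : ℝ} (hq : 1 ≤ q) (ha : 0 ≤ a) (hb : 0 ≤ b) (hc : 0 ≤ c)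
    (hd : 0 ≤ d) : |qmean q a c - qmean q b d| ≤ qmean q |a - b| |c - d| := by
  have key : ∀ {a b c d : ℝ}, 0 ≤ a → 0 ≤ b → 0 ≤ c → 0 ≤ d →
      qmean q a c - qmean q b d ≤ qmean q |a - b| |c - d| := by
    intro a b c d ha hb hc hd
    have h1 := qmean_add_le hq hb (abs_nonneg (a - b)) hd (abs_nonneg (c - d))
    have h2 := qmean_mono (q := q) (by linarith) ha hc
      (by linarith [le_abs_self (a - b)] : a ≤ b + |a - b|)
      (by linarith [le_abs_self (c - d)] : c ≤ d + |c - d|)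
    linarith
  refine abs_le.2 ⟨?_, key ha hb hc hd⟩
  have := key hb ha hd hc
  rw [abs_sub_comm b a, abs_sub_comm d c] at this
  linarith

lemma qmean_incr_rpow_le {p q a b c d : ℝ} (hq : 1 ≤ q) (hqp : q ≤ p) (ha : 0 ≤ a) (hb : 0 ≤ b)
    (hc : 0 ≤ c) (hd : 0 ≤ d) :
    |qmean q a c - qmean q b d| ^ p ≤ (|a - b| ^ p + |c - d| ^ p) / 2 :=
  (Real.rpow_le_rpow (abs_nonneg _) (abs_qmean_sub_le hq ha hb hc hd) (by linarith)).trans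
    (qmean_rpow_le (by linarith) hqp (abs_nonneg _) (abs_nonneg _))

/-- Hidden convexity of the local energy. The vector on the left is the gradient of the power mean
of two functions; Hölder with exponents q/(q-1) and q bounds its norm by the power mean of ‖ξ‖ and
‖η‖, because a/M and c/M have power mean 1. -/
lemma qmean_gradient_rpow_le {H : Type*} [NormedAddCommGroup H] [InnerProductSpace ℝ H]
    {p q a c : ℝ} (hq : 1 ≤ q) (hqp : q ≤ p) (ha : 0 ≤ a) (hc : 0 ≤ c) (hM : 0 < qmean q a c)
    (ξ η : H) :
    ‖(1 / 2 * (a / qmean q a c) ^ (q - 1)) • ξ + (1 / 2 * (c / qmean q a c) ^ (q - 1)) • η‖ ^ p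
      ≤ (‖ξ‖ ^ p + ‖η‖ ^ p) / 2 := by
  have hq0 : 0 < q := by linarith
  set M := qmean q a c with hMdef
  refine le_trans (Real.rpow_le_rpow (norm_nonneg _) ?_ (by linarith))
    (qmean_rpow_le hq0 hqp (norm_nonneg ξ) (norm_nonneg η))
  refine (norm_add_le _ _).trans ?_
  rw [norm_smul, norm_smul, Real.norm_of_nonneg (by positivity), Real.norm_of_nonneg (by positivity)]
  set x := ‖ξ‖
  set y := ‖η‖
  have hx : 0 ≤ x := norm_nonneg _
  have hy : 0 ≤ y := norm_nonneg _
  rcases eq_or_lt_of_le (qmean_nonneg hx hy : 0 ≤ qmean q x y) with hS | hS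
  · have h1 := qmean_rpow hq0 hx hy
    rw [← hS, Real.zero_rpow hq0.ne'] at h1
    have hx0 : x ^ q = 0 := by linarith [Real.rpow_nonneg hx q, Real.rpow_nonneg hy q]
    have hy0 : y ^ q = 0 := by linarith [Real.rpow_nonneg hx q, Real.rpow_nonneg hy q]
    rw [Real.rpow_eq_zero hx hq0.ne'] at hx0
    rw [Real.rpow_eq_zero hy hq0.ne'] at hy0
    rw [← hS, hx0, hy0]; simp
  · set S := qmean q x y with hSdef
    have yg : ∀ {b z : ℝ}, 0 ≤ b → 0 ≤ z → (b / M) ^ (q - 1) * (z / S) ≤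
        (q - 1) / q * (b ^ q / M ^ q) + 1 / q * (z ^ q / S ^ q) := by
      intro b z hb hz
      have h := Real.geom_mean_le_arith_mean2_weighted (w₁ := (q - 1) / q) (w₂ := 1 / q)
        (p₁ := (b / M) ^ q) (p₂ := (z / S) ^ q) (div_nonneg (by linarith) hq0.le) (by positivity)
        (by positivity) (by positivity) (by field_simp; ring)
      rw [← Real.rpow_mul (by positivity), ← Real.rpow_mul (by positivity),
        mul_div_cancel₀ _ hq0.ne', mul_div_cancel₀ _ hq0.ne', Real.rpow_one] at h
      rw [← Real.div_rpow hb hM.le, ← Real.div_rpow hz hS.le]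
      exact h
    have h1 := yg ha hx
    have h2 := yg hc hy
    have e1 : a ^ q / M ^ q + c ^ q / M ^ q = 2 := by
      rw [← add_div, qmean_rpow hq0 ha hc]
      have : 0 < a ^ q + c ^ q := by
        have := qmean_rpow hq0 ha hc
        have : 0 < M ^ q := by positivity
        linarith
      field_simp
    have e2 : x ^ q / S ^ q + y ^ q / S ^ q = 2 := by
      rw [← add_div, qmean_rpow hq0 hx hy]
      have : 0 < x ^ q + y ^ q := by
        have := qmean_rpow hq0 hx hy
        have : 0 < S ^ q := by positivity
        linarith
      field_simp
    have h3 : 1 / 2 * (a / M) ^ (q - 1) * (x / S) + 1 / 2 * (c / M) ^ (q - 1) * (y / S) ≤ 1 := by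
      have e3 : (q - 1) / q + 1 / q = 1 := by field_simp; ring
      have h4 : (q - 1) / q * (a ^ q / M ^ q) + (q - 1) / q * (c ^ q / M ^ q) = (q - 1) / q * 2 := by
        rw [← mul_add, e1]
      have h5 : 1 / q * (x ^ q / S ^ q) + 1 / q * (y ^ q / S ^ q) = 1 / q * 2 := by
        rw [← mul_add, e2]
      linarith
    have h6 := mul_le_mul_of_nonneg_right h3 hS.le
    have e7 : (1 / 2 * (a / M) ^ (q - 1) * (x / S) + 1 / 2 * (c / M) ^ (q - 1) * (y / S)) * S
      = 1 / 2 * (a / M) ^ (q - 1) * x + 1 / 2 * (c / M) ^ (q - 1) * y := by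
      field_simp
    rw [e7, one_mul] at h6
    exact h6

lemma convexOn_abs_rpow {p : ℝ} (hp : 1 ≤ p) : ConvexOn ℝ univ fun t : ℝ => |t| ^ p := by
  refine ⟨convex_univ, fun x _ y _ a b ha hb hab => ?_⟩
  have h := (convexOn_rpow hp).2 (x := |x|) (y := |y|) (mem_Ici.2 (abs_nonneg _))
    (mem_Ici.2 (abs_nonneg _)) ha hb hab
  refine le_trans (Real.rpow_le_rpow (abs_nonneg _) ?_ (by linarith)) h
  simp only [smul_eq_mul]
  refine (abs_add_le _ _).trans ?_
  rw [abs_mul, abs_mul, abs_of_nonneg ha, abs_of_nonneg hb]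

/-- Karamata's inequality for two points: x and y are convex combinations of A and B with
interchanged weights. -/
lemma abs_rpow_majorize {p x y A B : ℝ} (hp : 1 ≤ p) (hx : A ≤ x) (hxB : x ≤ B)
    (hsum : x + y = A + B) : |x| ^ p + |y| ^ p ≤ |A| ^ p + |B| ^ p := by
  rcases eq_or_lt_of_le (hx.trans hxB) with h | h
  · have : x = A := by linarith
    have : y = B := by linarith
    subst_vars; rfl
  · have hBA : 0 < B - A := by linarith
    set θ := (x - A) / (B - A) with hθ
    have h0 : 0 ≤ θ := div_nonneg (by linarith) hBA.le
    have h1 : θ ≤ 1 := (div_le_one hBA).2 (by linarith)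
    have hc := convexOn_abs_rpow hp
    have hθB : θ * (B - A) = x - A := div_mul_cancel₀ _ hBA.ne'
    have e1 : (1 - θ) • A + θ • B = x := by simp only [smul_eq_mul]; linarith
    have e2 : θ • A + (1 - θ) • B = y := by simp only [smul_eq_mul]; linarith
    have c1 := hc.2 (mem_univ A) (mem_univ B) (by linarith : 0 ≤ 1 - θ) h0 (by ring)
    have c2 := hc.2 (mem_univ A) (mem_univ B) h0 (by linarith : 0 ≤ 1 - θ) (by ring)
    rw [e1] at c1
    rw [e2] at c2
    simp only [smul_eq_mul] at c1 c2
    linarith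

/-- When a, c and b, d are ordered in the same way, the increments are only permuted. Otherwise the
new increments have the same sum as a - b and c - d and lie between them, so convexity decides. -/
lemma min_max_incr_rpow_le {p : ℝ} (hp : 1 ≤ p) (a b c d : ℝ) :
    |min a c - min b d| ^ p + |max a c - max b d| ^ p ≤ |a - b| ^ p + |c - d| ^ p := by
  rcases le_total a c with h1 | h1 <;> rcases le_total b d with h2 | h2
  · simp [h1, h2]
  · rw [min_eq_left h1, min_eq_right h2, max_eq_right h1, max_eq_left h2]
    exact abs_rpow_majorize hp (by linarith) (by linarith) (by ring)
  · rw [min_eq_right h1, min_eq_left h2, max_eq_left h1, max_eq_right h2]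
    rw [add_comm (|a - b| ^ p)]
    exact abs_rpow_majorize hp (by linarith) (by linarith) (by ring)
  · rw [min_eq_right h1, min_eq_right h2, max_eq_left h1, max_eq_left h2]
    linarith

end Inequalities

/-! ### Integrability, first variation and uniform convexity of p-energies -/

section Energy

variable {X H : Type*} [MeasurableSpace X] {μ : Measure X} [NormedAddCommGroup H]
  {p q θ : ℝ} {ξ η : X → H}

lemma integrable_norm_rpow (hp : 0 < p) (hξ : MemLp ξ (ENNReal.ofReal p) μ) :
    Integrable (fun x => ‖ξ x‖ ^ p) μ := by
  have := hξ.integrable_norm_rpow (by simpa using hp) ENNReal.ofReal_ne_top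
  rwa [ENNReal.toReal_ofReal hp.le] at this

lemma memLp_of_integrable_norm_rpow (hp : 0 < p) (hm : AEStronglyMeasurable ξ μ)
    (h : Integrable (fun x => ‖ξ x‖ ^ p) μ) : MemLp ξ (ENNReal.ofReal p) μ := by
  rw [← integrable_norm_rpow_iff hm (by simpa using hp) ENNReal.ofReal_ne_top,
    ENNReal.toReal_ofReal hp.le]
  exact h

lemma integrable_add_norm_rpow (hp : 0 < p) (hξ : MemLp ξ (ENNReal.ofReal p) μ)
    (hη : MemLp η (ENNReal.ofReal p) μ) : Integrable (fun x => (‖ξ x‖ + ‖η x‖) ^ p) μ := by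
  have h := integrable_norm_rpow hp (hξ.norm.add hη.norm)
  refine h.congr (Eventually.of_forall fun x => ?_)
  simp only [Pi.add_apply]
  rw [Real.norm_of_nonneg (by positivity)]

variable [InnerProductSpace ℝ H]

/-- A single majorant for the form, integrable as soon as both arguments are in L^p. It also
dominates the derivative of the energy along a segment. -/
lemma abs_norm_rpow_inner_le (hp : 1 < p) (a b : H) :
    |‖a‖ ^ (p - 2) * inner ℝ a b| ≤ (‖a‖ + ‖b‖) ^ p := by
  rcases eq_or_ne a 0 with rfl | ha
  · simp; positivity
  have hpos : 0 < ‖a‖ := norm_pos_iff.2 ha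
  rw [abs_mul, abs_of_nonneg (Real.rpow_nonneg (norm_nonneg _) _)]
  calc ‖a‖ ^ (p - 2) * |inner ℝ a b| ≤ ‖a‖ ^ (p - 2) * (‖a‖ * ‖b‖) := by
        gcongr; exact abs_real_inner_le_norm _ _
    _ = ‖a‖ ^ (p - 1) * ‖b‖ := by
        rw [← mul_assoc, ← Real.rpow_add_one hpos.ne']; ring_nf
    _ ≤ (‖a‖ + ‖b‖) ^ (p - 1) * (‖a‖ + ‖b‖) := by
        have : ‖a‖ ^ (p - 1) ≤ (‖a‖ + ‖b‖) ^ (p - 1) := by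
          refine Real.rpow_le_rpow hpos.le ?_ (by linarith)
          linarith [norm_nonneg b]
        gcongr
        linarith
    _ = (‖a‖ + ‖b‖) ^ p := by
        rw [← Real.rpow_add_one (by positivity)]; ring_nf

lemma aestronglyMeasurable_form (hξ : AEStronglyMeasurable ξ μ) (hη : AEStronglyMeasurable η μ) :
    AEStronglyMeasurable (fun x => ‖ξ x‖ ^ (p - 2) * inner ℝ (ξ x) (η x)) μ :=
  (hξ.norm.aemeasurable.pow_const _).aestronglyMeasurable.mul (hξ.inner hη)

lemma integrable_form (hp : 1 < p) (hξ : MemLp ξ (ENNReal.ofReal p) μ)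
    (hη : MemLp η (ENNReal.ofReal p) μ) :
    Integrable (fun x => ‖ξ x‖ ^ (p - 2) * inner ℝ (ξ x) (η x)) μ :=
  (integrable_add_norm_rpow (by linarith) hξ hη).mono' (aestronglyMeasurable_form hξ.1 hη.1)
    (Eventually.of_forall fun _ => abs_norm_rpow_inner_le hp _ _)

lemma hasDerivAt_norm_add_smul_rpow (hp : 1 < p) (a b : H) (t : ℝ) :
    HasDerivAt (fun t : ℝ => ‖a + t • b‖ ^ p)
      (p * (‖a + t • b‖ ^ (p - 2) * inner ℝ (a + t • b) b)) t := by
  have h1 : HasDerivAt (fun t : ℝ => a + t • b) b t := by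
    simpa using ((hasDerivAt_id t).smul_const b).const_add a
  have h2 := (hasFDerivAt_norm_rpow (a + t • b) hp).comp_hasDerivAt t h1
  refine h2.congr_deriv ?_
  simp only [smul_apply, innerSL_apply_apply, smul_eq_mul, mul_assoc]

/-- First variation of the `p`-energy. -/
lemma hasDerivAt_integral_norm_rpow (hp : 1 < p) (hξ : MemLp ξ (ENNReal.ofReal p) μ)
    (hη : MemLp η (ENNReal.ofReal p) μ) :
    HasDerivAt (fun t : ℝ => ∫ x, ‖ξ x + t • η x‖ ^ p ∂μ)
      (p * ∫ x, ‖ξ x‖ ^ (p - 2) * inner ℝ (ξ x) (η x) ∂μ) 0 := by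
  have hp0 : 0 < p := by linarith
  have hm : ∀ t : ℝ, AEStronglyMeasurable (fun x => ξ x + t • η x) μ := fun t =>
    hξ.1.add (hη.1.const_smul t)
  have h := hasDerivAt_integral_of_dominated_loc_of_deriv_le (μ := μ) (𝕜 := ℝ) (x₀ := (0:ℝ))
    (s := Metric.ball 0 1) (F := fun t x => ‖ξ x + t • η x‖ ^ p)
    (F' := fun t x => p * (‖ξ x + t • η x‖ ^ (p - 2) * inner ℝ (ξ x + t • η x) (η x)))
    (bound := fun x => p * ((‖ξ x‖ + ‖η x‖ + ‖η x‖) ^ p)) (Metric.ball_mem_nhds 0 one_pos)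
    (Eventually.of_forall fun t => ((hm t).norm.aemeasurable.pow_const p).aestronglyMeasurable)
    (by simpa using integrable_norm_rpow hp0 hξ)
    ((aestronglyMeasurable_form (hm 0) hη.1).const_mul p) ?_ ?_ ?_
  · have h2 := h.2
    simp only [zero_smul, add_zero, integral_const_mul] at h2
    exact h2
  · refine Eventually.of_forall fun x t ht => ?_
    rw [norm_mul, Real.norm_of_nonneg hp0.le, Real.norm_eq_abs]
    refine mul_le_mul_of_nonneg_left ((abs_norm_rpow_inner_le hp _ _).trans ?_) hp0.le
    refine Real.rpow_le_rpow (by positivity) ?_ hp0.le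
    have ht1 : |t| ≤ 1 := by simpa using (mem_ball_zero_iff.1 ht).le
    have : ‖t • η x‖ ≤ ‖η x‖ := by
      rw [norm_smul]; exact mul_le_of_le_one_left (norm_nonneg _) ht1
    linarith [norm_add_le (ξ x) (t • η x)]
  · have := integrable_add_norm_rpow hp0 (hξ.norm.add hη.norm) hη.norm
    refine (this.const_mul p).congr (Eventually.of_forall fun x => ?_)
    simp only [Pi.add_apply]
    rw [Real.norm_of_nonneg (by positivity : 0 ≤ ‖ξ x‖ + ‖η x‖), norm_norm]
  · exact Eventually.of_forall fun x t _ => hasDerivAt_norm_add_smul_rpow hp _ _ t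

lemma hasDerivAt_abs_rpow_mul_self (hθ : 0 ≤ θ) (x : ℝ) :
    HasDerivAt (fun t : ℝ => |t| ^ θ * t) ((θ + 1) * |x| ^ θ) x := by
  rcases eq_or_lt_of_le hθ with rfl | hθ
  · simpa using hasDerivAt_id' x
  rcases lt_trichotomy x 0 with h | h | h
  · have h1 : HasDerivAt (fun t : ℝ => (-t) ^ (θ + 1)) (-1 * (θ + 1) * (-x) ^ (θ + 1 - 1)) x :=
      (hasDerivAt_neg x).rpow_const (Or.inl (by linarith))
    have h2 := h1.neg
    refine (h2.congr_deriv ?_).congr_of_eventuallyEq ?_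
    · rw [abs_of_neg h]; ring_nf
    · filter_upwards [gt_mem_nhds h] with t ht
      simp only [Pi.neg_apply]
      rw [abs_of_neg ht, Real.rpow_add_one (by linarith)]; ring
  · subst h
    rw [hasDerivAt_iff_tendsto_slope_zero]
    have hc : Continuous fun t : ℝ => |t| ^ θ := by
      exact continuous_abs.rpow_const fun _ => Or.inr hθ.le
    have h1 : Tendsto (fun t : ℝ => |t| ^ θ) (𝓝[≠] 0) (𝓝 ((θ + 1) * |0| ^ θ)) := by
      have := (hc.tendsto 0).mono_left (nhdsWithin_le_nhds (s := {0}ᶜ))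
      simpa [Real.zero_rpow hθ.ne'] using this
    refine h1.congr' ?_
    filter_upwards [self_mem_nhdsWithin] with t ht
    have : t ≠ 0 := ht
    simp
    field_simp
  · have h1 : HasDerivAt (fun t : ℝ => t ^ (θ + 1)) (1 * (θ + 1) * x ^ (θ + 1 - 1)) x :=
      (hasDerivAt_id x).rpow_const (Or.inl h.ne')
    refine (h1.congr_deriv ?_).congr_of_eventuallyEq ?_
    · rw [abs_of_pos h]; ring_nf
    · filter_upwards [lt_mem_nhds h] with t ht
      rw [abs_of_pos ht, Real.rpow_add_one (by linarith)]

lemma memLp_two_rpow (hq : 0 < q) {u : X → ℝ} (hu : MemLp u (ENNReal.ofReal (2 * q)) μ) :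
    MemLp (fun x => |u x| ^ q) 2 μ := by
  have h := hu.norm_rpow_div (ENNReal.ofReal q)
  rw [ENNReal.toReal_ofReal hq.le, ← ENNReal.ofReal_div_of_pos hq, mul_div_cancel_right₀ _ hq.ne'] at h
  simpa using h

lemma rpow_le_one_add_rpow {a b x : ℝ} (ha : 0 ≤ a) (hab : a ≤ b) (hx : 0 ≤ x) :
    x ^ a ≤ 1 + x ^ b := by
  rcases le_total x 1 with h | h
  · exact (Real.rpow_le_one hx h ha).trans (by linarith [Real.rpow_nonneg hx b])
  · linarith [Real.rpow_le_rpow_of_exponent_le h hab]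

lemma memLp_two_rpow_of_le [IsFiniteMeasure μ] (hθ : 0 ≤ θ) (hθq : θ ≤ q) (hq : 0 < q) {u : X → ℝ}
    (hu : MemLp u (ENNReal.ofReal (2 * q)) μ) : MemLp (fun x => |u x| ^ θ) 2 μ := by
  refine ((memLp_const (1 : ℝ)).add (memLp_two_rpow hq hu)).mono
    (hu.1.norm.aemeasurable.pow_const θ).aestronglyMeasurable (Eventually.of_forall fun x => ?_)
  simp only [Pi.add_apply]
  rw [Real.norm_of_nonneg (by positivity), Real.norm_of_nonneg (by positivity)]
  exact rpow_le_one_add_rpow hθ hθq (abs_nonneg _)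

lemma integrable_mul_of_two {f g : X → ℝ} (hf : MemLp f 2 μ) (hg : MemLp g 2 μ) :
    Integrable (fun x => f x * g x) μ := hf.integrable_mul hg

lemma abs_rpow_mul_le (hθ : 0 ≤ θ) (a b : ℝ) : |a| ^ θ * |b| ≤ (|a| + |b|) ^ (θ + 1) := by
  rcases eq_or_lt_of_le (by positivity : 0 ≤ |a| + |b|) with h | h
  · have : |b| = 0 := by linarith [abs_nonneg a, abs_nonneg b]
    rw [this, mul_zero]; positivity
  rw [Real.rpow_add_one h.ne']
  gcongr <;> linarith [abs_nonneg a, abs_nonneg b]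

lemma memLp_two_rpow_mul [IsFiniteMeasure μ] (hθ : 0 ≤ θ) (hθq : θ + 1 ≤ q) {u φ : X → ℝ}
    (hu : MemLp u (ENNReal.ofReal (2 * q)) μ) (hφ : MemLp φ (ENNReal.ofReal (2 * q)) μ) :
    MemLp (fun x => |u x| ^ θ * φ x) 2 μ := by
  refine (memLp_two_rpow_of_le (θ := θ + 1) (q := q) (by linarith) hθq (by linarith)
    (hu.abs.add hφ.abs)).mono
    ((hu.1.norm.aemeasurable.pow_const θ).aestronglyMeasurable.mul hφ.1) (Eventually.of_forall fun x => ?_)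
  rw [norm_mul, Real.norm_of_nonneg (by positivity : 0 ≤ |u x| ^ θ), Real.norm_eq_abs (φ x),
    Real.norm_of_nonneg (by positivity)]
  refine (abs_rpow_mul_le hθ _ _).trans (le_of_eq ?_)
  rw [← abs_of_nonneg (a := |u x| + |φ x|) (by positivity)]
  rfl

/-- First variation of the lower order terms. -/
lemma hasDerivAt_integral_mul_abs_rpow [IsFiniteMeasure μ] (hθ : 0 ≤ θ) (hθq : θ + 1 ≤ q)
    {f u φ : X → ℝ} (hf : MemLp f 2 μ) (hu : MemLp u (ENNReal.ofReal (2 * q)) μ)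
    (hφ : MemLp φ (ENNReal.ofReal (2 * q)) μ) :
    HasDerivAt (fun t : ℝ => ∫ x, f x * (|u x + t * φ x| ^ θ * (u x + t * φ x)) ∂μ)
      ((θ + 1) * ∫ x, f x * (|u x| ^ θ * φ x) ∂μ) 0 := by
  have hmL : ∀ t : ℝ, MemLp (fun x => u x + t * φ x) (ENNReal.ofReal (2 * q)) μ := fun t =>
    hu.add (hφ.const_mul t)
  have hq : 0 < q := by linarith
  have h := hasDerivAt_integral_of_dominated_loc_of_deriv_le (μ := μ) (𝕜 := ℝ) (x₀ := (0:ℝ))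
    (s := Metric.ball 0 1) (F := fun t x => f x * (|u x + t * φ x| ^ θ * (u x + t * φ x)))
    (F' := fun t x => f x * ((θ + 1) * |u x + t * φ x| ^ θ * φ x))
    (bound := fun x => |f x| * ((θ + 1) * (|(|u x| + |φ x|)| ^ θ * |φ x|))) (Metric.ball_mem_nhds 0 one_pos)
    (Eventually.of_forall fun t => hf.1.mul (memLp_two_rpow_mul hθ hθq (hmL t) (hmL t)).1)
    (integrable_mul_of_two hf (memLp_two_rpow_mul hθ hθq (hmL 0) (hmL 0)))
    ?_ ?_ ?_ ?_
  · have h2 := h.2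
    simp only [zero_mul, add_zero] at h2
    refine h2.congr_deriv ?_
    rw [← integral_const_mul]
    exact integral_congr_ae (Eventually.of_forall fun x => by simp only; ring)
  · refine hf.1.mul ?_
    have := (memLp_two_rpow_mul hθ hθq (hmL 0) hφ).1.const_mul (θ + 1)
    simpa only [mul_assoc] using this
  · refine Eventually.of_forall fun x t ht => ?_
    have ht1 : |t| ≤ 1 := by simpa using (mem_ball_zero_iff.1 ht).le
    rw [norm_mul, norm_mul, norm_mul, Real.norm_of_nonneg (by linarith : 0 ≤ θ + 1),
      Real.norm_of_nonneg (by positivity : 0 ≤ |u x + t * φ x| ^ θ), Real.norm_eq_abs,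
      Real.norm_eq_abs, mul_assoc (θ + 1)]
    have h3 : |t * φ x| ≤ |φ x| := by
      rw [abs_mul]; exact mul_le_of_le_one_left (abs_nonneg _) ht1
    have h4 : |u x + t * φ x| ≤ |(|u x| + |φ x|)| :=
      (abs_add_le _ _).trans ((by linarith : |u x| + |t * φ x| ≤ |u x| + |φ x|).trans
        (le_abs_self _))
    have h5 := Real.rpow_le_rpow (abs_nonneg _) h4 hθ
    exact mul_le_mul_of_nonneg_left (mul_le_mul_of_nonneg_left
      (mul_le_mul_of_nonneg_right h5 (abs_nonneg _)) (by linarith)) (abs_nonneg _)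
  · refine integrable_mul_of_two hf.abs ?_
    exact (memLp_two_rpow_mul hθ hθq (hu.abs.add hφ.abs) hφ.abs).const_mul (θ + 1)
  · refine Eventually.of_forall fun x t _ => ?_
    have h1 : HasDerivAt (fun t : ℝ => u x + t * φ x) (φ x) t := by
      simpa using ((hasDerivAt_id t).mul_const (φ x)).const_add (u x)
    exact ((hasDerivAt_abs_rpow_mul_self hθ (u x + t * φ x)).comp t h1).const_mul (f x)

/-- If the norms agree, strictness comes from the strict triangle inequality in an inner product
space. If they differ, it comes from the strict convexity of t^p. -/
lemma midpoint_rpow_lt (hp : 1 < p) {a b : H} (hab : a ≠ b) :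
    ‖(1 / 2 : ℝ) • (a + b)‖ ^ p < (‖a‖ ^ p + ‖b‖ ^ p) / 2 := by
  have hp0 : 0 < p := by linarith
  have hn : ‖(1 / 2 : ℝ) • (a + b)‖ = 1 / 2 * ‖a + b‖ := by rw [norm_smul]; norm_num
  rcases eq_or_ne ‖a‖ ‖b‖ with h | h
  · have h1 : ‖a + b‖ < ‖a‖ + ‖b‖ := by
      refine norm_add_lt_of_not_sameRay fun hs => hab ?_
      exact (sameRay_iff_of_norm_eq h).1 hs
    have h2 : (1 / 2 * ‖a + b‖) ^ p < ‖a‖ ^ p :=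
      Real.rpow_lt_rpow (by positivity) (by linarith) hp0
    rw [hn, ← h]; linarith
  · have h1 := (strictConvexOn_rpow hp).2 (mem_Ici.2 (norm_nonneg a)) (mem_Ici.2 (norm_nonneg b)) h
      (show (0:ℝ) < 1 / 2 by norm_num) (show (0:ℝ) < 1 / 2 by norm_num) (by norm_num)
    simp only [smul_eq_mul] at h1
    have h2 : (1 / 2 * ‖a + b‖) ^ p ≤ (1 / 2 * ‖a‖ + 1 / 2 * ‖b‖) ^ p :=
      Real.rpow_le_rpow (by positivity) (by linarith [norm_add_le a b]) hp0.le
    rw [hn]; linarith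

lemma midpoint_rpow_le (hp : 1 < p) (a b : H) :
    ‖(1 / 2 : ℝ) • (a + b)‖ ^ p ≤ (‖a‖ ^ p + ‖b‖ ^ p) / 2 := by
  rcases eq_or_ne a b with rfl | h
  · rw [← two_smul ℝ a, smul_smul]; norm_num
  · exact (midpoint_rpow_lt hp h).le

/-- Quantitative strict convexity of `‖·‖ ^ p` in finite dimension. -/
lemma exists_uniform_convexity [FiniteDimensional ℝ H] (hp : 1 < p) {ε : ℝ} (hε : 0 < ε) :
    ∃ C : ℝ, 0 ≤ C ∧ ∀ a b : H, ‖a - b‖ ^ p ≤ ε * (‖a‖ ^ p + ‖b‖ ^ p) +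
      C * ((‖a‖ ^ p + ‖b‖ ^ p) / 2 - ‖(1 / 2 : ℝ) • (a + b)‖ ^ p) := by
  have hp0 : 0 < p := by linarith
  have hc : ∀ {f : H × H → H}, Continuous f → Continuous fun z => ‖f z‖ ^ p := fun hf =>
    hf.norm.rpow_const fun _ => Or.inr hp0.le
  -- On this compact set the midpoint defect is positive, hence bounded below by some d > 0. All
  -- expressions are p-homogeneous, so the bound extends to every pair with ‖a - b‖^p > ε (‖a‖^p +
  -- ‖b‖^p).
  set K : Set (H × H) := {z | ‖z.1‖ ^ p + ‖z.2‖ ^ p = 1 ∧ ε ≤ ‖z.1 - z.2‖ ^ p} with hK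
  have hKc : IsCompact K := by
    refine Metric.isCompact_of_isClosed_isBounded ?_ ?_
    · refine IsClosed.inter (isClosed_eq ((hc continuous_fst).add (hc continuous_snd)) continuous_const) ?_
      exact isClosed_le continuous_const (hc (continuous_fst.sub continuous_snd))
    · refine (Metric.isBounded_closedBall (x := (0 : H × H)) (r := 1)).subset fun z hz => ?_
      have hb : ∀ w : H, ‖w‖ ^ p ≤ 1 → ‖w‖ ≤ 1 := fun w hw => by
        by_contra! h
        exact absurd (Real.one_lt_rpow h hp0) (not_lt.2 hw)
      rw [mem_closedBall_zero_iff, Prod.norm_def]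
      have h1 := hz.1
      exact max_le (hb _ (by linarith [Real.rpow_nonneg (norm_nonneg z.2) p]))
        (hb _ (by linarith [Real.rpow_nonneg (norm_nonneg z.1) p]))
  set D : H × H → ℝ := fun z => (‖z.1‖ ^ p + ‖z.2‖ ^ p) / 2 - ‖(1 / 2 : ℝ) • (z.1 + z.2)‖ ^ p with hD
  have hDc : Continuous D := (((hc continuous_fst).add (hc continuous_snd)).div_const 2).sub
    (hc ((continuous_fst.add continuous_snd).const_smul (1 / 2 : ℝ)))
  have hD0 : ∀ z, 0 ≤ D z := fun z => sub_nonneg.2 (midpoint_rpow_le hp _ _)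
  obtain ⟨d, hd, hdK⟩ : ∃ d > 0, ∀ z ∈ K, d ≤ D z := by
    rcases K.eq_empty_or_nonempty with h | h
    · exact ⟨1, one_pos, by simp [h]⟩
    · obtain ⟨z, hz, hmin⟩ := hKc.exists_isMinOn h hDc.continuousOn
      refine ⟨D z, sub_pos.2 (midpoint_rpow_lt hp fun he => ?_), fun w hw => hmin hw⟩
      have := hz.2
      rw [he, sub_self, norm_zero, Real.zero_rpow hp0.ne'] at this
      linarith
  refine ⟨2 ^ p / d, by positivity, fun a b => ?_⟩
  set S := ‖a‖ ^ p + ‖b‖ ^ p with hS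
  have hS0 : 0 ≤ S := by positivity
  rcases eq_or_lt_of_le hS0 with h | hSp
  · have ha : ‖a‖ ^ p = 0 := by
      linarith [Real.rpow_nonneg (norm_nonneg a) p, Real.rpow_nonneg (norm_nonneg b) p]
    have hb : ‖b‖ ^ p = 0 := by
      linarith [Real.rpow_nonneg (norm_nonneg a) p, Real.rpow_nonneg (norm_nonneg b) p]
    rw [Real.rpow_eq_zero (norm_nonneg _) hp0.ne', norm_eq_zero] at ha hb
    rw [← h, ha, hb]; simp [Real.zero_rpow hp0.ne']
  have hDab := hD0 (a, b)
  simp only [hD] at hDab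
  by_cases hle : ‖a - b‖ ^ p ≤ ε * S
  · have : 0 ≤ 2 ^ p / d * (S / 2 - ‖(1 / 2 : ℝ) • (a + b)‖ ^ p) := by positivity
    linarith
  · push Not at hle
    set r := S ^ (1 / p) with hr
    have hrp : 0 < r := by positivity
    have hrS : r ^ p = S := by rw [hr, ← Real.rpow_mul hS0, one_div_mul_cancel hp0.ne', Real.rpow_one]
    have hsc : ∀ w : H, ‖r⁻¹ • w‖ ^ p = ‖w‖ ^ p / S := fun w => by
      rw [norm_smul, Real.norm_of_nonneg (by positivity), Real.mul_rpow (by positivity) (norm_nonneg _),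
        Real.inv_rpow hrp.le, hrS]; ring
    have hmem : (r⁻¹ • a, r⁻¹ • b) ∈ K := by
      refine ⟨?_, ?_⟩
      · simp only [hsc]; rw [← add_div, ← hS, div_self hSp.ne']
      · simp only [← smul_sub, hsc]; rw [le_div_iff₀ hSp]; exact hle.le
    have h1 := hdK _ hmem
    simp only [hD] at h1
    rw [← smul_add, smul_comm, hsc, hsc, hsc, ← add_div, ← hS] at h1
    have h2 : d * S ≤ S / 2 - ‖(1 / 2 : ℝ) • (a + b)‖ ^ p := by
      have := mul_le_mul_of_nonneg_right h1 hS0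
      have e : (S / S / 2 - ‖(1 / 2 : ℝ) • (a + b)‖ ^ p / S) * S = S / 2 - ‖(1 / 2 : ℝ) • (a + b)‖ ^ p := by
        field_simp
      rwa [e] at this
    -- The midpoint inequality for a and -b. Together with the lower bound d S of the defect it
    -- explains the constant 2^p / d.
    have h3 : ‖a - b‖ ^ p ≤ 2 ^ p * S := by
      have hm := midpoint_rpow_le hp a (-b)
      rw [norm_neg, ← sub_eq_add_neg, norm_smul, Real.mul_rpow (by positivity) (by positivity), ← hS] at hm
      have h2p : (0:ℝ) < 2 ^ p := by positivity
      have e : ‖(1 / 2 : ℝ)‖ ^ p = 1 / 2 ^ p := by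
        rw [Real.norm_of_nonneg (by norm_num), Real.div_rpow (by norm_num) (by norm_num), Real.one_rpow]
      rw [e, one_div_mul_eq_div, div_le_iff₀ h2p] at hm
      nlinarith
    have h4 : 2 ^ p * S ≤ 2 ^ p / d * (S / 2 - ‖(1 / 2 : ℝ) • (a + b)‖ ^ p) := by
      calc 2 ^ p * S = 2 ^ p / d * (d * S) := by field_simp
        _ ≤ _ := by gcongr
    have : 0 ≤ ε * S := by positivity
    linarith

end Energy

/-! ### Weak solutions and the strong maximum principle -/

/-- Weak solutions of `u^{2m+1} - lam Δ_p u + lam (-Δ)^s_p u = g u^m + k u^δ`, for general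
coefficients `g` and `k`. -/
structure WeakSol {N : ℕ} (Ω : Set (Euc N)) (p s m δ lam : ℝ) (g k u : Euc N → ℝ) : Prop where
  memWL : MemWL Ω p m u
  nonneg : ∀ᵐ x ∂volume.restrict Ω, 0 ≤ u x
  nontrivial : ¬ (∀ᵐ x ∂volume.restrict Ω, u x = 0)
  weak_eq : ∀ φ : Euc N → ℝ, MemWL Ω p m φ →
    (∫ x in Ω, u x ^ (2 * m + 1) * φ x) + lam * localForm Ω p u φ + lam * nonlocalForm p s u φ
      = ∫ x in Ω, (g x * u x ^ m + k x * u x ^ δ) * φ x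

section Setup

variable {N : ℕ} {Ω : Set (Euc N)} {p s m δ lam : ℝ} {g k u v φ : Euc N → ℝ} {G : Euc N → Euc N}

lemma ae_eq_zero_of_restrict_compl (hΩ : IsOpen Ω) (h : ∀ᵐ x ∂volume.restrict Ωᶜ, u x = 0) :
    ∀ᵐ x, x ∉ Ω → u x = 0 :=
  (ae_restrict_iff' hΩ.measurableSet.compl).1 h

lemma memWL_of_isSobolev (hΩ : IsOpen Ω) (h : IsSobolev p u G) (h0 : ∀ᵐ x, x ∉ Ω → u x = 0)
    (hL : MemLp u (ENNReal.ofReal (2 * (m + 1))) (volume.restrict Ω)) : MemWL Ω p m u :=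
  ⟨h.memW01p ((ae_restrict_iff' hΩ.measurableSet.compl).2 h0), hL⟩

lemma MemWL.isSobolev (h : MemWL Ω p m u) : IsSobolev p u (weakGradient u) := h.memW01p.isSobolev

lemma MemWL.ae_eq_zero (hΩ : IsOpen Ω) (h : MemWL Ω p m u) : ∀ᵐ x, x ∉ Ω → u x = 0 :=
  ae_eq_zero_of_restrict_compl hΩ h.memW01p.eq_zero_outside

lemma ae_nonneg_of_memWL (hΩ : IsOpen Ω) (h : MemWL Ω p m u)
    (h0 : ∀ᵐ x ∂volume.restrict Ω, 0 ≤ u x) : ∀ᵐ x, 0 ≤ u x := by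
  filter_upwards [(ae_restrict_iff' hΩ.measurableSet).1 h0, h.ae_eq_zero hΩ] with x h1 h2
  by_cases hx : x ∈ Ω
  · exact h1 hx
  · rw [h2 hx]

lemma WeakSol.ae_nonneg (hΩ : IsOpen Ω) (h : WeakSol Ω p s m δ lam g k u) : ∀ᵐ x, 0 ≤ u x :=
  ae_nonneg_of_memWL hΩ h.memWL h.nonneg

lemma isFiniteMeasure_restrict (hΩb : Bornology.IsBounded Ω) :
    IsFiniteMeasure ((volume : Measure (Euc N)).restrict Ω) :=
  ⟨by simpa using hΩb.measure_lt_top⟩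

lemma MemWL.add (hΩ : IsOpen Ω) (hu : MemWL Ω p m u) (hv : MemWL Ω p m v) :
    MemWL Ω p m fun x => u x + v x := by
  refine memWL_of_isSobolev hΩ (hu.isSobolev.add hv.isSobolev) ?_ (hu.memLp.add hv.memLp)
  filter_upwards [hu.ae_eq_zero hΩ, hv.ae_eq_zero hΩ] with x h1 h2 hx
  rw [h1 hx, h2 hx, add_zero]

lemma MemWL.const_mul (hΩ : IsOpen Ω) (hu : MemWL Ω p m u) (c : ℝ) :
    MemWL Ω p m fun x => c * u x := by
  refine memWL_of_isSobolev hΩ (hu.isSobolev.const_mul c) ?_ (hu.memLp.const_mul c)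
  filter_upwards [hu.ae_eq_zero hΩ] with x h1 hx
  rw [h1 hx, mul_zero]

/-- A smooth function which is positive exactly on `Ω`. -/
lemma exists_bump (hΩ : IsOpen Ω) (hΩb : Bornology.IsBounded Ω) :
    ∃ ψ : Euc N → ℝ, ContDiff ℝ 1 ψ ∧ HasCompactSupport ψ ∧ (∀ x, 0 ≤ ψ x) ∧ (∀ x, ψ x ≤ 1) ∧
      (∀ x ∈ Ω, 0 < ψ x) ∧ ∀ x ∉ Ω, ψ x = 0 := by
  obtain ⟨ψ, hs, hd, hr⟩ := hΩ.exists_contDiff_support_eq (n := 1)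
  have h01 : ∀ x, ψ x ∈ Icc (0 : ℝ) 1 := fun x => hr (mem_range_self x)
  refine ⟨ψ, hd, ?_, fun x => (h01 x).1, fun x => (h01 x).2, fun x hx => ?_, fun x hx => ?_⟩
  · refine HasCompactSupport.of_support_subset_isCompact (hΩb.isCompact_closure) ?_
    rw [hs]; exact subset_closure
  · refine lt_of_le_of_ne (h01 x).1 (Ne.symm ?_)
    rw [← hs] at hx; exact hx
  · rw [← hs] at hx; exact Function.notMem_support.1 hx

lemma memWL_bump (hΩ : IsOpen Ω) {ψ : Euc N → ℝ} (h1 : ContDiff ℝ 1 ψ) (h2 : HasCompactSupport ψ)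
    (h3 : ∀ x ∉ Ω, ψ x = 0) : MemWL Ω p m ψ :=
  memWL_of_isSobolev hΩ (isSobolev_of_contDiff h1 h2) (Eventually.of_forall h3)
    ((h1.continuous.memLp_of_hasCompactSupport h2).restrict _)

lemma localForm_congr {W : Euc N → Euc N} (h : IsWeakGradient φ W) :
    localForm Ω p u φ = ∫ x in Ω, ‖weakGradient u x‖ ^ (p - 2) * inner ℝ (weakGradient u x) (W x) := by
  refine integral_congr_ae (ae_restrict_of_ae ?_)
  filter_upwards [h.weakGradient_ae_eq] with x hx
  rw [hx]

/-- The kernel is positive off the diagonal, so null sets of the two measures agree there. -/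
lemma ae_of_ae_nlMeasure {P : Euc N × Euc N → Prop} (h : ∀ᵐ z ∂nlMeasure N p s, P z) :
    ∀ᵐ z ∂((volume : Measure (Euc N)).prod volume), z.1 ≠ z.2 → P z := by
  rw [nlMeasure, ae_withDensity_iff measurable_kernel.ennreal_ofReal] at h
  filter_upwards [h] with z hz hne
  refine hz ?_
  have : 0 < ‖z.1 - z.2‖ := norm_pos_iff.2 (sub_ne_zero.2 hne)
  simp only [ne_eq, ENNReal.ofReal_eq_zero, not_le]
  positivity

/-- Subtracting n u before truncating can only lower the product with the increment of u, since
truncation is monotone and 1-Lipschitz. The bound does not depend on n and serves as a one-sided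
majorant in the maximum principle. -/
lemma truncated_incr_le {a b c d n P : ℝ} (hn : 0 ≤ n) (hP : 0 ≤ P) :
    P * ((max (c - n * a) 0 - max (d - n * b) 0) * (a - b)) ≤ |P * ((c - d) * (a - b))| := by
  rw [abs_mul, abs_of_nonneg hP]
  refine mul_le_mul_of_nonneg_left ?_ hP
  rw [abs_mul]
  rcases le_total b a with h | h
  · rw [abs_of_nonneg (by linarith : 0 ≤ a - b)]
    refine mul_le_mul_of_nonneg_right ?_ (by linarith)
    have h1 : max (c - n * a) 0 ≤ max (c - n * b) 0 := by gcongr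
    have h2 := abs_max_sub_max_le_abs (c - n * b) (d - n * b) 0
    rw [sub_sub_sub_cancel_right] at h2
    linarith [le_abs_self (max (c - n * b) 0 - max (d - n * b) 0)]
  · rw [abs_of_nonpos (by linarith : a - b ≤ 0), mul_neg, ← neg_mul_neg, neg_sub, ← mul_neg]
    refine mul_le_mul_of_nonneg_right ?_ (by linarith)
    have h1 : max (d - n * b) 0 ≤ max (d - n * a) 0 := by gcongr
    have h2 := abs_max_sub_max_le_abs (d - n * a) (c - n * a) 0
    rw [sub_sub_sub_cancel_right, abs_sub_comm d c] at h2
    linarith [le_abs_self (max (d - n * a) 0 - max (c - n * a) 0)]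

open Classical in
/-- Strong maximum principle: weak solutions are positive almost everywhere. -/
lemma WeakSol.ae_pos (hΩ : IsOpen Ω) (hΩb : Bornology.IsBounded Ω) (hN : 0 < N) (hp : 1 < p)
    (hs0 : 0 < s) (hs1 : s < 1) (hm : 0 ≤ m) (hlam : 0 < lam)
    (hg : ∀ᵐ x ∂volume.restrict Ω, 0 ≤ g x) (hk : ∀ᵐ x ∂volume.restrict Ω, 0 ≤ k x)
    (hu : WeakSol Ω p s m δ lam g k u) : ∀ᵐ x ∂volume.restrict Ω, 0 < u x := by
  have := isFiniteMeasure_restrict hΩb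
  obtain ⟨ψ, hψd, hψc, hψ0, hψ1, hψpos, hψz⟩ := exists_bump hΩ hΩb
  have hψS := isSobolev_of_contDiff (p := p) hψd hψc
  have hS := hu.memWL.isSobolev
  set U := weakGradient u with hU
  have hu0 := hu.ae_nonneg hΩ
  have huz := hu.memWL.ae_eq_zero hΩ
  have hn0 : ∀ n : ℕ, (0:ℝ) ≤ (n:ℝ) := fun n => Nat.cast_nonneg n
  -- These test functions concentrate on {u = 0}: they tend to ψ there and to 0 where u > 0. The
  -- source tested with them is nonnegative, so the equation bounds the nonlocal form below by minus
  -- the other two terms, both asymptotically harmless.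
  set φ : ℕ → Euc N → ℝ := fun n x => max (ψ x - (n:ℝ) * u x) 0 with hφ
  have hφS : ∀ n, IsSobolev p (φ n) (fun x => if 0 < ψ x - (n:ℝ) * u x then
      gradient ψ x - (n:ℝ) • U x else 0) := fun n => (hψS.sub (hS.const_mul n)).posPart hp
  have hφ0 : ∀ n x, 0 ≤ φ n x := fun n x => le_max_right _ _
  have hφψ : ∀ᵐ x, ∀ n, φ n x ≤ ψ x := by
    filter_upwards [hu0] with x hx n
    exact max_le (by nlinarith [hn0 n]) (hψ0 x)
  have hφWL : ∀ n, MemWL Ω p m (φ n) := fun n => by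
    refine memWL_of_isSobolev hΩ (hφS n) ?_ ?_
    · filter_upwards [huz] with x hx hxΩ
      simp only [hφ, hx hxΩ, hψz x hxΩ]; simp
    · refine ((hψd.continuous.memLp_of_hasCompactSupport hψc).restrict Ω).mono
        (hφS n).memLp.1.restrict (ae_restrict_of_ae ?_)
      filter_upwards [hφψ] with x hx
      rw [Real.norm_of_nonneg (hφ0 n x), Real.norm_of_nonneg (hψ0 x)]; exact hx n
  have hlarge : ∀ {x}, 0 < u x → ∀ᶠ n : ℕ in atTop, ψ x - (n:ℝ) * u x < 0 := by
    intro x hx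
    have : Tendsto (fun n : ℕ => (n:ℝ) * u x) atTop atTop :=
      tendsto_natCast_atTop_atTop.atTop_mul_const hx
    filter_upwards [this.eventually_gt_atTop (ψ x)] with n hn
    linarith
  -- zeroth order term
  have hZ : Tendsto (fun n => ∫ x in Ω, u x ^ (2 * m + 1) * φ n x) atTop (𝓝 0) := by
    -- The index starts at n + 1 so that φ vanishes wherever u > 1, because ψ ≤ 1. The integrand is
    -- then bounded by 1.
    have := tendsto_integral_of_dominated_convergence (μ := volume.restrict Ω)
      (F := fun n x => u x ^ (2 * m + 1) * φ (n + 1) x) (f := fun _ => (0:ℝ)) (fun _ => (1:ℝ))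
      (fun n => (hS.memLp.1.restrict.aemeasurable.pow_const _).aestronglyMeasurable.mul
        (hφS (n + 1)).memLp.1.restrict) (integrable_const _) ?_ ?_
    · rw [← tendsto_add_atTop_iff_nat 1]; simpa using this
    · intro n
      refine ae_restrict_of_ae ?_
      filter_upwards [hu0, hφψ] with x hx hxψ
      rw [Real.norm_of_nonneg (mul_nonneg (Real.rpow_nonneg hx _) (hφ0 _ x))]
      rcases le_or_gt (u x) 1 with h1 | h1
      · exact mul_le_one₀ (Real.rpow_le_one hx h1 (by linarith)) (hφ0 _ x)
          ((hxψ _).trans (hψ1 x))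
      · have : φ (n + 1) x = 0 := by
          refine max_eq_right ?_
          push_cast
          nlinarith [hψ1 x, hn0 n]
        rw [this, mul_zero]; exact zero_le_one
    · refine ae_restrict_of_ae ?_
      filter_upwards [hu0] with x hx
      rcases eq_or_lt_of_le hx with h | h
      · rw [← h, Real.zero_rpow (by linarith)]; simp
      · refine tendsto_const_nhds.congr' ?_
        filter_upwards [(tendsto_add_atTop_nat 1).eventually (hlarge h)] with n hn
        rw [show φ (n + 1) x = 0 from max_eq_right hn.le, mul_zero]
  -- local term
  set l : ℕ → Euc N → ℝ := fun n x => if 0 < ψ x - (n:ℝ) * u x then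
    ‖U x‖ ^ (p - 2) * inner ℝ (U x) (gradient ψ x) else 0 with hl
  have hUr := hS.memLp_grad.restrict Ω
  have hlform := integrable_form hp hUr (hψS.memLp_grad.restrict Ω)
  have hcut : ∀ n : ℕ, NullMeasurableSet {x | 0 < ψ x - (n:ℝ) * u x} (volume.restrict Ω) := fun n =>
    nullMeasurableSet_lt aemeasurable_const
      (hψS.memLp.1.restrict.sub (hS.memLp.1.restrict.const_mul _)).aemeasurable
  have hlm : ∀ n, AEStronglyMeasurable (l n) (volume.restrict Ω) := fun n =>
    hlform.1.indicator₀ (hcut n)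
  have hLlim : Tendsto (fun n => ∫ x in Ω, l n x) atTop (𝓝 0) := by
    have := tendsto_integral_of_dominated_convergence (μ := volume.restrict Ω)
      (F := l) (f := fun _ => (0:ℝ)) _ hlm hlform.norm ?_ ?_
    · simpa using this
    · refine fun n => Eventually.of_forall fun x => ?_
      simp only [hl]; split_ifs
      · exact le_rfl
      · simp only [norm_zero]; exact norm_nonneg _
    · refine ae_restrict_of_ae ?_
      filter_upwards [hu0, hS.grad_eq_zero_of_eq hp le_rfl] with x hx hG
      rcases eq_or_lt_of_le hx with h | h
      · have : ∀ n, l n x = 0 := fun n => by simp [hl, hG h.symm]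
        simp [this]
      · refine tendsto_const_nhds.congr' ?_
        filter_upwards [hlarge h] with n hn
        simp only [hl]; rw [if_neg (not_lt.2 hn.le)]
  have hLle : ∀ n, localForm Ω p u (φ n) ≤ ∫ x in Ω, l n x := by
    intro n
    rw [localForm_congr (hφS n).weak]
    refine integral_mono (integrable_form hp hUr ((hφS n).memLp_grad.restrict Ω))
      (hlform.norm.mono' (hlm n) (Eventually.of_forall fun x => ?_)) fun x => ?_
    · simp only [hl]; split_ifs
      · exact le_rfl
      · simp only [norm_zero]; exact norm_nonneg _
    · simp only [hl]
      split_ifs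
      · refine mul_le_mul_of_nonneg_left ?_ (by positivity)
        rw [inner_sub_right, inner_smul_right, real_inner_self_eq_norm_sq]
        have : 0 ≤ (n:ℝ) * ‖U x‖ ^ 2 := by positivity
        linarith
      · simp
  -- nonlocal term
  have hui := hS.memLp_incr hN hp hs0 hs1
  have hψi := hψS.memLp_incr hN hp hs0 hs1
  have hφi := fun n => (hφS n).memLp_incr hN hp hs0 hs1
  set ν := nlMeasure N p s with hν
  set a : ℕ → Euc N × Euc N → ℝ := fun n z =>
    ‖incr u z‖ ^ (p - 2) * inner ℝ (incr u z) (incr (φ n) z) with ha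
  set b : Euc N × Euc N → ℝ := fun z => |‖incr u z‖ ^ (p - 2) * inner ℝ (incr u z) (incr ψ z)| +
    ‖incr u z‖ ^ p with hb
  have hai : ∀ n, Integrable (a n) ν := fun n => integrable_form hp hui (hφi n)
  have hbi : Integrable b ν := (integrable_form hp hui hψi).abs.add
    (integrable_norm_rpow (by linarith) hui)
  have hb0 : ∀ z, 0 ≤ b z := fun z => by positivity
  have hab : ∀ n z, a n z ≤ b z := fun n z => by
    have h1 := truncated_incr_le (a := u z.1) (b := u z.2) (c := ψ z.1) (d := ψ z.2) (hn0 n)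
      (Real.rpow_nonneg (norm_nonneg (incr u z)) (p - 2))
    have h2 : 0 ≤ ‖incr u z‖ ^ p := by positivity
    simp only [ha, hb, RCLike.inner_apply, conj_trivial]
    simp only [incr] at h1 h2 ⊢
    linarith
  -- The limiting integrand a' is nonpositive, since ψZ lives where u is smallest. It is strictly
  -- negative on pairs with u(x) = 0, ψ(x) > 0 and u(y) > 0.
  set ψZ : Euc N → ℝ := fun x => if u x = 0 then ψ x else 0 with hψZ
  set a' : Euc N × Euc N → ℝ := fun z => ‖incr u z‖ ^ (p - 2) * inner ℝ (incr u z) (incr ψZ z) with ha'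
  have hφlim : ∀ᵐ x, Tendsto (fun n => φ n x) atTop (𝓝 (ψZ x)) := by
    filter_upwards [hu0] with x hx
    rcases eq_or_lt_of_le hx with h | h
    · have : ∀ n, φ n x = ψ x := fun n => by simp [hφ, ← h, hψ0 x]
      simp [this, hψZ, ← h]
    · simp only [hψZ, if_neg h.ne']
      refine tendsto_const_nhds.congr' ?_
      filter_upwards [hlarge h] with n hn
      exact (max_eq_right hn.le).symm
  have halim : ∀ᵐ z ∂ν, Tendsto (fun n => a n z) atTop (𝓝 (a' z)) := by
    filter_upwards [ae_nlMeasure_fst hφlim, ae_nlMeasure_snd hφlim] with z h1 h2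
    have h3 : Tendsto (fun n => incr (φ n) z) atTop (𝓝 (incr ψZ z)) := h1.sub h2
    exact ((tendsto_const_nhds (x := incr u z)).inner h3).const_mul _
  have ha'0 : ∀ᵐ z ∂ν, a' z ≤ 0 := by
    filter_upwards [ae_nlMeasure_fst hu0, ae_nlMeasure_snd hu0] with z h1 h2
    simp only [ha']
    refine mul_nonpos_of_nonneg_of_nonpos (by positivity) ?_
    simp only [RCLike.inner_apply, conj_trivial, incr, hψZ]
    split_ifs with c1 c2 c2
    · rw [c1, c2]; simp
    · rw [c1]; nlinarith [hψ0 z.1]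
    · rw [c2]; nlinarith [hψ0 z.2]
    · simp
  have hpos : Tendsto (fun n => ∫ z, max (a n z) 0 ∂ν) atTop (𝓝 0) := by
    have := tendsto_integral_of_dominated_convergence (μ := ν) (F := fun n z => max (a n z) 0)
      (f := fun _ => (0:ℝ)) b (fun n => (hai n).1.sup aestronglyMeasurable_const) hbi ?_ ?_
    · simpa using this
    · refine fun n => Eventually.of_forall fun z => ?_
      rw [Real.norm_of_nonneg (le_max_right _ _)]
      exact max_le (hab n z) (hb0 z)
    · filter_upwards [halim, ha'0] with z h1 h2
      have := h1.max (tendsto_const_nhds (x := (0:ℝ)))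
      rwa [max_eq_right h2] at this
  -- The negative parts have no uniform majorant; capping them at b restores dominated convergence
  -- and still detects where a' is negative.
  have hneg : Tendsto (fun n => ∫ z, min (max (-(a n z)) 0) (b z) ∂ν) atTop
      (𝓝 (∫ z, min (-(a' z)) (b z) ∂ν)) := by
    refine tendsto_integral_of_dominated_convergence b
      (fun n => ((hai n).1.neg.sup aestronglyMeasurable_const).inf hbi.1) hbi ?_ ?_
    · refine fun n => Eventually.of_forall fun z => ?_
      rw [Real.norm_of_nonneg (le_min (le_max_right _ _) (hb0 z))]
      exact min_le_right _ _
    · filter_upwards [halim, ha'0] with z h1 h2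
      have := (h1.neg.max (tendsto_const_nhds (x := (0:ℝ)))).min (tendsto_const_nhds (x := b z))
      rwa [max_eq_left (by linarith)] at this
  have hle : ∀ n, ∫ z, min (max (-(a n z)) 0) (b z) ∂ν ≤ (∫ z, max (a n z) 0 ∂ν) +
      lam⁻¹ * (∫ x in Ω, u x ^ (2 * m + 1) * φ n x) + ∫ x in Ω, l n x := by
    intro n
    have i1 : Integrable (fun z => max (a n z) 0) ν := (hai n).pos_part
    have i2 : Integrable (fun z => max (-(a n z)) 0) ν := (hai n).neg_part
    have h1 : ∫ z, min (max (-(a n z)) 0) (b z) ∂ν ≤ ∫ z, max (-(a n z)) 0 ∂ν := by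
      refine integral_mono_of_nonneg (Eventually.of_forall fun z => le_min (le_max_right _ _) (hb0 z))
        i2 (Eventually.of_forall fun z => min_le_left _ _)
    have h2 : ∫ z, max (-(a n z)) 0 ∂ν = ∫ z, max (a n z) 0 ∂ν - ∫ z, a n z ∂ν := by
      rw [← integral_sub i1 (hai n)]
      refine integral_congr_ae (Eventually.of_forall fun z => ?_)
      simp only
      rcases le_total (a n z) 0 with h | h
      · rw [max_eq_left (by linarith), max_eq_right h]; ring
      · rw [max_eq_right (by linarith), max_eq_left h]; ring
    have h3 := hu.weak_eq (φ n) (hφWL n)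
    rw [nonlocalForm_eq] at h3
    have h4 : 0 ≤ ∫ x in Ω, (g x * u x ^ m + k x * u x ^ δ) * φ n x := by
      refine integral_nonneg_of_ae ?_
      filter_upwards [hg, hk, hu.nonneg] with x h1 h2 h3
      exact mul_nonneg (add_nonneg (mul_nonneg h1 (Real.rpow_nonneg h3 _))
        (mul_nonneg h2 (Real.rpow_nonneg h3 _))) (hφ0 n x)
    have h5 := hLle n
    change _ + _ + lam * ∫ z, a n z ∂ν = _ at h3
    have h6 : -∫ z, a n z ∂ν ≤ lam⁻¹ * (∫ x in Ω, u x ^ (2 * m + 1) * φ n x) + localForm Ω p u (φ n) := by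
      rw [← mul_le_mul_iff_right₀ hlam, mul_add, mul_inv_cancel_left₀ hlam.ne']
      linarith
    linarith
  have hfin : ∫ z, min (-(a' z)) (b z) ∂ν ≤ 0 := by
    have := (hpos.add (hZ.const_mul lam⁻¹)).add hLlim
    simp only [mul_zero, add_zero] at this
    exact le_of_tendsto_of_tendsto' hneg this hle
  have hmin0 : 0 ≤ᵐ[ν] fun z => min (-(a' z)) (b z) := by
    filter_upwards [ha'0] with z hz
    exact le_min (show (0 : ℝ) ≤ _ by linarith) (hb0 z)
  have ha'm : AEStronglyMeasurable a' ν :=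
    aestronglyMeasurable_of_tendsto_ae atTop (fun n => (hai n).1) halim
  have hminI : Integrable (fun z => min (-(a' z)) (b z)) ν := by
    refine hbi.mono' (ha'm.neg.inf hbi.1) ?_
    filter_upwards [hmin0] with z hz
    rw [Real.norm_of_nonneg hz]; exact min_le_right _ _
  have hae := (integral_eq_zero_iff_of_nonneg_ae hmin0 hminI).1
    (le_antisymm hfin (integral_nonneg_of_ae hmin0))
  have hprod := Measure.ae_ae_of_ae_prod (ae_of_ae_nlMeasure hae)
  rw [ae_restrict_iff' hΩ.measurableSet]
  filter_upwards [hprod, hu0] with x hx hx0 hxΩ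
  -- If u vanishes at a generic point x of Ω, the strict sign of the interaction with x forces u(y)
  -- = 0 for almost every y. Positivity of ψ(x) is what makes the sign strict.
  refine lt_of_le_of_ne hx0 fun hux => hu.nontrivial (ae_restrict_of_ae ?_)
  filter_upwards [hx, hu0] with y hy hy0
  by_contra hne
  have hyp : 0 < u y := lt_of_le_of_ne hy0 (Ne.symm hne)
  have hxy : x ≠ y := fun h => hne (by rw [← h, ← hux])
  have h1 := hy hxy
  simp only [Pi.zero_apply] at h1
  have hin : ‖incr u (x, y)‖ = u y := by
    simp [incr, ← hux, abs_of_pos hyp]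
  have h2 : 0 < -(a' (x, y)) := by
    simp only [ha', hin, RCLike.inner_apply, conj_trivial]
    simp only [incr, hψZ, ← hux, if_true, if_neg hne]
    have := hψpos x hxΩ
    have h3 : 0 < u y ^ (p - 2) := by positivity
    have : 0 < u y ^ (p - 2) * (ψ x * u y) := by positivity
    linarith
  have h3 : 0 < b (x, y) := by
    have : 0 < ‖incr u (x, y)‖ ^ p := by rw [hin]; positivity
    simp only [hb]
    positivity
  exact (lt_min h2 h3).ne' h1

end Setup

/-! ### Picone quotients as test functions and Picone's inequality -/

section Picone

variable {N : ℕ} {Ω : Set (Euc N)} {p q s m δ lam : ℝ} {g k u v w φ : Euc N → ℝ}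
  {U V W G : Euc N → Euc N}

/-- The tangent line of t^q at r lies below the graph, rearranged; obtained from the weighted AM–GM
inequality. -/
lemma rpow_tangent_le {q r t : ℝ} (hq : 1 ≤ q) (hr : 0 ≤ r) (ht : 0 ≤ t) :
    q * r ^ (q - 1) * t ≤ (q - 1) * r ^ q + t ^ q := by
  have hq0 : 0 < q := by linarith
  have h := Real.geom_mean_le_arith_mean2_weighted (w₁ := (q - 1) / q) (w₂ := 1 / q)
    (p₁ := r ^ q) (p₂ := t ^ q) (div_nonneg (by linarith) hq0.le) (by positivity)
    (by positivity) (by positivity) (by field_simp; ring)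
  rw [← Real.rpow_mul hr, ← Real.rpow_mul ht, mul_div_cancel₀ _ hq0.ne',
    mul_div_cancel₀ _ hq0.ne', Real.rpow_one] at h
  have h2 := mul_le_mul_of_nonneg_left h hq0.le
  calc q * r ^ (q - 1) * t = q * (r ^ (q - 1) * t) := by ring
    _ ≤ _ := h2
    _ = _ := by field_simp

lemma perspective_eq {q x y : ℝ} (hx : 0 ≤ x) (hy : 0 < y) :
    x ^ q / y ^ (q - 1) = y * (x / y) ^ q := by
  rw [Real.div_rpow hx hy.le, Real.rpow_sub_one hy.ne']
  field_simp

/-- The perspective is convex and homogeneous of degree one, so its gradient depends only on the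
ratio x/y. The tangent plane at the first point gives a one-sided Lipschitz bound under a ratio
bound at that point alone; using it both ways gives `piconeQuot_lipschitz`. -/
lemma perspective_sub_le {q C x₁ x₂ y₁ y₂ : ℝ} (hq : 1 ≤ q) (hx₁ : 0 ≤ x₁) (hx₂ : 0 ≤ x₂)
    (hy₁ : 0 < y₁) (hy₂ : 0 < y₂) (h₁ : x₁ ≤ C * y₁) :
    x₁ ^ q / y₁ ^ (q - 1) - x₂ ^ q / y₂ ^ (q - 1) ≤
      (q * C ^ (q - 1) + (q - 1) * C ^ q) * (|y₁ - y₂| + |x₁ - x₂|) := by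
  rw [perspective_eq hx₁ hy₁, perspective_eq hx₂ hy₂]
  set r := x₁ / y₁ with hr
  have hr0 : 0 ≤ r := by positivity
  have hrC : r ≤ C := (div_le_iff₀ hy₁).2 h₁
  have hx : x₁ = r * y₁ := (div_mul_cancel₀ _ hy₁.ne').symm
  have h := mul_le_mul_of_nonneg_left (rpow_tangent_le hq hr0 (by positivity : 0 ≤ x₂ / y₂)) hy₂.le
  have e : y₂ * (q * r ^ (q - 1) * (x₂ / y₂)) = q * r ^ (q - 1) * x₂ := by field_simp
  rw [e] at h
  have e2 : r ^ (q - 1) * x₁ = y₁ * r ^ q := by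
    rcases eq_or_lt_of_le hr0 with h0 | h0
    · rw [hx, ← h0, Real.zero_rpow (by linarith : q ≠ 0)]; ring
    · rw [hx, Real.rpow_sub_one h0.ne']; field_simp
  have h1 : y₁ * r ^ q - y₂ * (x₂ / y₂) ^ q ≤ q * r ^ (q - 1) * (x₁ - x₂) + (q - 1) * r ^ q * (y₂ - y₁) := by
    linear_combination h + (-q) * e2
  have a1 : q * r ^ (q - 1) * (x₁ - x₂) ≤ q * C ^ (q - 1) * |x₁ - x₂| := by
    have : r ^ (q - 1) ≤ C ^ (q - 1) := Real.rpow_le_rpow hr0 hrC (by linarith)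
    calc q * r ^ (q - 1) * (x₁ - x₂) ≤ q * r ^ (q - 1) * |x₁ - x₂| := by
          gcongr; exact le_abs_self _
      _ ≤ _ := by gcongr
  have hq1 : 0 ≤ q - 1 := by linarith
  have a2 : (q - 1) * r ^ q * (y₂ - y₁) ≤ (q - 1) * C ^ q * |y₁ - y₂| := by
    have : r ^ q ≤ C ^ q := Real.rpow_le_rpow hr0 hrC (by linarith)
    calc (q - 1) * r ^ q * (y₂ - y₁) ≤ (q - 1) * r ^ q * |y₁ - y₂| := by
          gcongr; rw [abs_sub_comm]; exact le_abs_self _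
      _ ≤ _ := by gcongr
  have hC0 : 0 ≤ C := hr0.trans hrC
  have b1 : 0 ≤ q * C ^ (q - 1) * |y₁ - y₂| := by positivity
  have b2 : 0 ≤ (q - 1) * C ^ q * |x₁ - x₂| := by positivity
  nlinarith

/-- The Picone quotient `(v+ε)^q/(u+ε)^{q-1} - ε`. -/
noncomputable def piconeQuot (q ε : ℝ) (z : ℝ × ℝ) : ℝ := (z.2 + ε) ^ q / (z.1 + ε) ^ (q - 1) - ε

/-- The convex set on which the Picone quotient is Lipschitz. -/
def piconeSet (ε C : ℝ) : Set (ℝ × ℝ) := {z | 0 ≤ z.1 ∧ 0 ≤ z.2 ∧ z.2 + ε ≤ C * (z.1 + ε)}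

lemma piconeQuot_lipschitz {q ε C : ℝ} (hq : 1 ≤ q) (hε : 0 < ε) :
    ∀ a ∈ piconeSet ε C, ∀ b ∈ piconeSet ε C, |piconeQuot q ε a - piconeQuot q ε b| ≤
      (q * C ^ (q - 1) + (q - 1) * C ^ q) * (|a.1 - b.1| + |a.2 - b.2|) := by
  intro a ha b hb
  obtain ⟨ha1, ha2, ha3⟩ := ha
  obtain ⟨hb1, hb2, hb3⟩ := hb
  have h1 := perspective_sub_le (x₂ := b.2 + ε) (y₂ := b.1 + ε) hq (by linarith) (by linarith)
    (by linarith) (by linarith) ha3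
  have h2 := perspective_sub_le (x₂ := a.2 + ε) (y₂ := a.1 + ε) hq (by linarith) (by linarith)
    (by linarith) (by linarith) hb3
  rw [add_sub_add_right_eq_sub, add_sub_add_right_eq_sub] at h1 h2
  rw [abs_sub_comm b.1, abs_sub_comm b.2] at h2
  rw [abs_le]
  unfold piconeQuot
  constructor <;> linarith

lemma piconeQuot_zero {q ε : ℝ} (hε : 0 < ε) : piconeQuot q ε (0, 0) = 0 := by
  simp only [piconeQuot, zero_add]
  rw [Real.rpow_sub_one hε.ne']
  have : 0 < ε ^ q := by positivity
  field_simp; ring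

lemma piconeQuot_dirDeriv {q ε C : ℝ} (hε : 0 < ε) {z η : ℝ × ℝ}
    (hz : z ∈ piconeSet ε C) :
    DirDeriv (piconeQuot q ε) (piconeSet ε C) z η
      (q * ((z.2 + ε) / (z.1 + ε)) ^ (q - 1) * η.2
        - (q - 1) * ((z.2 + ε) / (z.1 + ε)) ^ q * η.1) := by
  have hzS := hz
  obtain ⟨h1, h2, -⟩ := hz
  have hy : 0 < z.1 + ε := by linarith
  have hx : 0 < z.2 + ε := by linarith
  have d1 : HasFDerivAt (fun z : ℝ × ℝ => (z.2 + ε) ^ q)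
      ((q * (z.2 + ε) ^ (q - 1)) • ContinuousLinearMap.snd ℝ ℝ ℝ) z :=
    (hasFDerivAt_snd.add_const ε).rpow_const (Or.inl hx.ne')
  have d2 : HasFDerivAt (fun z : ℝ × ℝ => (z.1 + ε) ^ (1 - q))
      (((1 - q) * (z.1 + ε) ^ (1 - q - 1)) • ContinuousLinearMap.fst ℝ ℝ ℝ) z :=
    (hasFDerivAt_fst.add_const ε).rpow_const (Or.inl hy.ne')
  have d3 := (d1.mul d2).sub_const ε
  have key := dirDeriv_of_hasFDerivAt (S := piconeSet ε C) (η := η) d3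
  intro σ d hs0 hs hd hS
  have e : ∀ w ∈ piconeSet ε C, (w.2 + ε) ^ q * (w.1 + ε) ^ (1 - q) - ε = piconeQuot q ε w := by
    intro w hw
    have : 0 < w.1 + ε := by linarith [hw.1]
    rw [piconeQuot, ← neg_sub q 1, Real.rpow_neg this.le, div_eq_mul_inv]
  have h3 := key σ d hs0 hs hd hS
  refine (h3.congr fun n => ?_).trans (le_of_eq ?_)
  · simp only [Pi.mul_apply]
    rw [e _ (hS n), e _ hzS]
  · congr 1
    simp only [add_apply, smul_apply,
      ContinuousLinearMap.coe_fst', ContinuousLinearMap.coe_snd', smul_eq_mul]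
    have r1 : (z.1 + ε) ^ (1 - q) = ((z.1 + ε) ^ (q - 1))⁻¹ := by
      rw [← neg_sub q 1, Real.rpow_neg hy.le]
    have r2 : (z.1 + ε) ^ (1 - q - 1) = ((z.1 + ε) ^ q)⁻¹ := by
      rw [show 1 - q - 1 = -q by ring, Real.rpow_neg hy.le]
    rw [r1, r2, Real.div_rpow hx.le hy.le, Real.div_rpow hx.le hy.le]
    ring

/-- The Picone-type test function `(u+ε) - (v+ε)^q/(u+ε)^{q-1}`. -/
noncomputable def piconeTest (q ε : ℝ) (u v : Euc N → ℝ) (x : Euc N) : ℝ :=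
  (u x + ε) - (v x + ε) ^ q / (u x + ε) ^ (q - 1)

lemma piconeTest_eq (q ε : ℝ) (u v : Euc N → ℝ) (x : Euc N) :
    piconeTest q ε u v x = u x - piconeQuot q ε (u x, v x) := by
  simp only [piconeTest, piconeQuot]; ring

/-- The chain rule on `piconeSet`, where the quotient is Lipschitz. The condition C ≥ 1 places the
origin in that set, and the quotient vanishes at the origin, so integrability follows from that of u
and v. -/
lemma isSobolev_piconeTest (hp : 1 < p) {ε C : ℝ} (hq : 1 ≤ q) (hε : 0 < ε) (hC : 1 ≤ C)
    (hu : IsSobolev p u U) (hv : IsSobolev p v V)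
    (hS : ∀ᵐ x, (u x, v x) ∈ piconeSet ε C) :
    IsSobolev p (piconeTest q ε u v) (fun x => U x -
      ((q * ((v x + ε) / (u x + ε)) ^ (q - 1)) • V x
        - ((q - 1) * ((v x + ε) / (u x + ε)) ^ q) • U x)) := by
  have hm : AEStronglyMeasurable (fun x => piconeQuot q ε (u x, v x)) volume :=
    ((((hv.memLp.1.aemeasurable.add_const ε).pow_const q).div
      ((hu.memLp.1.aemeasurable.add_const ε).pow_const (q - 1))).sub_const ε).aestronglyMeasurable
  have h0 : ((0, 0) : ℝ × ℝ) ∈ piconeSet ε C := ⟨le_rfl, le_rfl, by simp only; nlinarith⟩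
  have h := hu.comp₂ (Φ := piconeQuot q ε) (S := piconeSet ε C)
    (V := fun x => ((q * ((v x + ε) / (u x + ε)) ^ (q - 1)) • V x
        - ((q - 1) * ((v x + ε) / (u x + ε)) ^ q) • U x)) hp hv hS (piconeQuot_lipschitz hq hε)
    (memLp_of_lipschitz hS h0 (piconeQuot_zero hε) (piconeQuot_lipschitz hq hε) hm hu.memLp hv.memLp)
    (by
      filter_upwards [hS] with x hx i
      have := piconeQuot_dirDeriv (q := q) (η := (U x i, V x i)) hε hx
      simpa using this)
  refine (hu.sub h).congr (Eventually.of_forall fun x => ?_) (EventuallyEq.refl _ _)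
  exact (piconeTest_eq q ε u v x).symm

lemma memWL_piconeTest (hΩ : IsOpen Ω) (hp : 1 < p) {ε C : ℝ} (hm : 0 ≤ m) (hε : 0 < ε)
    (hC : 1 ≤ C) (hu : MemWL Ω p m u) (hv : MemWL Ω p m v)
    (hS : ∀ᵐ x, (u x, v x) ∈ piconeSet ε C) : MemWL Ω p m (piconeTest (m + 1) ε u v) := by
  have hq : 1 ≤ m + 1 := by linarith
  have hSob := isSobolev_piconeTest hp hq hε hC hu.isSobolev hv.isSobolev hS
  refine memWL_of_isSobolev hΩ hSob ?_ ?_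
  · filter_upwards [hu.ae_eq_zero hΩ, hv.ae_eq_zero hΩ] with x h1 h2 hx
    rw [piconeTest_eq, h1 hx, h2 hx, piconeQuot_zero hε, sub_zero]
  · have h0 : ((0, 0) : ℝ × ℝ) ∈ piconeSet ε C := ⟨le_rfl, le_rfl, by simp only; nlinarith⟩
    have hmeas : AEStronglyMeasurable (fun x => piconeQuot (m + 1) ε (u x, v x)) (volume.restrict Ω) := by
      refine (hu.memLp.1.sub hSob.memLp.1.restrict).congr (Eventually.of_forall fun x => ?_)
      simp only [Pi.sub_apply, piconeTest_eq]; ring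
    refine (hu.memLp.sub (memLp_of_lipschitz (ae_restrict_of_ae hS) h0 (piconeQuot_zero hε)
      (piconeQuot_lipschitz hq hε) hmeas hu.memLp hv.memLp)).ae_eq (Eventually.of_forall fun x => ?_)
    exact (piconeTest_eq _ ε u v x).symm

/-- The sum of the local and nonlocal `p`-energies. -/
noncomputable def energy (Ω : Set (Euc N)) (p s : ℝ) (u : Euc N → ℝ) : ℝ :=
  (∫ x in Ω, ‖weakGradient u x‖ ^ p) + ∫ z, ‖incr u z‖ ^ p ∂nlMeasure N p s

lemma energy_eq (h : IsSobolev p u U) : energy Ω p s u =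
    (∫ x in Ω, ‖U x‖ ^ p) + ∫ z, ‖incr u z‖ ^ p ∂nlMeasure N p s := by
  unfold energy
  congr 1
  refine integral_congr_ae (ae_restrict_of_ae ?_)
  filter_upwards [h.weak.weakGradient_ae_eq] with x hx
  rw [hx]

/-- Conditions on the parameters of the operator. -/
structure Exponents (N : ℕ) (p s : ℝ) : Prop where
  dim_pos : 0 < N
  one_lt : 1 < p
  s_pos : 0 < s
  s_lt : s < 1

lemma Exponents.memLp_incr (h : Exponents N p s) (hu : IsSobolev p u U) :
    MemLp (incr u) (ENNReal.ofReal p) (nlMeasure N p s) :=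
  hu.memLp_incr h.dim_pos h.one_lt h.s_pos h.s_lt

lemma Exponents.integrable_grad (h : Exponents N p s) (hu : IsSobolev p u U) :
    Integrable (fun x => ‖U x‖ ^ p) (volume.restrict Ω) :=
  integrable_norm_rpow (by linarith [h.one_lt]) (hu.memLp_grad.restrict Ω)

lemma Exponents.integrable_incr (h : Exponents N p s) (hu : IsSobolev p u U) :
    Integrable (fun z => ‖incr u z‖ ^ p) (nlMeasure N p s) :=
  integrable_norm_rpow (by linarith [h.one_lt]) (h.memLp_incr hu)

lemma energy_mono (h : Exponents N p s) (hu : IsSobolev p u U) (hv : IsSobolev p v V)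
    (h1 : ∀ᵐ x, ‖U x‖ ≤ ‖V x‖) (h2 : ∀ᵐ z ∂nlMeasure N p s, ‖incr u z‖ ≤ ‖incr v z‖) :
    energy Ω p s u ≤ energy Ω p s v := by
  have hp : 0 < p := by linarith [h.one_lt]
  rw [energy_eq hu, energy_eq hv]
  refine add_le_add (integral_mono_ae (h.integrable_grad hu) (h.integrable_grad hv) ?_)
    (integral_mono_ae (h.integrable_incr hu) (h.integrable_incr hv) ?_)
  · refine ae_restrict_of_ae ?_
    filter_upwards [h1] with x hx
    exact Real.rpow_le_rpow (norm_nonneg _) hx hp.le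
  · filter_upwards [h2] with z hz
    exact Real.rpow_le_rpow (norm_nonneg _) hz hp.le

-- Submodularity. At each point the gradients of the minimum and maximum are those of u and v in
-- some order, so the local energies balance exactly. The nonlocal energies are compared pair by
-- pair with `min_max_incr_rpow_le`.
open Classical in
lemma energy_min_add_max_le (h : Exponents N p s) (hu : IsSobolev p u U) (hv : IsSobolev p v V) :
    energy Ω p s (fun x => min (u x) (v x)) + energy Ω p s (fun x => max (u x) (v x)) ≤
      energy Ω p s u + energy Ω p s v := by
  have hp := h.one_lt
  have hmin := hu.inf hp hv
  have hmax := hu.sup hp hv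
  rw [energy_eq hmin, energy_eq hmax, energy_eq hu, energy_eq hv]
  have h1 : (∫ x in Ω, ‖if v x < u x then V x else U x‖ ^ p) +
      ∫ x in Ω, ‖if v x < u x then U x else V x‖ ^ p = (∫ x in Ω, ‖U x‖ ^ p) + ∫ x in Ω, ‖V x‖ ^ p := by
    rw [← integral_add (h.integrable_grad hmin) (h.integrable_grad hmax),
      ← integral_add (h.integrable_grad hu) (h.integrable_grad hv)]
    refine integral_congr_ae (Eventually.of_forall fun x => ?_)
    simp only
    split_ifs <;> ring
  have h2 : (∫ z, ‖incr (fun x => min (u x) (v x)) z‖ ^ p ∂nlMeasure N p s) +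
      ∫ z, ‖incr (fun x => max (u x) (v x)) z‖ ^ p ∂nlMeasure N p s ≤
      (∫ z, ‖incr u z‖ ^ p ∂nlMeasure N p s) + ∫ z, ‖incr v z‖ ^ p ∂nlMeasure N p s := by
    rw [← integral_add (h.integrable_incr hmin) (h.integrable_incr hmax),
      ← integral_add (h.integrable_incr hu) (h.integrable_incr hv)]
    refine integral_mono ((h.integrable_incr hmin).add (h.integrable_incr hmax))
      ((h.integrable_incr hu).add (h.integrable_incr hv)) fun z => ?_
    exact min_max_incr_rpow_le hp.le (u z.1) (u z.2) (v z.1) (v z.2)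
  linarith

/-- Picone's inequality for the mixed operator. -/
lemma picone_form (h : Exponents N p s) {ε C : ℝ} (hq : 1 ≤ q) (hqp : q ≤ p) (hε : 0 < ε)
    (hC : 1 ≤ C) (hu : IsSobolev p u U) (hv : IsSobolev p v V)
    (hS : ∀ᵐ x, (u x, v x) ∈ piconeSet ε C) :
    q / p * (energy Ω p s u - energy Ω p s v) ≤
      localForm Ω p u (piconeTest q ε u v) + nonlocalForm p s u (piconeTest q ε u v) := by
  have hp := h.one_lt
  have hu' := hu.weakGradient
  have hφ := isSobolev_piconeTest hp hq hε hC hu' hv hS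
  rw [energy_eq hu', energy_eq hv, localForm_congr hφ.weak, nonlocalForm_eq]
  have h1 := integral_mono_ae (μ := volume.restrict Ω)
    (((h.integrable_grad hu').sub (h.integrable_grad hv)).const_mul (q / p))
    (integrable_form hp (hu'.memLp_grad.restrict Ω) (hφ.memLp_grad.restrict Ω)) (by
      refine ae_restrict_of_ae ?_
      filter_upwards [hS] with x hx
      obtain ⟨h1, h2, -⟩ := hx
      exact gradient_picone hq hqp (by positivity) _ _)
  have h2 := integral_mono_ae (μ := nlMeasure N p s)
    (((h.integrable_incr hu').sub (h.integrable_incr hv)).const_mul (q / p))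
    (integrable_form hp (h.memLp_incr hu') (h.memLp_incr hφ)) (by
      filter_upwards [ae_nlMeasure_fst hS, ae_nlMeasure_snd hS] with z h1 h2
      have := discrete_picone (a := u z.1 + ε) (b := u z.2 + ε) (a' := v z.1 + ε)
        (b' := v z.2 + ε) hq hqp (by linarith [h1.1]) (by linarith [h2.1]) (by linarith [h1.2.1])
        (by linarith [h2.2.1])
      rw [add_sub_add_right_eq_sub, add_sub_add_right_eq_sub] at this
      simp only [RCLike.inner_apply, conj_trivial, Real.norm_eq_abs, Pi.sub_apply]
      simp only [incr, piconeTest]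
      rw [mul_comm _ (u z.1 - u z.2)]
      exact this)
  simp only [Pi.sub_apply, integral_const_mul] at h1 h2
  rw [integral_sub (h.integrable_grad hu') (h.integrable_grad hv)] at h1
  rw [integral_sub (h.integrable_incr hu') (h.integrable_incr hv)] at h2
  linarith

end Picone

/-! ### L² comparison of weak solutions -/

section Comparison

variable {N : ℕ} {Ω : Set (Euc N)} {p q s m δ lam : ℝ} {g k u v w φ : Euc N → ℝ}
  {U V W G : Euc N → Euc N}

lemma MemWL.inf (hΩ : IsOpen Ω) (hp : 1 < p) (hu : MemWL Ω p m u) (hv : MemWL Ω p m v) :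
    MemWL Ω p m fun x => min (u x) (v x) := by
  classical
  refine memWL_of_isSobolev hΩ (hu.isSobolev.inf hp hv.isSobolev) ?_ (hu.memLp.inf hv.memLp)
  filter_upwards [hu.ae_eq_zero hΩ, hv.ae_eq_zero hΩ] with x h1 h2 hx
  rw [h1 hx, h2 hx, min_self]

lemma MemWL.sup (hΩ : IsOpen Ω) (hp : 1 < p) (hu : MemWL Ω p m u) (hv : MemWL Ω p m v) :
    MemWL Ω p m fun x => max (u x) (v x) := by
  classical
  refine memWL_of_isSobolev hΩ (hu.isSobolev.sup hp hv.isSobolev) ?_ (hu.memLp.sup hv.memLp)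
  filter_upwards [hu.ae_eq_zero hΩ, hv.ae_eq_zero hΩ] with x h1 h2 hx
  rw [h1 hx, h2 hx, max_self]

open Classical in
lemma IsSobolev.truncate (hp : 1 < p) (hu : IsSobolev p u U) {c : ℝ} (hc : 0 ≤ c) :
    IsSobolev p (fun x => min (u x) c) (fun x => U x - if c < u x then U x else 0) := by
  refine (hu.sub (hu.subLevel hp hc)).congr (Eventually.of_forall fun x => ?_) (EventuallyEq.refl _ _)
  simp only
  rcases le_total (u x) c with h | h
  · rw [min_eq_left h, max_eq_right (by linarith)]; ring
  · rw [min_eq_right h, max_eq_left (by linarith)]; ring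

lemma MemWL.truncate (hΩ : IsOpen Ω) (hp : 1 < p) (hu : MemWL Ω p m u) {c : ℝ} (hc : 0 ≤ c) :
    MemWL Ω p m fun x => min (u x) c := by
  classical
  have h := hu.isSobolev.truncate hp hc
  refine memWL_of_isSobolev hΩ h ?_ (hu.memLp.mono h.memLp.1.restrict (Eventually.of_forall fun x => ?_))
  · filter_upwards [hu.ae_eq_zero hΩ] with x h1 hx
    rw [h1 hx, min_eq_left hc]
  · rw [Real.norm_eq_abs, Real.norm_eq_abs, abs_le]
    refine ⟨le_min (neg_abs_le _) ?_, (min_le_left _ _).trans (le_abs_self _)⟩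
    linarith [abs_nonneg (u x)]

lemma energy_truncate_le (h : Exponents N p s) (hu : IsSobolev p u U) {c : ℝ} (hc : 0 ≤ c) :
    energy Ω p s (fun x => min (u x) c) ≤ energy Ω p s u := by
  classical
  refine energy_mono h (hu.truncate h.one_lt hc) hu (Eventually.of_forall fun x => ?_)
    (Eventually.of_forall fun z => ?_)
  · split_ifs <;> simp
  · have := abs_min_sub_min_le_max (u z.1) c (u z.2) c
    rw [sub_self, abs_zero, max_eq_left (abs_nonneg _)] at this
    exact this

/-- Picone bounds the sum from below by (q/p)(E(u) - E(min) + E(v) - E(max)), with u truncated at c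
inside the minimum and the maximum. Submodularity and E(min(u, c)) ≤ E(u) make this nonnegative. The
truncation keeps (max + ε)/(v + ε) bounded, by c/ε + 1, as `piconeSet` requires. -/
lemma picone_pair_nonneg (h : Exponents N p s) (hq : 1 ≤ q) (hqp : q ≤ p) (hu : IsSobolev p u U)
    (hv : IsSobolev p v V) (hu0 : ∀ᵐ x, 0 ≤ u x) (hv0 : ∀ᵐ x, 0 ≤ v x) {ε c : ℝ} (hε : 0 < ε)
    (hc : 0 ≤ c) :
    0 ≤ localForm Ω p u (piconeTest q ε u fun x => min (min (u x) c) (v x)) +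
        nonlocalForm p s u (piconeTest q ε u fun x => min (min (u x) c) (v x)) +
      (localForm Ω p v (piconeTest q ε v fun x => max (min (u x) c) (v x)) +
        nonlocalForm p s v (piconeTest q ε v fun x => max (min (u x) c) (v x))) := by
  classical
  have hp := h.one_lt
  have hT := hu.truncate hp hc
  have h1 := picone_form (Ω := Ω) (C := 1) h hq hqp hε le_rfl hu (hT.inf hp hv) (by
    filter_upwards [hu0, hv0] with x h1 h2
    refine ⟨h1, le_min (le_min h1 hc) h2, ?_⟩
    have : min (min (u x) c) (v x) ≤ u x := (min_le_left _ _).trans (min_le_left _ _)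
    simp only; linarith)
  have h2 := picone_form (Ω := Ω) (C := c / ε + 1) h hq hqp hε (by linarith [div_nonneg hc hε.le]) hv
    (hT.sup hp hv) (by
    filter_upwards [hu0, hv0] with x h1 h2
    refine ⟨h2, h2.trans (le_max_right _ _), ?_⟩
    have h3 : c ≤ c / ε * (v x + ε) := by
      rw [mul_add, div_mul_cancel₀ _ hε.ne']
      linarith [mul_nonneg (div_nonneg hc hε.le) h2]
    have h4 : max (min (u x) c) (v x) ≤ c + v x :=
      max_le (by linarith [min_le_right (u x) c]) (by linarith)
    simp only; linarith)
  have h3 := energy_min_add_max_le (Ω := Ω) h hT hv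
  have h4 := energy_truncate_le (Ω := Ω) h hu hc
  have h5 : 0 ≤ q / p := by positivity
  nlinarith [mul_nonneg h5 (sub_nonneg.2 (h3.trans (add_le_add_left h4 _)))]

/-- The integrand obtained from testing two problems with Picone-type functions. -/
noncomputable def comparisonIntegrand (m δ ε c a b g₁ g₂ k : ℝ) : ℝ :=
  a ^ (m + 1) * (a ^ m * ((a + ε) - (min (min a c) b + ε) ^ (m + 1) / (a + ε) ^ m)) +
  b ^ (m + 1) * (b ^ m * ((b + ε) - (max (min a c) b + ε) ^ (m + 1) / (b + ε) ^ m)) -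
  g₁ * (a ^ m * ((a + ε) - (min (min a c) b + ε) ^ (m + 1) / (a + ε) ^ m)) -
  g₂ * (b ^ m * ((b + ε) - (max (min a c) b + ε) ^ (m + 1) / (b + ε) ^ m)) -
  k * max (a ^ δ * ((a + ε) - (min (min a c) b + ε) ^ (m + 1) / (a + ε) ^ m) +
    b ^ δ * ((b + ε) - (max (min a c) b + ε) ^ (m + 1) / (b + ε) ^ m)) 0

lemma picone_upper_mem {m ε c a b : ℝ} (hm : 0 ≤ m) (hε : 0 < ε) (hc : 0 ≤ c) (ha : 0 ≤ a)
    (hb : 0 ≤ b) : 0 ≤ (a + ε) - (min (min a c) b + ε) ^ (m + 1) / (a + ε) ^ m ∧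
      (a + ε) - (min (min a c) b + ε) ^ (m + 1) / (a + ε) ^ m ≤ a + ε := by
  have h0 : 0 ≤ min (min a c) b := le_min (le_min ha hc) hb
  have h1 : min (min a c) b ≤ a := (min_le_left _ _).trans (min_le_left _ _)
  have h2 : (min (min a c) b + ε) ^ (m + 1) ≤ (a + ε) ^ (m + 1) := by gcongr
  constructor
  · rw [sub_nonneg, div_le_iff₀ (by positivity), mul_comm, ← Real.rpow_add_one (by positivity)]
    exact h2
  · have : 0 ≤ (min (min a c) b + ε) ^ (m + 1) / (a + ε) ^ m := by positivity
    linarith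

lemma picone_lower_mem {m ε c a b : ℝ} (hm : 0 ≤ m) (hε : 0 < ε) (hc : 0 ≤ c) (ha : 0 ≤ a)
    (hb : 0 ≤ b) : (b + ε) - (max (min a c) b + ε) ^ (m + 1) / (b + ε) ^ m ≤ 0 ∧
      -(a + b + ε) ^ (m + 1) ≤
        b ^ m * ((b + ε) - (max (min a c) b + ε) ^ (m + 1) / (b + ε) ^ m) := by
  have h1 : b ≤ max (min a c) b := le_max_right _ _
  have h2 : (b + ε) ^ (m + 1) ≤ (max (min a c) b + ε) ^ (m + 1) := by gcongr
  have h3 : max (min a c) b ≤ a + b := max_le (by linarith [min_le_left a c]) (by linarith)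
  have h4 : (max (min a c) b + ε) ^ (m + 1) ≤ (a + b + ε) ^ (m + 1) := by gcongr
  constructor
  · rw [sub_nonpos, le_div_iff₀ (by positivity), mul_comm, ← Real.rpow_add_one (by positivity)]
    exact h2
  · have h5 : b ^ m ≤ (b + ε) ^ m := by gcongr; linarith
    have h6 : b ^ m * ((max (min a c) b + ε) ^ (m + 1) / (b + ε) ^ m) ≤
        (max (min a c) b + ε) ^ (m + 1) := by
      rw [← mul_div_assoc, div_le_iff₀ (by positivity), mul_comm]
      gcongr
    have h7 : 0 ≤ b ^ m * (b + ε) := by positivity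
    linarith

/-- A majorant independent of ε and c. The factor b^m tames the quotient by (b + ε)^m, but b^δ need
not. This is why the k term enters `comparisonIntegrand` only through its positive part, to which
the nonpositive b contribution adds nothing. -/
lemma abs_comparisonIntegrand_le {m δ ε c a b g₁ g₂ k : ℝ} (hm : 0 ≤ m) (hδ : 0 ≤ δ) (hδm : δ ≤ m)
    (hε : 0 < ε) (hε1 : ε ≤ 1) (hc : 0 ≤ c) (ha : 0 ≤ a) (hb : 0 ≤ b) :
    |comparisonIntegrand m δ ε c a b g₁ g₂ k| ≤
      (a ^ (m + 1) + b ^ (m + 1) + |g₁| + |g₂| + |k|) * (a + b + 1) ^ (m + 1) := by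
  set B := (a + b + 1) ^ (m + 1) with hB
  obtain ⟨p1, p2⟩ := picone_upper_mem (b := b) hm hε hc ha hb
  obtain ⟨p3, p4⟩ := picone_lower_mem hm hε hc ha hb
  unfold comparisonIntegrand
  set P := (a + ε) - (min (min a c) b + ε) ^ (m + 1) / (a + ε) ^ m
  set Q := (b + ε) - (max (min a c) b + ε) ^ (m + 1) / (b + ε) ^ m
  have hB1 : (a + b + ε) ^ (m + 1) ≤ B := by rw [hB]; gcongr
  have hθ : ∀ θ, 0 ≤ θ → θ ≤ m → a ^ θ * P ≤ B := by
    intro θ h0 h1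
    have e1 : a ^ θ ≤ (a + b + 1) ^ θ := by gcongr; linarith
    have e2 : (a + b + 1) ^ θ ≤ (a + b + 1) ^ m := Real.rpow_le_rpow_of_exponent_le (by linarith) h1
    rw [hB, Real.rpow_add_one (by positivity)]
    exact mul_le_mul (e1.trans e2) (by linarith) p1 (by positivity)
  have hA : |a ^ m * P| ≤ B := by
    rw [abs_of_nonneg (by positivity)]; exact hθ m hm le_rfl
  have hBb : |b ^ m * Q| ≤ B := by
    rw [abs_of_nonpos (mul_nonpos_of_nonneg_of_nonpos (by positivity) p3)]; linarith
  have hR : |max (a ^ δ * P + b ^ δ * Q) 0| ≤ B := by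
    rw [abs_of_nonneg (le_max_right _ _)]
    refine max_le ?_ (by positivity)
    have : b ^ δ * Q ≤ 0 := mul_nonpos_of_nonneg_of_nonpos (by positivity) p3
    linarith [hθ δ hδ hδm]
  refine (abs_sub _ _).trans ?_
  have t1 : |a ^ (m + 1) * (a ^ m * P)| ≤ a ^ (m + 1) * B := by
    rw [abs_mul, abs_of_nonneg (by positivity : 0 ≤ a ^ (m + 1))]; gcongr
  have t2 : |b ^ (m + 1) * (b ^ m * Q)| ≤ b ^ (m + 1) * B := by
    rw [abs_mul, abs_of_nonneg (by positivity : 0 ≤ b ^ (m + 1))]; gcongr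
  have t3 : |g₁ * (a ^ m * P)| ≤ |g₁| * B := by rw [abs_mul]; gcongr
  have t4 : |g₂ * (b ^ m * Q)| ≤ |g₂| * B := by rw [abs_mul]; gcongr
  have t5 : |k * max (a ^ δ * P + b ^ δ * Q) 0| ≤ |k| * B := by rw [abs_mul]; gcongr
  have s1 := abs_sub (a ^ (m + 1) * (a ^ m * P) + b ^ (m + 1) * (b ^ m * Q) - g₁ * (a ^ m * P))
    (g₂ * (b ^ m * Q))
  have s2 := abs_sub (a ^ (m + 1) * (a ^ m * P) + b ^ (m + 1) * (b ^ m * Q)) (g₁ * (a ^ m * P))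
  have s3 := abs_add_le (a ^ (m + 1) * (a ^ m * P)) (b ^ (m + 1) * (b ^ m * Q))
  linarith

/-- With w = (a^(m+1) - b^(m+1))^+ the two test quantities tend to w / a^m and -w / b^m. The k term
disappears: where w > 0 one has a > b, hence a^(δ-m) ≤ b^(δ-m) since δ ≤ m, and its positive part is
zero. -/
lemma tendsto_comparisonIntegrand {m δ a b g₁ g₂ k : ℝ} (hm : 0 ≤ m) (hδm : δ ≤ m)
    (ha : 0 < a) (hb : 0 < b) {ε c : ℕ → ℝ} (hε : Tendsto ε atTop (𝓝 0))
    (hc : Tendsto c atTop atTop) :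
    Tendsto (fun n => comparisonIntegrand m δ (ε n) (c n) a b g₁ g₂ k) atTop
      (𝓝 ((a ^ (m + 1) - b ^ (m + 1) - (g₁ - g₂)) * max (a ^ (m + 1) - b ^ (m + 1)) 0)) := by
  have hpow : ∀ t : ℝ, 0 < t → ∀ r : ℝ, Tendsto (fun n => (t + ε n) ^ r) atTop (𝓝 (t ^ r)) := by
    intro t ht r
    have : Tendsto (fun n => t + ε n) atTop (𝓝 t) := by simpa using hε.const_add t
    exact this.rpow_const (Or.inl ht.ne')
  have hq : ∀ t x : ℝ, 0 < t → 0 < x →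
      Tendsto (fun n => (t + ε n) - (x + ε n) ^ (m + 1) / (t + ε n) ^ m) atTop
        (𝓝 (t - x ^ (m + 1) / t ^ m)) := by
    intro t x ht hx
    have : Tendsto (fun n => t + ε n) atTop (𝓝 t) := by simpa using hε.const_add t
    exact this.sub ((hpow x hx _).div (hpow t ht _) (by positivity))
  have e : ∀ t x : ℝ, 0 < t → ∀ r : ℝ,
      t ^ r * (t - x ^ (m + 1) / t ^ m) = t ^ (r - m) * (t ^ (m + 1) - x ^ (m + 1)) := by
    intro t x ht r
    rw [Real.rpow_sub ht, Real.rpow_add_one ht.ne']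
    field_simp
  have hmin : 0 < min a b := lt_min ha hb
  have hmax : 0 < max a b := ha.trans_le (le_max_left _ _)
  set w := max (a ^ (m + 1) - b ^ (m + 1)) 0 with hw
  have w1 : a ^ (m + 1) - min a b ^ (m + 1) = w := by
    rcases le_total a b with h | h
    · have : a ^ (m + 1) ≤ b ^ (m + 1) := by gcongr
      rw [min_eq_left h, hw, max_eq_right (by linarith), sub_self]
    · have : b ^ (m + 1) ≤ a ^ (m + 1) := by gcongr
      rw [min_eq_right h, hw, max_eq_left (by linarith)]
  have w2 : b ^ (m + 1) - max a b ^ (m + 1) = -w := by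
    rcases le_total a b with h | h
    · have : a ^ (m + 1) ≤ b ^ (m + 1) := by gcongr
      rw [max_eq_right h, hw, max_eq_right (by linarith), sub_self, neg_zero]
    · have : b ^ (m + 1) ≤ a ^ (m + 1) := by gcongr
      rw [max_eq_left h, hw, max_eq_left (by linarith)]; ring
  have hP := hq a (min a b) ha hmin
  have hQ := hq b (max a b) hb hmax
  have lim := (((((hP.const_mul (a ^ m)).const_mul (a ^ (m + 1))).add
    ((hQ.const_mul (b ^ m)).const_mul (b ^ (m + 1)))).sub
    ((hP.const_mul (a ^ m)).const_mul g₁)).sub ((hQ.const_mul (b ^ m)).const_mul g₂)).sub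
    ((((hP.const_mul (a ^ δ)).add (hQ.const_mul (b ^ δ))).max
      (tendsto_const_nhds (x := (0:ℝ)))).const_mul k)
  rw [e a _ ha, e b _ hb, e a _ ha, e b _ hb, w1, w2, sub_self, Real.rpow_zero, Real.rpow_zero] at lim
  have hz : max (a ^ (δ - m) * w + b ^ (δ - m) * -w) 0 = 0 := by
    refine max_eq_right ?_
    have hw0 : 0 ≤ w := le_max_right _ _
    rcases le_total a b with h | h
    · have : a ^ (m + 1) ≤ b ^ (m + 1) := by gcongr
      have : w = 0 := max_eq_right (by linarith)
      simp [this]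
    · have := Real.rpow_le_rpow_of_nonpos hb h (by linarith : δ - m ≤ 0)
      nlinarith
  rw [hz] at lim
  have ew : a ^ (m + 1) * (1 * w) + b ^ (m + 1) * (1 * -w) - g₁ * (1 * w) - g₂ * (1 * -w) - k * 0 =
      (a ^ (m + 1) - b ^ (m + 1) - (g₁ - g₂)) * w := by ring
  rw [ew] at lim
  refine lim.congr' ?_
  filter_upwards [hc.eventually_ge_atTop a] with n hn
  rw [comparisonIntegrand, min_eq_left hn]

lemma WeakSol.integral_comparison_nonpos (hΩ : IsOpen Ω) (hΩb : Bornology.IsBounded Ω)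
    (h : Exponents N p s) (hm : 0 ≤ m) (hmp : m + 1 ≤ p) (hδ : 0 ≤ δ) (hδm : δ ≤ m)
    (hlam : 0 < lam) {g₁ g₂ u₁ u₂ : Euc N → ℝ} (hg₁ : MemLp g₁ 2 (volume.restrict Ω))
    (hg₂ : MemLp g₂ 2 (volume.restrict Ω)) (hk : MemLp k 2 (volume.restrict Ω))
    (hk0 : ∀ᵐ x ∂volume.restrict Ω, 0 ≤ k x) (h₁ : WeakSol Ω p s m δ lam g₁ k u₁)
    (h₂ : WeakSol Ω p s m δ lam g₂ k u₂) (hu₁ : ∀ᵐ x ∂volume.restrict Ω, 0 < u₁ x)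
    (hu₂ : ∀ᵐ x ∂volume.restrict Ω, 0 < u₂ x) {ε c : ℝ} (hε : 0 < ε) (hc : 0 ≤ c)
    (hI : Integrable (fun x => comparisonIntegrand m δ ε c (u₁ x) (u₂ x) (g₁ x) (g₂ x) (k x))
      (volume.restrict Ω)) :
    ∫ x in Ω, comparisonIntegrand m δ ε c (u₁ x) (u₂ x) (g₁ x) (g₂ x) (k x) ≤ 0 := by
  have := isFiniteMeasure_restrict hΩb
  have hp := h.one_lt
  have n₁ := h₁.ae_nonneg hΩ
  have n₂ := h₂.ae_nonneg hΩ
  have hT := h₁.memWL.truncate hΩ hp hc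
  have hφ : MemWL Ω p m (piconeTest (m + 1) ε u₁ fun x => min (min (u₁ x) c) (u₂ x)) := by
    refine memWL_piconeTest hΩ hp hm hε le_rfl h₁.memWL (hT.inf hΩ hp h₂.memWL) ?_
    filter_upwards [n₁, n₂] with x a1 a2
    refine ⟨a1, le_min (le_min a1 hc) a2, ?_⟩
    have : min (min (u₁ x) c) (u₂ x) ≤ u₁ x := (min_le_left _ _).trans (min_le_left _ _)
    simp only; linarith
  have hψ : MemWL Ω p m (piconeTest (m + 1) ε u₂ fun x => max (min (u₁ x) c) (u₂ x)) := by
    refine memWL_piconeTest (C := c / ε + 1) hΩ hp hm hε (by linarith [div_nonneg hc hε.le]) h₂.memWL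
      (hT.sup hΩ hp h₂.memWL) ?_
    filter_upwards [n₁, n₂] with x a1 a2
    refine ⟨a2, a2.trans (le_max_right _ _), ?_⟩
    have h3 : c ≤ c / ε * (u₂ x + ε) := by
      rw [mul_add, div_mul_cancel₀ _ hε.ne']
      linarith [mul_nonneg (div_nonneg hc hε.le) a2]
    have h4 : max (min (u₁ x) c) (u₂ x) ≤ c + u₂ x :=
      max_le (by linarith [min_le_right (u₁ x) c]) (by linarith)
    simp only; linarith
  have hF := picone_pair_nonneg (Ω := Ω) h (q := m + 1) (by linarith) hmp h₁.memWL.isSobolev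
    h₂.memWL.isSobolev n₁ n₂ hε hc
  have e₁ := h₁.weak_eq _ hφ
  have e₂ := h₂.weak_eq _ hψ
  set φ := piconeTest (m + 1) ε u₁ fun x => min (min (u₁ x) c) (u₂ x) with hφd
  set ψ := piconeTest (m + 1) ε u₂ fun x => max (min (u₁ x) c) (u₂ x) with hψd
  have L₁ := h₁.memWL.memLp
  have L₂ := h₂.memWL.memLp
  have hL : ∀ {u φ : Euc N → ℝ} {θ : ℝ}, MemWL Ω p m u → MemWL Ω p m φ → 0 ≤ θ → θ ≤ m →
      (∀ᵐ x ∂volume.restrict Ω, 0 < u x) → MemLp (fun x => u x ^ θ * φ x) 2 (volume.restrict Ω) := by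
    intro u φ θ hu hφ h0 h1 hpos
    refine (memLp_two_rpow_mul (q := m + 1) h0 (by linarith) hu.memLp hφ.memLp).ae_eq ?_
    filter_upwards [hpos] with x hx
    rw [abs_of_pos hx]
  have hq : ∀ {u : Euc N → ℝ}, MemWL Ω p m u → (∀ᵐ x ∂volume.restrict Ω, 0 < u x) →
      MemLp (fun x => u x ^ (m + 1)) 2 (volume.restrict Ω) := by
    intro u hu hpos
    refine (memLp_two_rpow (q := m + 1) (by linarith) hu.memLp).ae_eq ?_
    filter_upwards [hpos] with x hx
    rw [abs_of_pos hx]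
  have s₁ : (∫ x in Ω, u₁ x ^ (2 * m + 1) * φ x) = ∫ x in Ω, u₁ x ^ (m + 1) * (u₁ x ^ m * φ x) := by
    refine integral_congr_ae ?_
    filter_upwards [hu₁] with x hx
    rw [show 2 * m + 1 = (m + 1) + m by ring, Real.rpow_add hx, mul_assoc]
  have s₂ : (∫ x in Ω, u₂ x ^ (2 * m + 1) * ψ x) = ∫ x in Ω, u₂ x ^ (m + 1) * (u₂ x ^ m * ψ x) := by
    refine integral_congr_ae ?_
    filter_upwards [hu₂] with x hx
    rw [show 2 * m + 1 = (m + 1) + m by ring, Real.rpow_add hx, mul_assoc]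
  have am := hL h₁.memWL hφ hm le_rfl hu₁
  have ad := hL h₁.memWL hφ hδ hδm hu₁
  have bm := hL h₂.memWL hψ hm le_rfl hu₂
  have bd := hL h₂.memWL hψ hδ hδm hu₂
  have i1 := integrable_mul_of_two (hq h₁.memWL hu₁) am
  have i2 := integrable_mul_of_two (hq h₂.memWL hu₂) bm
  have i3 := integrable_mul_of_two hg₁ am
  have i4 := integrable_mul_of_two hg₂ bm
  have i5 := integrable_mul_of_two hk ad
  have i6 := integrable_mul_of_two hk bd
  have r₁ : (∫ x in Ω, (g₁ x * u₁ x ^ m + k x * u₁ x ^ δ) * φ x) =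
      (∫ x in Ω, g₁ x * (u₁ x ^ m * φ x)) + ∫ x in Ω, k x * (u₁ x ^ δ * φ x) := by
    rw [← integral_add i3 i5]
    exact integral_congr_ae (Eventually.of_forall fun x => by ring)
  have r₂ : (∫ x in Ω, (g₂ x * u₂ x ^ m + k x * u₂ x ^ δ) * ψ x) =
      (∫ x in Ω, g₂ x * (u₂ x ^ m * ψ x)) + ∫ x in Ω, k x * (u₂ x ^ δ * ψ x) := by
    rw [← integral_add i4 i6]
    exact integral_congr_ae (Eventually.of_forall fun x => by ring)
  rw [s₁, r₁] at e₁
  rw [s₂, r₂] at e₂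
  -- As k ≥ 0, replacing the k bracket by its positive part only decreases the integrand, so the
  -- tested equations still give an upper bound.
  have hle : ∫ x in Ω, comparisonIntegrand m δ ε c (u₁ x) (u₂ x) (g₁ x) (g₂ x) (k x) ≤
      ∫ x in Ω, (u₁ x ^ (m + 1) * (u₁ x ^ m * φ x) + u₂ x ^ (m + 1) * (u₂ x ^ m * ψ x)
        - g₁ x * (u₁ x ^ m * φ x) - g₂ x * (u₂ x ^ m * ψ x)
        - (k x * (u₁ x ^ δ * φ x) + k x * (u₂ x ^ δ * ψ x))) := by
    refine integral_mono_ae hI ((((i1.add i2).sub i3).sub i4).sub (i5.add i6)) ?_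
    filter_upwards [hk0] with x hx
    have := mul_le_mul_of_nonneg_left (le_max_left (u₁ x ^ δ * φ x + u₂ x ^ δ * ψ x) 0) hx
    simp only [comparisonIntegrand]
    simp only [hφd, hψd, piconeTest, add_sub_cancel_right] at this ⊢
    linarith
  have j1 : Integrable (fun x => u₁ x ^ (m + 1) * (u₁ x ^ m * φ x) + u₂ x ^ (m + 1) * (u₂ x ^ m * ψ x))
    (volume.restrict Ω) := i1.add i2
  have j2 : Integrable (fun x => u₁ x ^ (m + 1) * (u₁ x ^ m * φ x) + u₂ x ^ (m + 1) * (u₂ x ^ m * ψ x)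
    - g₁ x * (u₁ x ^ m * φ x)) (volume.restrict Ω) := j1.sub i3
  have j3 : Integrable (fun x => u₁ x ^ (m + 1) * (u₁ x ^ m * φ x) + u₂ x ^ (m + 1) * (u₂ x ^ m * ψ x)
    - g₁ x * (u₁ x ^ m * φ x) - g₂ x * (u₂ x ^ m * ψ x)) (volume.restrict Ω) := j2.sub i4
  have j4 : Integrable (fun x => k x * (u₁ x ^ δ * φ x) + k x * (u₂ x ^ δ * ψ x))
    (volume.restrict Ω) := i5.add i6
  rw [integral_sub j3 j4, integral_sub j2 i4, integral_sub j1 i3, integral_add i1 i2,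
    integral_add i5 i6] at hle
  nlinarith [mul_nonneg hlam.le hF]

lemma eLpNorm_two_le_of_integral_sq_le {X : Type*} [MeasurableSpace X] {μ : Measure X} {f g : X → ℝ}
    (hf : MemLp f 2 μ) (hg : MemLp g 2 μ) (h : ∫ x, f x ^ 2 ∂μ ≤ ∫ x, g x ^ 2 ∂μ) :
    eLpNorm f 2 μ ≤ eLpNorm g 2 μ := by
  rw [hf.eLpNorm_eq_integral_rpow_norm two_ne_zero ENNReal.ofNat_ne_top,
    hg.eLpNorm_eq_integral_rpow_norm two_ne_zero ENNReal.ofNat_ne_top]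
  refine ENNReal.ofReal_le_ofReal (Real.rpow_le_rpow (by positivity) ?_ (by positivity))
  simpa using h

/-- `L²` comparison of weak solutions. -/
theorem WeakSol.eLpNorm_le (hΩ : IsOpen Ω) (hΩb : Bornology.IsBounded Ω)
    (h : Exponents N p s) (hm : 0 ≤ m) (hmp : m + 1 ≤ p) (hδ : 0 ≤ δ) (hδm : δ ≤ m)
    (hlam : 0 < lam) {g₁ g₂ u₁ u₂ : Euc N → ℝ} (hg₁ : MemLp g₁ 2 (volume.restrict Ω))
    (hg₂ : MemLp g₂ 2 (volume.restrict Ω)) (hk : MemLp k 2 (volume.restrict Ω))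
    (hg₁0 : ∀ᵐ x ∂volume.restrict Ω, 0 ≤ g₁ x) (hg₂0 : ∀ᵐ x ∂volume.restrict Ω, 0 ≤ g₂ x)
    (hk0 : ∀ᵐ x ∂volume.restrict Ω, 0 ≤ k x) (h₁ : WeakSol Ω p s m δ lam g₁ k u₁)
    (h₂ : WeakSol Ω p s m δ lam g₂ k u₂) :
    eLpNorm (fun x => max (u₁ x ^ (m + 1) - u₂ x ^ (m + 1)) 0) 2 (volume.restrict Ω)
        ≤ eLpNorm (fun x => max (g₁ x - g₂ x) 0) 2 (volume.restrict Ω) := by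
  have := isFiniteMeasure_restrict hΩb
  have hu₁ := h₁.ae_pos hΩ hΩb h.dim_pos h.one_lt h.s_pos h.s_lt hm hlam hg₁0 hk0
  have hu₂ := h₂.ae_pos hΩ hΩb h.dim_pos h.one_lt h.s_pos h.s_lt hm hlam hg₂0 hk0
  have hq : ∀ {u : Euc N → ℝ}, MemLp u (ENNReal.ofReal (2 * (m + 1))) (volume.restrict Ω) →
      (∀ᵐ x ∂volume.restrict Ω, 0 < u x) →
      MemLp (fun x => u x ^ (m + 1)) 2 (volume.restrict Ω) := by
    intro u hu hpos
    refine (memLp_two_rpow (q := m + 1) (by linarith) hu).ae_eq ?_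
    filter_upwards [hpos] with x hx
    rw [abs_of_pos hx]
  have q₁ := hq h₁.memWL.memLp hu₁
  have q₂ := hq h₂.memWL.memLp hu₂
  have hB := hq ((h₁.memWL.memLp.add h₂.memWL.memLp).add (memLp_const (1:ℝ))) (by
    filter_upwards [hu₁, hu₂] with x a1 a2
    simp only [Pi.add_apply]; linarith)
  have hbound : Integrable (fun x => (u₁ x ^ (m + 1) + u₂ x ^ (m + 1) + |g₁ x| + |g₂ x| + |k x|) *
      (u₁ x + u₂ x + 1) ^ (m + 1)) (volume.restrict Ω) :=
    integrable_mul_of_two ((((q₁.add q₂).add hg₁.abs).add hg₂.abs).add hk.abs) hB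
  set ε : ℕ → ℝ := fun n => 1 / ((n:ℝ) + 1) with hεd
  have hε1 : ∀ n, ε n ≤ 1 := fun n => by
    rw [hεd]; simp only; rw [div_le_one (by positivity)]; linarith [n.cast_nonneg (α := ℝ)]
  have hle : ∀ n : ℕ, ∀ᵐ x ∂volume.restrict Ω,
      ‖comparisonIntegrand m δ (ε n) n (u₁ x) (u₂ x) (g₁ x) (g₂ x) (k x)‖ ≤
      (u₁ x ^ (m + 1) + u₂ x ^ (m + 1) + |g₁ x| + |g₂ x| + |k x|) *
      (u₁ x + u₂ x + 1) ^ (m + 1) := fun n => by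
    filter_upwards [hu₁, hu₂] with x a1 a2
    exact abs_comparisonIntegrand_le hm hδ hδm (inv_nat_succ_pos n) (hε1 n) n.cast_nonneg a1.le a2.le
  have hmeas : ∀ n : ℕ, AEStronglyMeasurable (fun x =>
      comparisonIntegrand m δ (ε n) n (u₁ x) (u₂ x) (g₁ x) (g₂ x) (k x)) (volume.restrict Ω) := by
    intro n
    have m1 := h₁.memWL.memLp.1.aemeasurable
    have m2 := h₂.memWL.memLp.1.aemeasurable
    have m3 := hg₁.1.aemeasurable
    have m4 := hg₂.1.aemeasurable
    have m5 := hk.1.aemeasurable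
    unfold comparisonIntegrand
    exact AEMeasurable.aestronglyMeasurable (by fun_prop)
  have hlim := tendsto_integral_of_dominated_convergence _ hmeas hbound hle (by
    filter_upwards [hu₁, hu₂] with x a1 a2
    exact tendsto_comparisonIntegrand hm hδm a1 a2 tendsto_inv_nat_succ tendsto_natCast_atTop_atTop)
  have hneg := le_of_tendsto' hlim fun n => h₁.integral_comparison_nonpos hΩ hΩb h hm hmp hδ hδm hlam
    hg₁ hg₂ hk hk0 h₂ hu₁ hu₂ (inv_nat_succ_pos n) n.cast_nonneg (hbound.mono' (hmeas n) (hle n))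
  have hw : MemLp (fun x => max (u₁ x ^ (m + 1) - u₂ x ^ (m + 1)) 0) 2 (volume.restrict Ω) :=
    (q₁.sub q₂).pos_part
  have hh : MemLp (fun x => max (g₁ x - g₂ x) 0) 2 (volume.restrict Ω) := (hg₁.sub hg₂).pos_part
  refine eLpNorm_two_le_of_integral_sq_le hw hh ?_
  have hwi := hw.integrable_sq
  have hhi := hh.integrable_sq
  -- With A and B the differences of the powers and of the data, (A - B) A^+ ≥ (A^+)²/2 - (B^+)²/2
  -- by Young's inequality and B ≤ B^+.
  have hge : ∫ x in Ω, (1 / 2 * max (u₁ x ^ (m + 1) - u₂ x ^ (m + 1)) 0 ^ 2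
      - 1 / 2 * max (g₁ x - g₂ x) 0 ^ 2) ≤
      ∫ x in Ω, (u₁ x ^ (m + 1) - u₂ x ^ (m + 1) - (g₁ x - g₂ x)) *
        max (u₁ x ^ (m + 1) - u₂ x ^ (m + 1)) 0 := by
    refine integral_mono ((hwi.const_mul _).sub (hhi.const_mul _))
      (integrable_mul_of_two ((q₁.sub q₂).sub (hg₁.sub hg₂)) hw) fun x => ?_
    simp only
    set A := u₁ x ^ (m + 1) - u₂ x ^ (m + 1)
    set B := g₁ x - g₂ x
    have b1 := le_max_left B 0
    rcases le_total A 0 with hA | hA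
    · rw [max_eq_right hA]
      nlinarith [sq_nonneg (max B 0)]
    · rw [max_eq_left hA]
      nlinarith [sq_nonneg (A - max B 0), mul_nonneg hA (sub_nonneg.2 b1)]
  rw [integral_sub (hwi.const_mul _) (hhi.const_mul _), integral_const_mul, integral_const_mul] at hge
  linarith

end Comparison

/-! ### Completeness, Fatou's lemma and control of lower-order terms -/

section Convergence

variable {X H : Type*} [MeasurableSpace X] {μ : Measure X} [NormedAddCommGroup H] {p q r : ℝ}

lemma lintegral_enorm_rpow_eq (hp : 0 < p) {f : X → H} (hf : MemLp f (ENNReal.ofReal p) μ) :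
    ∫⁻ x, ‖f x‖ₑ ^ p ∂μ = ENNReal.ofReal (∫ x, ‖f x‖ ^ p ∂μ) := by
  rw [ofReal_integral_eq_lintegral_ofReal (integrable_norm_rpow hp hf)
    (Eventually.of_forall fun x => by positivity)]
  refine lintegral_congr fun x => ?_
  rw [← ENNReal.ofReal_rpow_of_nonneg (norm_nonneg _) hp.le, ofReal_norm]

/-- Completeness of `L^p`, in terms of functions. -/
lemma exists_tendsto_of_cauchy [CompleteSpace H] (hp : 1 ≤ p) {f : ℕ → X → H}
    (hf : ∀ n, MemLp (f n) (ENNReal.ofReal p) μ)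
    (h : ∀ ε > 0, ∃ M : ℕ, ∀ n ≥ M, ∀ k ≥ M, ∫ x, ‖f n x - f k x‖ ^ p ∂μ ≤ ε) :
    ∃ F : X → H, MemLp F (ENNReal.ofReal p) μ ∧
      Tendsto (fun n => eLpNorm (f n - F) (ENNReal.ofReal p) μ) atTop (𝓝 0) := by
  have hp0 : 0 < p := by linarith
  have : Fact (1 ≤ ENNReal.ofReal p) := ⟨by simpa using ENNReal.ofReal_le_ofReal hp⟩
  have hc : CauchySeq fun n => (hf n).toLp := by
    rw [EMetric.cauchySeq_iff]
    intro ε hε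
    obtain ⟨ε', hε', hlt⟩ : ∃ ε' : NNReal, 0 < ε' ∧ (ε' : ENNReal) < ε := by
      obtain ⟨a, h1, h2⟩ := ENNReal.lt_iff_exists_nnreal_btwn.1 hε
      exact ⟨a, by exact_mod_cast h1, h2⟩
    obtain ⟨M, hM⟩ := h ((ε' : ℝ) ^ p) (by positivity)
    refine ⟨M, fun n hn k hk => ?_⟩
    rw [Lp.edist_toLp_toLp]
    refine lt_of_le_of_lt ?_ hlt
    rw [← ENNReal.rpow_le_rpow_iff hp0, eLpNorm_rpow_ofReal hp0,
      lintegral_enorm_rpow_eq hp0 ((hf n).sub (hf k))]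
    refine (ENNReal.ofReal_le_ofReal (hM n hn k hk)).trans (le_of_eq ?_)
    rw [← ENNReal.ofReal_rpow_of_nonneg (by positivity) hp0.le, ENNReal.ofReal_coe_nnreal]
  obtain ⟨F, hF⟩ := cauchySeq_tendsto_of_complete hc
  refine ⟨F, Lp.memLp F, ?_⟩
  have h1 := (Lp.tendsto_Lp_iff_tendsto_eLpNorm' _ _).1 hF
  refine h1.congr fun n => eLpNorm_congr_ae ?_
  filter_upwards [(hf n).coeFn_toLp] with x hx
  simp only [Pi.sub_apply, hx]

lemma exists_subseq_ae_tendsto (hp : 0 < p) {f : ℕ → X → H} {F : X → H}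
    (hf : ∀ n, MemLp (f n) (ENNReal.ofReal p) μ) (hF : MemLp F (ENNReal.ofReal p) μ)
    (h : Tendsto (fun n => eLpNorm (f n - F) (ENNReal.ofReal p) μ) atTop (𝓝 0)) :
    ∃ ns : ℕ → ℕ, StrictMono ns ∧ ∀ᵐ x ∂μ, Tendsto (fun i => f (ns i) x) atTop (𝓝 (F x)) :=
  (tendstoInMeasure_of_tendsto_eLpNorm (by simpa using hp) (fun n => (hf n).1) hF.1
    h).exists_seq_tendsto_ae

/-- Fatou's lemma for integrals of nonnegative functions. -/
lemma integral_le_of_ae_tendsto {f : ℕ → X → ℝ} {F : X → ℝ} {c : ℝ} (hf : ∀ n, Integrable (f n) μ)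
    (h0 : ∀ n x, 0 ≤ f n x) (hF0 : ∀ x, 0 ≤ F x) (hF : AEStronglyMeasurable F μ)
    (h : ∀ᵐ x ∂μ, Tendsto (fun n => f n x) atTop (𝓝 (F x))) (hc : ∀ᶠ n in atTop, ∫ x, f n x ∂μ ≤ c) :
    Integrable F μ ∧ ∫ x, F x ∂μ ≤ c := by
  have hc0 : 0 ≤ c := by
    obtain ⟨n, hn⟩ := hc.exists
    exact (integral_nonneg (h0 n)).trans hn
  have h1 : ∫⁻ x, ENNReal.ofReal (F x) ∂μ ≤ ENNReal.ofReal c := by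
    calc ∫⁻ x, ENNReal.ofReal (F x) ∂μ = ∫⁻ x, liminf (fun n => ENNReal.ofReal (f n x)) atTop ∂μ := by
          refine lintegral_congr_ae ?_
          filter_upwards [h] with x hx
          exact ((ENNReal.continuous_ofReal.tendsto _).comp hx).liminf_eq.symm
      _ ≤ liminf (fun n => ∫⁻ x, ENNReal.ofReal (f n x) ∂μ) atTop :=
          lintegral_liminf_le' fun n => (hf n).1.aemeasurable.ennreal_ofReal
      _ ≤ ENNReal.ofReal c := by
          refine liminf_le_of_frequently_le' (hc.mono fun n hn => ?_).frequently
          rw [← ofReal_integral_eq_lintegral_ofReal (hf n) (Eventually.of_forall (h0 n))]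
          exact ENNReal.ofReal_le_ofReal hn
  have hi : Integrable F μ := by
    refine ⟨hF, ?_⟩
    rw [hasFiniteIntegral_iff_ofReal (Eventually.of_forall hF0)]
    exact h1.trans_lt ENNReal.ofReal_lt_top
  refine ⟨hi, ?_⟩
  rwa [← ofReal_integral_eq_lintegral_ofReal hi (Eventually.of_forall hF0),
    ENNReal.ofReal_le_ofReal_iff hc0] at h1

/-- With θ = r/q ≤ 1, Hölder continuity of t^θ gives |a^r - b^r| ≤ |a^q - b^q|^θ. This is at most η
when the base is small, and at most a constant times the base otherwise. -/
lemma exists_abs_rpow_sub_rpow_le (hr : 0 < r) (hrq : r ≤ q) {η : ℝ} (hη : 0 < η) :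
    ∃ C : ℝ, 0 ≤ C ∧ ∀ a b : ℝ, 0 ≤ a → 0 ≤ b → |a ^ r - b ^ r| ≤ η + C * |a ^ q - b ^ q| := by
  have hq : 0 < q := by linarith
  set θ := r / q with hθ
  have hθ0 : 0 < θ := by positivity
  have hθ1 : θ ≤ 1 := (div_le_one hq).2 hrq
  have hsub : ∀ x y : ℝ, 0 ≤ x → x ≤ y → |x ^ θ - y ^ θ| ≤ |x - y| ^ θ := by
    intro x y hx hxy
    have h := Real.rpow_add_le_add_rpow hx (sub_nonneg.2 hxy) hθ0.le hθ1
    rw [add_sub_cancel] at h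
    have h2 : x ^ θ ≤ y ^ θ := by gcongr
    rw [abs_of_nonpos (by linarith), abs_of_nonpos (by linarith), neg_sub, neg_sub]
    linarith
  set η' := η ^ (1 / θ) with hη'
  have hη'0 : 0 < η' := by positivity
  refine ⟨η' ^ (θ - 1), by positivity, fun a b ha hb => ?_⟩
  have e : ∀ x : ℝ, 0 ≤ x → x ^ r = (x ^ q) ^ θ := fun x hx => by
    rw [← Real.rpow_mul hx, hθ, mul_div_cancel₀ _ hq.ne']
  have h1 : |a ^ r - b ^ r| ≤ |a ^ q - b ^ q| ^ θ := by
    rw [e a ha, e b hb]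
    rcases le_total (a ^ q) (b ^ q) with h | h
    · exact hsub _ _ (by positivity) h
    · rw [abs_sub_comm, abs_sub_comm (a ^ q)]
      exact hsub _ _ (by positivity) h
  refine h1.trans ?_
  set t := |a ^ q - b ^ q|
  have ht : 0 ≤ t := abs_nonneg _
  rcases le_total t η' with h | h
  · have : t ^ θ ≤ η := by
      calc t ^ θ ≤ η' ^ θ := by gcongr
        _ = η := by rw [hη', ← Real.rpow_mul hη.le, one_div_mul_cancel hθ0.ne', Real.rpow_one]
    have : 0 ≤ η' ^ (θ - 1) * t := by positivity
    linarith
  · have ht0 : 0 < t := hη'0.trans_le h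
    have : t ^ θ = t ^ (θ - 1) * t := by rw [← Real.rpow_add_one ht0.ne']; ring_nf
    rw [this]
    have := Real.rpow_le_rpow_of_nonpos hη'0 h (by linarith : θ - 1 ≤ 0)
    nlinarith

/-- The constant does not depend on a and b, so closeness of the q-th powers in L² controls the
source terms with no a priori bound on a and b. -/
lemma exists_integral_mul_abs_rpow_sub_le [IsFiniteMeasure μ] (hr : 0 < r) (hrq : r ≤ q) {f : X → ℝ}
    (hf : MemLp f 2 μ) (hf0 : ∀ᵐ x ∂μ, 0 ≤ f x) {ε : ℝ} (hε : 0 < ε) :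
    ∃ C : ℝ, 0 ≤ C ∧ ∀ a b : X → ℝ, (∀ x, 0 ≤ a x) → (∀ x, 0 ≤ b x) →
      MemLp a (ENNReal.ofReal (2 * q)) μ → MemLp b (ENNReal.ofReal (2 * q)) μ →
      ∫ x, f x * |a x ^ r - b x ^ r| ∂μ ≤ ε + C * ∫ x, (a x ^ q - b x ^ q) ^ 2 ∂μ := by
  have hq : 0 < q := by linarith
  have hfi : Integrable f μ := hf.integrable one_le_two
  set S := ∫ x, (f x + f x ^ 2) ∂μ with hS
  have hSI : Integrable (fun x => f x + f x ^ 2) μ := hfi.add hf.integrable_sq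
  have hS0 : 0 ≤ S := integral_nonneg_of_ae (by filter_upwards [hf0] with x hx; positivity)
  set η := ε / (S + 1) with hη
  have hη0 : 0 < η := by positivity
  obtain ⟨C, hC0, hC⟩ := exists_abs_rpow_sub_rpow_le hr hrq hη0
  -- Young's inequality C f |t| ≤ η f² + C² t² / (4η), with t = a^q - b^q; the remaining η (f + f²)
  -- integrates to at most ε by the choice of η.
  refine ⟨C ^ 2 / (4 * η), by positivity, fun a b ha hb hma hmb => ?_⟩
  have m1 : ∀ {u : X → ℝ} {θ : ℝ}, (∀ x, 0 ≤ u x) → MemLp u (ENNReal.ofReal (2 * q)) μ → 0 ≤ θ →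
      θ ≤ q → MemLp (fun x => u x ^ θ) 2 μ := fun h0 hu h1 h2 => by
    refine (memLp_two_rpow_of_le h1 h2 hq hu).ae_eq (Eventually.of_forall fun x => ?_)
    simp only [abs_of_nonneg (h0 x)]
  have hd := (m1 ha hma hq.le le_rfl).sub (m1 hb hmb hq.le le_rfl)
  have hdi : Integrable (fun x => (a x ^ q - b x ^ q) ^ 2) μ := hd.integrable_sq
  have hl := integrable_mul_of_two hf ((m1 ha hma hr.le hrq).sub (m1 hb hmb hr.le hrq)).abs
  calc ∫ x, f x * |a x ^ r - b x ^ r| ∂μ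
      ≤ ∫ x, (η * (f x + f x ^ 2) + C ^ 2 / (4 * η) * (a x ^ q - b x ^ q) ^ 2) ∂μ := by
        refine integral_mono_ae hl ((hSI.const_mul η).add (hdi.const_mul _)) ?_
        filter_upwards [hf0] with x hx
        refine (mul_le_mul_of_nonneg_left (hC _ _ (ha x) (hb x)) hx).trans ?_
        set t := a x ^ q - b x ^ q
        have h1 : C ^ 2 / (4 * η) * t ^ 2 = (C * |t| / (2 * η)) ^ 2 * η := by
          rw [div_pow, mul_pow, sq_abs]; field_simp; ring
        rw [h1]
        have h2 : 0 ≤ η * (f x - C * |t| / (2 * η)) ^ 2 := by positivity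
        have h3 : f x * (C * |t|) = 2 * η * (f x * (C * |t| / (2 * η))) := by field_simp
        nlinarith
    _ = η * S + C ^ 2 / (4 * η) * ∫ x, (a x ^ q - b x ^ q) ^ 2 ∂μ := by
        rw [integral_add (hSI.const_mul η) (hdi.const_mul _), integral_const_mul, integral_const_mul]
    _ ≤ _ := by
        gcongr
        rw [hη, div_mul_eq_mul_div, div_le_iff₀ (by positivity)]
        nlinarith

end Convergence

/-! ### Hidden convexity of the energy along power means -/

section Means

variable {N : ℕ} {Ω : Set (Euc N)} {p q s m : ℝ} {u v : Euc N → ℝ} {U V : Euc N → Euc N}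

/-- Handles the origin in the chain rule for `qmean`, where the function need not be differentiable:
both gradients vanish almost everywhere on that set, and in the zero direction a Lipschitz bound is
enough. -/
lemma dirDeriv_zero_of_lipschitz {Φ : ℝ × ℝ → ℝ} {S : Set (ℝ × ℝ)} {z : ℝ × ℝ} (hz : z ∈ S) {L : ℝ}
    (hL : ∀ a ∈ S, ∀ b ∈ S, |Φ a - Φ b| ≤ L * (|a.1 - b.1| + |a.2 - b.2|)) :
    DirDeriv Φ S z (0, 0) 0 := by
  intro σ d hs0 _ hd hS
  have h1 : Tendsto (fun n => (d n).1) atTop (𝓝 0) := (continuous_fst.tendsto _).comp hd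
  have h2 : Tendsto (fun n => (d n).2) atTop (𝓝 0) := (continuous_snd.tendsto _).comp hd
  have h3 : Tendsto (fun n => L * (|(d n).1| + |(d n).2|)) atTop (𝓝 0) := by
    simpa using (h1.abs.add h2.abs).const_mul L
  refine squeeze_zero_norm (fun n => ?_) h3
  have h := hL _ (hS n) _ hz
  simp only [Prod.fst_add, Prod.snd_add, Prod.smul_fst, Prod.smul_snd, smul_eq_mul,
    add_sub_cancel_left, abs_mul, abs_of_pos (hs0 n)] at h
  rw [Real.norm_eq_abs, abs_mul, abs_of_pos (inv_pos.2 (hs0 n)), inv_mul_le_iff₀ (hs0 n)]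
  linarith

lemma abs_qmean_sub_le_add {q : ℝ} (hq : 1 ≤ q) (a : ℝ × ℝ) (ha : a ∈ {z : ℝ × ℝ | 0 ≤ z.1 ∧ 0 ≤ z.2})
    (b : ℝ × ℝ) (hb : b ∈ {z : ℝ × ℝ | 0 ≤ z.1 ∧ 0 ≤ z.2}) :
    |qmean q a.1 a.2 - qmean q b.1 b.2| ≤ 1 * (|a.1 - b.1| + |a.2 - b.2|) := by
  have hq0 : 0 < q := by linarith
  refine (abs_qmean_sub_le hq ha.1 hb.1 ha.2 hb.2).trans ?_
  set x := |a.1 - b.1|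
  set y := |a.2 - b.2|
  have hx : 0 ≤ x := abs_nonneg _
  have hy : 0 ≤ y := abs_nonneg _
  have h := qmean_mono hq0 hx hy (le_add_of_nonneg_right hy) (le_add_of_nonneg_left hx)
  refine h.trans (le_of_eq ?_)
  rw [qmean, add_self_div_two, ← Real.rpow_mul (by positivity), mul_one_div_cancel hq0.ne',
    Real.rpow_one, one_mul]

lemma qmean_dirDeriv (hq : 1 ≤ q) {S : Set (ℝ × ℝ)} {a c : ℝ} (ha : 0 ≤ a) (hc : 0 ≤ c)
    (hM : 0 < qmean q a c) (η : ℝ × ℝ) :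
    DirDeriv (fun z => qmean q z.1 z.2) S (a, c) η
      (1 / 2 * (a / qmean q a c) ^ (q - 1) * η.1 + 1 / 2 * (c / qmean q a c) ^ (q - 1) * η.2) := by
  have hq0 : 0 < q := by linarith
  have hMq := qmean_rpow hq0 ha hc
  set M := qmean q a c with hMd
  have hA : 0 < (a ^ q + c ^ q) / 2 := by rw [← hMq]; positivity
  have d1 : HasFDerivAt (fun z : ℝ × ℝ => z.1 ^ q)
      ((q * a ^ (q - 1)) • ContinuousLinearMap.fst ℝ ℝ ℝ) (a, c) :=
    (hasFDerivAt_fst (p := (a, c))).rpow_const (Or.inr hq)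
  have d2 : HasFDerivAt (fun z : ℝ × ℝ => z.2 ^ q)
      ((q * c ^ (q - 1)) • ContinuousLinearMap.snd ℝ ℝ ℝ) (a, c) :=
    (hasFDerivAt_snd (p := (a, c))).rpow_const (Or.inr hq)
  have d3 := ((d1.add d2).mul_const (1 / 2 : ℝ)).rpow_const (p := 1 / q)
    (Or.inl (by simp only [Pi.add_apply]; rw [mul_one_div]; exact hA.ne'))
  have key := dirDeriv_of_hasFDerivAt (S := S) (η := η) d3
  simp only [Pi.add_apply, mul_one_div] at key
  convert key using 1
  · rfl
  simp only [add_apply, smul_apply, ContinuousLinearMap.coe_fst', ContinuousLinearMap.coe_snd',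
    smul_eq_mul]
  have e : ((a ^ q + c ^ q) / 2) ^ (1 / q - 1) = (M ^ (q - 1))⁻¹ := by
    rw [← hMq, ← Real.rpow_mul hM.le, ← Real.rpow_neg hM.le]
    congr 1
    field_simp
    ring
  rw [e, Real.div_rpow ha hM.le, Real.div_rpow hc hM.le]
  field_simp

/-- The weak gradient of `qmean q u v`. -/
noncomputable def qmeanGrad (q : ℝ) (u v : Euc N → ℝ) (U V : Euc N → Euc N) (x : Euc N) : Euc N :=
  (1 / 2 * (u x / qmean q (u x) (v x)) ^ (q - 1)) • U x +
    (1 / 2 * (v x / qmean q (u x) (v x)) ^ (q - 1)) • V x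

lemma eq_zero_of_qmean_eq_zero {a c : ℝ} (hq : 0 < q) (ha : 0 ≤ a) (hc : 0 ≤ c)
    (h : qmean q a c = 0) : a = 0 ∧ c = 0 := by
  have h1 := qmean_rpow hq ha hc
  rw [h, Real.zero_rpow hq.ne'] at h1
  have h2 := Real.rpow_nonneg ha q
  have h3 := Real.rpow_nonneg hc q
  exact ⟨(Real.rpow_eq_zero ha hq.ne').1 (by linarith), (Real.rpow_eq_zero hc hq.ne').1 (by linarith)⟩

lemma isSobolev_qmean (hp : 1 < p) (hq : 1 ≤ q) (hu : IsSobolev p u U) (hv : IsSobolev p v V)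
    (hu0 : ∀ x, 0 ≤ u x) (hv0 : ∀ x, 0 ≤ v x) :
    IsSobolev p (fun x => qmean q (u x) (v x)) (qmeanGrad q u v U V) := by
  have hq0 : 0 < q := by linarith
  set S : Set (ℝ × ℝ) := {z | 0 ≤ z.1 ∧ 0 ≤ z.2} with hSd
  have hS : ∀ x, (u x, v x) ∈ S := fun x => ⟨hu0 x, hv0 x⟩
  have hm : AEStronglyMeasurable (fun x => qmean q (u x) (v x)) volume := by
    have := hu.memLp.1.aemeasurable
    have := hv.memLp.1.aemeasurable
    unfold qmean
    exact AEMeasurable.aestronglyMeasurable (by fun_prop)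
  refine hu.comp₂ (Φ := fun z => qmean q z.1 z.2) (S := S) hp hv (Eventually.of_forall hS)
    (abs_qmean_sub_le_add hq) (memLp_of_lipschitz (Φ := fun z => qmean q z.1 z.2) (S := S)
      (Eventually.of_forall hS) ⟨le_rfl, le_rfl⟩
      (qmean_zero hq0) (abs_qmean_sub_le_add hq) hm hu.memLp hv.memLp) ?_
  filter_upwards [hu.grad_eq_zero_of_eq hp le_rfl, hv.grad_eq_zero_of_eq hp le_rfl] with x h1 h2 i
  rcases eq_or_lt_of_le (qmean_nonneg (q := q) (hu0 x) (hv0 x)) with h | h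
  · obtain ⟨a0, b0⟩ := eq_zero_of_qmean_eq_zero hq0 (hu0 x) (hv0 x) h.symm
    have := dirDeriv_zero_of_lipschitz (Φ := fun z => qmean q z.1 z.2) (hS x)
      (abs_qmean_sub_le_add hq)
    simpa [qmeanGrad, h1 a0, h2 b0] using this
  · have := qmean_dirDeriv (S := S) hq (hu0 x) (hv0 x) h (U x i, V x i)
    simpa [qmeanGrad] using this

lemma memWL_qmean (hΩ : IsOpen Ω) (hp : 1 < p) (hm : 0 ≤ m) (hu : MemWL Ω p m u) (hv : MemWL Ω p m v)
    (hu0 : ∀ x, 0 ≤ u x) (hv0 : ∀ x, 0 ≤ v x) :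
    MemWL Ω p m fun x => qmean (m + 1) (u x) (v x) := by
  have h := isSobolev_qmean hp (by linarith : 1 ≤ m + 1) hu.isSobolev hv.isSobolev hu0 hv0
  refine memWL_of_isSobolev hΩ h ?_ ?_
  · filter_upwards [hu.ae_eq_zero hΩ, hv.ae_eq_zero hΩ] with x h1 h2 hx
    rw [h1 hx, h2 hx, qmean_zero (by linarith)]
  · exact memLp_of_lipschitz (Φ := fun z => qmean (m + 1) z.1 z.2) (S := {z | 0 ≤ z.1 ∧ 0 ≤ z.2})
      (Eventually.of_forall fun x => ⟨hu0 x, hv0 x⟩) ⟨le_rfl, le_rfl⟩ (qmean_zero (by linarith))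
      (abs_qmean_sub_le_add (by linarith)) h.memLp.1.restrict hu.memLp hv.memLp

lemma energy_le_half_add (h : Exponents N p s) {w : Euc N → ℝ} {W : Euc N → Euc N}
    (hu : IsSobolev p u U) (hv : IsSobolev p v V) (hw : IsSobolev p w W)
    (h1 : ∀ᵐ x, ‖W x‖ ^ p ≤ (‖U x‖ ^ p + ‖V x‖ ^ p) / 2)
    (h2 : ∀ᵐ z ∂nlMeasure N p s, ‖incr w z‖ ^ p ≤ (‖incr u z‖ ^ p + ‖incr v z‖ ^ p) / 2) :
    energy Ω p s w ≤ (energy Ω p s u + energy Ω p s v) / 2 := by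
  rw [energy_eq hw, energy_eq hu, energy_eq hv]
  have i1 := integral_mono_ae (h.integrable_grad (Ω := Ω) hw)
    (((h.integrable_grad hu).add (h.integrable_grad hv)).div_const 2) (ae_restrict_of_ae h1)
  have i2 := integral_mono_ae (h.integrable_incr hw)
    (((h.integrable_incr hu).add (h.integrable_incr hv)).div_const 2) h2
  simp only [Pi.add_apply] at i1 i2
  rw [integral_div, integral_add (h.integrable_grad hu) (h.integrable_grad hv)] at i1
  rw [integral_div, integral_add (h.integrable_incr hu) (h.integrable_incr hv)] at i2
  linarith

lemma energy_qmean_le (h : Exponents N p s) (hq : 1 ≤ q) (hqp : q ≤ p) (hu : IsSobolev p u U)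
    (hv : IsSobolev p v V) (hu0 : ∀ x, 0 ≤ u x) (hv0 : ∀ x, 0 ≤ v x) :
    energy Ω p s (fun x => qmean q (u x) (v x)) ≤ (energy Ω p s u + energy Ω p s v) / 2 := by
  have hp := h.one_lt
  refine energy_le_half_add h hu hv (isSobolev_qmean hp hq hu hv hu0 hv0) ?_
    (Eventually.of_forall fun z =>
      qmean_incr_rpow_le hq hqp (hu0 z.1) (hu0 z.2) (hv0 z.1) (hv0 z.2))
  filter_upwards [hu.grad_eq_zero_of_eq hp le_rfl, hv.grad_eq_zero_of_eq hp le_rfl] with x h1 h2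
  rcases eq_or_lt_of_le (qmean_nonneg (q := q) (hu0 x) (hv0 x)) with h | h
  · obtain ⟨a0, b0⟩ := eq_zero_of_qmean_eq_zero (by linarith) (hu0 x) (hv0 x) h.symm
    rw [qmeanGrad, h1 a0, h2 b0]
    simp [Real.zero_rpow (by linarith : p ≠ 0)]
  · exact qmean_gradient_rpow_le hq hqp (hu0 x) (hv0 x) h _ _

lemma isSobolev_midpoint (hu : IsSobolev p u U) (hv : IsSobolev p v V) :
    IsSobolev p (fun x => 1 / 2 * (u x + v x)) (fun x => (1 / 2 : ℝ) • (U x + V x)) :=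
  (hu.add hv).const_mul (1 / 2)

/-- The gradients converge if the midpoint defects of the energies tend to zero. -/
lemma exists_integral_grad_sub_le (h : Exponents N p s) {K ε : ℝ} (hK : 0 ≤ K) (hε : 0 < ε) :
    ∃ η > 0, ∀ (u v : Euc N → ℝ) (U V : Euc N → Euc N), IsSobolev p u U → IsSobolev p v V →
      energy Ω p s u ≤ K → energy Ω p s v ≤ K →
      (energy Ω p s u + energy Ω p s v) / 2 - energy Ω p s (fun x => 1 / 2 * (u x + v x)) ≤ η →
      ∫ x in Ω, ‖U x - V x‖ ^ p ≤ ε := by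
  have hp := h.one_lt
  obtain ⟨C, hC0, hC⟩ := exists_uniform_convexity (H := Euc N) hp
    (by positivity : 0 < ε / (4 * (K + 1)))
  -- Half of ε comes from the bound K on the energies, through ε/(4(K+1)), and half from the defect
  -- times C. The nonlocal part of the defect is nonnegative and is discarded.
  refine ⟨ε / (2 * (C + 1)), by positivity, fun u v U V hu hv eu ev hd => ?_⟩
  have hw := isSobolev_midpoint hu hv
  rw [energy_eq hu] at eu hd
  rw [energy_eq hv] at ev hd
  rw [energy_eq hw] at hd
  have g1 := h.integrable_grad (Ω := Ω) hu
  have g2 := h.integrable_grad (Ω := Ω) hv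
  have g3 := h.integrable_grad (Ω := Ω) hw
  have n1 : 0 ≤ ∫ z, ‖incr u z‖ ^ p ∂nlMeasure N p s := integral_nonneg fun z => by positivity
  have n2 : 0 ≤ ∫ z, ‖incr v z‖ ^ p ∂nlMeasure N p s := integral_nonneg fun z => by positivity
  have i2 := integral_mono (h.integrable_incr hw)
    (((h.integrable_incr hu).add (h.integrable_incr hv)).div_const 2) (fun z => by
      have := midpoint_rpow_le hp (incr u z) (incr v z)
      have e : incr (fun x => 1 / 2 * (u x + v x)) z = (1 / 2 : ℝ) • (incr u z + incr v z) := by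
        simp only [incr, smul_eq_mul]; ring
      simp only [e, Pi.add_apply]
      exact this)
  simp only [Pi.add_apply] at i2
  rw [integral_div, integral_add (h.integrable_incr hu) (h.integrable_incr hv)] at i2
  have i1 := integral_mono (h.integrable_grad (Ω := Ω) (hu.sub hv))
    (((g1.add g2).const_mul (ε / (4 * (K + 1)))).add
      ((((g1.add g2).div_const 2).sub g3).const_mul C)) (fun x => hC (U x) (V x))
  have j : ∫ x in Ω, (ε / (4 * (K + 1)) * (‖U x‖ ^ p + ‖V x‖ ^ p) +
      C * ((‖U x‖ ^ p + ‖V x‖ ^ p) / 2 - ‖(1 / 2 : ℝ) • (U x + V x)‖ ^ p)) =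
      ε / (4 * (K + 1)) * ((∫ x in Ω, ‖U x‖ ^ p) + ∫ x in Ω, ‖V x‖ ^ p) +
      C * (((∫ x in Ω, ‖U x‖ ^ p) + ∫ x in Ω, ‖V x‖ ^ p) / 2 -
        ∫ x in Ω, ‖(1 / 2 : ℝ) • (U x + V x)‖ ^ p) := by
    have s1 : Integrable (fun x => ‖U x‖ ^ p + ‖V x‖ ^ p) (volume.restrict Ω) := g1.add g2
    have s2 : Integrable (fun x => (‖U x‖ ^ p + ‖V x‖ ^ p) / 2 - ‖(1 / 2 : ℝ) • (U x + V x)‖ ^ p)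
      (volume.restrict Ω) := (s1.div_const 2).sub g3
    rw [integral_add (s1.const_mul _) (s2.const_mul C), integral_const_mul,
      integral_const_mul, integral_sub (s1.div_const 2) g3, integral_div, integral_add g1 g2]
  have i1' := i1.trans (le_of_eq j)
  refine i1'.trans ?_
  set a := ∫ x in Ω, ‖U x‖ ^ p
  set b := ∫ x in Ω, ‖V x‖ ^ p
  have t1 : ε / (4 * (K + 1)) * (a + b) ≤ ε / 2 := by
    rw [div_mul_eq_mul_div, div_le_div_iff₀ (by positivity) two_pos]
    nlinarith
  have t2 : C * ((a + b) / 2 - ∫ x in Ω, ‖(1 / 2 : ℝ) • (U x + V x)‖ ^ p) ≤ ε / 2 := by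
    calc _ ≤ C * (ε / (2 * (C + 1))) := by gcongr; linarith
      _ ≤ ε / 2 := by
        rw [mul_div_assoc', div_le_div_iff₀ (by positivity) two_pos]
        nlinarith
  linarith

end Means

/-! ### Convexity and continuity of the lower-order functional -/

section LowerOrder

variable {X : Type*} [MeasurableSpace X] {μ : Measure X} {m δ : ℝ} {g k u v : X → ℝ}

/-- The part of the functional which does not involve derivatives. -/
noncomputable def lowerOrder (μ : Measure X) (m δ : ℝ) (g k u : X → ℝ) : ℝ :=
  1 / (2 * (m + 1)) * ∫ x, ‖u x‖ ^ (2 * (m + 1)) ∂μ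
    - 1 / (m + 1) * ∫ x, g x * (|u x| ^ m * u x) ∂μ
    - 1 / (δ + 1) * ∫ x, k x * (|u x| ^ δ * u x) ∂μ

/-- Conditions on the lower-order data. -/
structure Source (μ : Measure X) (m δ : ℝ) (g k : X → ℝ) : Prop where
  finite : IsFiniteMeasure μ
  m_nonneg : 0 ≤ m
  δ_nonneg : 0 ≤ δ
  δ_le : δ ≤ m
  memLp_left : MemLp g 2 μ
  memLp_right : MemLp k 2 μ
  nonneg_left : ∀ᵐ x ∂μ, 0 ≤ g x
  nonneg_right : ∀ᵐ x ∂μ, 0 ≤ k x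

lemma memLp_rpow_of_nonneg [IsFiniteMeasure μ] {q θ : ℝ} (hq : 0 < q) (h0 : ∀ x, 0 ≤ u x)
    (hu : MemLp u (ENNReal.ofReal (2 * q)) μ) (h1 : 0 ≤ θ) (h2 : θ ≤ q) :
    MemLp (fun x => u x ^ θ) 2 μ := by
  refine (memLp_two_rpow_of_le h1 h2 hq hu).ae_eq (Eventually.of_forall fun x => ?_)
  simp only [abs_of_nonneg (h0 x)]

lemma integrable_mul_abs_sub {f a b : X → ℝ} (hf : MemLp f 2 μ) (ha : MemLp a 2 μ)
    (hb : MemLp b 2 μ) : Integrable (fun x => f x * |a x - b x|) μ :=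
  integrable_mul_of_two hf (ha.sub hb).abs

lemma rpow_mul_self_of_nonneg {a θ : ℝ} (ha : 0 ≤ a) (hθ : 0 ≤ θ) : |a| ^ θ * a = a ^ (θ + 1) := by
  rw [abs_of_nonneg ha]
  rcases eq_or_lt_of_le ha with h | h
  · rw [← h, mul_zero, Real.zero_rpow (by linarith)]
  · rw [Real.rpow_add_one h.ne']

lemma Source.lowerOrder_eq (h : Source μ m δ g k) (h0 : ∀ x, 0 ≤ u x) :
    lowerOrder μ m δ g k u = 1 / (2 * (m + 1)) * ∫ x, (u x ^ (m + 1)) ^ 2 ∂μ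
      - 1 / (m + 1) * ∫ x, g x * u x ^ (m + 1) ∂μ - 1 / (δ + 1) * ∫ x, k x * u x ^ (δ + 1) ∂μ := by
  have e1 : ∫ x, ‖u x‖ ^ (2 * (m + 1)) ∂μ = ∫ x, (u x ^ (m + 1)) ^ 2 ∂μ := by
    refine integral_congr_ae (Eventually.of_forall fun x => ?_)
    simp only
    rw [Real.norm_of_nonneg (h0 x), ← Real.rpow_mul_natCast (h0 x)]
    congr 1
    push_cast; ring
  simp only [lowerOrder, e1, rpow_mul_self_of_nonneg (h0 _) h.m_nonneg,
    rpow_mul_self_of_nonneg (h0 _) h.δ_nonneg]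

/-- In the variable w = u^(m+1) the power mean is the midpoint. The first term is quadratic in w,
and the parallelogram law produces the gain; the g term is linear; the k term is minus a concave
function because δ ≤ m. -/
lemma Source.lowerOrder_qmean_le (h : Source μ m δ g k) (hu0 : ∀ x, 0 ≤ u x) (hv0 : ∀ x, 0 ≤ v x)
    (hu : MemLp u (ENNReal.ofReal (2 * (m + 1))) μ) (hv : MemLp v (ENNReal.ofReal (2 * (m + 1))) μ)
    (hw : MemLp (fun x => qmean (m + 1) (u x) (v x)) (ENNReal.ofReal (2 * (m + 1))) μ) :
    lowerOrder μ m δ g k (fun x => qmean (m + 1) (u x) (v x)) ≤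
      (lowerOrder μ m δ g k u + lowerOrder μ m δ g k v) / 2
        - 1 / (8 * (m + 1)) * ∫ x, (u x ^ (m + 1) - v x ^ (m + 1)) ^ 2 ∂μ := by
  have := h.finite
  have hm := h.m_nonneg
  have hδ := h.δ_nonneg
  have hδm := h.δ_le
  have hq : 0 < m + 1 := by linarith
  have hw0 : ∀ x, 0 ≤ qmean (m + 1) (u x) (v x) := fun x => qmean_nonneg (hu0 x) (hv0 x)
  rw [h.lowerOrder_eq hu0, h.lowerOrder_eq hv0, h.lowerOrder_eq hw0]
  have a1 := memLp_rpow_of_nonneg hq hu0 hu hq.le le_rfl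
  have a2 := memLp_rpow_of_nonneg hq hv0 hv hq.le le_rfl
  have b1 := memLp_rpow_of_nonneg hq hu0 hu (by linarith : 0 ≤ δ + 1) (by linarith)
  have b2 := memLp_rpow_of_nonneg hq hv0 hv (by linarith : 0 ≤ δ + 1) (by linarith)
  have b3 := memLp_rpow_of_nonneg hq hw0 hw (by linarith : 0 ≤ δ + 1) (by linarith)
  have e1 : ∫ x, (qmean (m + 1) (u x) (v x) ^ (m + 1)) ^ 2 ∂μ =
      ((∫ x, (u x ^ (m + 1)) ^ 2 ∂μ) + ∫ x, (v x ^ (m + 1)) ^ 2 ∂μ) / 2 -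
        (∫ x, (u x ^ (m + 1) - v x ^ (m + 1)) ^ 2 ∂μ) / 4 := by
    have s1 : Integrable (fun x => (u x ^ (m + 1)) ^ 2 + (v x ^ (m + 1)) ^ 2) μ :=
      a1.integrable_sq.add a2.integrable_sq
    have s2 : Integrable (fun x => (u x ^ (m + 1) - v x ^ (m + 1)) ^ 2) μ := (a1.sub a2).integrable_sq
    rw [← integral_add a1.integrable_sq a2.integrable_sq, ← integral_div, ← integral_div,
      ← integral_sub (s1.div_const 2) (s2.div_const 4)]
    refine integral_congr_ae (Eventually.of_forall fun x => ?_)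
    simp only [qmean_rpow hq (hu0 x) (hv0 x)]
    ring
  have e2 : ∫ x, g x * qmean (m + 1) (u x) (v x) ^ (m + 1) ∂μ =
      ((∫ x, g x * u x ^ (m + 1) ∂μ) + ∫ x, g x * v x ^ (m + 1) ∂μ) / 2 := by
    rw [← integral_add (integrable_mul_of_two h.memLp_left a1) (integrable_mul_of_two h.memLp_left a2),
      ← integral_div]
    refine integral_congr_ae (Eventually.of_forall fun x => ?_)
    simp only [qmean_rpow hq (hu0 x) (hv0 x)]
    ring
  have e3 : ((∫ x, k x * u x ^ (δ + 1) ∂μ) + ∫ x, k x * v x ^ (δ + 1) ∂μ) / 2 ≤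
      ∫ x, k x * qmean (m + 1) (u x) (v x) ^ (δ + 1) ∂μ := by
    have i1 := integrable_mul_of_two h.memLp_right b1
    have i2 := integrable_mul_of_two h.memLp_right b2
    rw [← integral_add i1 i2, ← integral_div]
    refine integral_mono_ae ((i1.add i2).div_const 2) (integrable_mul_of_two h.memLp_right b3) ?_
    filter_upwards [h.nonneg_right] with x hx
    have := mul_le_mul_of_nonneg_left (le_qmean_rpow (by linarith : 0 < δ + 1)
      (by linarith : δ + 1 ≤ m + 1) (hu0 x) (hv0 x)) hx
    linarith
  rw [e1, e2]
  have e4 := mul_le_mul_of_nonneg_left e3 (by positivity : 0 ≤ 1 / (δ + 1))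
  have e5 : 1 / (2 * (m + 1)) * ((∫ x, (u x ^ (m + 1) - v x ^ (m + 1)) ^ 2 ∂μ) / 4) =
      1 / (8 * (m + 1)) * ∫ x, (u x ^ (m + 1) - v x ^ (m + 1)) ^ 2 ∂μ := by field_simp; ring
  linarith

lemma rpow_midpoint_le {a b r : ℝ} (hr : 1 ≤ r) (ha : 0 ≤ a) (hb : 0 ≤ b) :
    (1 / 2 * (a + b)) ^ r ≤ (a ^ r + b ^ r) / 2 := by
  have h := (convexOn_rpow hr).2 (mem_Ici.2 ha) (mem_Ici.2 hb) (show (0:ℝ) ≤ 1 / 2 by norm_num)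
    (show (0:ℝ) ≤ 1 / 2 by norm_num) (by norm_num)
  simp only [smul_eq_mul] at h
  rw [mul_add]; linarith

lemma rpow_sub_abs_le_rpow_midpoint {a b r : ℝ} (hr : 0 ≤ r) (ha : 0 ≤ a) (hb : 0 ≤ b) :
    (a ^ r + b ^ r) / 2 - |a ^ r - b ^ r| ≤ (1 / 2 * (a + b)) ^ r := by
  rcases le_total a b with h | h
  · have h1 : a ^ r ≤ (1 / 2 * (a + b)) ^ r := Real.rpow_le_rpow ha (by linarith) hr
    linarith [neg_abs_le (a ^ r - b ^ r), abs_nonneg (a ^ r - b ^ r)]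
  · have h1 : b ^ r ≤ (1 / 2 * (a + b)) ^ r := Real.rpow_le_rpow hb (by linarith) hr
    linarith [le_abs_self (a ^ r - b ^ r), abs_nonneg (a ^ r - b ^ r)]

/-- Uniform convexity of the p-energy concerns ordinary midpoints, at which the source terms are not
convex. The error terms are small once the powers are close in L², by
`exists_integral_mul_abs_rpow_sub_le`. -/
lemma Source.lowerOrder_midpoint_le (h : Source μ m δ g k) (hu0 : ∀ x, 0 ≤ u x) (hv0 : ∀ x, 0 ≤ v x)
    (hu : MemLp u (ENNReal.ofReal (2 * (m + 1))) μ)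
    (hv : MemLp v (ENNReal.ofReal (2 * (m + 1))) μ) :
    lowerOrder μ m δ g k (fun x => 1 / 2 * (u x + v x)) ≤
      (lowerOrder μ m δ g k u + lowerOrder μ m δ g k v) / 2
        + (∫ x, g x * |u x ^ (m + 1) - v x ^ (m + 1)| ∂μ)
        + ∫ x, k x * |u x ^ (δ + 1) - v x ^ (δ + 1)| ∂μ := by
  have := h.finite
  have hm := h.m_nonneg
  have hδ := h.δ_nonneg
  have hδm := h.δ_le
  have hq : 0 < m + 1 := by linarith
  have hw0 : ∀ x, 0 ≤ 1 / 2 * (u x + v x) := fun x => by linarith [hu0 x, hv0 x]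
  have hw : MemLp (fun x => 1 / 2 * (u x + v x)) (ENNReal.ofReal (2 * (m + 1))) μ :=
    (hu.add hv).const_mul _
  rw [h.lowerOrder_eq hu0, h.lowerOrder_eq hv0, h.lowerOrder_eq hw0]
  have a1 := memLp_rpow_of_nonneg hq hu0 hu hq.le le_rfl
  have a2 := memLp_rpow_of_nonneg hq hv0 hv hq.le le_rfl
  have a3 := memLp_rpow_of_nonneg hq hw0 hw hq.le le_rfl
  have b1 := memLp_rpow_of_nonneg hq hu0 hu (by linarith : 0 ≤ δ + 1) (by linarith)
  have b2 := memLp_rpow_of_nonneg hq hv0 hv (by linarith : 0 ≤ δ + 1) (by linarith)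
  have b3 := memLp_rpow_of_nonneg hq hw0 hw (by linarith : 0 ≤ δ + 1) (by linarith)
  have e1 : ∫ x, ((1 / 2 * (u x + v x)) ^ (m + 1)) ^ 2 ∂μ ≤
      ((∫ x, (u x ^ (m + 1)) ^ 2 ∂μ) + ∫ x, (v x ^ (m + 1)) ^ 2 ∂μ) / 2 := by
    rw [← integral_add a1.integrable_sq a2.integrable_sq, ← integral_div]
    refine integral_mono a3.integrable_sq ((a1.integrable_sq.add a2.integrable_sq).div_const 2)
      fun x => ?_
    have h1 := rpow_midpoint_le (by linarith : 1 ≤ m + 1) (hu0 x) (hv0 x)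
    have h2 : 0 ≤ (1 / 2 * (u x + v x)) ^ (m + 1) := Real.rpow_nonneg (hw0 x) _
    have h3 := pow_le_pow_left₀ h2 h1 2
    simp only
    nlinarith [sq_nonneg (u x ^ (m + 1) - v x ^ (m + 1))]
  have key : ∀ {f : X → ℝ} {r : ℝ}, 0 ≤ r → MemLp f 2 μ → (∀ᵐ x ∂μ, 0 ≤ f x) →
      MemLp (fun x => u x ^ r) 2 μ → MemLp (fun x => v x ^ r) 2 μ →
      MemLp (fun x => (1 / 2 * (u x + v x)) ^ r) 2 μ →
      ((∫ x, f x * u x ^ r ∂μ) + ∫ x, f x * v x ^ r ∂μ) / 2 - ∫ x, f x * |u x ^ r - v x ^ r| ∂μ ≤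
        ∫ x, f x * (1 / 2 * (u x + v x)) ^ r ∂μ := by
    intro f r hr hf hf0 c1 c2 c3
    have i1 := integrable_mul_of_two hf c1
    have i2 := integrable_mul_of_two hf c2
    have i3 := integrable_mul_abs_sub hf c1 c2
    have i4 : Integrable (fun x => (f x * u x ^ r + f x * v x ^ r) / 2) μ := (i1.add i2).div_const 2
    rw [← integral_add i1 i2, ← integral_div, ← integral_sub i4 i3]
    refine integral_mono_ae (i4.sub i3) (integrable_mul_of_two hf c3) ?_
    filter_upwards [hf0] with x hx
    have := mul_le_mul_of_nonneg_left (rpow_sub_abs_le_rpow_midpoint hr (hu0 x) (hv0 x)) hx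
    linarith
  have e2 := key hq.le h.memLp_left h.nonneg_left a1 a2 a3
  have e3 := key (by linarith : 0 ≤ δ + 1) h.memLp_right h.nonneg_right b1 b2 b3
  have f1 := mul_le_mul_of_nonneg_left e1 (by positivity : 0 ≤ 1 / (2 * (m + 1)))
  have f2 := mul_le_mul_of_nonneg_left e2 (by positivity : 0 ≤ 1 / (m + 1))
  have f3 := mul_le_mul_of_nonneg_left e3 (by positivity : 0 ≤ 1 / (δ + 1))
  have n1 : 0 ≤ ∫ x, g x * |u x ^ (m + 1) - v x ^ (m + 1)| ∂μ := integral_nonneg_of_ae (by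
    filter_upwards [h.nonneg_left] with x hx; positivity)
  have n2 : 0 ≤ ∫ x, k x * |u x ^ (δ + 1) - v x ^ (δ + 1)| ∂μ := integral_nonneg_of_ae (by
    filter_upwards [h.nonneg_right] with x hx; positivity)
  have l1 : 1 / (m + 1) ≤ 1 := (div_le_one hq).2 (by linarith)
  have l2 : 1 / (δ + 1) ≤ 1 := (div_le_one (by linarith)).2 (by linarith)
  have f4 := mul_le_mul_of_nonneg_right l1 n1
  have f5 := mul_le_mul_of_nonneg_right l2 n2
  linarith

/-- Both source terms are at most linear in w = u^(m+1), up to a constant, and are absorbed by the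
quadratic term on completing squares. -/
lemma Source.exists_le_lowerOrder (h : Source μ m δ g k) : ∃ C : ℝ, ∀ u : X → ℝ, (∀ x, 0 ≤ u x) →
    MemLp u (ENNReal.ofReal (2 * (m + 1))) μ → -C ≤ lowerOrder μ m δ g k u := by
  have := h.finite
  have hm := h.m_nonneg
  have hδ := h.δ_nonneg
  have hδm := h.δ_le
  have hq : 0 < m + 1 := by linarith
  have ik := h.memLp_right.integrable one_le_two
  refine ⟨∫ x, (g x ^ 2 / (m + 1) + (m + 1) * k x ^ 2 + k x) ∂μ, fun u h0 hu => ?_⟩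
  rw [h.lowerOrder_eq h0]
  have a1 := memLp_rpow_of_nonneg hq h0 hu hq.le le_rfl
  have b1 := memLp_rpow_of_nonneg hq h0 hu (by linarith : 0 ≤ δ + 1) (by linarith)
  have i1 := a1.integrable_sq.const_mul (1 / (2 * (m + 1)))
  have i2 := (integrable_mul_of_two h.memLp_left a1).const_mul (1 / (m + 1))
  have i3 := (integrable_mul_of_two h.memLp_right b1).const_mul (1 / (δ + 1))
  have i4 : Integrable (fun x => g x ^ 2 / (m + 1) + (m + 1) * k x ^ 2 + k x) μ :=
    ((h.memLp_left.integrable_sq.div_const _).add (h.memLp_right.integrable_sq.const_mul _)).add ik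
  have i5 : Integrable (fun x => 1 / (2 * (m + 1)) * (u x ^ (m + 1)) ^ 2 -
    1 / (m + 1) * (g x * u x ^ (m + 1))) μ := i1.sub i2
  rw [← integral_const_mul, ← integral_const_mul, ← integral_const_mul, ← integral_sub i1 i2,
    ← integral_sub i5 i3, ← integral_neg]
  refine integral_mono_ae i4.neg (i5.sub i3) ?_
  filter_upwards [h.nonneg_left, h.nonneg_right] with x hg hk
  have h1 := rpow_le_one_add_rpow (by linarith : 0 ≤ δ + 1) (by linarith : δ + 1 ≤ m + 1) (h0 x)
  have hw : 0 ≤ u x ^ (m + 1) := Real.rpow_nonneg (h0 x) _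
  set w := u x ^ (m + 1)
  have l2 : 1 / (δ + 1) ≤ 1 := (div_le_one (by linarith)).2 (by linarith)
  have h2 : 1 / (δ + 1) * (k x * u x ^ (δ + 1)) ≤ k x * (1 + w) := by
    have : 0 ≤ u x ^ (δ + 1) := Real.rpow_nonneg (h0 x) _
    calc _ ≤ 1 * (k x * u x ^ (δ + 1)) := by gcongr
      _ ≤ _ := by rw [one_mul]; gcongr
  have h3 : 1 / (2 * (m + 1)) * w ^ 2 - 1 / (m + 1) * (g x * w) - k x * w +
      (g x ^ 2 / (m + 1) + (m + 1) * k x ^ 2) =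
      ((w / 2 - g x) ^ 2 + (w / 2 - (m + 1) * k x) ^ 2) / (m + 1) := by field_simp; ring
  have h4 : 0 ≤ ((w / 2 - g x) ^ 2 + (w / 2 - (m + 1) * k x) ^ 2) / (m + 1) := by positivity
  linarith

lemma Source.lowerOrder_le_add (h : Source μ m δ g k) (hu0 : ∀ x, 0 ≤ u x) (hv0 : ∀ x, 0 ≤ v x)
    (hu : MemLp u (ENNReal.ofReal (2 * (m + 1))) μ)
    (hv : MemLp v (ENNReal.ofReal (2 * (m + 1))) μ) :
    lowerOrder μ m δ g k u ≤ lowerOrder μ m δ g k v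
        + (∫ x, (u x ^ (m + 1) + g x) * |u x ^ (m + 1) - v x ^ (m + 1)| ∂μ)
        + ∫ x, k x * |u x ^ (δ + 1) - v x ^ (δ + 1)| ∂μ := by
  have := h.finite
  have hm := h.m_nonneg
  have hδ := h.δ_nonneg
  have hδm := h.δ_le
  have hq : 0 < m + 1 := by linarith
  rw [h.lowerOrder_eq hu0, h.lowerOrder_eq hv0]
  have a1 := memLp_rpow_of_nonneg hq hu0 hu hq.le le_rfl
  have a2 := memLp_rpow_of_nonneg hq hv0 hv hq.le le_rfl
  have b1 := memLp_rpow_of_nonneg hq hu0 hu (by linarith : 0 ≤ δ + 1) (by linarith)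
  have b2 := memLp_rpow_of_nonneg hq hv0 hv (by linarith : 0 ≤ δ + 1) (by linarith)
  have key : ∀ {f : X → ℝ} {r : ℝ}, MemLp f 2 μ → (∀ᵐ x ∂μ, 0 ≤ f x) →
      MemLp (fun x => u x ^ r) 2 μ → MemLp (fun x => v x ^ r) 2 μ →
      (∫ x, f x * v x ^ r ∂μ) - ∫ x, f x * |u x ^ r - v x ^ r| ∂μ ≤ ∫ x, f x * u x ^ r ∂μ := by
    intro f r hf hf0 c1 c2
    have i1 := integrable_mul_of_two hf c1
    have i2 := integrable_mul_of_two hf c2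
    have i3 := integrable_mul_abs_sub hf c1 c2
    rw [← integral_sub i2 i3]
    refine integral_mono_ae (i2.sub i3) i1 ?_
    filter_upwards [hf0] with x hx
    have := mul_le_mul_of_nonneg_left (neg_abs_le (u x ^ r - v x ^ r)) hx
    linarith
  have e2 := key h.memLp_left h.nonneg_left a1 a2
  have e3 := key h.memLp_right h.nonneg_right b1 b2
  have i1 := integrable_mul_abs_sub a1 a1 a2
  have i2 := integrable_mul_abs_sub h.memLp_left a1 a2
  have e1 : 1 / 2 * (∫ x, (u x ^ (m + 1)) ^ 2 ∂μ) ≤ 1 / 2 * (∫ x, (v x ^ (m + 1)) ^ 2 ∂μ) +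
      ∫ x, u x ^ (m + 1) * |u x ^ (m + 1) - v x ^ (m + 1)| ∂μ := by
    have j := a2.integrable_sq.const_mul (1 / 2)
    rw [← integral_const_mul, ← integral_const_mul, ← integral_add j i1]
    refine integral_mono (a1.integrable_sq.const_mul (1 / 2)) (j.add i1) fun x => ?_
    have hw : 0 ≤ u x ^ (m + 1) := Real.rpow_nonneg (hu0 x) _
    have := mul_le_mul_of_nonneg_left (le_abs_self (u x ^ (m + 1) - v x ^ (m + 1))) hw
    simp only
    nlinarith [sq_nonneg (u x ^ (m + 1) - v x ^ (m + 1))]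
  have e4 : ∫ x, (u x ^ (m + 1) + g x) * |u x ^ (m + 1) - v x ^ (m + 1)| ∂μ =
      (∫ x, u x ^ (m + 1) * |u x ^ (m + 1) - v x ^ (m + 1)| ∂μ) +
        ∫ x, g x * |u x ^ (m + 1) - v x ^ (m + 1)| ∂μ := by
    rw [← integral_add i1 i2]
    exact integral_congr_ae (Eventually.of_forall fun x => by ring)
  rw [e4]
  have f1 := mul_le_mul_of_nonneg_left e1 (by positivity : 0 ≤ 1 / (m + 1))
  have f2 := mul_le_mul_of_nonneg_left e2 (by positivity : 0 ≤ 1 / (m + 1))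
  have f3 := mul_le_mul_of_nonneg_left e3 (by positivity : 0 ≤ 1 / (δ + 1))
  have n0 : 0 ≤ ∫ x, u x ^ (m + 1) * |u x ^ (m + 1) - v x ^ (m + 1)| ∂μ := integral_nonneg fun x => by
    have hw : 0 ≤ u x ^ (m + 1) := Real.rpow_nonneg (hu0 x) _
    positivity
  have n1 : 0 ≤ ∫ x, g x * |u x ^ (m + 1) - v x ^ (m + 1)| ∂μ := integral_nonneg_of_ae (by
    filter_upwards [h.nonneg_left] with x hx; positivity)
  have n2 : 0 ≤ ∫ x, k x * |u x ^ (δ + 1) - v x ^ (δ + 1)| ∂μ := integral_nonneg_of_ae (by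
    filter_upwards [h.nonneg_right] with x hx; positivity)
  have l1 : 1 / (m + 1) ≤ 1 := (div_le_one hq).2 (by linarith)
  have l2 : 1 / (δ + 1) ≤ 1 := (div_le_one (by linarith)).2 (by linarith)
  have f0 := mul_le_mul_of_nonneg_right l1 n0
  have f4 := mul_le_mul_of_nonneg_right l1 n1
  have f5 := mul_le_mul_of_nonneg_right l2 n2
  have z : ∀ t : ℝ, 1 / (2 * (m + 1)) * t = 1 / (m + 1) * (1 / 2 * t) := fun t => by field_simp
  rw [z, z]
  linarith

/-- With g, k ≥ 0 the odd powers in `lowerOrder` make negative values unprofitable. A minimizer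
among nonnegative functions is thus a minimizer without sign constraint, and two-sided variations
are allowed. -/
lemma Source.lowerOrder_posPart_le (h : Source μ m δ g k)
    (hu : MemLp u (ENNReal.ofReal (2 * (m + 1))) μ) :
    lowerOrder μ m δ g k (fun x => max (u x) 0) ≤ lowerOrder μ m δ g k u := by
  have := h.finite
  have hm := h.m_nonneg
  have hδ := h.δ_nonneg
  have hδm := h.δ_le
  have hq : 0 < m + 1 := by linarith
  have hu' : MemLp (fun x => max (u x) 0) (ENNReal.ofReal (2 * (m + 1))) μ := hu.pos_part
  have habs : ∀ x, ‖max (u x) 0‖ ≤ ‖u x‖ := fun x => by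
    rw [Real.norm_of_nonneg (le_max_right _ _)]
    exact max_le (le_abs_self _) (norm_nonneg _)
  have e1 : ∫ x, ‖max (u x) 0‖ ^ (2 * (m + 1)) ∂μ ≤ ∫ x, ‖u x‖ ^ (2 * (m + 1)) ∂μ :=
    integral_mono (integrable_norm_rpow (by linarith) hu') (integrable_norm_rpow (by linarith) hu)
      fun x => Real.rpow_le_rpow (norm_nonneg _) (habs x) (by linarith)
  have key : ∀ {f : X → ℝ} {θ : ℝ}, 0 ≤ θ → θ ≤ m → MemLp f 2 μ → (∀ᵐ x ∂μ, 0 ≤ f x) →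
      ∫ x, f x * (|u x| ^ θ * u x) ∂μ ≤ ∫ x, f x * (|max (u x) 0| ^ θ * max (u x) 0) ∂μ := by
    intro f θ h0 h1 hf hf0
    refine integral_mono_ae
      (integrable_mul_of_two hf (memLp_two_rpow_mul (q := m + 1) h0 (by linarith) hu hu))
      (integrable_mul_of_two hf (memLp_two_rpow_mul (q := m + 1) h0 (by linarith) hu' hu')) ?_
    filter_upwards [hf0] with x hx
    refine mul_le_mul_of_nonneg_left ?_ hx
    rcases le_total (u x) 0 with hux | hux
    · rw [max_eq_right hux, mul_zero]
      exact mul_nonpos_of_nonneg_of_nonpos (by positivity) hux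
    · rw [max_eq_left hux]
  have e2 := key hm le_rfl h.memLp_left h.nonneg_left
  have e3 := key hδ hδm h.memLp_right h.nonneg_right
  unfold lowerOrder
  gcongr

end LowerOrder

/-! ### Existence of a minimizer -/

section Minimizer

variable {N : ℕ} {Ω : Set (Euc N)} {p s m δ lam : ℝ} {g k u v : Euc N → ℝ} {U V : Euc N → Euc N}

lemma IsSobolev.integral_grad_eq (hp : 1 < p) (hu : IsSobolev p u U)
    (h0 : ∀ᵐ x, x ∉ Ω → u x = 0) : ∫ x, ‖U x‖ ^ p = ∫ x in Ω, ‖U x‖ ^ p := by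
  refine (setIntegral_eq_integral_of_ae_compl_eq_zero ?_).symm
  filter_upwards [h0, hu.grad_eq_zero_of_eq hp le_rfl] with x h1 h2 hx
  rw [h2 (h1 hx), norm_zero, Real.zero_rpow (by linarith)]

lemma exists_poincare (hΩb : Bornology.IsBounded Ω) (hp : 1 < p) (hN : 0 < N) :
    ∃ C : ℝ, 0 < C ∧ ∀ (u : Euc N → ℝ) (U : Euc N → Euc N), IsSobolev p u U →
      (∀ᵐ x, x ∉ Ω → u x = 0) → ∫ x, ‖u x‖ ^ p ≤ C * ∫ x in Ω, ‖U x‖ ^ p := by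
  have hp0 : 0 < p := by linarith
  obtain ⟨R, hR0, hR⟩ := hΩb.exists_pos_norm_le
  refine ⟨(3 * R) ^ p, by positivity, fun u U hu h0 => ?_⟩
  have h := hu.poincare hp hN hR0 (by
    filter_upwards [h0] with x hx hlt
    exact hx fun hxΩ => absurd (hR x hxΩ) (not_le.2 hlt))
  rw [lintegral_enorm_rpow_eq hp0 hu.memLp, lintegral_enorm_rpow_eq hp0 hu.memLp_grad,
    ENNReal.ofReal_rpow_of_nonneg (by positivity) hp0.le, ← ENNReal.ofReal_mul (by positivity),
    hu.integral_grad_eq hp h0] at h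
  exact (ENNReal.ofReal_le_ofReal_iff (mul_nonneg (by positivity)
    (integral_nonneg fun x => by positivity))).1 h

/-- Sequences whose midpoint defects of the energy vanish have limits. -/
lemma exists_limit (hΩ : IsOpen Ω) (hΩb : Bornology.IsBounded Ω) (h : Exponents N p s) {B : ℝ}
    (hB : 0 ≤ B) {f : ℕ → Euc N → ℝ} (hf : ∀ n, MemWL Ω p m (f n)) (h0 : ∀ n x, 0 ≤ f n x)
    (hE : ∀ n, energy Ω p s (f n) ≤ B)
    (hd : ∀ η > 0, ∃ M : ℕ, ∀ n ≥ M, ∀ k ≥ M, (energy Ω p s (f n) + energy Ω p s (f k)) / 2 -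
      energy Ω p s (fun x => 1 / 2 * (f n x + f k x)) ≤ η) :
    ∃ (u : Euc N → ℝ) (U : Euc N → Euc N) (ns : ℕ → ℕ), IsSobolev p u U ∧ (∀ x, 0 ≤ u x) ∧
      (∀ᵐ x, x ∉ Ω → u x = 0) ∧ StrictMono ns ∧
      (∀ᵐ x, Tendsto (fun i => f (ns i) x) atTop (𝓝 (u x))) ∧
      ∀ᵐ x, Tendsto (fun i => weakGradient (f (ns i)) x) atTop (𝓝 (U x)) := by
  have hp := h.one_lt
  have hp0 : 0 < p := by linarith
  have hS := fun n => (hf n).isSobolev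
  have hz : ∀ n k, ∀ᵐ x, x ∉ Ω → f n x - f k x = 0 := fun n k => by
    filter_upwards [(hf n).ae_eq_zero hΩ, (hf k).ae_eq_zero hΩ] with x h1 h2 hx
    rw [h1 hx, h2 hx, sub_zero]
  have hG : ∀ ε > 0, ∃ M : ℕ, ∀ n ≥ M, ∀ k ≥ M,
      ∫ x in Ω, ‖weakGradient (f n) x - weakGradient (f k) x‖ ^ p ≤ ε := by
    intro ε hε
    obtain ⟨η, hη, H⟩ := exists_integral_grad_sub_le (Ω := Ω) h hB hε
    obtain ⟨M, hM⟩ := hd η hη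
    exact ⟨M, fun n hn k hk => H _ _ _ _ (hS n) (hS k) (hE n) (hE k) (hM n hn k hk)⟩
  obtain ⟨C, hC0, hC⟩ := exists_poincare hΩb hp h.dim_pos
  obtain ⟨U, hU, hUt⟩ := exists_tendsto_of_cauchy (f := fun n => weakGradient (f n)) hp.le
    (fun n => (hS n).memLp_grad) (fun ε hε => by
      obtain ⟨M, hM⟩ := hG ε hε
      refine ⟨M, fun n hn k hk => ?_⟩
      rw [((hS n).sub (hS k)).integral_grad_eq hp (hz n k)]
      exact hM n hn k hk)
  obtain ⟨u, hu, hut⟩ := exists_tendsto_of_cauchy (f := f) hp.le (fun n => (hS n).memLp)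
    (fun ε hε => by
      obtain ⟨M, hM⟩ := hG (ε / C) (by positivity)
      refine ⟨M, fun n hn k hk => (hC _ _ ((hS n).sub (hS k)) (hz n k)).trans ?_⟩
      rw [← le_div_iff₀' hC0]
      exact hM n hn k hk)
  have hSu := IsSobolev.of_tendsto hp hS hu hU hut hUt
  obtain ⟨n1, hn1, ha1⟩ := exists_subseq_ae_tendsto hp0 (fun n => (hS n).memLp) hu hut
  obtain ⟨n2, hn2, ha2⟩ := exists_subseq_ae_tendsto hp0 (f := fun n => weakGradient (f (n1 n)))
    (fun n => (hS (n1 n)).memLp_grad) hU (hUt.comp hn1.tendsto_atTop)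
  have hu0 : ∀ᵐ x, 0 ≤ u x := by
    filter_upwards [ha1] with x hx
    exact ge_of_tendsto' hx fun i => h0 _ x
  have hmax : u =ᵐ[volume] fun x => max (u x) 0 := by
    filter_upwards [hu0] with x hx
    rw [max_eq_left hx]
  refine ⟨fun x => max (u x) 0, U, n1 ∘ n2, hSu.congr hmax (EventuallyEq.refl _ _),
    fun x => le_max_right _ _, ?_, hn1.comp hn2, ?_, ha2⟩
  · filter_upwards [ha1, ae_all_iff.2 fun n => (hf n).ae_eq_zero hΩ] with x h1 h2 hx
    have : u x = 0 := tendsto_nhds_unique h1 (by simp only [h2 _ hx]; exact tendsto_const_nhds)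
    rw [this, max_self]
  · filter_upwards [ha1, hmax] with x h1 h2
    rw [← h2]
    exact h1.comp hn2.tendsto_atTop

/-- Lower semicontinuity of the energy. -/
lemma energy_le_of_tendsto (h : Exponents N p s) {f : ℕ → Euc N → ℝ} (hf : ∀ n, MemWL Ω p m (f n))
    (hu : IsSobolev p u U) (h1 : ∀ᵐ x, Tendsto (fun i => f i x) atTop (𝓝 (u x)))
    (h2 : ∀ᵐ x, Tendsto (fun i => weakGradient (f i) x) atTop (𝓝 (U x))) {c : ℝ}
    (hc : ∀ᶠ n in atTop, energy Ω p s (f n) ≤ c) : energy Ω p s u ≤ c := by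
  have hp0 : 0 < p := by linarith [h.one_lt]
  have hS := fun n => (hf n).isSobolev
  set A : ℕ → ℝ := fun n => ∫ x in Ω, ‖weakGradient (f n) x‖ ^ p with hA
  set B : ℕ → ℝ := fun n => ∫ z, ‖incr (f n) z‖ ^ p ∂nlMeasure N p s with hBd
  have hAB : ∀ n, energy Ω p s (f n) = A n + B n := fun n => energy_eq (hS n)
  have hA0 : ∀ n, 0 ≤ A n := fun n => integral_nonneg fun x => by positivity
  have hB0 : ∀ n, 0 ≤ B n := fun n => integral_nonneg fun x => by positivity
  -- Along a subsequence the local energies converge to some a, so the nonlocal ones are eventually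
  -- at most c - a + η/2, and Fatou applies to each part separately.
  have hAI : ∃ᶠ n in atTop, A n ∈ Icc 0 c := (hc.mono fun n hn => by
    rw [hAB] at hn; exact ⟨hA0 n, by linarith [hB0 n]⟩).frequently
  obtain ⟨a, -, ns, hns, ha⟩ := isCompact_Icc.tendsto_subseq' hAI
  have hcont : Continuous fun t : ℝ => t ^ p := Real.continuous_rpow_const hp0.le
  have hcc := hns.tendsto_atTop.eventually hc
  rw [energy_eq hu]
  refine le_of_forall_pos_le_add fun η hη => ?_
  have e1 := (integral_le_of_ae_tendsto (c := a + η / 2) (fun n => h.integrable_grad (Ω := Ω) (hS (ns n)))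
    (fun n x => by positivity) (fun x => by positivity) (h.integrable_grad (Ω := Ω) hu).1 (by
      refine ae_restrict_of_ae ?_
      filter_upwards [h2] with x hx
      exact (hcont.tendsto _).comp ((hx.comp hns.tendsto_atTop).norm)) (by
      filter_upwards [ha.eventually (gt_mem_nhds (by linarith : a < a + η / 2))] with n hn
      exact hn.le)).2
  have e2 := (integral_le_of_ae_tendsto (c := c - a + η / 2) (fun n => h.integrable_incr (hS (ns n)))
    (fun n x => by positivity) (fun x => by positivity) (h.integrable_incr hu).1 (by
      filter_upwards [ae_nlMeasure_fst h1, ae_nlMeasure_snd h1] with z hz1 hz2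
      exact (hcont.tendsto _).comp
        (((hz1.comp hns.tendsto_atTop).sub (hz2.comp hns.tendsto_atTop)).norm)) (by
      filter_upwards [ha.eventually (lt_mem_nhds (by linarith : a - η / 2 < a)), hcc] with n hn hn2
      rw [hAB] at hn2
      have : a - η / 2 < A (ns n) := hn
      change B (ns n) ≤ _
      linarith)).2
  linarith

/-- The functional whose critical points are the weak solutions. -/
noncomputable def functional (Ω : Set (Euc N)) (p s m δ lam : ℝ) (g k u : Euc N → ℝ) : ℝ :=
  lowerOrder (volume.restrict Ω) m δ g k u + lam / p * energy Ω p s u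

lemma energy_nonneg (u : Euc N → ℝ) : 0 ≤ energy Ω p s u :=
  add_nonneg (integral_nonneg fun x => by positivity) (integral_nonneg fun x => by positivity)

lemma memWL_zero (hΩ : IsOpen Ω) : MemWL Ω p m fun _ => 0 :=
  memWL_bump hΩ contDiff_const (HasCompactSupport.zero) fun _ _ => rfl

lemma exists_minimizing_sequence (hΩ : IsOpen Ω) (h : Exponents N p s)
    (hS : Source (volume.restrict Ω) m δ g k) (hlam : 0 < lam) :
    ∃ (I : ℝ) (f : ℕ → Euc N → ℝ),
      (∀ v, MemWL Ω p m v → (∀ x, 0 ≤ v x) → I ≤ functional Ω p s m δ lam g k v) ∧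
      ∀ n, MemWL Ω p m (f n) ∧ (∀ x, 0 ≤ f n x) ∧
        functional Ω p s m δ lam g k (f n) ≤ I + 1 / ((n : ℝ) + 1) := by
  have hp0 : 0 < p := by linarith [h.one_lt]
  obtain ⟨C, hC⟩ := hS.exists_le_lowerOrder
  set T : Set ℝ := (functional Ω p s m δ lam g k) '' {v | MemWL Ω p m v ∧ ∀ x, 0 ≤ v x} with hT
  have hne : T.Nonempty := ⟨_, _, ⟨memWL_zero hΩ, fun _ => le_rfl⟩, rfl⟩
  have hbd : BddBelow T := by
    refine ⟨-C, ?_⟩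
    rintro _ ⟨v, ⟨hv, hv0⟩, rfl⟩
    have h1 := hC v hv0 hv.memLp
    have h2 : 0 ≤ lam / p * energy Ω p s v := mul_nonneg (by positivity) (energy_nonneg v)
    unfold functional; linarith
  have hex : ∀ n : ℕ, ∃ v, MemWL Ω p m v ∧ (∀ x, 0 ≤ v x) ∧
      functional Ω p s m δ lam g k v ≤ sInf T + 1 / ((n : ℝ) + 1) := fun n => by
    obtain ⟨_, ⟨v, ⟨hv, hv0⟩, rfl⟩, hlt⟩ := exists_lt_of_csInf_lt hne
      (lt_add_of_pos_right (sInf T) (inv_nat_succ_pos n))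
    exact ⟨v, hv, hv0, hlt.le⟩
  choose f hf using hex
  exact ⟨sInf T, f, fun v hv hv0 => csInf_le hbd ⟨v, ⟨hv, hv0⟩, rfl⟩, hf⟩

/-- The functional attains its infimum over nonnegative functions. -/
theorem exists_minimizer (hΩ : IsOpen Ω) (hΩb : Bornology.IsBounded Ω) (h : Exponents N p s)
    (hS : Source (volume.restrict Ω) m δ g k) (hmp : m + 1 ≤ p) (hlam : 0 < lam) :
    ∃ u, MemWL Ω p m u ∧ (∀ x, 0 ≤ u x) ∧ ∀ v, MemWL Ω p m v → (∀ x, 0 ≤ v x) →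
      functional Ω p s m δ lam g k u ≤ functional Ω p s m δ lam g k v := by
  have := hS.finite
  have hp := h.one_lt
  have hp0 : 0 < p := by linarith
  have hm := hS.m_nonneg
  have hδ := hS.δ_nonneg
  have hδm := hS.δ_le
  have hq : 0 < m + 1 := by linarith
  have hlp : 0 < lam / p := by positivity
  obtain ⟨I, f, hI, hf⟩ := exists_minimizing_sequence hΩ h hS hlam
  obtain ⟨C₀, hC₀⟩ := hS.exists_le_lowerOrder
  set Z := lowerOrder (volume.restrict Ω) m δ g k with hZ
  set E := energy Ω p s with hE
  have hJ : ∀ v, functional Ω p s m δ lam g k v = Z v + lam / p * E v := fun v => rfl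
  have hsmall : ∀ ε > 0, ∃ M : ℕ, ∀ n ≥ M, functional Ω p s m δ lam g k (f n) ≤ I + ε := by
    intro ε hε
    obtain ⟨M, hM⟩ := (tendsto_inv_nat_succ.eventually (gt_mem_nhds hε)).exists_forall_of_atTop
    exact ⟨M, fun n hn => by linarith [(hf n).2.2, hM n hn]⟩
  -- The power mean of two almost minimizers is a competitor. Its value cannot fall below I, so the
  -- strong convexity gain bounds the L² distance of the powers.
  have hw : ∀ ε > 0, ∃ M : ℕ, ∀ n ≥ M, ∀ k ≥ M,
      ∫ x in Ω, (f n x ^ (m + 1) - f k x ^ (m + 1)) ^ 2 ≤ ε := by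
    intro ε hε
    obtain ⟨M, hM⟩ := hsmall (ε / (8 * (m + 1))) (by positivity)
    refine ⟨M, fun n hn k hk => ?_⟩
    have hq' := memWL_qmean hΩ hp hm (hf n).1 (hf k).1 (hf n).2.1 (hf k).2.1
    have h1 := hI _ hq' fun x => qmean_nonneg ((hf n).2.1 x) ((hf k).2.1 x)
    have h2 := hS.lowerOrder_qmean_le (hf n).2.1 (hf k).2.1 (hf n).1.memLp (hf k).1.memLp hq'.memLp
    have h3 := energy_qmean_le (Ω := Ω) h (by linarith : 1 ≤ m + 1) hmp (hf n).1.isSobolev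
      (hf k).1.isSobolev (hf n).2.1 (hf k).2.1
    have h4 := mul_le_mul_of_nonneg_left h3 hlp.le
    have h5 := hM n hn
    have h6 := hM k hk
    rw [hJ] at h1 h5 h6
    have h7 : 1 / (8 * (m + 1)) * ∫ x in Ω, (f n x ^ (m + 1) - f k x ^ (m + 1)) ^ 2 ≤
        ε / (8 * (m + 1)) := by linarith
    rw [one_div_mul_eq_div] at h7
    exact (div_le_div_iff_of_pos_right (by positivity)).1 h7
  have hd : ∀ η > 0, ∃ M : ℕ, ∀ n ≥ M, ∀ k ≥ M,
      (E (f n) + E (f k)) / 2 - E (fun x => 1 / 2 * (f n x + f k x)) ≤ η := by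
    intro η hη
    -- Almost minimality costs one ε, the two source errors one each, and the distance of the powers
    -- one more; the fifth is slack.
    set ε := lam / p * η / 5 with hε
    have hε0 : 0 < ε := by positivity
    obtain ⟨C1, hC1, H1⟩ := exists_integral_mul_abs_rpow_sub_le hq le_rfl hS.memLp_left
      hS.nonneg_left hε0
    obtain ⟨C2, hC2, H2⟩ := exists_integral_mul_abs_rpow_sub_le (by linarith : 0 < δ + 1)
      (by linarith : δ + 1 ≤ m + 1) hS.memLp_right hS.nonneg_right hε0
    obtain ⟨M1, hM1⟩ := hw (ε / (C1 + C2 + 1)) (by positivity)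
    obtain ⟨M2, hM2⟩ := hsmall ε hε0
    refine ⟨max M1 M2, fun n hn k hk => ?_⟩
    have d1 := hM1 n (le_of_max_le_left hn) k (le_of_max_le_left hk)
    have h5 := hM2 n (le_of_max_le_right hn)
    have h6 := hM2 k (le_of_max_le_right hk)
    have r1 := H1 _ _ (hf n).2.1 (hf k).2.1 (hf n).1.memLp (hf k).1.memLp
    have r2 := H2 _ _ (hf n).2.1 (hf k).2.1 (hf n).1.memLp (hf k).1.memLp
    have hmid : MemWL Ω p m fun x => 1 / 2 * (f n x + f k x) :=
      ((hf n).1.add hΩ (hf k).1).const_mul hΩ (1 / 2)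
    have h1 := hI _ hmid fun x => by linarith [(hf n).2.1 x, (hf k).2.1 x]
    have h2 := hS.lowerOrder_midpoint_le (hf n).2.1 (hf k).2.1 (hf n).1.memLp (hf k).1.memLp
    rw [hJ] at h1 h5 h6
    set D := ∫ x in Ω, (f n x ^ (m + 1) - f k x ^ (m + 1)) ^ 2
    have hD0 : 0 ≤ D := integral_nonneg fun x => by positivity
    have hCD : C1 * D + C2 * D ≤ ε := by
      rw [le_div_iff₀ (by positivity)] at d1
      nlinarith
    have h8 : lam / p * ((E (f n) + E (f k)) / 2 - E (fun x => 1 / 2 * (f n x + f k x))) ≤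
        lam / p * η := by
      have : lam / p * η = 5 * ε := by rw [hε]; ring
      linarith
    exact le_of_mul_le_mul_left h8 hlp
  set B := (I + 1 + C₀) / (lam / p) with hB
  have hEB : ∀ n, E (f n) ≤ B := fun n => by
    rw [hB, le_div_iff₀ hlp]
    have h1 := (hf n).2.2
    have h2 := hC₀ _ (hf n).2.1 (hf n).1.memLp
    rw [hJ] at h1
    have h3 : 1 / ((n:ℝ) + 1) ≤ 1 := by
      rw [div_le_one (by positivity)]; linarith [n.cast_nonneg (α := ℝ)]
    linarith
  obtain ⟨u, U, ns, hu, hu0, huz, hns, ha, haU⟩ := exists_limit hΩ hΩb h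
    ((energy_nonneg _).trans (hEB 0)) (fun n => (hf n).1) (fun n => (hf n).2.1) hEB hd
  have hum : ∀ r : ℝ, 0 ≤ r → AEStronglyMeasurable (fun x => u x ^ r) (volume.restrict Ω) := fun r hr =>
    (Real.continuous_rpow_const hr).comp_aestronglyMeasurable hu.memLp.1.restrict
  have hfw := fun n => memLp_rpow_of_nonneg hq (hf n).2.1 (hf n).1.memLp hq.le le_rfl
  -- Fatou in one of the two indices turns the Cauchy estimate into convergence of the powers to
  -- that of u. It also puts u in L^{2(m+1)}.
  have hwu : ∀ ε > 0, ∃ M : ℕ, ∀ n ≥ M,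
      Integrable (fun x => (u x ^ (m + 1) - f n x ^ (m + 1)) ^ 2) (volume.restrict Ω) ∧
      ∫ x in Ω, (u x ^ (m + 1) - f n x ^ (m + 1)) ^ 2 ≤ ε := by
    intro ε hε
    obtain ⟨M, hM⟩ := hw ε hε
    refine ⟨M, fun n hn => ?_⟩
    refine integral_le_of_ae_tendsto (f := fun i x => (f (ns i) x ^ (m + 1) - f n x ^ (m + 1)) ^ 2)
      (fun i => ((hfw (ns i)).sub (hfw n)).integrable_sq) (fun i x => by positivity)
      (fun x => by positivity) (((hum _ hq.le).sub (hfw n).1).pow 2) ?_ ?_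
    · refine ae_restrict_of_ae ?_
      filter_upwards [ha] with x hx
      exact ((hx.rpow_const (Or.inr hq.le)).sub_const _).pow 2
    · filter_upwards [hns.tendsto_atTop.eventually_ge_atTop M] with i hi
      exact hM _ hi n hn
  have huL : MemLp u (ENNReal.ofReal (2 * (m + 1))) (volume.restrict Ω) := by
    obtain ⟨M, hM⟩ := hwu 1 one_pos
    have h1 : MemLp (fun x => u x ^ (m + 1) - f M x ^ (m + 1)) 2 (volume.restrict Ω) :=
      (memLp_two_iff_integrable_sq ((hum _ hq.le).sub (hfw M).1)).2 (hM M le_rfl).1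
    have h2 : MemLp (fun x => u x ^ (m + 1)) 2 (volume.restrict Ω) :=
      (h1.add (hfw M)).ae_eq (Eventually.of_forall fun x => by simp)
    refine memLp_of_integrable_norm_rpow (by linarith) hu.memLp.1.restrict
      (h2.integrable_sq.congr (Eventually.of_forall fun x => ?_))
    simp only
    rw [Real.norm_of_nonneg (hu0 x), ← Real.rpow_mul_natCast (hu0 x)]
    congr 1
    push_cast; ring
  have hWL : MemWL Ω p m u := memWL_of_isSobolev hΩ hu huz huL
  refine ⟨u, hWL, hu0, fun v hv hv0 => le_trans ?_ (hI v hv hv0)⟩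
  refine le_of_forall_pos_le_add fun η hη => ?_
  set ε := η / 4 with hε
  have hε0 : 0 < ε := by positivity
  have hwL := memLp_rpow_of_nonneg hq hu0 huL hq.le le_rfl
  obtain ⟨C1, hC1, H1⟩ := exists_integral_mul_abs_rpow_sub_le hq le_rfl (hwL.add hS.memLp_left)
    (by filter_upwards [hS.nonneg_left] with x hx
        exact add_nonneg (Real.rpow_nonneg (hu0 x) _) hx) hε0
  obtain ⟨C2, hC2, H2⟩ := exists_integral_mul_abs_rpow_sub_le (by linarith : 0 < δ + 1)
    (by linarith : δ + 1 ≤ m + 1) hS.memLp_right hS.nonneg_right hε0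
  obtain ⟨M1, hM1⟩ := hwu (ε / (C1 + C2 + 1)) (by positivity)
  obtain ⟨M2, hM2⟩ := hsmall ε hε0
  -- Lower semicontinuity of the energy, with `Z u` exceeding the value of Z along the sequence by
  -- at most 3ε and the sequence being minimizing up to ε.
  have hEu : E u ≤ (I + 4 * ε - Z u) / (lam / p) := by
    refine energy_le_of_tendsto h (fun n => (hf (ns n)).1) hu ha haU ?_
    filter_upwards [hns.tendsto_atTop.eventually_ge_atTop (max M1 M2)] with i hi
    have d1 := (hM1 (ns i) (le_of_max_le_left hi)).2
    have h5 := hM2 (ns i) (le_of_max_le_right hi)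
    have r1 := H1 _ _ hu0 (hf (ns i)).2.1 huL (hf (ns i)).1.memLp
    have r2 := H2 _ _ hu0 (hf (ns i)).2.1 huL (hf (ns i)).1.memLp
    have h2 := hS.lowerOrder_le_add hu0 (hf (ns i)).2.1 huL (hf (ns i)).1.memLp
    rw [hJ] at h5
    simp only [Pi.add_apply] at r1
    set D := ∫ x in Ω, (u x ^ (m + 1) - f (ns i) x ^ (m + 1)) ^ 2
    have hD0 : 0 ≤ D := integral_nonneg fun x => by positivity
    have hCD : C1 * D + C2 * D ≤ ε := by
      rw [le_div_iff₀ (by positivity)] at d1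
      nlinarith
    rw [le_div_iff₀ hlp]
    linarith
  rw [le_div_iff₀ hlp] at hEu
  rw [hJ]
  linarith

end Minimizer

/-! ### The Euler–Lagrange equation and nontriviality -/

section EulerLagrange

variable {N : ℕ} {Ω : Set (Euc N)} {p s m δ lam : ℝ} {g k u v φ ψ : Euc N → ℝ} {U V : Euc N → Euc N}

lemma hasDerivAt_energy (h : Exponents N p s) (hu : IsSobolev p u U) (hφ : IsSobolev p φ V) :
    HasDerivAt (fun t : ℝ => energy Ω p s fun x => u x + t * φ x)
      (p * (localForm Ω p u φ + nonlocalForm p s u φ)) 0 := by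
  have hp := h.one_lt
  have hu' := hu.weakGradient
  have hφ' := hφ.weakGradient
  have d1 := hasDerivAt_integral_norm_rpow (μ := volume.restrict Ω) hp (hu'.memLp_grad.restrict Ω)
    (hφ'.memLp_grad.restrict Ω)
  have d2 := hasDerivAt_integral_norm_rpow hp (h.memLp_incr hu') (h.memLp_incr hφ')
  rw [← nonlocalForm_eq] at d2
  rw [mul_add]
  refine (d1.add d2).congr_of_eventuallyEq (Eventually.of_forall fun t => ?_)
  simp only [Pi.add_apply]
  rw [energy_eq (hu'.add (hφ'.const_mul t))]
  congr 1
  refine integral_congr_ae (Eventually.of_forall fun z => ?_)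
  simp only [incr, smul_eq_mul]
  congr 2
  ring

lemma Source.hasDerivAt_lowerOrder (hS : Source (volume.restrict Ω) m δ g k)
    (hu : MemLp u (ENNReal.ofReal (2 * (m + 1))) (volume.restrict Ω))
    (hφ : MemLp φ (ENNReal.ofReal (2 * (m + 1))) (volume.restrict Ω)) :
    HasDerivAt (fun t : ℝ => lowerOrder (volume.restrict Ω) m δ g k fun x => u x + t * φ x)
      ((∫ x in Ω, ‖u x‖ ^ (2 * (m + 1) - 2) * inner ℝ (u x) (φ x)) -
        (∫ x in Ω, g x * (|u x| ^ m * φ x)) - ∫ x in Ω, k x * (|u x| ^ δ * φ x)) 0 := by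
  have := hS.finite
  have hm := hS.m_nonneg
  have hδ := hS.δ_nonneg
  have hδm := hS.δ_le
  have hq : 0 < m + 1 := by linarith
  have d1 := (hasDerivAt_integral_norm_rpow (p := 2 * (m + 1)) (by linarith) hu hφ).const_mul
    (1 / (2 * (m + 1)))
  have d2 := (hasDerivAt_integral_mul_abs_rpow (q := m + 1) hm le_rfl hS.memLp_left hu hφ).const_mul
    (1 / (m + 1))
  have d3 := (hasDerivAt_integral_mul_abs_rpow (q := m + 1) hδ (by linarith) hS.memLp_right hu
    hφ).const_mul (1 / (δ + 1))
  refine ((d1.sub d2).sub d3).congr_deriv ?_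
  field_simp

lemma energy_posPart_le (h : Exponents N p s) (hu : IsSobolev p u U) :
    energy Ω p s (fun x => max (u x) 0) ≤ energy Ω p s u := by
  classical
  refine energy_mono h (hu.posPart h.one_lt) hu (Eventually.of_forall fun x => ?_)
    (Eventually.of_forall fun z => ?_)
  · split_ifs <;> simp
  · have := abs_max_sub_max_le_abs (u z.1) (u z.2) 0
    exact this

lemma MemWL.posPart (hΩ : IsOpen Ω) (hp : 1 < p) (hu : MemWL Ω p m u) :
    MemWL Ω p m fun x => max (u x) 0 := hu.sup hΩ hp (memWL_zero hΩ)

/-- Minimizers satisfy the Euler–Lagrange equation. -/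
lemma weak_eq_of_minimizer (hΩ : IsOpen Ω) (h : Exponents N p s)
    (hS : Source (volume.restrict Ω) m δ g k) (hlam : 0 < lam) (hu : MemWL Ω p m u)
    (hu0 : ∀ x, 0 ≤ u x) (hmin : ∀ v, MemWL Ω p m v → (∀ x, 0 ≤ v x) →
      functional Ω p s m δ lam g k u ≤ functional Ω p s m δ lam g k v) (hφ : MemWL Ω p m φ) :
    (∫ x in Ω, u x ^ (2 * m + 1) * φ x) + lam * localForm Ω p u φ + lam * nonlocalForm p s u φ
      = ∫ x in Ω, (g x * u x ^ m + k x * u x ^ δ) * φ x := by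
  have := hS.finite
  have hp := h.one_lt
  have hp0 : 0 < p := by linarith
  have hm := hS.m_nonneg
  have hδ := hS.δ_nonneg
  have hδm := hS.δ_le
  -- The positive part of a competitor does no worse, so the sign constraint can be dropped and u +
  -- tφ may be used for both signs of t.
  have hmin' : ∀ v, MemWL Ω p m v →
      functional Ω p s m δ lam g k u ≤ functional Ω p s m δ lam g k v := fun v hv => by
    refine (hmin _ (hv.posPart hΩ hp) fun x => le_max_right _ _).trans ?_
    exact add_le_add (hS.lowerOrder_posPart_le hv.memLp)
      (mul_le_mul_of_nonneg_left (energy_posPart_le h hv.isSobolev) (by positivity))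
  have hd := (hS.hasDerivAt_lowerOrder hu.memLp hφ.memLp).add
    ((hasDerivAt_energy (Ω := Ω) h hu.isSobolev hφ.isSobolev).const_mul (lam / p))
  have hloc : IsLocalMin (fun t : ℝ => functional Ω p s m δ lam g k fun x => u x + t * φ x) 0 := by
    refine Eventually.of_forall fun t => ?_
    simp only [zero_mul, add_zero]
    exact hmin' _ (hu.add hΩ (hφ.const_mul hΩ t))
  have h0 := hloc.hasDerivAt_eq_zero hd
  have e1 : ∫ x in Ω, ‖u x‖ ^ (2 * (m + 1) - 2) * inner ℝ (u x) (φ x) =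
      ∫ x in Ω, u x ^ (2 * m + 1) * φ x := by
    refine integral_congr_ae (Eventually.of_forall fun x => ?_)
    simp only [RCLike.inner_apply, conj_trivial]
    rw [← rpow_mul_self_of_nonneg (hu0 x) (by linarith : 0 ≤ 2 * m), Real.norm_eq_abs,
      show 2 * (m + 1) - 2 = 2 * m by ring]
    ring
  have e2 : ∫ x in Ω, (g x * u x ^ m + k x * u x ^ δ) * φ x =
      (∫ x in Ω, g x * (|u x| ^ m * φ x)) + ∫ x in Ω, k x * (|u x| ^ δ * φ x) := by
    rw [← integral_add (integrable_mul_of_two hS.memLp_left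
        (memLp_two_rpow_mul (q := m + 1) hm le_rfl hu.memLp hφ.memLp))
      (integrable_mul_of_two hS.memLp_right
        (memLp_two_rpow_mul (q := m + 1) hδ (by linarith) hu.memLp hφ.memLp))]
    refine integral_congr_ae (Eventually.of_forall fun x => ?_)
    simp only [abs_of_nonneg (hu0 x)]
    ring
  rw [e1] at h0
  rw [e2]
  have e3 : lam / p * (p * (localForm Ω p u φ + nonlocalForm p s u φ)) =
      lam * localForm Ω p u φ + lam * nonlocalForm p s u φ := by field_simp
  linarith

lemma energy_const_mul (hu : IsSobolev p u U) {t : ℝ} (ht : 0 ≤ t) :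
    energy Ω p s (fun x => t * u x) = t ^ p * energy Ω p s u := by
  rw [energy_eq (hu.const_mul t), energy_eq hu, mul_add, ← integral_const_mul, ← integral_const_mul]
  congr 1
  · refine integral_congr_ae (Eventually.of_forall fun x => ?_)
    simp only [norm_smul, Real.norm_of_nonneg ht]
    rw [Real.mul_rpow ht (norm_nonneg _)]
  · refine integral_congr_ae (Eventually.of_forall fun z => ?_)
    simp only [incr, ← mul_sub, norm_mul, Real.norm_of_nonneg ht]
    rw [Real.mul_rpow ht (norm_nonneg _)]

lemma functional_ae_zero (hΩ : IsOpen Ω) (h : Exponents N p s)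
    (hS : Source (volume.restrict Ω) m δ g k) (hu : MemWL Ω p m u)
    (h0 : ∀ᵐ x ∂volume.restrict Ω, u x = 0) : functional Ω p s m δ lam g k u = 0 := by
  have hm := hS.m_nonneg
  have hp0 : 0 < p := by linarith [h.one_lt]
  have hu0 : ∀ᵐ x, u x = 0 := by
    filter_upwards [(ae_restrict_iff' hΩ.measurableSet).1 h0, hu.ae_eq_zero hΩ] with x h1 h2
    by_cases hx : x ∈ Ω
    exacts [h1 hx, h2 hx]
  have e1 : energy Ω p s u = 0 := by
    have i1 : ∫ x in Ω, ‖weakGradient u x‖ ^ p = 0 := by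
      rw [integral_eq_zero_of_ae]
      refine ae_restrict_of_ae ?_
      filter_upwards [hu0, hu.isSobolev.grad_eq_zero_of_eq h.one_lt le_rfl] with x h1 h2
      simp [h2 h1, Real.zero_rpow hp0.ne']
    have i2 : ∫ z, ‖incr u z‖ ^ p ∂nlMeasure N p s = 0 := by
      rw [integral_eq_zero_of_ae]
      filter_upwards [ae_nlMeasure_fst hu0, ae_nlMeasure_snd hu0] with z h1 h2
      simp [incr, h1, h2, Real.zero_rpow hp0.ne']
    rw [energy, i1, i2, add_zero]
  have e2 : lowerOrder (volume.restrict Ω) m δ g k u = 0 := by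
    have i1 : ∫ x in Ω, ‖u x‖ ^ (2 * (m + 1)) = 0 := by
      rw [integral_eq_zero_of_ae]
      filter_upwards [h0] with x hx
      simp [hx, Real.zero_rpow (by linarith : 2 * (m + 1) ≠ 0)]
    have i2 : ∀ (f : Euc N → ℝ) (θ : ℝ), ∫ x in Ω, f x * (|u x| ^ θ * u x) = 0 := fun f θ => by
      rw [integral_eq_zero_of_ae]
      filter_upwards [h0] with x hx
      simp [hx]
    rw [lowerOrder, i1, i2, i2]; simp
  rw [functional, e1, e2]; simp

/-- At tψ with ψ a bump positive on Ω, the g term is of order t^(m+1), the other two are t^(2(m+1))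
and t^p, and the k term has the good sign. Since m + 1 < p, the g term wins for small t. -/
lemma exists_functional_neg (hΩ : IsOpen Ω) (hΩb : Bornology.IsBounded Ω)
    (hS : Source (volume.restrict Ω) m δ g k) (hmp : m + 1 < p)
    (hg : ¬ ∀ᵐ x ∂volume.restrict Ω, g x = 0) :
    ∃ v, MemWL Ω p m v ∧ (∀ x, 0 ≤ v x) ∧ functional Ω p s m δ lam g k v < 0 := by
  have := hS.finite
  have hm := hS.m_nonneg
  have hδ := hS.δ_nonneg
  have hq : 0 < m + 1 := by linarith
  obtain ⟨ψ, hψd, hψc, hψ0, -, hψpos, hψz⟩ := exists_bump hΩ hΩb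
  have hψ : MemWL Ω p m ψ := memWL_bump hΩ hψd hψc hψz
  have hψq := memLp_rpow_of_nonneg hq hψ0 hψ.memLp hq.le le_rfl
  have hgi := integrable_mul_of_two hS.memLp_left hψq
  set A := 1 / (2 * (m + 1)) * ∫ x in Ω, (ψ x ^ (m + 1)) ^ 2 with hA
  set E := lam / p * energy Ω p s ψ with hE
  set G := 1 / (m + 1) * ∫ x in Ω, g x * ψ x ^ (m + 1) with hG
  have hG0 : 0 < G := by
    refine mul_pos (by positivity) (lt_of_le_of_ne (integral_nonneg_of_ae ?_) fun h0 => hg ?_)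
    · filter_upwards [hS.nonneg_left] with x hx
      exact mul_nonneg hx (Real.rpow_nonneg (hψ0 x) _)
    · have h1 := (integral_eq_zero_iff_of_nonneg_ae (by
        filter_upwards [hS.nonneg_left] with x hx
        exact mul_nonneg hx (Real.rpow_nonneg (hψ0 x) _)) hgi).1 h0.symm
      filter_upwards [h1, ae_restrict_mem hΩ.measurableSet] with x hx hxΩ
      have : 0 < ψ x ^ (m + 1) := Real.rpow_pos_of_pos (hψpos x hxΩ) _
      simpa [this.ne'] using hx
  have hle : ∀ t : ℝ, 0 < t → functional Ω p s m δ lam g k (fun x => t * ψ x) ≤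
      t ^ (m + 1) * (t ^ (m + 1) * A + t ^ (p - (m + 1)) * E - G) := by
    intro t ht
    have ht0 : ∀ x, 0 ≤ t * ψ x := fun x => mul_nonneg ht.le (hψ0 x)
    rw [functional, hS.lowerOrder_eq ht0, energy_const_mul hψ.isSobolev ht.le]
    have i1 : ∫ x in Ω, ((t * ψ x) ^ (m + 1)) ^ 2 = (t ^ (m + 1)) ^ 2 * ∫ x in Ω, (ψ x ^ (m + 1)) ^ 2 := by
      rw [← integral_const_mul]
      refine integral_congr_ae (Eventually.of_forall fun x => ?_)
      simp only [Real.mul_rpow ht.le (hψ0 x), mul_pow]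
    have i2 : ∫ x in Ω, g x * (t * ψ x) ^ (m + 1) = t ^ (m + 1) * ∫ x in Ω, g x * ψ x ^ (m + 1) := by
      rw [← integral_const_mul]
      refine integral_congr_ae (Eventually.of_forall fun x => ?_)
      simp only [Real.mul_rpow ht.le (hψ0 x)]
      ring
    have i3 : 0 ≤ 1 / (δ + 1) * ∫ x in Ω, k x * (t * ψ x) ^ (δ + 1) := by
      refine mul_nonneg (by positivity) (integral_nonneg_of_ae ?_)
      filter_upwards [hS.nonneg_right] with x hx
      exact mul_nonneg hx (Real.rpow_nonneg (ht0 x) _)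
    have e : t ^ p = t ^ (m + 1) * t ^ (p - (m + 1)) := by
      rw [← Real.rpow_add ht]; congr 1; ring
    rw [i1, i2, e]
    have : t ^ (m + 1) * (t ^ (m + 1) * A + t ^ (p - (m + 1)) * E - G) =
      1 / (2 * (m + 1)) * ((t ^ (m + 1)) ^ 2 * ∫ x in Ω, (ψ x ^ (m + 1)) ^ 2) -
      1 / (m + 1) * (t ^ (m + 1) * ∫ x in Ω, g x * ψ x ^ (m + 1)) +
      lam / p * (t ^ (m + 1) * t ^ (p - (m + 1)) * energy Ω p s ψ) := by
        rw [hA, hE, hG]; ring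
    linarith
  have hlim : Tendsto (fun n : ℕ => (1 / ((n : ℝ) + 1)) ^ (m + 1) * A +
      (1 / ((n : ℝ) + 1)) ^ (p - (m + 1)) * E - G) atTop (𝓝 (0 * A + 0 * E - G)) := by
    have hz : ∀ r : ℝ, 0 < r → Tendsto (fun n : ℕ => (1 / ((n : ℝ) + 1)) ^ r) atTop (𝓝 0) := by
      intro r hr
      have := tendsto_inv_nat_succ.rpow_const (p := r) (Or.inr hr.le)
      rwa [Real.zero_rpow hr.ne'] at this
    exact (((hz _ hq).mul_const A).add ((hz _ (by linarith)).mul_const E)).sub_const G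
  obtain ⟨n, hn⟩ := (hlim.eventually (gt_mem_nhds (by linarith : 0 * A + 0 * E - G < 0))).exists
  have ht := inv_nat_succ_pos n
  refine ⟨_, hψ.const_mul hΩ (1 / ((n : ℝ) + 1)), fun x => mul_nonneg ht.le (hψ0 x),
    (hle _ ht).trans_lt (mul_neg_of_pos_of_neg (Real.rpow_pos_of_pos ht _) hn)⟩

/-- Existence of weak solutions. -/
theorem exists_weakSol (hΩ : IsOpen Ω) (hΩb : Bornology.IsBounded Ω) (h : Exponents N p s)
    (hS : Source (volume.restrict Ω) m δ g k) (hmp : m + 1 < p) (hlam : 0 < lam)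
    (hg : ¬ ∀ᵐ x ∂volume.restrict Ω, g x = 0) : ∃ u, WeakSol Ω p s m δ lam g k u := by
  obtain ⟨u, hu, hu0, hmin⟩ := exists_minimizer hΩ hΩb h hS hmp.le hlam
  obtain ⟨v, hv, hv0, hneg⟩ := exists_functional_neg hΩ hΩb hS hmp hg
  refine ⟨u, hu, Eventually.of_forall hu0, fun h0 => ?_, fun φ hφ =>
    weak_eq_of_minimizer hΩ h hS hlam hu hu0 hmin hφ⟩
  have := hmin v hv hv0
  rw [functional_ae_zero hΩ h hS hu h0] at this
  linarith

end EulerLagrange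

/-! ### The Sobolev inequality by mollification -/

section Sobolev

open ContinuousLinearMap Convolution

variable {N : ℕ} {p : ℝ} {u : Euc N → ℝ} {G : Euc N → Euc N}

/-- The probability measure whose density is the kernel of a mollifier. -/
noncomputable def bumpMeasure {N : ℕ} (φ : ContDiffBump (0 : Euc N)) : Measure (Euc N) :=
  volume.withDensity fun x => ENNReal.ofReal (φ.normed volume x)

instance (φ : ContDiffBump (0 : Euc N)) : IsProbabilityMeasure (bumpMeasure φ) := by
  refine ⟨?_⟩
  rw [bumpMeasure, withDensity_apply _ MeasurableSet.univ, Measure.restrict_univ,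
    ← ofReal_integral_eq_lintegral_ofReal φ.integrable_normed
    (Eventually.of_forall fun x => φ.nonneg_normed x), φ.integral_normed, ENNReal.ofReal_one]

lemma integral_bumpMeasure {H : Type*} [NormedAddCommGroup H] [NormedSpace ℝ H]
    (φ : ContDiffBump (0 : Euc N)) (f : Euc N → H) :
    ∫ x, f x ∂bumpMeasure φ = ∫ x, φ.normed volume x • f x := by
  rw [bumpMeasure, integral_withDensity_eq_integral_toReal_smul
    (φ.continuous_normed.measurable.ennreal_ofReal) (by simp)]
  refine integral_congr_ae (Eventually.of_forall fun x => ?_)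
  simp only [ENNReal.toReal_ofReal (φ.nonneg_normed x)]

lemma lintegral_mollify_le (hp : 1 ≤ p) (φ : ContDiffBump (0 : Euc N)) (hG : AEStronglyMeasurable G) :
    ∫⁻ x, ‖∫ t, G (x - t) ∂bumpMeasure φ‖ₑ ^ p ≤ ∫⁻ x, ‖G x‖ₑ ^ p := by
  have hac : bumpMeasure φ ≪ volume := withDensity_absolutelyContinuous _ _
  have hm : AEStronglyMeasurable (fun z : Euc N × Euc N => G (z.1 - z.2))
      ((volume : Measure (Euc N)).prod (bumpMeasure φ)) :=
    (hG.comp_quasiMeasurePreserving (quasiMeasurePreserving_sub volume volume)).mono_ac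
      (Measure.AbsolutelyContinuous.rfl.prod hac)
  refine (lintegral_enorm_integral_rpow_le hp hm).trans (le_of_eq ?_)
  simp only
  have e : ∀ t : Euc N, ∫⁻ x, ‖G (x - t)‖ₑ ^ p = ∫⁻ x, ‖G x‖ₑ ^ p := fun t =>
    lintegral_sub_right_eq_self (fun x => ‖G x‖ₑ ^ p) t
  simp [e]

/-- The weak formulation is applied to the test function z ↦ ρ(x - z), with ρ the normalized kernel.
The sign from the reflection cancels the one from integration by parts. Writing the result as an
average over a probability measure lets `lintegral_mollify_le` bound it in L^p. -/
lemma IsWeakGradient.fderiv_mollify (h : IsWeakGradient u G) (φ : ContDiffBump (0 : Euc N)) (x : Euc N) :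
    HasFDerivAt (φ.normed volume ⋆[lsmul ℝ ℝ, volume] u)
      (innerSL ℝ (∫ t, G (x - t) ∂bumpMeasure φ)) x := by
  have hρc : HasCompactSupport (φ.normed volume) := φ.hasCompactSupport_normed
  have hρd : ContDiff ℝ ∞ (φ.normed volume) := φ.contDiff_normed
  have hρ1 : ContDiff ℝ 1 (φ.normed volume) := φ.contDiff_normed
  have hd := hρc.hasFDerivAt_convolution_left (lsmul ℝ ℝ) hρ1 h.locallyIntegrable x
  refine hd.congr_fderiv (ContinuousLinearMap.ext fun v => ?_)
  have hex := (hρc.fderiv ℝ).convolutionExists_left (((lsmul ℝ ℝ : ℝ →L[ℝ] ℝ →L[ℝ] ℝ)).precompL (Euc N))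
    (hρ1.continuous_fderiv one_ne_zero) h.locallyIntegrable x
  rw [convolution_eq_swap, ContinuousLinearMap.integral_apply hex.integrable_swap]
  simp only [precompL_apply, lsmul_apply, smul_eq_mul, innerSL_apply_apply]
  have hψd : ContDiff ℝ ∞ fun z => φ.normed volume (x - z) := hρd.comp (contDiff_const.sub contDiff_id)
  have hψc : HasCompactSupport fun z => φ.normed volume (x - z) :=
    hρc.comp_homeomorph (Homeomorph.subLeft x)
  have hw := h.integral_fderiv hψd hψc v
  have hfd : ∀ z, fderiv ℝ (fun z => φ.normed volume (x - z)) z v = - fderiv ℝ (φ.normed volume) (x - z) v := by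
    intro z
    have h1 : HasFDerivAt (fun z => φ.normed volume (x - z)) _ z :=
      ((hρ1.differentiable one_ne_zero (x - z)).hasFDerivAt).comp z ((hasFDerivAt_id z).const_sub x)
    rw [h1.fderiv]; simp
  simp only [hfd, mul_neg, integral_neg, neg_inj] at hw
  rw [integral_bumpMeasure]
  have hi : Integrable (fun t => φ.normed volume t • G (x - t)) := by
    have := (hρc.convolutionExists_left (lsmul ℝ ℝ : ℝ →L[ℝ] Euc N →L[ℝ] Euc N) hρ1.continuous
      h.locallyIntegrable_grad x).integrable
    simpa using this
  rw [real_inner_comm, ← integral_inner hi]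
  calc ∫ t, fderiv ℝ (φ.normed volume) (x - t) v * u t = ∫ t, u t * fderiv ℝ (φ.normed volume) (x - t) v := by
        simp only [mul_comm]
    _ = ∫ t, inner ℝ (G t) v * φ.normed volume (x - t) := hw
    _ = ∫ t, inner ℝ (G (x - t)) v * φ.normed volume t := by
        rw [← integral_sub_left_eq_self _ volume x]; simp
    _ = _ := by
        refine integral_congr_ae (Eventually.of_forall fun t => ?_)
        simp only [inner_smul_right, real_inner_comm v]
        ring

lemma exists_bump_sequence (N : ℕ) : ∃ φ : ℕ → ContDiffBump (0 : Euc N),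
    Tendsto (fun n => (φ n).rOut) atTop (𝓝 0) ∧ ∀ n, (φ n).rOut ≤ 2 * (φ n).rIn := by
  refine ⟨fun n => ⟨1 / ((n : ℝ) + 1), 2 * (1 / ((n : ℝ) + 1)), inv_nat_succ_pos n, ?_⟩, ?_, fun n => le_rfl⟩
  · linarith [inv_nat_succ_pos n]
  · simpa using (tendsto_inv_nat_succ.const_mul (2:ℝ))

/-- The Sobolev inequality for functions with bounded support. -/
theorem exists_sobolev (hp : 1 < p) (hpN : p < N) (R : ℝ) : ∃ C : NNReal, ∀ (u : Euc N → ℝ) (G : Euc N → Euc N),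
    IsSobolev p u G → (∀ᵐ x, R < ‖x‖ → u x = 0) →
    eLpNorm u (ENNReal.ofReal (N * p / (N - p))) volume ≤ C * eLpNorm G (ENNReal.ofReal p) volume := by
  have hp0 : 0 < p := by linarith
  have hN : 0 < N := by
    rcases Nat.eq_zero_or_pos N with h | h
    · subst h; norm_num at hpN; linarith
    · exact h
  have hNr : (0:ℝ) < N := by exact_mod_cast hN
  refine ⟨eLpNormLESNormFDerivOfEqInnerConst (volume : Measure (Euc N)) p.toNNReal, fun u G hu h0 => ?_⟩
  -- Vanishing almost everywhere outside the ball does not make the topological support compact; the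
  -- modified representative has compact support, and so have its mollifications.
  set u' : Euc N → ℝ := (Metric.closedBall 0 R).indicator u with hu'
  have hae : u =ᵐ[volume] u' := by
    filter_upwards [h0] with x hx
    by_cases hxR : ‖x‖ ≤ R
    · rw [hu', indicator_of_mem (by simpa using hxR)]
    · rw [hu', indicator_of_notMem (by simpa using hxR), hx (not_le.1 hxR)]
  have hu1 : IsSobolev p u' G := hu.congr hae (EventuallyEq.refl _ _)
  have hc : HasCompactSupport u' := by
    refine HasCompactSupport.of_support_subset_isCompact (isCompact_closedBall (0 : Euc N) R) ?_
    exact Function.support_subset_iff'.2 fun x hx => indicator_of_notMem hx _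
  obtain ⟨φ, hφ0, hφ2⟩ := exists_bump_sequence N
  set w : ℕ → Euc N → ℝ := fun n => (φ n).normed volume ⋆[lsmul ℝ ℝ, volume] u' with hw
  have hwd : ∀ n, ContDiff ℝ 1 (w n) := fun n =>
    (φ n).hasCompactSupport_normed.contDiff_convolution_left _ (φ n).contDiff_normed
      hu1.weak.locallyIntegrable
  have hwc : ∀ n, HasCompactSupport (w n) := fun n =>
    HasCompactSupport.convolution _ (φ n).hasCompactSupport_normed hc
  have hlim : ∀ᵐ x, Tendsto (fun n => w n x) atTop (𝓝 (u' x)) :=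
    ContDiffBump.ae_convolution_tendsto_right_of_locallyIntegrable hφ0
      (Eventually.of_forall hφ2) hu1.weak.locallyIntegrable
  have hfd : ∀ n, eLpNorm (fderiv ℝ (w n)) (ENNReal.ofReal p) volume ≤
      eLpNorm G (ENNReal.ofReal p) volume := fun n => by
    rw [← ENNReal.rpow_le_rpow_iff hp0, eLpNorm_rpow_ofReal hp0, eLpNorm_rpow_ofReal hp0]
    refine le_trans (le_of_eq ?_) (lintegral_mollify_le hp.le (φ n) hu1.memLp_grad.1)
    refine lintegral_congr fun x => ?_
    rw [(hu1.weak.fderiv_mollify (φ n) x).fderiv, ← ofReal_norm, innerSL_apply_norm, ofReal_norm]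
  have hS : ∀ n, eLpNorm (w n) (ENNReal.ofReal (N * p / (N - p))) volume ≤
      eLpNormLESNormFDerivOfEqInnerConst (volume : Measure (Euc N)) p.toNNReal *
        eLpNorm G (ENNReal.ofReal p) volume := fun n => by
    refine (eLpNorm_le_eLpNorm_fderiv_of_eq_inner volume (hwd n) (hwc n)
      (p := p.toNNReal) (p' := (N * p / (N - p)).toNNReal) ?_ ?_ ?_).trans
      (mul_le_mul_right (hfd n) _)
    · simpa using Real.toNNReal_le_toNNReal hp.le
    · simpa using hN
    · have : 0 < (N:ℝ) - p := by linarith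
      rw [Real.coe_toNNReal _ (by positivity), NNReal.coe_inv, Real.coe_toNNReal _ hp0.le, finrank_euclideanSpace_fin]
      field_simp
  rw [eLpNorm_congr_ae hae]
  -- The bound for the mollifications is uniform, and Fatou's lemma carries it to the almost
  -- everywhere limit.
  refine (Lp.eLpNorm_lim_le_liminf_eLpNorm (fun n => (hwd n).continuous.aestronglyMeasurable) u' hlim).trans ?_
  exact liminf_le_of_frequently_le' (Eventually.of_forall hS).frequently

end Sobolev

/-! ### De Giorgi iteration and boundedness -/

section Bounded

variable {N : ℕ} {Ω : Set (Euc N)} {p s m δ lam : ℝ} {g k u : Euc N → ℝ} {U : Euc N → Euc N}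

lemma memLp_rpow_ofReal {X : Type*} [MeasurableSpace X] {μ : Measure X} {θ t : ℝ} (hθ : 0 < θ)
    {a : X → ℝ} (h0 : ∀ x, 0 ≤ a x) (ha : MemLp a (ENNReal.ofReal (t * θ)) μ) :
    MemLp (fun x => a x ^ θ) (ENNReal.ofReal t) μ := by
  have h := ha.norm_rpow_div (ENNReal.ofReal θ)
  rw [ENNReal.toReal_ofReal hθ.le, ← ENNReal.ofReal_div_of_pos hθ, mul_div_cancel_right₀ _ hθ.ne'] at h
  refine h.ae_eq (Eventually.of_forall fun x => ?_)
  simp only [Real.norm_of_nonneg (h0 x)]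

/-- Fast geometric convergence. -/
lemma exists_fast_convergence {A B β : ℝ} (hA : 0 < A) (hB : 1 < B) (hβ : 0 < β) :
    ∃ ε > 0, ∀ W : ℕ → ℝ, (∀ j, 0 ≤ W j) → (∀ j, W (j + 1) ≤ A * B ^ j * W j ^ (1 + β)) →
      W 0 ≤ ε → Tendsto W atTop (𝓝 0) := by
  have hB0 : 0 < B := by linarith
  -- The ratio D is chosen so that D^β B = 1, and below ε is chosen so that A ε^β = D. The bound W j
  -- ≤ ε D^j then reproduces itself under the recursion.
  set D := B ^ (-(1 / β)) with hD
  have hD0 : 0 < D := Real.rpow_pos_of_pos hB0 _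
  have hD1 : D < 1 := Real.rpow_lt_one_of_one_lt_of_neg hB (by simpa using hβ)
  have hDB : D ^ β * B = 1 := by
    rw [hD, ← Real.rpow_mul hB0.le, neg_mul, one_div_mul_cancel hβ.ne', Real.rpow_neg_one,
      inv_mul_cancel₀ hB0.ne']
  refine ⟨(D / A) ^ (1 / β), by positivity, fun W hW0 hW h0 => ?_⟩
  set ε := (D / A) ^ (1 / β) with hε
  have hε0 : 0 < ε := by positivity
  have hεβ : A * ε ^ β = D := by
    rw [hε, ← Real.rpow_mul (by positivity), one_div_mul_cancel hβ.ne', Real.rpow_one]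
    field_simp
  have key : ∀ j, W j ≤ ε * D ^ j := by
    intro j
    induction j with
    | zero => simpa using h0
    | succ j ih =>
      calc W (j + 1) ≤ A * B ^ j * W j ^ (1 + β) := hW j
        _ ≤ A * B ^ j * (ε * D ^ j) ^ (1 + β) := by
            have := Real.rpow_le_rpow (hW0 j) ih (by linarith : 0 ≤ 1 + β)
            gcongr
        _ = (A * ε ^ β) * ε * D ^ j * (D ^ β * B) ^ j := by
            rw [Real.rpow_add (by positivity), Real.rpow_one, Real.mul_rpow hε0.le (by positivity),
              ← Real.rpow_natCast D j, ← Real.rpow_mul hD0.le, mul_comm (j : ℝ) β,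
              Real.rpow_mul hD0.le, Real.rpow_natCast, Real.rpow_natCast, mul_pow]
            ring
        _ = ε * D ^ (j + 1) := by rw [hεβ, hDB, one_pow, pow_succ]; ring
  refine squeeze_zero hW0 key ?_
  simpa using (tendsto_pow_atTop_nhds_zero_of_lt_one hD0.le hD1).const_mul ε

lemma exists_sobolev_integral (hΩb : Bornology.IsBounded Ω) (hp : 1 < p) (hpN : p < N) :
    ∃ C : ℝ, 0 ≤ C ∧ ∀ (u : Euc N → ℝ) (U : Euc N → Euc N), IsSobolev p u U →
      (∀ᵐ x, x ∉ Ω → u x = 0) → MemLp u (ENNReal.ofReal (N * p / (N - p))) volume ∧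
      (∫ x in Ω, ‖u x‖ ^ (N * p / (N - p))) ^ (1 / (N * p / (N - p))) ≤
        C * (∫ x in Ω, ‖U x‖ ^ p) ^ (1 / p) := by
  have hp0 : 0 < p := by linarith
  have hNp : 0 < (N : ℝ) - p := by linarith
  have hN0 : (0 : ℝ) < N := by linarith
  set P := N * p / ((N : ℝ) - p) with hP
  have hP0 : 0 < P := by positivity
  obtain ⟨R, hR0, hR⟩ := hΩb.exists_pos_norm_le
  obtain ⟨C, hC⟩ := exists_sobolev hp hpN R
  refine ⟨C, C.2, fun u U hu h0 => ?_⟩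
  have h := hC u U hu (by
    filter_upwards [h0] with x hx hlt
    exact hx fun hxΩ => absurd (hR x hxΩ) (not_le.2 hlt))
  have hm : MemLp u (ENNReal.ofReal P) volume :=
    ⟨hu.memLp.1, h.trans_lt (ENNReal.mul_lt_top ENNReal.coe_lt_top hu.memLp_grad.2)⟩
  refine ⟨hm, ?_⟩
  have h2 := (eLpNorm_mono_measure u (Measure.restrict_le_self (s := Ω))).trans h
  rw [(hm.restrict Ω).eLpNorm_eq_integral_rpow_norm (by simpa using hP0) ENNReal.ofReal_ne_top,
    hu.memLp_grad.eLpNorm_eq_integral_rpow_norm (by simpa using hp0) ENNReal.ofReal_ne_top,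
    ENNReal.toReal_ofReal hP0.le, ENNReal.toReal_ofReal hp0.le, ← ENNReal.ofReal_coe_nnreal,
    ← ENNReal.ofReal_mul (NNReal.coe_nonneg C), hu.integral_grad_eq hp h0] at h2
  have h3 := (ENNReal.ofReal_le_ofReal_iff (by positivity)).1 h2
  simpa only [one_div] using h3

-- Caccioppoli estimate: test with (u - κ)^+. The zeroth-order term is nonnegative, and so is the
-- nonlocal form because truncation is monotone; only the local energy above level κ is kept.
open Classical in
lemma WeakSol.energy_subLevel_le (hΩ : IsOpen Ω) (h : Exponents N p s) (hlam : 0 < lam)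
    (hu : WeakSol Ω p s m δ lam g k u) {κ : ℝ} (hκ : 0 ≤ κ) :
    lam * ∫ x in Ω, ‖if κ < u x then weakGradient u x else 0‖ ^ p ≤
      ∫ x in Ω, (g x * u x ^ m + k x * u x ^ δ) * max (u x - κ) 0 := by
  have hp := h.one_lt
  have hS := hu.memWL.isSobolev
  have hφ := hS.subLevel hp hκ
  have hφW : MemWL Ω p m fun x => max (u x - κ) 0 := by
    refine memWL_of_isSobolev hΩ hφ ?_ (hu.memWL.memLp.mono hφ.memLp.1.restrict
      (Eventually.of_forall fun x => ?_))
    · filter_upwards [hu.memWL.ae_eq_zero hΩ] with x hx hxΩ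
      rw [hx hxΩ, max_eq_right (by linarith)]
    · rw [Real.norm_of_nonneg (le_max_right _ _)]
      exact max_le (by linarith [le_abs_self (u x), Real.norm_eq_abs (u x)]) (norm_nonneg _)
  have e := hu.weak_eq _ hφW
  have e1 : 0 ≤ ∫ x in Ω, u x ^ (2 * m + 1) * max (u x - κ) 0 := integral_nonneg_of_ae (by
    filter_upwards [hu.nonneg] with x hx
    exact mul_nonneg (Real.rpow_nonneg hx _) (le_max_right _ _))
  have e2 : localForm Ω p u (fun x => max (u x - κ) 0) =
      ∫ x in Ω, ‖if κ < u x then weakGradient u x else 0‖ ^ p := by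
    rw [localForm_congr hφ.weak]
    refine integral_congr_ae (Eventually.of_forall fun x => ?_)
    simp only
    split_ifs with hx
    · rw [real_inner_self_eq_norm_sq]
      rcases eq_or_lt_of_le (norm_nonneg (weakGradient u x)) with h0 | h0
      · rw [← h0, Real.zero_rpow (by linarith : p ≠ 0)]; simp
      · rw [← Real.rpow_natCast ‖weakGradient u x‖ 2, ← Real.rpow_add h0]
        congr 1; push_cast; ring
    · rw [inner_zero_right, mul_zero, norm_zero, Real.zero_rpow (by linarith : p ≠ 0)]
  have e3 : 0 ≤ nonlocalForm p s u (fun x => max (u x - κ) 0) := by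
    refine integral_nonneg fun z => div_nonneg ?_ (by positivity)
    rw [signedPow, mul_assoc]
    refine mul_nonneg (by positivity) ?_
    rcases le_total (u z.1) (u z.2) with hz | hz
    · have : max (u z.1 - κ) 0 ≤ max (u z.2 - κ) 0 := by gcongr
      exact mul_nonneg_of_nonpos_of_nonpos (by linarith) (by linarith)
    · have : max (u z.2 - κ) 0 ≤ max (u z.1 - κ) 0 := by gcongr
      exact mul_nonneg (by linarith) (by linarith)
  rw [← e, e2]
  have := mul_nonneg hlam.le e3
  linarith

/-- Above the level κ₂ ≥ 1 both powers of t are at most t^(p-1), and t is comparable with its excess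
over the lower level κ₁. The source thus becomes p-homogeneous in (t - κ₁)^+. -/
lemma source_le_subLevel {m δ p c κ₁ κ₂ a b t : ℝ} (hp : 1 < p) (hδm : δ ≤ m) (hmp : m ≤ p - 1)
    (hκ₁ : 1 ≤ κ₁) (hκ : κ₁ ≤ κ₂) (hc0 : 0 ≤ c) (hc : ∀ t, κ₂ < t → t ≤ c * (t - κ₁))
    (ha : 0 ≤ a) (hb : 0 ≤ b) :
    (a * t ^ m + b * t ^ δ) * max (t - κ₂) 0 ≤
      c ^ (p - 1) * ((a + b) * max (t - κ₁) 0 ^ p) := by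
  rcases le_or_gt t κ₂ with h | h
  · rw [max_eq_right (by linarith), mul_zero]
    have : 0 ≤ max (t - κ₁) 0 := le_max_right _ _
    positivity
  · have h1 : 0 < t - κ₁ := by linarith
    rw [max_eq_left (by linarith), max_eq_left h1.le]
    have ht : 1 ≤ t := by linarith
    have e1 : t ^ m ≤ t ^ (p - 1) := Real.rpow_le_rpow_of_exponent_le ht hmp
    have e2 : t ^ δ ≤ t ^ (p - 1) := Real.rpow_le_rpow_of_exponent_le ht (by linarith)
    have e3 : t ^ (p - 1) ≤ (c * (t - κ₁)) ^ (p - 1) :=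
      Real.rpow_le_rpow (by linarith) (hc t h) (by linarith)
    rw [Real.mul_rpow hc0 h1.le] at e3
    have e4 : (t - κ₁) ^ p = (t - κ₁) ^ (p - 1) * (t - κ₁) := by
      rw [← Real.rpow_add_one h1.ne']; congr 1; ring
    calc (a * t ^ m + b * t ^ δ) * (t - κ₂) ≤
          ((a + b) * (c ^ (p - 1) * (t - κ₁) ^ (p - 1))) * (t - κ₁) := by
          have e5 : a * t ^ m + b * t ^ δ ≤ (a + b) * (c ^ (p - 1) * (t - κ₁) ^ (p - 1)) := by
            rw [add_mul]
            exact add_le_add (mul_le_mul_of_nonneg_left (e1.trans e3) ha)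
              (mul_le_mul_of_nonneg_left (e2.trans e3) hb)
          exact mul_le_mul e5 (by linarith) (by linarith) (by positivity)
      _ = _ := by rw [e4]; ring

/-- One step of De Giorgi's iteration. -/
lemma WeakSol.exists_step (hΩ : IsOpen Ω) (hΩb : Bornology.IsBounded Ω) (h : Exponents N p s)
    (hpN : p < N) (hlam : 0 < lam) (hδm : δ ≤ m) (hmp : m ≤ p - 1)
    (hg0 : ∀ᵐ x ∂volume.restrict Ω, 0 ≤ g x) (hk0 : ∀ᵐ x ∂volume.restrict Ω, 0 ≤ k x)
    {r r' P β : ℝ} (hr : r.HolderConjugate r') (hP : P = p * r')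
    (hPS : P < N * p / (N - p)) (hβ : β = 1 - P / (N * p / (N - p)))
    (hf : MemLp (fun x => g x + k x) (ENNReal.ofReal r) (volume.restrict Ω))
    (hu : WeakSol Ω p s m δ lam g k u) :
    MemLp u (ENNReal.ofReal P) (volume.restrict Ω) ∧
    ∃ A > 0, ∀ κ₁ κ₂ c : ℝ, 1 ≤ κ₁ → κ₁ ≤ κ₂ → 0 < c → (∀ t, κ₂ < t → t ≤ c * (t - κ₁)) →
      ∫ x in Ω, max (u x - κ₂) 0 ^ P ≤ A * c ^ ((p - 1) * r' + P * β) *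
        (∫ x in Ω, max (u x - κ₁) 0 ^ P) ^ (1 + β) := by
  classical
  have := isFiniteMeasure_restrict hΩb
  have hp := h.one_lt
  have hp0 : 0 < p := by linarith
  have hr'0 : 0 < r' := hr.symm.pos
  have hP0 : 0 < P := by rw [hP]; positivity
  set S := N * p / ((N : ℝ) - p) with hS
  have hS0 : 0 < S := hP0.trans hPS
  have hβ0 : 0 < β := by rw [hβ, sub_pos, div_lt_one hS0]; exact hPS
  obtain ⟨C, hC0, hC⟩ := exists_sobolev_integral hΩb hp hpN
  have hSob := hu.memWL.isSobolev
  have huS : MemLp u (ENNReal.ofReal S) (volume.restrict Ω) :=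
    (hC _ _ hSob (hu.memWL.ae_eq_zero hΩ)).1.restrict Ω
  have huP : MemLp u (ENNReal.ofReal P) (volume.restrict Ω) :=
    huS.mono_exponent (ENNReal.ofReal_le_ofReal hPS.le)
  refine ⟨huP, ?_⟩
  set F := (∫ x in Ω, (g x + k x) ^ r) ^ (1 / r) with hF
  have hf0 : ∀ᵐ x ∂volume.restrict Ω, 0 ≤ g x + k x := by
    filter_upwards [hg0, hk0] with x h1 h2
    linarith
  have hF0 : 0 ≤ F := Real.rpow_nonneg (integral_nonneg_of_ae (by
    filter_upwards [hf0] with x hx; exact Real.rpow_nonneg hx _)) _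
  -- The summand 1 only keeps the constant positive. It depends on the data but not on the levels,
  -- which the iteration needs.
  refine ⟨C ^ P * (F / lam) ^ r' + 1, by positivity, fun κ₁ κ₂ c hκ₁ hκ hc0 hc => ?_⟩
  have hφ0 : ∀ κ x, 0 ≤ max (u x - κ) 0 := fun κ x => le_max_right _ _
  have hφm : ∀ {κ : ℝ} {t : ENNReal}, 0 ≤ κ → MemLp u t (volume.restrict Ω) →
      MemLp (fun x => max (u x - κ) 0) t (volume.restrict Ω) := fun {κ t} h0 ht =>
    ht.mono ((ht.1.sub aestronglyMeasurable_const).sup aestronglyMeasurable_const)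
      (Eventually.of_forall fun x => by
        rw [Real.norm_of_nonneg (le_max_right _ _)]
        exact max_le (by linarith [le_abs_self (u x), Real.norm_eq_abs (u x)]) (norm_nonneg _))
  set W := ∫ x in Ω, max (u x - κ₁) 0 ^ P with hW
  have hW0 : 0 ≤ W := integral_nonneg fun x => Real.rpow_nonneg (hφ0 _ _) _
  -- energy
  have hfφ : Integrable (fun x => (g x + k x) * max (u x - κ₁) 0 ^ p) (volume.restrict Ω) := by
    have := hr.ennrealOfReal
    exact hf.integrable_mul (q := ENNReal.ofReal r') (memLp_rpow_ofReal hp0 (hφ0 κ₁) (by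
      rw [mul_comm, ← hP]; exact hφm (by linarith) huP))
  have hE : lam * ∫ x in Ω, ‖if κ₂ < u x then weakGradient u x else 0‖ ^ p ≤
      c ^ (p - 1) * (F * W ^ (1 / r')) := by
    refine (hu.energy_subLevel_le hΩ h hlam (by linarith : 0 ≤ κ₂)).trans ?_
    have h1 : ∫ x in Ω, (g x * u x ^ m + k x * u x ^ δ) * max (u x - κ₂) 0 ≤
        ∫ x in Ω, c ^ (p - 1) * ((g x + k x) * max (u x - κ₁) 0 ^ p) := by
      refine integral_mono_of_nonneg ?_ (hfφ.const_mul _) ?_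
      · filter_upwards [hg0, hk0, hu.nonneg] with x h1 h2 h3
        have := hφ0 κ₂ x
        have := Real.rpow_nonneg h3 m
        have := Real.rpow_nonneg h3 δ
        simp only [Pi.zero_apply]
        positivity
      · filter_upwards [hg0, hk0] with x h1 h2
        exact source_le_subLevel hp hδm hmp hκ₁ hκ hc0.le hc h1 h2
    refine h1.trans ?_
    rw [integral_const_mul]
    refine mul_le_mul_of_nonneg_left ?_ (by positivity)
    have h2 := integral_mul_le_Lp_mul_Lq_of_nonneg hr hf0 (Eventually.of_forall fun x =>
      Real.rpow_nonneg (hφ0 κ₁ x) p) hf (memLp_rpow_ofReal hp0 (hφ0 κ₁) (by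
      rw [mul_comm, ← hP]; exact hφm (by linarith) huP))
    refine h2.trans (le_of_eq ?_)
    congr 2
    refine integral_congr_ae (Eventually.of_forall fun x => ?_)
    simp only [← Real.rpow_mul (hφ0 κ₁ x), hP]
  -- Sobolev
  have hκ₂ : 0 ≤ κ₂ := by linarith
  have hsob := (hC _ _ (hSob.subLevel hp hκ₂) (by
    filter_upwards [hu.memWL.ae_eq_zero hΩ] with x hx hxΩ
    rw [hx hxΩ, max_eq_right (by linarith)])).2
  set E := ∫ x in Ω, ‖if κ₂ < u x then weakGradient u x else 0‖ ^ p with hEd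
  have hE0 : 0 ≤ E := integral_nonneg fun x => by positivity
  simp only [Real.norm_of_nonneg (hφ0 κ₂ _)] at hsob
  set T := ∫ x in Ω, max (u x - κ₂) 0 ^ S with hT
  have hT0 : 0 ≤ T := integral_nonneg fun x => Real.rpow_nonneg (hφ0 _ _) _
  have hsob2 : T ^ (P / S) ≤ C ^ P * E ^ r' := by
    have := Real.rpow_le_rpow (by positivity) hsob hP0.le
    rw [← Real.rpow_mul hT0, Real.mul_rpow hC0 (by positivity), ← Real.rpow_mul hE0] at this
    have e1 : 1 / S * P = P / S := by ring
    have e2 : 1 / p * P = r' := by rw [hP]; field_simp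
    rwa [e1, e2] at this
  have hE2 : E ^ r' ≤ (F / lam) ^ r' * c ^ ((p - 1) * r') * W := by
    have h1 : E ≤ F / lam * c ^ (p - 1) * W ^ (1 / r') := by
      rw [div_mul_eq_mul_div, div_mul_eq_mul_div, le_div_iff₀ hlam]
      linarith
    have h2 := Real.rpow_le_rpow hE0 h1 hr'0.le
    rwa [Real.mul_rpow (by positivity) (by positivity), Real.mul_rpow (by positivity) (by positivity),
      ← Real.rpow_mul hc0.le, ← Real.rpow_mul hW0, one_div_mul_cancel hr'0.ne', Real.rpow_one] at h2
  -- Hölder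
  have hconj : (S / P).HolderConjugate (1 / β) := by
    rw [Real.holderConjugate_iff]
    refine ⟨(one_lt_div hP0).2 hPS, ?_⟩
    rw [hβ]
    simp
  -- On {u > κ₂} one has c (u - κ₁) ≥ u ≥ 1, so inserting a power of this factor costs nothing. It
  -- replaces Chebyshev's bound for the measure of the level set in Hölder's inequality.
  have hl : ∫ x in Ω, max (u x - κ₂) 0 ^ P ≤
      ∫ x in Ω, max (u x - κ₂) 0 ^ P * (c * max (u x - κ₁) 0) ^ (P * β) := by
    have m1 : MemLp (fun x => max (u x - κ₂) 0 ^ P) (ENNReal.ofReal (S / P)) (volume.restrict Ω) :=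
      memLp_rpow_ofReal hP0 (hφ0 κ₂) (by rw [div_mul_cancel₀ _ hP0.ne']; exact hφm hκ₂ huS)
    have m2 : MemLp (fun x => (c * max (u x - κ₁) 0) ^ (P * β)) (ENNReal.ofReal (1 / β))
        (volume.restrict Ω) :=
      memLp_rpow_ofReal (by positivity) (fun x => mul_nonneg hc0.le (hφ0 κ₁ x)) (by
        rw [show 1 / β * (P * β) = P by field_simp]
        exact (hφm (by linarith) huP).const_mul c)
    have := hconj.ennrealOfReal
    refine integral_mono_of_nonneg (Eventually.of_forall fun x => Real.rpow_nonneg (hφ0 _ _) _)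
      (m1.integrable_mul m2) (Eventually.of_forall fun x => ?_)
    simp only
    rcases le_or_gt (u x) κ₂ with hx | hx
    · rw [max_eq_right (by linarith), Real.zero_rpow hP0.ne', zero_mul]
    · refine le_mul_of_one_le_right (Real.rpow_nonneg (hφ0 _ _) _) (Real.one_le_rpow ?_ (by positivity))
      rw [max_eq_left (by linarith)]
      linarith [hc _ hx]
  have hH := integral_mul_le_Lp_mul_Lq_of_nonneg (μ := volume.restrict Ω) hconj
    (Eventually.of_forall fun x => Real.rpow_nonneg (hφ0 κ₂ x) P)
    (Eventually.of_forall fun x => Real.rpow_nonneg (mul_nonneg hc0.le (hφ0 κ₁ x)) (P * β))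
    (memLp_rpow_ofReal hP0 (hφ0 κ₂) (by rw [div_mul_cancel₀ _ hP0.ne']; exact hφm hκ₂ huS))
    (memLp_rpow_ofReal (by positivity) (fun x => mul_nonneg hc0.le (hφ0 κ₁ x)) (by
        rw [show 1 / β * (P * β) = P by field_simp]
        exact (hφm (by linarith) huP).const_mul c))
  have e1 : ∫ x in Ω, (max (u x - κ₂) 0 ^ P) ^ (S / P) = T := by
    refine integral_congr_ae (Eventually.of_forall fun x => ?_)
    simp only [← Real.rpow_mul (hφ0 κ₂ x), mul_div_cancel₀ S hP0.ne']
  have e2 : ∫ x in Ω, ((c * max (u x - κ₁) 0) ^ (P * β)) ^ (1 / β) = c ^ P * W := by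
    rw [hW, ← integral_const_mul]
    refine integral_congr_ae (Eventually.of_forall fun x => ?_)
    simp only
    rw [← Real.rpow_mul (mul_nonneg hc0.le (hφ0 κ₁ x)), show P * β * (1 / β) = P by field_simp,
      Real.mul_rpow hc0.le (hφ0 κ₁ x)]
  rw [e1, e2, one_div_div, one_div_one_div] at hH
  calc ∫ x in Ω, max (u x - κ₂) 0 ^ P ≤ T ^ (P / S) * (c ^ P * W) ^ β := hl.trans hH
    _ ≤ (C ^ P * ((F / lam) ^ r' * c ^ ((p - 1) * r') * W)) * (c ^ P * W) ^ β := by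
        refine mul_le_mul_of_nonneg_right (hsob2.trans ?_) (by positivity)
        exact mul_le_mul_of_nonneg_left hE2 (by positivity)
    _ = C ^ P * (F / lam) ^ r' * c ^ ((p - 1) * r' + P * β) * W ^ (1 + β) := by
        rw [Real.rpow_add hc0, Real.rpow_add_of_nonneg hW0 zero_le_one hβ0.le, Real.rpow_one,
          Real.mul_rpow (by positivity) hW0, ← Real.rpow_mul hc0.le]
        ring
    _ ≤ _ := by
        have : 0 ≤ c ^ ((p - 1) * r' + P * β) * W ^ (1 + β) := by positivity
        nlinarith

end Bounded

section Bounded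

variable {N : ℕ} {Ω : Set (Euc N)} {p s m δ lam : ℝ} {g k u : Euc N → ℝ}

/-- Boundedness of weak solutions. -/
theorem WeakSol.memLp_top (hΩ : IsOpen Ω) (hΩb : Bornology.IsBounded Ω) (h : Exponents N p s)
    (hpN : p < N) (hlam : 0 < lam) (hδm : δ ≤ m) (hmp : m ≤ p - 1)
    (hg0 : ∀ᵐ x ∂volume.restrict Ω, 0 ≤ g x) (hk0 : ∀ᵐ x ∂volume.restrict Ω, 0 ≤ k x)
    {r : ℝ} (hr : N / p < r) (hg : MemLp g (ENNReal.ofReal r) (volume.restrict Ω))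
    (hk : MemLp k (ENNReal.ofReal r) (volume.restrict Ω)) (hu : WeakSol Ω p s m δ lam g k u) :
    MemLp u ⊤ (volume.restrict Ω) := by
  have hp := h.one_lt
  have hp0 : 0 < p := by linarith
  have hr1 : 1 < r := ((one_lt_div hp0).2 hpN).trans hr
  have hNp : 0 < (N : ℝ) - p := by linarith
  have hconj := Real.HolderConjugate.conjExponent hr1
  set r' := r.conjExponent with hr'
  have hr'e : r' = r / (r - 1) := rfl
  -- After clearing denominators this is the condition r > N/p: the exponent p r' required by Hölder
  -- is below the Sobolev exponent, and the gap makes β > 0.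
  have hPS : p * r' < N * p / (N - p) := by
    rw [hr'e, mul_div_assoc', div_lt_div_iff₀ (by linarith) hNp]
    rw [div_lt_iff₀ hp0] at hr
    nlinarith
  set β := 1 - p * r' / (N * p / (N - p)) with hβ
  have hr'0 : 0 < r' := hconj.symm.pos
  have hS0 : 0 < N * p / ((N : ℝ) - p) := (by positivity : 0 < p * r').trans hPS
  have hβ0 : 0 < β := by rw [hβ, sub_pos, div_lt_one hS0]; exact hPS
  obtain ⟨huP, A, hA0, hA⟩ := hu.exists_step hΩ hΩb h hpN hlam hδm hmp hg0 hk0 hconj rfl hPS hβ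
    (hg.add hk)
  set P := p * r' with hP
  have hP0 : 0 < P := by positivity
  set σ := (p - 1) * r' + P * β with hσ
  have hσ0 : 0 < σ := by
    have : 0 < p - 1 := by linarith
    positivity
  obtain ⟨ε, hε0, hε⟩ := exists_fast_convergence (A := A * 8 ^ σ) (B := 2 ^ σ) (β := β)
    (by positivity) (Real.one_lt_rpow one_lt_two hσ0) hβ0
  have hφI : ∀ {κ : ℝ}, 0 ≤ κ → Integrable (fun x => max (u x - κ) 0 ^ P) (volume.restrict Ω) ∧
      ∀ x, ‖max (u x - κ) 0 ^ P‖ ≤ ‖u x‖ ^ P := by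
    intro κ hκ
    have hb : ∀ x, ‖max (u x - κ) 0 ^ P‖ ≤ ‖u x‖ ^ P := fun x => by
      rw [Real.norm_of_nonneg (Real.rpow_nonneg (le_max_right _ _) _)]
      refine Real.rpow_le_rpow (le_max_right _ _) (max_le ?_ (norm_nonneg _)) hP0.le
      linarith [le_abs_self (u x), Real.norm_eq_abs (u x)]
    refine ⟨(integrable_norm_rpow hP0 huP).mono' ?_ (Eventually.of_forall hb), hb⟩
    exact (Real.continuous_rpow_const hP0.le).comp_aestronglyMeasurable
      ((huP.1.sub aestronglyMeasurable_const).sup aestronglyMeasurable_const)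
  have hlim : Tendsto (fun n : ℕ => ∫ x in Ω, max (u x - n) 0 ^ P) atTop
      (𝓝 (∫ _ in Ω, (0 : ℝ))) := by
    refine tendsto_integral_of_dominated_convergence (fun x => ‖u x‖ ^ P)
      (fun n => (hφI n.cast_nonneg).1.1) (integrable_norm_rpow hP0 huP)
      (fun n => Eventually.of_forall (hφI n.cast_nonneg).2) (Eventually.of_forall fun x => ?_)
    refine tendsto_const_nhds.congr' ?_
    filter_upwards [tendsto_natCast_atTop_atTop.eventually_ge_atTop (u x)] with n hn
    rw [max_eq_right (by linarith), Real.zero_rpow hP0.ne']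
  rw [integral_zero] at hlim
  -- The smallness threshold ε does not depend on the starting level, so that level can be raised
  -- until the first integral falls below it.
  obtain ⟨n, hn, hn1⟩ := ((hlim.eventually (gt_mem_nhds hε0)).and (eventually_ge_atTop 1)).exists
  have hK1 : (1 : ℝ) ≤ n := by exact_mod_cast hn1
  obtain ⟨K, hK⟩ : ∃ K : ℝ, K = (n : ℝ) := ⟨_, rfl⟩
  rw [← hK] at hn hK1
  -- Levels increase from K to 2K with gaps K 2^(-j) / 2. Above the next level t ≤ (t - κ_j) + 2K ≤
  -- 5 · 2^j (t - κ_j), which the factor 8 · 2^j covers.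
  set κ : ℕ → ℝ := fun j => K * (2 - (1 / 2) ^ j) with hκ
  have hpow : ∀ j : ℕ, (1 / 2 : ℝ) ^ j ≤ 1 := fun j => pow_le_one₀ (by norm_num) (by norm_num)
  have hpow0 : ∀ j : ℕ, 0 < (1 / 2 : ℝ) ^ j := fun j => by positivity
  have hκ1 : ∀ j, 1 ≤ κ j := fun j => by
    have := hpow j
    simp only [hκ]; nlinarith
  have hκ2 : ∀ j, κ j ≤ 2 * K := fun j => by
    have := hpow0 j
    simp only [hκ]; nlinarith
  have hdiff : ∀ j, κ (j + 1) - κ j = K * (1 / 2) ^ j / 2 := fun j => by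
    simp only [hκ, pow_succ]; ring
  have hstep := hε (fun j => ∫ x in Ω, max (u x - κ j) 0 ^ P)
    (fun j => integral_nonneg fun x => Real.rpow_nonneg (le_max_right _ _) _) (fun j => by
      have hle : κ j ≤ κ (j + 1) := by
        have := hdiff j
        have := mul_nonneg (by linarith : 0 ≤ K) (hpow0 j).le
        linarith
      refine (hA (κ j) (κ (j + 1)) (8 * 2 ^ j) (hκ1 j) hle (by positivity) fun t ht => ?_).trans
        (le_of_eq ?_)
      · have h1 := hdiff j
        have h2 := hκ2 j
        have h3 : (2 : ℝ) ^ j * (1 / 2) ^ j = 1 := by rw [← mul_pow]; norm_num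
        have h4 : K * (1 / 2) ^ j / 2 ≤ t - κ j := by linarith
        have h5 : (1 : ℝ) ≤ 2 ^ j := one_le_pow₀ (by norm_num)
        have h6 := mul_le_mul_of_nonneg_left h4 (by positivity : (0 : ℝ) ≤ 2 ^ j)
        have h7 : 2 ^ j * (K * (1 / 2) ^ j / 2) = K / 2 := by linear_combination (K / 2) * h3
        have h8 : 0 ≤ t - κ j := by linarith
        have h9 := mul_le_mul_of_nonneg_right h5 h8
        linarith
      · rw [Real.mul_rpow (by norm_num) (by positivity), ← Real.rpow_natCast, ← Real.rpow_mul (by norm_num),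
          mul_comm (j : ℝ) σ, Real.rpow_mul (by norm_num), Real.rpow_natCast]
        ring) (by
      simp only [hκ, pow_zero]
      rw [show K * (2 - 1) = K by ring]
      exact hn.le)
  have hzero : ∫ x in Ω, max (u x - 2 * K) 0 ^ P ≤ 0 := by
    refine ge_of_tendsto' hstep fun j => ?_
    refine integral_mono (hφI (by linarith)).1 (hφI (by linarith [hκ1 j])).1 fun x => ?_
    refine Real.rpow_le_rpow (le_max_right _ _) ?_ hP0.le
    have := hκ2 j
    gcongr
  have hae := (integral_eq_zero_iff_of_nonneg (fun x => Real.rpow_nonneg (le_max_right _ _) _)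
    (hφI (by linarith : 0 ≤ 2 * K)).1).1 (le_antisymm hzero (integral_nonneg fun x =>
      Real.rpow_nonneg (le_max_right _ _) _))
  refine memLp_top_of_bound huP.1 (2 * K) ?_
  filter_upwards [hae, hu.nonneg] with x h1 h2
  have h3 := (Real.rpow_eq_zero (le_max_right (u x - 2 * K) 0) hP0.ne').1 h1
  rw [Real.norm_of_nonneg h2]
  linarith [le_max_left (u x - 2 * K) 0]

end Bounded

/-! ### Volume near a smooth boundary and integrability of powers of the distance -/

section BoundaryDistance

variable {N : ℕ} {Ω : Set (Euc N)}

/-- The volume of the slab is averaged over its translates by t v, t in [0,1], and Fubini is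
applied. Along a line in direction v the function ρ grows at rate at least c while in the ball, so
the parameters for which the line is in the slab have diameter at most 2ε/c. No straightening of the
boundary is needed. -/
lemma volume_transversal_le {ρ : Euc N → ℝ} (hρ : ContDiff ℝ 1 ρ) {x₀ v : Euc N} {η c : ℝ}
    (hc : 0 < c) (hv : ∀ y ∈ Metric.ball x₀ η, c ≤ fderiv ℝ ρ y v) {ε : ℝ} :
    volume (Metric.ball x₀ η ∩ {y | |ρ y| < ε}) ≤
      ENNReal.ofReal (2 * ε / c) * volume (Metric.ball x₀ (η + ‖v‖)) := by
  set A := Metric.ball x₀ η ∩ {y | |ρ y| < ε} with hA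
  have hAo : IsOpen A := Metric.isOpen_ball.inter (isOpen_lt hρ.continuous.abs continuous_const)
  set B := Metric.ball x₀ (η + ‖v‖) with hB
  set S : Set (Euc N × ℝ) := {z | z.1 + z.2 • v ∈ A} with hS
  have hSm : MeasurableSet S := by
    have : Continuous fun z : Euc N × ℝ => z.1 + z.2 • v := by fun_prop
    exact (hAo.preimage this).measurableSet
  have e1 : volume A = ∫⁻ t in Icc (0 : ℝ) 1, volume {y | (y, t) ∈ S} := by
    have : ∀ t : ℝ, volume {y | (y, t) ∈ S} = volume A := fun t =>
      measure_preimage_add_right volume (t • v) A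
    simp [this]
  have e2 : ∫⁻ t in Icc (0 : ℝ) 1, volume {y | (y, t) ∈ S} =
      ∫⁻ y, volume.restrict (Icc (0 : ℝ) 1) {t | (y, t) ∈ S} :=
    (Measure.prod_apply_symm hSm).symm.trans (Measure.prod_apply hSm)
  have e3 : ∀ y, volume.restrict (Icc (0 : ℝ) 1) {t | (y, t) ∈ S} ≤
      B.indicator (fun _ => ENNReal.ofReal (2 * ε / c)) y := by
    intro y
    by_cases hy : y ∈ B
    · rw [indicator_of_mem hy]
      refine (Measure.restrict_apply_le _ _).trans ?_
      refine (Real.volume_le_diam _).trans (Metric.ediam_le_of_forall_dist_le fun t ht t' ht' => ?_)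
      have key : ∀ {t t' : ℝ}, y + t • v ∈ A → y + t' • v ∈ A → t ≤ t' → t' - t ≤ 2 * ε / c := by
        intro t t' ht ht' htt
        have hconv : ∀ σ ∈ Icc t t', y + σ • v ∈ Metric.ball x₀ η := by
          intro σ hσ
          have hcx : Convex ℝ {σ : ℝ | y + σ • v ∈ Metric.ball x₀ η} := by
            intro σ₁ h₁ σ₂ h₂ a b ha hb hab
            have := convex_ball x₀ η h₁ h₂ ha hb hab
            have e : y + (a • σ₁ + b • σ₂) • v = a • (y + σ₁ • v) + b • (y + σ₂ • v) := by
              rw [smul_add, smul_add, add_add_add_comm, ← add_smul, hab, one_smul, add_smul,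
                smul_assoc, smul_assoc]
            exact (congrArg (· ∈ Metric.ball x₀ η) e).mpr this
          exact hcx.ordConnected.out ht.1 ht'.1 hσ
        have hd : ∀ σ : ℝ, HasDerivAt (fun σ : ℝ => ρ (y + σ • v)) (fderiv ℝ ρ (y + σ • v) v) σ := by
          intro σ
          have h1 : HasDerivAt (fun σ : ℝ => y + σ • v) v σ := by
            simpa using ((hasDerivAt_id σ).smul_const v).const_add y
          exact ((hρ.differentiable one_ne_zero (y + σ • v)).hasFDerivAt).comp_hasDerivAt σ h1
        have := (convex_Icc t t').mul_sub_le_image_sub_of_le_deriv (C := c)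
          (f := fun σ : ℝ => ρ (y + σ • v)) (fun σ _ => (hd σ).continuousAt.continuousWithinAt)
          (fun σ _ => (hd σ).differentiableAt.differentiableWithinAt)
          (fun σ hσ => by
            rw [(hd σ).deriv]
            exact hv _ (hconv σ (interior_subset hσ)))
          t (left_mem_Icc.2 htt) t' (right_mem_Icc.2 htt) htt
        have h1 : |ρ (y + t • v)| < ε := ht.2
        have h2 : |ρ (y + t' • v)| < ε := ht'.2
        rw [le_div_iff₀ hc]
        linarith [abs_lt.1 h1, abs_lt.1 h2, (abs_lt.1 h1).1, (abs_lt.1 h2).2]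
      rw [Real.dist_eq]
      rcases le_total t t' with h | h
      · rw [abs_of_nonpos (by linarith), neg_sub]; exact key ht ht' h
      · rw [abs_of_nonneg (by linarith)]; exact key ht' ht h
    · rw [indicator_of_notMem hy, nonpos_iff_eq_zero, Measure.restrict_apply' measurableSet_Icc]
      convert measure_empty (μ := (volume : Measure ℝ))
      refine eq_empty_of_forall_notMem fun t ht => hy ?_
      have h1 : dist (y + t • v) x₀ < η := ht.1.1
      have h2 : dist y (y + t • v) ≤ ‖v‖ := by
        rw [dist_self_add_right, norm_smul, Real.norm_of_nonneg ht.2.1]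
        exact mul_le_of_le_one_left (norm_nonneg _) ht.2.2
      rw [hB, Metric.mem_ball]
      linarith [dist_triangle y (y + t • v) x₀]
  rw [e1, e2]
  refine (lintegral_mono e3).trans ?_
  rw [lintegral_indicator Metric.isOpen_ball.measurableSet, setLIntegral_const]

lemma frontier_nonempty (hN : 0 < N) (hΩ : IsSmoothBoundedDomain Ω) : (frontier Ω).Nonempty := by
  by_contra hne
  rw [not_nonempty_iff_eq_empty] at hne
  have hcl : IsClopen Ω := isClopen_iff_frontier_eq_empty.2 hne
  have : Nontrivial (Euc N) := by
    have : Nonempty (Fin N) := ⟨⟨0, hN⟩⟩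
    infer_instance
  rcases isClopen_iff.1 hcl with h | h
  · exact hΩ.isConnected.nonempty.ne_empty h
  · have := hΩ.isBounded
    rw [h] at this
    exact NormedSpace.unbounded_univ ℝ (Euc N) this

/-- The defining function vanishes on the boundary and is Lipschitz with constant L nearby, so d(y)
< ε implies |ρ(y)| < Lε, and the slab estimate applies. -/
lemma exists_local_volume_le (hΩ : IsSmoothBoundedDomain Ω) {x₀ : Euc N}
    (hx₀ : x₀ ∈ frontier Ω) : ∃ V ∈ 𝓝 x₀, ∃ C : NNReal, ∀ ε : ℝ, 0 < ε →
      volume (Ω ∩ V ∩ {y | bdryDist Ω y < ε}) ≤ C * ENNReal.ofReal ε := by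
  obtain ⟨U, hU, ρ, hρ, hρ0, hρU⟩ := hΩ.smooth_boundary x₀ hx₀
  have hρ1 : ContDiff ℝ 1 ρ := hρ.of_le (by exact_mod_cast le_top)
  obtain ⟨w, hw⟩ : ∃ w, fderiv ℝ ρ x₀ w ≠ 0 := by
    by_contra hcon
    push Not at hcon
    exact hρ0 (ContinuousLinearMap.ext hcon)
  -- Normalized so that the derivative of ρ along v is 1 at x₀, hence above 1/2 in a neighbourhood.
  set v := (fderiv ℝ ρ x₀ w)⁻¹ • w with hv
  have hv1 : fderiv ℝ ρ x₀ v = 1 := by rw [hv, map_smul, smul_eq_mul, inv_mul_cancel₀ hw]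
  have hcf : Continuous (fderiv ℝ ρ) := hρ1.continuous_fderiv one_ne_zero
  have c1 : ∀ᶠ y in 𝓝 x₀, 1 / 2 < fderiv ℝ ρ y v :=
    ((hcf.clm_apply continuous_const).tendsto x₀).eventually
      (lt_mem_nhds (by rw [hv1]; norm_num))
  set L := ‖fderiv ℝ ρ x₀‖ + 1 with hL
  have c2 : ∀ᶠ y in 𝓝 x₀, ‖fderiv ℝ ρ y‖ < L :=
    (hcf.norm.tendsto x₀).eventually (gt_mem_nhds (by linarith))
  have hL0 : 0 < L := by positivity
  obtain ⟨η, hη0, hη⟩ := Metric.eventually_nhds_iff_ball.1 ((c1.and c2).and hU)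
  have hfr : ∀ z ∈ frontier Ω, z ∈ Metric.ball x₀ η → ρ z = 0 := by
    intro z hz hzb
    have hzU : z ∈ U := (hη z hzb).2
    rw [hΩ.isOpen.frontier_eq] at hz
    refine le_antisymm (not_lt.1 fun hlt => ?_)
      (not_lt.1 fun hlt => hz.2 ((hρU z hzU).2 hlt))
    obtain ⟨y, ⟨hyb, hy0⟩, hyΩ⟩ := mem_closure_iff.1 hz.1 (Metric.ball x₀ η ∩ {y | 0 < ρ y})
      (Metric.isOpen_ball.inter (isOpen_lt continuous_const hρ.continuous)) ⟨hzb, hlt⟩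
    exact lt_asymm hy0 ((hρU y (hη y hyb).2).1 hyΩ)
  set W := volume (Metric.ball x₀ (η + ‖v‖)) with hW
  have hWt : W ≠ ⊤ := measure_ball_lt_top.ne
  -- Half the radius: a nearest boundary point of y is no farther from y than x₀ is, so it remains
  -- in the ball of radius η.
  refine ⟨Metric.ball x₀ (η / 2), Metric.ball_mem_nhds _ (half_pos hη0),
    (ENNReal.ofReal (4 * L) * W).toNNReal, fun ε hε => ?_⟩
  have hsub : Ω ∩ Metric.ball x₀ (η / 2) ∩ {y | bdryDist Ω y < ε} ⊆
      Metric.ball x₀ η ∩ {y | |ρ y| < L * ε} := by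
    rintro y ⟨⟨-, hyb⟩, hyd⟩
    have hyb' : y ∈ Metric.ball x₀ η := Metric.ball_subset_ball (by linarith) hyb
    refine ⟨hyb', ?_⟩
    obtain ⟨z, hz, hzd⟩ := isClosed_frontier.exists_infDist_eq_dist ⟨x₀, hx₀⟩ y
    have hyz : dist y z ≤ dist y x₀ := hzd ▸ Metric.infDist_le_dist_of_mem hx₀
    have hzb : z ∈ Metric.ball x₀ η := by
      rw [Metric.mem_ball] at hyb ⊢
      linarith [dist_triangle_left z x₀ y]
    have h1 := (convex_ball x₀ η).norm_image_sub_le_of_norm_fderiv_le (𝕜 := ℝ) (f := ρ)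
      (fun w _ => hρ1.differentiable one_ne_zero w) (fun w hw => (hη w hw).1.2.le) hzb hyb'
    rw [hfr z hz hzb, sub_zero, Real.norm_eq_abs, ← dist_eq_norm, ← hzd] at h1
    exact h1.trans_lt (mul_lt_mul_of_pos_left hyd hL0)
  refine (measure_mono hsub).trans ((volume_transversal_le hρ1 (c := 1 / 2) (by norm_num)
    fun y hy => (hη y hy).1.1.le).trans_eq ?_)
  rw [ENNReal.coe_toNNReal (ENNReal.mul_ne_top ENNReal.ofReal_ne_top hWt), mul_right_comm,
    ← ENNReal.ofReal_mul (by positivity)]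
  congr 2
  ring

/-- Compactness of the closure reduces this to neighbourhoods of points. Near the boundary it is the
local estimate; near a point at distance a > 0 from the boundary the set is empty for ε ≤ a/2, and
for larger ε the volume of Ω is at most a constant times ε. -/
lemma exists_volume_le (hN : 0 < N) (hΩ : IsSmoothBoundedDomain Ω) :
    ∃ C : NNReal, ∀ ε : ℝ, 0 < ε → volume (Ω ∩ {y | bdryDist Ω y < ε}) ≤ C * ENNReal.ofReal ε := by
  have hcpt : IsCompact (closure Ω) := hΩ.isBounded.isCompact_closure
  have key : ∃ C : NNReal, ∀ ε : ℝ, 0 < ε →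
      volume (Ω ∩ closure Ω ∩ {y | bdryDist Ω y < ε}) ≤ C * ENNReal.ofReal ε := by
    refine hcpt.induction_on (p := fun V => ∃ C : NNReal, ∀ ε : ℝ, 0 < ε →
      volume (Ω ∩ V ∩ {y | bdryDist Ω y < ε}) ≤ C * ENNReal.ofReal ε) ⟨0, by simp⟩ ?_ ?_ ?_
    · rintro V V' hV ⟨C, hC⟩
      exact ⟨C, fun ε hε => (measure_mono (by gcongr)).trans (hC ε hε)⟩
    · rintro V V' ⟨C, hC⟩ ⟨C', hC'⟩
      refine ⟨C + C', fun ε hε => ?_⟩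
      rw [inter_union_distrib_left, union_inter_distrib_right, ENNReal.coe_add, add_mul]
      exact (measure_union_le _ _).trans (add_le_add (hC ε hε) (hC' ε hε))
    · intro x hx
      by_cases hxf : x ∈ frontier Ω
      · obtain ⟨V, hV, h⟩ := exists_local_volume_le hΩ hxf
        exact ⟨V, mem_nhdsWithin_of_mem_nhds hV, h⟩
      · have hd : 0 < Metric.infDist x (frontier Ω) :=
          (isClosed_frontier.notMem_iff_infDist_pos (frontier_nonempty hN hΩ)).1 hxf
        set a := Metric.infDist x (frontier Ω) with ha
        have hvt : volume Ω / ENNReal.ofReal (a / 2) ≠ ⊤ :=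
          ENNReal.div_ne_top hΩ.isBounded.measure_lt_top.ne
            (ENNReal.ofReal_pos.2 (half_pos hd)).ne'
        refine ⟨Metric.ball x (a / 2), mem_nhdsWithin_of_mem_nhds
          (Metric.ball_mem_nhds _ (half_pos hd)), (volume Ω / ENNReal.ofReal (a / 2)).toNNReal,
          fun ε hε => ?_⟩
        rw [ENNReal.coe_toNNReal hvt]
        rcases le_or_gt ε (a / 2) with h | h
        · suffices he : Ω ∩ Metric.ball x (a / 2) ∩ {y | bdryDist Ω y < ε} = ∅ by simp [he]
          refine eq_empty_of_forall_notMem ?_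
          rintro y ⟨⟨-, hy⟩, hyd⟩
          rw [Metric.mem_ball] at hy
          have := Metric.infDist_le_infDist_add_dist (s := frontier Ω) (x := x) (y := y)
          rw [dist_comm] at this
          have h3 : Metric.infDist y (frontier Ω) < ε := hyd
          linarith
        · calc volume (Ω ∩ Metric.ball x (a / 2) ∩ {y | bdryDist Ω y < ε}) ≤ volume Ω :=
                measure_mono fun y hy => hy.1.1
            _ = volume Ω / ENNReal.ofReal (a / 2) * ENNReal.ofReal (a / 2) :=
                (ENNReal.div_mul_cancel (ENNReal.ofReal_pos.2 (half_pos hd)).ne'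
                  ENNReal.ofReal_ne_top).symm
            _ ≤ _ := by gcongr
  rwa [inter_eq_left.2 subset_closure] at key

/-- Layer cake formula: for t > 1 the set {d^(-a) > t} lies in {d < t^(-1/a)}, whose volume in Ω is
O(t^(-1/a)), integrable at infinity because a < 1. -/
lemma lintegral_bdryDist_rpow_lt_top (hN : 0 < N) (hΩ : IsSmoothBoundedDomain Ω) {a : ℝ}
    (ha0 : 0 < a) (ha1 : a < 1) :
    ∫⁻ x in Ω, ENNReal.ofReal (bdryDist Ω x ^ (-a)) < ⊤ := by
  obtain ⟨C, hC⟩ := exists_volume_le hN hΩ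
  have hmeas : Measurable (bdryDist Ω) := measurable_infDist
  have hnn : ∀ x, 0 ≤ bdryDist Ω x ^ (-a) := fun x => Real.rpow_nonneg Metric.infDist_nonneg _
  rw [lintegral_eq_lintegral_meas_lt _ (ae_of_all _ hnn) (hmeas.pow_const _).aemeasurable]
  have hsplit : Ioi (0 : ℝ) = Ioc 0 1 ∪ Ioi 1 := (Ioc_union_Ioi_eq_Ioi zero_le_one).symm
  rw [hsplit]
  refine (lintegral_union_le _ _ _).trans_lt (ENNReal.add_lt_top.2 ⟨?_, ?_⟩)
  · refine (lintegral_mono fun t => measure_mono (subset_univ _)).trans_lt ?_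
    simpa using hΩ.isBounded.measure_lt_top
  · have hle : ∀ t ∈ Ioi (1 : ℝ), volume.restrict Ω {x | t < bdryDist Ω x ^ (-a)} ≤
        C * ENNReal.ofReal (t ^ (-1 / a)) := by
      intro t ht
      have ht0 : (0 : ℝ) < t := zero_lt_one.trans ht
      rw [Measure.restrict_apply (measurableSet_lt measurable_const (hmeas.pow_const _)), inter_comm]
      refine (measure_mono ?_).trans (hC _ (Real.rpow_pos_of_pos ht0 _))
      refine inter_subset_inter_right _ fun x hx => ?_
      have hx' : t < bdryDist Ω x ^ (-a) := hx
      have hd0 : 0 ≤ bdryDist Ω x := Metric.infDist_nonneg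
      rcases hd0.eq_or_lt with h | h
      · rw [← h, Real.zero_rpow (by linarith)] at hx'
        linarith
      · have h1 := Real.rpow_lt_rpow_of_neg ht0 hx' (z := -1 / a) (div_neg_of_neg_of_pos (by norm_num) ha0)
        rwa [← Real.rpow_mul hd0, show -a * (-1 / a) = 1 by field_simp, Real.rpow_one] at h1
    refine (setLIntegral_mono' measurableSet_Ioi hle).trans_lt ?_
    rw [lintegral_const_mul _ (by fun_prop)]
    refine ENNReal.mul_lt_top ENNReal.coe_lt_top ?_
    have hi : IntegrableOn (fun t : ℝ => t ^ (-1 / a)) (Ioi 1) :=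
      integrableOn_Ioi_rpow_of_lt (by rw [div_lt_iff₀ ha0]; linarith) zero_lt_one
    exact hi.lintegral_lt_top

lemma memLp_bdryDist_rpow (hN : 0 < N) (hΩ : IsSmoothBoundedDomain Ω) {γ r : ℝ} (hr : 0 < r)
    (hγ : γ * r < 1) :
    MemLp (fun x => bdryDist Ω x ^ (-γ)) (ENNReal.ofReal r) (volume.restrict Ω) := by
  have hmeas : Measurable (bdryDist Ω) := measurable_infDist
  have hms : AEStronglyMeasurable (fun x => bdryDist Ω x ^ (-γ)) (volume.restrict Ω) :=
    (hmeas.pow_const _).aestronglyMeasurable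
  rcases le_or_gt γ 0 with h | h
  · have := isFiniteMeasure_restrict hΩ.isBounded
    obtain ⟨z, hz⟩ := frontier_nonempty hN hΩ
    obtain ⟨M, hM⟩ := hΩ.isBounded.subset_closedBall z
    refine MemLp.of_bound hms (M ^ (-γ)) ?_
    refine (ae_restrict_iff' hΩ.isOpen.measurableSet).2 (ae_of_all _ fun x hx => ?_)
    have h0 : 0 ≤ bdryDist Ω x := Metric.infDist_nonneg
    rw [Real.norm_of_nonneg (Real.rpow_nonneg h0 _)]
    exact Real.rpow_le_rpow Metric.infDist_nonneg
      ((Metric.infDist_le_dist_of_mem hz).trans (hM hx)) (by linarith)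
  · refine memLp_of_integrable_norm_rpow hr hms
      ⟨(((hmeas.pow_const _).norm).pow_const _).aestronglyMeasurable, ?_⟩
    have := lintegral_bdryDist_rpow_lt_top hN hΩ (mul_pos h hr) hγ
    refine lt_of_le_of_lt (lintegral_mono fun x => ?_) this
    have h0 : 0 ≤ bdryDist Ω x := Metric.infDist_nonneg
    beta_reduce
    rw [Real.norm_of_nonneg (Real.rpow_nonneg h0 _), ← Real.rpow_mul h0, neg_mul,
      Real.enorm_of_nonneg (Real.rpow_nonneg h0 _)]

end BoundaryDistance
end MixedLocalNonlocal

/-! ### Assembly of the main theorem -/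

theorem mainTheorem7 (N : ℕ) (Ω : Set (EuclideanSpace ℝ (Fin N)))
    (hΩ : IsSmoothBoundedDomain Ω)
    (p s m δ γ D lam : ℝ) (hp : 1 < p) (hpN : p < N) (hs0 : 0 < s) (hs1 : s < 1)
    (hm0 : 0 ≤ m) (hmp : m < p - 1)
    (hD : (N : ℝ) < D)
    (hδγ : 0 < m → 0 < δ ∧ δ < m ∧ 2 * m - 1 < 2 * δ - D * γ)
    (hγ : γ < 1 / D) (hlam : 0 < lam)
    (gl : EuclideanSpace ℝ (Fin N) → ℝ)
    (hgl_bdd : MemLp gl ⊤ (volume.restrict Ω))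
    (hgl_nonneg : ∀ᵐ x ∂volume.restrict Ω, 0 ≤ gl x)
    (hgl_nontrivial : ¬ (∀ᵐ x ∂volume.restrict Ω, gl x = 0)) :
    (∀ g₀ : EuclideanSpace ℝ (Fin N) → ℝ, MemLp g₀ 2 (volume.restrict Ω) →
      (∀ᵐ x ∂volume.restrict Ω, lam * gl x ≤ g₀ x) →
      ∃ u : EuclideanSpace ℝ (Fin N) → ℝ,
        IsWeakSolution Ω p s m δ γ lam g₀ u ∧
        (∀ᵐ x ∂volume.restrict Ω, 0 < u x) ∧
        ∀ r : ℝ, (N : ℝ) / (s * p) < r → (0 < γ → r < 1 / γ) →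
          MemLp g₀ (ENNReal.ofReal r) (volume.restrict Ω) →
          MemLp u ⊤ (volume.restrict Ω)) ∧
    (∀ g₁ g₂ u₁ u₂ : EuclideanSpace ℝ (Fin N) → ℝ,
      MemLp g₁ 2 (volume.restrict Ω) → MemLp g₂ 2 (volume.restrict Ω) →
      (∀ᵐ x ∂volume.restrict Ω, lam * gl x ≤ g₁ x) →
      (∀ᵐ x ∂volume.restrict Ω, lam * gl x ≤ g₂ x) →
      IsWeakSolution Ω p s m δ γ lam g₁ u₁ → IsWeakSolution Ω p s m δ γ lam g₂ u₂ →
      eLpNorm (fun x => max (u₁ x ^ (m + 1) - u₂ x ^ (m + 1)) 0) 2 (volume.restrict Ω)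
        ≤ eLpNorm (fun x => max (g₁ x - g₂ x) 0) 2 (volume.restrict Ω)) := by
  have hN0 : 0 < N := by
    have : (0 : ℝ) < N := by linarith
    exact_mod_cast this
  have hN2 : (2 : ℝ) ≤ N := by
    have : 1 < N := by
      have : (1 : ℝ) < N := hp.trans hpN
      exact_mod_cast this
    exact_mod_cast this
  have hE : Exponents N p s := ⟨hN0, hp, hs0, hs1⟩
  have hΩo := hΩ.isOpen
  have hΩb := hΩ.isBounded
  have := isFiniteMeasure_restrict hΩb
  -- For m = 0 nothing is known about δ, but the coefficient λ m d^(-γ) is then zero, so δ may be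
  -- replaced by 0 without changing the equation.
  obtain ⟨δ', hδ0, hδm, hδ⟩ : ∃ δ', 0 ≤ δ' ∧ δ' ≤ m ∧ (0 < m → δ' = δ) := by
    rcases hm0.eq_or_lt with h | h
    · exact ⟨0, le_rfl, hm0, fun h' => absurd h' (by rw [← h]; exact lt_irrefl _)⟩
    · exact ⟨δ, (hδγ h).1.le, (hδγ h).2.1.le, fun _ => rfl⟩
  set k : EuclideanSpace ℝ (Fin N) → ℝ := fun x => lam * m * bdryDist Ω x ^ (-γ) with hk
  have hk0 : ∀ᵐ x ∂volume.restrict Ω, 0 ≤ k x := ae_of_all _ fun x =>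
    mul_nonneg (mul_nonneg hlam.le hm0) (Real.rpow_nonneg Metric.infDist_nonneg _)
  have hkr : ∀ {r : ℝ}, 0 < r → γ * r < 1 → MemLp k (ENNReal.ofReal r) (volume.restrict Ω) :=
    fun hr h => (memLp_bdryDist_rpow hN0 hΩ hr h).const_mul _
  have hk2 : MemLp k 2 (volume.restrict Ω) := by
    -- Since 1 < p < N and N is an integer, N ≥ 2. Hence D > 2 and γ < 1/D ≤ 1/2, which puts the
    -- weight in L².
    have : γ * 2 < 1 := by
      have : 1 / D ≤ 1 / 2 := one_div_le_one_div_of_le two_pos (by linarith)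
      linarith
    simpa using hkr two_pos this
  have hiff : ∀ {g u : EuclideanSpace ℝ (Fin N) → ℝ},
      IsWeakSolution Ω p s m δ γ lam g u ↔ WeakSol Ω p s m δ' lam g k u := by
    intro g u
    have e : ∀ x, lam * m * bdryDist Ω x ^ (-γ) * u x ^ δ = k x * u x ^ δ' := by
      intro x
      rcases hm0.eq_or_lt with h | h
      · simp [hk, ← h]
      · rw [hδ h]
    constructor
    · rintro ⟨h1, h2, h3, h4⟩
      exact ⟨h1, h2, h3, fun φ hφ => by simpa only [e] using h4 φ hφ⟩
    · rintro ⟨h1, h2, h3, h4⟩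
      exact ⟨h1, h2, h3, fun φ hφ => by simpa only [e] using h4 φ hφ⟩
  have hnn : ∀ {g : EuclideanSpace ℝ (Fin N) → ℝ},
      (∀ᵐ x ∂volume.restrict Ω, lam * gl x ≤ g x) → ∀ᵐ x ∂volume.restrict Ω, 0 ≤ g x := by
    intro g hg
    filter_upwards [hg, hgl_nonneg] with x h1 h2
    exact (mul_nonneg hlam.le h2).trans h1
  refine ⟨fun g₀ hg₀ hgl => ?_, fun g₁ g₂ u₁ u₂ hg₁ hg₂ hgl₁ hgl₂ hu₁ hu₂ => ?_⟩
  · have hS : Source (volume.restrict Ω) m δ' g₀ k :=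
      ⟨this, hm0, hδ0, hδm, hg₀, hk2, hnn hgl, hk0⟩
    obtain ⟨u, hu⟩ := exists_weakSol hΩo hΩb hE hS (by linarith) hlam fun h0 => hgl_nontrivial <| by
      filter_upwards [h0, hgl, hgl_nonneg] with x h1 h2 h3
      rw [h1] at h2
      exact le_antisymm (nonpos_of_mul_nonpos_right h2 hlam) h3
    refine ⟨u, hiff.2 hu, hu.ae_pos hΩo hΩb hN0 hp hs0 hs1 hm0 hlam (hnn hgl) hk0,
      fun r hr hrγ hgr => ?_⟩
    have hp0 : 0 < p := by linarith
    -- The local operator gives boundedness already for r > N/p, and s < 1 makes N/(sp) the larger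
    -- threshold.
    have hr' : (N : ℝ) / p < r := by
      refine lt_of_le_of_lt ?_ hr
      exact div_le_div_of_nonneg_left (Nat.cast_nonneg _) (mul_pos hs0 hp0)
        (mul_le_of_le_one_left hp0.le hs1.le)
    have hr0 : 0 < r := lt_of_le_of_lt (div_nonneg (Nat.cast_nonneg _) hp0.le) hr'
    have hγr : γ * r < 1 := by
      rcases le_or_gt γ 0 with h | h
      · exact (mul_nonpos_of_nonpos_of_nonneg h hr0.le).trans_lt one_pos
      · rw [mul_comm]
        exact (lt_div_iff₀ h).1 (hrγ h)
    exact hu.memLp_top hΩo hΩb hE hpN hlam hδm hmp.le (hnn hgl) hk0 hr' hgr (hkr hr0 hγr)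
  · exact WeakSol.eLpNorm_le hΩo hΩb hE hm0 (by linarith) hδ0 hδm hlam hg₁ hg₂ hk2 (hnn hgl₁)
      (hnn hgl₂) hk0 (hiff.1 hu₁) (hiff.1 hu₂)
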